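/- Let $C$ be a small category with a terminal object $t$, and let $S$ be any class of morphisms of the category $\mathrm{sPS}(C)$ of simplicial presheaves on $C$. **Notation.** $\Theta C$ is the category with objects $[m](c_1,\dots,c_m)$ ($m\ge 0$, $c_i\in C$), in which a morphism $[m](c_1,\dots,c_m)\to[l](d_1,\dots,d_l)$ is a monotone map $\delta\colon[m]\to[l]$ together with a morphism $c_i\to d_j$ of $C$ whenever $\delta(i-1)<j\le\delta(i)$; $\Theta^0C=C$ and $\Theta^{n+1}C=\Theta(\Theta^nC)$. The object $[0]$ is terminal in $\Theta C$. For an object $X$, $F(X)$ is the discrete simplicial presheaf represented by $X$. For simplicial presheaves, $\mathrm{Map}(X,Y)_p=\mathrm{Hom}(X\times\Delta[p],Y)$; levelwise weak equivalences are the maps that are weak equivalences of simplicial sets at every object, and $W$ is injective fibrant if every map into $W$ extends along every monomorphism that is a levelwise weak equivalence. For a class $T$ of morphisms, $W$ is $T$-fibrant if it is injective fibrant and $f^*\colon\mathrm{Map}(Y,W)\to\mathrm{Map}(X,W)$ is a weak equivalence for all $f\colon X\to Y$ in $T$. Let $\mathrm{se}_C$ be the set of Segal maps $F([1](c_1))\amalg_{F[0]}\cdots\amalg_{F[0]}F([1](c_m))\hookrightarrow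 F([m](c_1,\dots,c_m))$, and let $\mathrm{cplt}_C$ consist of the map $\pi^*E\to F[0]$, where $E$ is the nerve of the walking isomorphism, regarded as discrete, and $\pi\colon\Theta C\to\Delta$ is the projection $[m](c_1,\dots,c_m)\mapsto[m]$. Let $V[1]\colon\mathrm{sPS}(C)\to\mathrm{sPS}(\Theta C)$ be the suspension, $V[1](A)_{[m](c_1,\dots,c_m)}=\coprod_{\delta\colon[m]\to[1]}\prod_{i:\,\delta(i-1)<\delta(i)}A_{c_i}$. Put $\mathrm{se}(S)=\mathrm{se}_C\cup V[1](S)$ and $\mathrm{cpt}(S)=\mathrm{cplt}_C\cup\mathrm{se}_C\cup V[1](S)$, and $\mathrm{se}^0(S)=\mathrm{cpt}^0(S)=S$, $\mathrm{se}^{n+1}(S)=\mathrm{se}(\mathrm{se}^n(S))$, $\mathrm{cpt}^{n+1}(S)=\mathrm{cpt}(\mathrm{cpt}^n(S))$, which are classes of morphisms of $\mathrm{sPS}(\Theta^{n+1}C)$. For $W\in\mathrm{sPS}(\Theta C)$ and $x,y\in W_{[0],0}$, the mapping object $\mathrm{map}_W(x,y)\in\mathrm{sPS}(C)$ has value at $c$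 the fibre of $W_{[1](c)}\to W_{[0]}\times W_{[0]}$ over $(x,y)$. If $W$ is $\mathrm{se}_C$-fibrant, $\mathrm{ho}(W)$ is the category with objects $W_{[0],0}$ and morphisms $\mathrm{Hom}(x,y)=\pi_0(\mathrm{map}_W(x,y)_t)$; composition is characterized by the fact that for every point $\sigma$ of $W_{[2](t,t)}$ the composite of the classes of the edges $0\to1$ and $1\to2$ of $\sigma$ is the class of the edge $0\to2$. A map $f\colon U\to V$ of $\mathrm{se}(S)$-fibrant objects of $\mathrm{sPS}(\Theta C)$ is a *DK-equivalence* if $\mathrm{ho}(f)\colon\mathrm{ho}(U)\to\mathrm{ho}(V)$ is an equivalence of categories and $\mathrm{map}_U(x,y)\to\mathrm{map}_V(f(x),f(y))$ is a levelwise weak equivalence for all $x,y\in U_{[0],0}$. A map $f\colon U\to V$ of $\mathrm{se}^n(S)$-fibrant objects of $\mathrm{sPS}(\Theta^nC)$ is a *DK-equivalence of $\mathrm{se}^n(S)$-fibrant objects* if $n=0$ and $f$ is a levelwise weak equivalence, or if $n\ge1$, $\mathrm{ho}(f)$ is an equivalence of categories and the maps $\mathrm{map}_U(x,y)\to\mathrm{map}_V(f(x),f(y))$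 are DK-equivalences of $\mathrm{se}^{n-1}(S)$-fibrant objects for all $x,y$. **Proposition.** 1. A map between $\mathrm{cpt}(S)$-fibrant objects of $\mathrm{sPS}(\Theta C)$ is a levelwise weak equivalence if and only if it is a DK-equivalence. 2. For every $n\ge0$, a map between $\mathrm{cpt}^n(S)$-fibrant objects of $\mathrm{sPS}(\Theta^nC)$ is a DK-equivalence of $\mathrm{se}^n(S)$-fibrant objects if and only if it is a levelwise weak equivalence. -/

import Mathlib

open CategoryTheory Opposite

universe v u

noncomputable section

namespace ThetaSpaces

section Constructions

open Simplicial MonoidalCategory HomotopicalAlgebra SSet.modelCategoryQuillen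

/-- The objects `[m](c₁, …, c_m)` of the category `Θ C`. -/
structure Theta (C : Type u) : Type u where
  /-- the length `m` -/
  len : ℕ
  /-- the labels `c₁, …, c_m` -/
  label : Fin len → C

namespace Theta

section Cat

variable {C : Type u} [Category.{v} C]

/-- A morphism `[m](c₁, …, c_m) ⟶ [l](d₁, …, d_l)`: a monotone map `φ : [m] → [l]`, together with
morphisms `c_i ⟶ d_j` whenever `φ (i - 1) < j ≤ φ i`. With labels indexed from `0` by `Fin m` and
`Fin l`, the label `i` sits between the vertices `i.castSucc` and `i.succ`. -/
@[ext]
structure Hom (X Y : Theta C) : Type v where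
  /-- the monotone map `[m] → [l]` -/
  φ : Fin (X.len + 1) →o Fin (Y.len + 1)
  /-- the maps between labels -/
  f : ∀ (i : Fin X.len) (j : Fin Y.len), φ i.castSucc < j.succ → j.succ ≤ φ i.succ →
    (X.label i ⟶ Y.label j)

/-- Given `φ (i - 1) < k ≤ φ i` for a monotone map `φ`, and more generally `φ a < k ≤ φ b`, there
is a unique step `j` with `φ (j - 1) < k ≤ φ j`. -/
lemma exists_step {m l : ℕ} (φ : Fin (m + 1) →o Fin (l + 1)) (a b : Fin (m + 1)) (k : Fin l)
    (h₁ : φ a < k.succ) (h₂ : k.succ ≤ φ b) :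
    ∃ j : Fin m, a < j.succ ∧ j.succ ≤ b ∧ φ j.castSucc < k.succ ∧ k.succ ≤ φ j.succ := by
  induction b using Fin.induction with
  | zero => exact absurd (h₂.trans (φ.monotone (Fin.zero_le a))) (not_le.2 h₁)
  | succ b ih =>
    by_cases h : k.succ ≤ φ b.castSucc
    · obtain ⟨j, h₃, h₄, h₅⟩ := ih h
      exact ⟨j, h₃, h₄.trans (Fin.castSucc_lt_succ).le, h₅⟩
    · refine ⟨b, ?_, le_rfl, not_le.1 h, h₂⟩
      by_contra h'
      exact absurd (h₂.trans (φ.monotone (not_lt.1 h'))) (not_le.2 h₁)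

lemma step_unique {m l : ℕ} (φ : Fin (m + 1) →o Fin (l + 1)) (k : Fin l) {j j' : Fin m}
    (h₁ : φ j.castSucc < k.succ) (h₂ : k.succ ≤ φ j.succ)
    (h₁' : φ j'.castSucc < k.succ) (h₂' : k.succ ≤ φ j'.succ) : j = j' := by
  rcases lt_trichotomy j j' with h | h | h
  · exact absurd (h₂.trans (φ.monotone (Fin.succ_le_castSucc_iff.2 h))) (not_le.2 h₁')
  · exact h
  · exact absurd (h₂'.trans (φ.monotone (Fin.succ_le_castSucc_iff.2 h))) (not_le.2 h₁)

/-- The identity morphism. -/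
def Hom.id (X : Theta C) : Hom X X where
  φ := OrderHom.id
  f i j h₁ h₂ := eqToHom (by
    have : i = j := le_antisymm (Fin.castSucc_lt_succ_iff.1 h₁) (Fin.succ_le_succ_iff.1 h₂)
    rw [this])

/-- The composition: the component `c_i ⟶ e_k` is the composite `c_i ⟶ d_j ⟶ e_k` for the unique
`j` for which both maps are present. -/
def Hom.comp {X Y Z : Theta C} (g : Hom X Y) (h : Hom Y Z) : Hom X Z where
  φ := h.φ.comp g.φ
  f i k h₁ h₂ :=
    have H := exists_step h.φ (g.φ i.castSucc) (g.φ i.succ) k h₁ h₂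
    g.f i H.choose H.choose_spec.1 H.choose_spec.2.1 ≫
      h.f H.choose k H.choose_spec.2.2.1 H.choose_spec.2.2.2

lemma Hom.comp_f {X Y Z : Theta C} (g : Hom X Y) (h : Hom Y Z) (i : Fin X.len) (j : Fin Y.len)
    (k : Fin Z.len) (h₁ h₂) (h₃ : g.φ i.castSucc < j.succ) (h₄ : j.succ ≤ g.φ i.succ)
    (h₅ : h.φ j.castSucc < k.succ) (h₆ : k.succ ≤ h.φ j.succ) :
    (g.comp h).f i k h₁ h₂ = g.f i j h₃ h₄ ≫ h.f j k h₅ h₆ := by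
  have H := exists_step h.φ (g.φ i.castSucc) (g.φ i.succ) k h₁ h₂
  obtain rfl : j = H.choose :=
    step_unique h.φ k h₅ h₆ H.choose_spec.2.2.1 H.choose_spec.2.2.2
  rfl

lemma Hom.ext' {X Y : Theta C} {g h : Hom X Y} (hφ : ∀ a, g.φ a = h.φ a)
    (hf : ∀ i j h₁ h₂ h₁' h₂', g.f i j h₁ h₂ = h.f i j h₁' h₂') : g = h := by
  obtain ⟨φ, f⟩ := g
  obtain ⟨φ', f'⟩ := h
  obtain rfl : φ = φ' := OrderHom.ext _ _ (funext hφ)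
  congr
  funext i j h₁ h₂
  exact hf i j h₁ h₂ h₁ h₂

lemma Hom.id_f (X : Theta C) (i : Fin X.len) (h₁ h₂) : (Hom.id X).f i i h₁ h₂ = 𝟙 _ := rfl

instance : Category.{v} (Theta C) where
  Hom := Hom
  id := Hom.id
  comp := Hom.comp
  id_comp g := by
    refine Hom.ext' (fun _ ↦ rfl) fun i j h₁ h₂ h₁' h₂' ↦ ?_
    exact (Hom.comp_f _ _ i i j h₁ h₂ (Fin.castSucc_lt_succ) le_rfl h₁' h₂').trans
      (Category.id_comp _)
  comp_id g := by
    refine Hom.ext' (fun _ ↦ rfl) fun i j h₁ h₂ h₁' h₂' ↦ ?_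
    exact (Hom.comp_f _ _ i j j h₁ h₂ h₁' h₂' (Fin.castSucc_lt_succ) le_rfl).trans
      (Category.comp_id _)
  assoc {W X Y Z} a b c := by
    refine Hom.ext' (fun _ ↦ rfl) fun i l h₁ h₂ h₁' h₂' ↦ ?_
    obtain ⟨k, h₃, h₄, h₅, h₆⟩ := exists_step c.φ _ _ l h₁ h₂
    obtain ⟨j, h₇, h₈, h₉, h₁₀⟩ := exists_step b.φ _ _ k h₃ h₄
    have h₁₁ : (b.comp c).φ j.castSucc < l.succ := (c.φ.monotone (not_lt.1 fun h ↦ ?_)).trans_lt h₅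
    · have h₁₂ : l.succ ≤ (b.comp c).φ j.succ := h₆.trans (c.φ.monotone h₁₀)
      rw [Hom.comp_f (a.comp b) c i k l h₁ h₂ h₃ h₄ h₅ h₆, Hom.comp_f a b i j k h₃ h₄ h₇ h₈ h₉ h₁₀,
        Hom.comp_f a (b.comp c) i j l h₁' h₂' h₇ h₈ h₁₁ h₁₂,
        Hom.comp_f b c j k l h₁₁ h₁₂ h₉ h₁₀ h₅ h₆, Category.assoc]
    · exact absurd h₉ (not_lt.2 (Fin.castSucc_lt_iff_succ_le.1 h))

@[ext]
lemma hom_ext {X Y : Theta C} {g h : X ⟶ Y} (hφ : ∀ a, g.φ a = h.φ a)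
    (hf : ∀ i j h₁ h₂ h₁' h₂', g.f i j h₁ h₂ = h.f i j h₁' h₂') : g = h :=
  Hom.ext' hφ hf

@[simp] lemma id_φ (X : Theta C) (a) : Hom.φ (𝟙 X) a = a := rfl

@[simp] lemma comp_φ {X Y Z : Theta C} (g : X ⟶ Y) (h : Y ⟶ Z) (a) :
    (g ≫ h).φ a = h.φ (g.φ a) := rfl

lemma comp_f {X Y Z : Theta C} (g : X ⟶ Y) (h : Y ⟶ Z) (i : Fin X.len) (j : Fin Y.len)
    (k : Fin Z.len) (h₁ h₂) (h₃ : g.φ i.castSucc < j.succ) (h₄ : j.succ ≤ g.φ i.succ)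
    (h₅ : h.φ j.castSucc < k.succ) (h₆ : k.succ ≤ h.φ j.succ) :
    (g ≫ h).f i k h₁ h₂ = g.f i j h₃ h₄ ≫ h.f j k h₅ h₆ :=
  Hom.comp_f g h i j k h₁ h₂ h₃ h₄ h₅ h₆

/-- The object `[0]`. -/
def zero : Theta C := ⟨0, Fin.elim0⟩

/-- The object `[1](c)`. -/
def one (c : C) : Theta C := ⟨1, fun _ ↦ c⟩

/-- The object `[m](t, …, t)`. -/
def diag (t : C) (m : ℕ) : Theta C := ⟨m, fun _ ↦ t⟩

/-- The unique morphism to `[0]`. -/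
def toZero (X : Theta C) : X ⟶ zero where
  φ := OrderHom.const _ 0
  f _ j := j.elim0

lemma hom_zero_ext {X : Theta C} (g h : X ⟶ zero) : g = h :=
  hom_ext (fun _ ↦ Subsingleton.elim (α := Fin 1) _ _) (fun _ j ↦ j.elim0)

variable (C) in
/-- `[0]` is a terminal object of `Θ C`. -/
def isTerminalZero : Limits.IsTerminal (zero : Theta C) :=
  Limits.IsTerminal.ofUniqueHom toZero fun _ _ ↦ hom_zero_ext _ _

/-- The vertex `[0] ⟶ [m](c₁, …, c_m)` with image `v`. -/
def vertex (X : Theta C) (v : Fin (X.len + 1)) : zero ⟶ X where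
  φ := OrderHom.const _ v
  f i := i.elim0

/-- The monotone map `[1] → [m]` onto the `i`-th edge. -/
def edgeHom {m : ℕ} (i : Fin m) : Fin (1 + 1) →o Fin (m + 1) where
  toFun := ![i.castSucc, i.succ]
  monotone' := by
    refine Fin.monotone_iff_le_succ.2 fun a ↦ ?_
    obtain rfl := Subsingleton.elim a 0
    exact Fin.castSucc_lt_succ.le

/-- The `i`-th edge `[1](c_i) ⟶ [m](c₁, …, c_m)`, given by the identity of `c_i`. -/
def edge (X : Theta C) (i : Fin X.len) : one (X.label i) ⟶ X where
  φ := edgeHom i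
  f := fun (k : Fin 1) j h₁ h₂ ↦ eqToHom (by
    obtain rfl := Subsingleton.elim k 0
    exact congrArg X.label
      (le_antisymm (Fin.castSucc_lt_succ_iff.1 h₁) (Fin.succ_le_succ_iff.1 h₂)))

variable (C) in
/-- The functor `c ↦ [1](c)`. -/
def oneFunctor : C ⥤ Theta C where
  obj := one
  map g := { φ := OrderHom.id, f := fun _ _ _ _ ↦ g }
  map_id c := hom_ext (fun _ ↦ rfl) fun i j _ _ _ _ ↦ by
    obtain rfl : i = j := Subsingleton.elim (α := Fin 1) _ _
    rfl
  map_comp {c d e} g h := hom_ext (fun _ ↦ rfl) fun i k h₁ h₂ _ _ ↦ by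
    obtain rfl : i = k := Subsingleton.elim (α := Fin 1) _ _
    exact (comp_f (X := one c) (Y := one d) (Z := one e) { φ := OrderHom.id, f := fun _ _ _ _ ↦ g }
      { φ := OrderHom.id, f := fun _ _ _ _ ↦ h } i i i h₁ h₂ h₁ h₂ h₁ h₂).symm

variable (C) in
/-- The projection `π : Θ C ⥤ Δ`, `[m](c₁, …, c_m) ↦ [m]`. -/
def proj : Theta C ⥤ SimplexCategory where
  obj X := SimplexCategory.mk X.len
  map g := SimplexCategory.Hom.mk g.φ

/-- The functor `Θ C ⥤ Θ D` induced by a functor `C ⥤ D`. -/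
def map {D : Type*} [Category* D] (F : C ⥤ D) : Theta C ⥤ Theta D where
  obj X := ⟨X.len, fun i ↦ F.obj (X.label i)⟩
  map g := { φ := g.φ, f := fun i j h₁ h₂ ↦ F.map (g.f i j h₁ h₂) }
  map_id X := hom_ext (fun _ ↦ rfl) fun i j h₁ h₂ _ _ ↦ by
    obtain rfl : i = j :=
      le_antisymm (Fin.castSucc_lt_succ_iff.1 h₁) (Fin.succ_le_succ_iff.1 h₂)
    exact F.map_id _
  map_comp {X Y Z} g h := hom_ext (fun _ ↦ rfl) fun i k h₁ h₂ _ _ ↦ by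
    obtain ⟨j, h₃, h₄, h₅, h₆⟩ := exists_step h.φ _ _ k h₁ h₂
    refine (congrArg F.map (comp_f g h i j k h₁ h₂ h₃ h₄ h₅ h₆)).trans ((F.map_comp _ _).trans ?_)
    exact (comp_f (X := ⟨X.len, fun i ↦ F.obj (X.label i)⟩)
      (Y := ⟨Y.len, fun i ↦ F.obj (Y.label i)⟩) (Z := ⟨Z.len, fun i ↦ F.obj (Z.label i)⟩)
      { φ := g.φ, f := fun i j h₁ h₂ ↦ F.map (g.f i j h₁ h₂) }
      { φ := h.φ, f := fun i j h₁ h₂ ↦ F.map (h.f i j h₁ h₂) }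
      i j k h₁ h₂ h₃ h₄ h₅ h₆).symm

end Cat

/-! ### The suspension -/

section Suspension

variable (C : Type u) [SmallCategory.{u} C]

/-- The suspension functor `V[1]` on presheaves of sets: an element of `V[1](P)` on
`[m](c₁, …, c_m)` is a morphism `[m](よ c₁, …, よ c_m) ⟶ [1](P)` in `Θ (PSh C)`, that is, by the
Yoneda lemma, a monotone map `δ : [m] → [1]` with an element of `P (c_i)` for the `i` such that
`δ (i - 1) < 1 ≤ δ i`, if there is one. -/
def suspPresheaf : (Cᵒᵖ ⥤ Type u) ⥤ ((Theta C)ᵒᵖ ⥤ Type u) :=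
  oneFunctor (Cᵒᵖ ⥤ Type u) ⋙ yoneda ⋙ (Functor.whiskeringLeft _ _ _).obj (map yoneda).op

/-- The suspension functor `V[1]` on simplicial presheaves, defined in each simplicial degree by
the suspension of presheaves of sets. -/
def susp : (Cᵒᵖ ⥤ SSet.{u}) ⥤ ((Theta C)ᵒᵖ ⥤ SSet.{u}) :=
  flipFunctor _ _ _ ⋙ (Functor.whiskeringRight _ _ _).obj (suspPresheaf C) ⋙ flipFunctor _ _ _

end Suspension

end Theta

/-! ### Simplicial presheaves -/

section SimplicialPresheaf

variable {D : Type u} [SmallCategory.{u} D]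

variable (D) in
/-- The inclusion of presheaves of sets as discrete simplicial presheaves. -/
def discPresheaf : (Dᵒᵖ ⥤ Type u) ⥤ (Dᵒᵖ ⥤ SSet.{u}) :=
  (Functor.whiskeringRight _ _ _).obj (SimplicialObject.const (Type u))

variable (D) in
/-- The discrete Yoneda embedding. -/
def discYoneda : D ⥤ (Dᵒᵖ ⥤ SSet.{u}) := yoneda ⋙ discPresheaf D

/-- The tensor `X × K` of a simplicial presheaf with a (constant) simplicial set. -/
def tensorConst (X : Dᵒᵖ ⥤ SSet.{u}) : SSet.{u} ⥤ (Dᵒᵖ ⥤ SSet.{u}) :=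
  MonoidalCategory.tensoringRight SSet.{u} ⋙ (Functor.whiskeringLeft _ _ _).obj X

/-- The mapping space, with `Map(X, Y)_p = Hom(X × Δ[p], Y)`. -/
def mapSpace (X Y : Dᵒᵖ ⥤ SSet.{u}) : SSet.{u} :=
  (SSet.stdSimplex ⋙ tensorConst X).op ⋙ yoneda.obj Y

/-- A map of simplicial sets `f : X ⟶ Y` is a weak equivalence (of the Kan–Quillen model structure)
if for every Kan complex `K`, precomposition with `f` is a bijection from the homotopy classes
of maps `Y ⟶ K` to the homotopy classes of maps `X ⟶ K`. -/
structure SSetWeakEquiv {X Y : SSet.{u}} (f : X ⟶ Y) : Prop where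
  surjective (K : SSet.{u}) [SSet.KanComplex K] (g : X ⟶ K) :
    ∃ h : Y ⟶ K, Nonempty (SSet.Homotopy (f ≫ h) g)
  injective (K : SSet.{u}) [SSet.KanComplex K] (h h' : Y ⟶ K) :
    Nonempty (SSet.Homotopy (f ≫ h) (f ≫ h')) → Nonempty (SSet.Homotopy h h')

/-- Levelwise weak equivalences of simplicial presheaves. -/
def LevelwiseWeakEquiv {X Y : Dᵒᵖ ⥤ SSet.{u}} (f : X ⟶ Y) : Prop :=
  ∀ d : Dᵒᵖ, SSetWeakEquiv (f.app d)

/-- Fibrant objects of the injective model structure: the cofibrations are the monomorphisms and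
the weak equivalences are the levelwise weak equivalences. -/
def InjectiveFibrant (W : Dᵒᵖ ⥤ SSet.{u}) : Prop :=
  ∀ ⦃A B : Dᵒᵖ ⥤ SSet.{u}⦄ (i : A ⟶ B), Mono i → LevelwiseWeakEquiv i →
    ∀ a : A ⟶ W, ∃ b : B ⟶ W, i ≫ b = a

/-- The map `f^* : Map(Y, W) ⟶ Map(X, W)`. -/
def mapSpacePre {X Y : Dᵒᵖ ⥤ SSet.{u}} (f : X ⟶ Y) (W : Dᵒᵖ ⥤ SSet.{u}) :
    mapSpace Y W ⟶ mapSpace X W where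
  app p := ↾fun g ↦ Functor.whiskerRight f (MonoidalCategory.tensorRight Δ[p.unop.len]) ≫ g

/-- `S`-local objects, for a class `S` of morphisms. -/
def IsLocalFor (S : MorphismProperty (Dᵒᵖ ⥤ SSet.{u})) (W : Dᵒᵖ ⥤ SSet.{u}) : Prop :=
  ∀ ⦃X Y : Dᵒᵖ ⥤ SSet.{u}⦄ (f : X ⟶ Y), S f → SSetWeakEquiv (mapSpacePre f W)

/-- `S`-fibrant objects. -/
structure IsFibrantFor (S : MorphismProperty (Dᵒᵖ ⥤ SSet.{u})) (W : Dᵒᵖ ⥤ SSet.{u}) : Prop where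
  isLocal : IsLocalFor S W
  injectiveFibrant : InjectiveFibrant W

end SimplicialPresheaf

section Segal

variable {C : Type u} [SmallCategory.{u} C]

/-- The spine `F([1](c₁)) ⊔_{F[0]} ⋯ ⊔_{F[0]} F([1](c_m))` of `F([m](c₁, …, c_m))`, as the union of
the images of all vertices and edges (for `m = 0` it is `F[0]`). -/
def spine (X : Theta C) : Subfunctor (yoneda.obj X) :=
  (⨆ v, Subfunctor.range (yoneda.map (X.vertex v))) ⊔
    ⨆ i, Subfunctor.range (yoneda.map (X.edge i))

/-- The Segal map, the inclusion of the spine. -/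
def segalMap (X : Theta C) :
    (discPresheaf (Theta C)).obj (spine X).toFunctor ⟶ (discYoneda (Theta C)).obj X :=
  (discPresheaf (Theta C)).map (spine X).ι

variable (C) in
/-- The set `se_C` of all Segal maps. -/
def segalMaps : MorphismProperty ((Theta C)ᵒᵖ ⥤ SSet.{u}) :=
  .ofHoms fun X : Theta C ↦ segalMap X

variable (C) in
/-- The completeness map `π^* E ⟶ F[0]`, where `E` is the discrete nerve of the walking
isomorphism. -/
def completenessMap :
    (discPresheaf (Theta C)).obj ((Theta.proj C).op ⋙ nerve WalkingIso.{u}) ⟶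
      (discYoneda (Theta C)).obj Theta.zero :=
  (discPresheaf (Theta C)).map
    { app X := ↾fun _ ↦ X.unop.toZero
      naturality _ _ _ := by ext; exact Theta.hom_zero_ext _ _ }

/-- The class `se(S) = se_C ∪ V[1](S)`. -/
def se (S : MorphismProperty (Cᵒᵖ ⥤ SSet.{u})) : MorphismProperty ((Theta C)ᵒᵖ ⥤ SSet.{u}) :=
  segalMaps C ⊔ S.strictMap (Theta.susp C)

/-- The class `cpt(S) = cplt_C ∪ se_C ∪ V[1](S)`. -/
def cpt (S : MorphismProperty (Cᵒᵖ ⥤ SSet.{u})) : MorphismProperty ((Theta C)ᵒᵖ ⥤ SSet.{u}) :=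
  .ofHoms (fun _ : Unit ↦ completenessMap C) ⊔ segalMaps C ⊔ S.strictMap (Theta.susp C)

/-! ### Objects -/

/-- The source `[0] ⟶ [1](c)`. -/
def src (c : C) : Theta.zero ⟶ Theta.one c := Theta.vertex (Theta.one c) (0 : Fin 2)

/-- The target `[0] ⟶ [1](c)`. -/
def tgt (c : C) : Theta.zero ⟶ Theta.one c := Theta.vertex (Theta.one c) (1 : Fin 2)

variable (W U V : (Theta C)ᵒᵖ ⥤ SSet.{u})

/-- The set `W_{[0],0}` of objects. -/
abbrev ObjOf : Type u := (W.obj (op Theta.zero)).obj (op ⦋0⦌)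

variable {W} in
/-- An object as a degenerate `p`-simplex of `W_{[0]}`. -/
def degen (x : ObjOf W) (p : SimplexCategoryᵒᵖ) : (W.obj (op Theta.zero)).obj p :=
  (W.obj (op Theta.zero)).map (SimplexCategory.const p.unop ⦋0⦌ 0).op x

end Segal

/-! ### Auxiliary facts on simplicial sets

These facts are needed to construct the composition of the homotopy category. -/

lemma app_congr {X Y : SSet.{u}} {f g : X ⟶ Y} (h : f = g) (n : SimplexCategoryᵒᵖ) (x : X.obj n) :
    f.app n x = g.app n x := by rw [h]

/-- A homotopy from a map on `X × Δ[1]` with given ends. -/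
def mkHomotopy {X Y : SSet.{u}} {f g : X ⟶ Y} (h : X ⊗ Δ[1] ⟶ Y) (h₀ : SSet.ι₀ ≫ h = f)
    (h₁ : SSet.ι₁ ≫ h = g) : SSet.Homotopy f g :=
  { h := h, h₀ := h₀, h₁ := h₁, rel := by ext _ ⟨⟨_, h⟩, _⟩; tauto }

lemma horn_lift_one {E B : SSet.{u}} (p : E ⟶ B) [Fibration p] (e : E _⦋0⦌) (b : B _⦋1⦌)
    (h : B.δ 1 b = p.app _ e) :
    ∃ e' : E _⦋1⦌, E.δ 1 e' = e ∧ p.app _ e' = b := by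
  have hc : SSet.horn.IsCompatible (n := 0) (i := 0)
    (fun j _ ↦ SSet.yonedaEquiv.symm e) := trivial
  obtain ⟨φ, h₁, h₂⟩ := hc.exists_lift p (SSet.yonedaEquiv.symm b) (by
    intro j hj
    obtain rfl := Fin.eq_one_of_ne_zero j hj
    rw [SSet.stdSimplex.δ_comp_yonedaEquiv_symm, SSet.yonedaEquiv_symm_comp, h])
  refine ⟨SSet.yonedaEquiv φ, ?_, ?_⟩
  · rw [← SSet.stdSimplex.yonedaEquiv_δ_comp, h₁ 1 one_ne_zero, Equiv.apply_symm_apply]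
  · apply SSet.yonedaEquiv.symm.injective
    rw [← SSet.yonedaEquiv_symm_comp, Equiv.symm_apply_apply, h₂]

lemma horn_lift_two {E B : SSet.{u}} (p : E ⟶ B) [Fibration p] (i : Fin 3) (e : Fin 3 → E _⦋1⦌)
    (he : ∀ (j k : Fin 3) (_ : j ≠ i) (_ : k ≠ i) (hjk : j < k),
      E.δ (k.pred (Fin.ne_zero_of_lt hjk)) (e j) = E.δ (j.castPred (Fin.ne_last_of_lt hjk)) (e k))
    (b : B _⦋2⦌) (h : ∀ j, j ≠ i → B.δ j b = p.app _ (e j)) :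
    ∃ e' : E _⦋2⦌, (∀ j, j ≠ i → E.δ j e' = e j) ∧ p.app _ e' = b := by
  have hc : SSet.horn.IsCompatible (n := 1) (i := i)
    (fun j _ ↦ SSet.yonedaEquiv.symm (e j)) := by
      intro j k hj hk hjk
      rw [SSet.stdSimplex.δ_comp_yonedaEquiv_symm, SSet.stdSimplex.δ_comp_yonedaEquiv_symm,
        he j k hj hk hjk]
  obtain ⟨φ, h₁, h₂⟩ := hc.exists_lift p (SSet.yonedaEquiv.symm b) (by
    intro j hj
    rw [SSet.stdSimplex.δ_comp_yonedaEquiv_symm, SSet.yonedaEquiv_symm_comp, h j hj])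
  refine ⟨SSet.yonedaEquiv φ, fun j hj ↦ ?_, ?_⟩
  · rw [← SSet.stdSimplex.yonedaEquiv_δ_comp, h₁ j hj, Equiv.apply_symm_apply]
  · apply SSet.yonedaEquiv.symm.injective
    rw [← SSet.yonedaEquiv_symm_comp, Equiv.symm_apply_apply, h₂]

/-- Simplices of the internal hom. -/
def ihomEquiv {X Y : SSet.{u}} {n : ℕ} : (X ⊗ Δ[n] ⟶ Y) ≃ ((ihom X).obj Y : SSet.{u}) _⦋n⦌ :=
  ((ihom.adjunction X).homEquiv _ _).trans SSet.yonedaEquiv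

lemma map_ihomEquiv_op {X Y : SSet.{u}} {n m : ℕ} (φ : ⦋m⦌ ⟶ ⦋n⦌) (h : X ⊗ Δ[n] ⟶ Y) :
    ((ihom X).obj Y).map φ.op (ihomEquiv h) = ihomEquiv (X ◁ SSet.stdSimplex.map φ ≫ h) := by
  dsimp only [ihomEquiv, Equiv.trans_apply]
  rw [SSet.yonedaEquiv_naturality]
  exact congrArg _ (Adjunction.homEquiv_naturality_left _ _ _).symm

lemma app_ihomEquiv {X Y Z : SSet.{u}} {n : ℕ} (p : Y ⟶ Z) (h : X ⊗ Δ[n] ⟶ Y) :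
    ((ihom X).map p).app _ (ihomEquiv h) = ihomEquiv (h ≫ p) := by
  dsimp only [ihomEquiv, Equiv.trans_apply]
  apply SSet.yonedaEquiv.symm.injective
  rw [← SSet.yonedaEquiv_symm_comp, Equiv.symm_apply_apply, Equiv.symm_apply_apply]
  exact (Adjunction.homEquiv_naturality_right _ _ _).symm

/-- The vertex of the internal hom given by a map. -/
def ihomVertex {X Y : SSet.{u}} (f : X ⟶ Y) : ((ihom X).obj Y : SSet.{u}) _⦋0⦌ :=
  ihomEquiv (SemiCartesianMonoidalCategory.fst _ _ ≫ f)

lemma app_ihomVertex {X Y Z : SSet.{u}} (p : Y ⟶ Z) (f : X ⟶ Y) :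
    ((ihom X).map p).app _ (ihomVertex f) = ihomVertex (f ≫ p) :=
  app_ihomEquiv _ _

lemma whiskerLeft_δ_one (X : SSet.{u}) :
    X ◁ (SSet.stdSimplex.δ (1 : Fin 2) : Δ[0] ⟶ Δ[1]) =
      SemiCartesianMonoidalCategory.fst _ _ ≫ SSet.ι₀ := by
  rw [SSet.stdSimplex.δ_one_eq_const]
  rfl

lemma whiskerLeft_δ_zero (X : SSet.{u}) :
    X ◁ (SSet.stdSimplex.δ (0 : Fin 2) : Δ[0] ⟶ Δ[1]) =
      SemiCartesianMonoidalCategory.fst _ _ ≫ SSet.ι₁ := by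
  rw [SSet.stdSimplex.δ_zero_eq_const]
  rfl

lemma δ_one_ihomEquiv {X Y : SSet.{u}} (h : X ⊗ Δ[1] ⟶ Y) :
    ((ihom X).obj Y).δ 1 (ihomEquiv h) = ihomVertex (SSet.ι₀ ≫ h) :=
  (map_ihomEquiv_op _ h).trans ((congrArg (fun k ↦ ihomEquiv (n := 0) (k ≫ h))
    (whiskerLeft_δ_one X)).trans (congrArg _ (Category.assoc _ _ _)))

lemma δ_zero_ihomEquiv {X Y : SSet.{u}} (h : X ⊗ Δ[1] ⟶ Y) :
    ((ihom X).obj Y).δ 0 (ihomEquiv h) = ihomVertex (SSet.ι₁ ≫ h) :=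
  (map_ihomEquiv_op _ h).trans ((congrArg (fun k ↦ ihomEquiv (n := 0) (k ≫ h))
    (whiskerLeft_δ_zero X)).trans (congrArg _ (Category.assoc _ _ _)))

lemma σ_ihomVertex {X Y : SSet.{u}} (f : X ⟶ Y) :
    ((ihom X).obj Y).σ 0 (ihomVertex f) =
      ihomEquiv (SemiCartesianMonoidalCategory.fst _ _ ≫ f) :=
  map_ihomEquiv_op _ _

lemma ihomVertex_injective {X Y : SSet.{u}} {f g : X ⟶ Y} (h : ihomVertex f = ihomVertex g) :
    f = g := by
  have h := congrArg (SSet.ι₀ (X := X) ≫ X ◁ SSet.stdSimplex.map (SimplexCategory.σ (0 : Fin 1)) ≫ ·) (ihomEquiv.injective h)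
  simpa using h

/-- A Kan fibration between Kan complexes that is a weak equivalence has a section `s` such that
`p ≫ s` is fibrewise homotopic to the identity. -/
lemma exists_section {E B : SSet.{u}} (p : E ⟶ B) [Fibration p] [SSet.KanComplex E]
    [SSet.KanComplex B] (hp : SSetWeakEquiv p) :
    ∃ (s : B ⟶ E) (F : E ⊗ Δ[1] ⟶ E), s ≫ p = 𝟙 B ∧ SSet.ι₀ ≫ F = 𝟙 E ∧ SSet.ι₁ ≫ F = p ≫ s ∧
      F ≫ p = SemiCartesianMonoidalCategory.fst _ _ ≫ p := by
  obtain ⟨q, ⟨H₁⟩⟩ := hp.surjective E (𝟙 E)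
  obtain ⟨H₂⟩ := hp.injective B (q ≫ p) (𝟙 B) ⟨mkHomotopy (H₁.h ≫ p) (by simp) (by simp)⟩
  -- a strict section
  obtain ⟨K, hK₁, hK₂⟩ := horn_lift_one ((ihom B).map p) (ihomVertex q) (ihomEquiv H₂.h) (by
    rw [δ_one_ihomEquiv, app_ihomVertex, SSet.Homotopy.h₀])
  obtain ⟨K, rfl⟩ := ihomEquiv.surjective K
  rw [δ_one_ihomEquiv] at hK₁
  replace hK₁ := ihomVertex_injective hK₁
  rw [app_ihomEquiv] at hK₂
  replace hK₂ := ihomEquiv.injective hK₂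
  set s : B ⟶ E := SSet.ι₁ ≫ K with hs
  have hsp : s ≫ p = 𝟙 B := by rw [hs, Category.assoc, hK₂, SSet.Homotopy.h₁]
  -- a homotopy from the identity to `p ≫ s`
  obtain ⟨H, hH₀, hH₁⟩ : ∃ H : E ⊗ Δ[1] ⟶ E, SSet.ι₀ ≫ H = 𝟙 E ∧ SSet.ι₁ ≫ H = p ≫ s := by
    obtain ⟨σ, hσ, -⟩ := horn_lift_two (Limits.terminal.from ((ihom E).obj E)) 0
      ![ihomEquiv H₁.h, ihomEquiv (p ▷ _ ≫ K), ihomEquiv H₁.h] (by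
        intro j k hj hk hjk
        obtain rfl : j = 1 := by lia
        obtain rfl : k = 2 := by lia
        refine (δ_one_ihomEquiv _).trans (Eq.trans ?_ (δ_one_ihomEquiv _).symm)
        rw [SSet.Homotopy.h₀, SSet.ι₀_comp_assoc, hK₁])
      (((Limits.terminal.from ((ihom E).obj E))).app _
        ((((ihom E).obj E)).σ 0 (ihomEquiv H₁.h))) (by
        intro j hj
        exact SSet.yonedaEquiv.symm.injective (Limits.terminalIsTerminal.hom_ext _ _))
    have hσ₁ := hσ 1 (by decide)
    have hσ₂ := hσ 2 (by decide)
    obtain ⟨H, hH⟩ := ihomEquiv.surjective (((ihom E).obj E).δ 0 σ)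
    refine ⟨H, ihomVertex_injective ?_, ihomVertex_injective ?_⟩
    · rw [← δ_one_ihomEquiv, hH]
      refine (SSet.δ_comp_δ'_apply (i := 0) (j := 2) (by decide) σ).symm.trans ?_
      rw [hσ₂]
      exact (δ_zero_ihomEquiv _).trans (by rw [SSet.Homotopy.h₁])
    · rw [← δ_zero_ihomEquiv, hH]
      refine (SSet.δ_comp_δ_self_apply (i := 0) σ).trans ?_
      refine (congrArg _ hσ₁).trans ?_
      exact (δ_zero_ihomEquiv _).trans (by rw [SSet.ι₁_comp_assoc])
  obtain ⟨σ, hσ, hσ'⟩ := horn_lift_two ((ihom E).map p) 2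
      ![ihomEquiv (H ≫ p ≫ s), ihomEquiv H, ihomEquiv H] (by
        intro j k hj hk hjk
        obtain rfl : j = 0 := by lia
        obtain rfl : k = 1 := by lia
        refine (δ_zero_ihomEquiv _).trans (Eq.trans ?_ (δ_zero_ihomEquiv _).symm)
        simp only [reassoc_of% hH₁, hH₁, reassoc_of% hsp])
      (((ihom E).obj B).σ 0 (ihomEquiv (H ≫ p))) (by
        intro j hj
        obtain rfl | rfl : j = 0 ∨ j = 1 := by lia
        · refine (SSet.δ_comp_σ_self_apply 0 _).trans (Eq.trans ?_ (app_ihomEquiv _ _).symm)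
          rw [Category.assoc, Category.assoc, hsp, Category.comp_id]
        · exact (SSet.δ_comp_σ_succ_apply 0 _).trans (app_ihomEquiv _ _).symm)
  have hσ₀ := hσ 0 (by decide)
  have hσ₁ := hσ 1 (by decide)
  obtain ⟨F, hF⟩ := ihomEquiv.surjective (((ihom E).obj E).δ 2 σ)
  refine ⟨s, F, hsp, ihomVertex_injective ?_, ihomVertex_injective ?_, ihomEquiv.injective ?_⟩
  · rw [← δ_one_ihomEquiv, hF]
    refine (SSet.δ_comp_δ_self_apply (i := 1) σ).symm.trans ?_
    refine (congrArg _ hσ₁).trans ?_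
    exact (δ_one_ihomEquiv _).trans (by rw [hH₀])
  · rw [← δ_zero_ihomEquiv, hF]
    refine (SSet.δ_comp_δ'_apply (i := 0) (j := 2) (by decide) σ).trans ?_
    refine (congrArg _ hσ₀).trans ?_
    exact (δ_one_ihomEquiv _).trans (by rw [reassoc_of% hH₀])
  · rw [← app_ihomEquiv, hF]
    refine (SSet.δ_naturality_apply ((ihom E).map p) 2 σ).trans ?_
    rw [hσ']
    refine (SSet.δ_comp_σ_of_gt_apply (i := 1) (j := 0) (by decide) _).trans ?_
    refine (congrArg _ (δ_one_ihomEquiv _)).trans ((σ_ihomVertex _).trans ?_)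
    rw [reassoc_of% hH₀]

lemma surjective_of_weakEquiv {E B : SSet.{u}} (p : E ⟶ B) [Fibration p] [SSet.KanComplex E]
    [SSet.KanComplex B] (hp : SSetWeakEquiv p) (b : B _⦋0⦌) : ∃ e : E _⦋0⦌, p.app _ e = b := by
  obtain ⟨s, -, hs, -⟩ := exists_section p hp
  exact ⟨s.app _ b, by rw [← NatTrans.comp_app_apply, hs]; rfl⟩

lemma lift_edge_of_weakEquiv {E B : SSet.{u}} (p : E ⟶ B) [Fibration p] [SSet.KanComplex E]
    [SSet.KanComplex B] (hp : SSetWeakEquiv p) (e₀ e₁ : E _⦋0⦌) (γ : B _⦋1⦌)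
    (h₀ : B.δ 1 γ = p.app _ e₀) (h₁ : B.δ 0 γ = p.app _ e₁) :
    ∃ e : E _⦋1⦌, E.δ 1 e = e₀ ∧ E.δ 0 e = e₁ ∧ p.app _ e = γ := by
  obtain ⟨s, F, hs, hF₀, hF₁, hF⟩ := exists_section p hp
  have hs' (n) (b : B.obj n) : p.app _ (s.app _ b) = b := by
    rw [← NatTrans.comp_app_apply, hs]; rfl
  -- the path from a vertex `e` to `s (p e)`
  have path (e : E _⦋0⦌) : ∃ g : E _⦋1⦌, E.δ 1 g = e ∧ E.δ 0 g = s.app _ (p.app _ e) ∧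
      p.app _ g = B.σ 0 (p.app _ e) := by
    refine ⟨F.app _ ⟨E.σ 0 e, SSet.stdSimplex.objEquiv.symm (𝟙 _)⟩, ?_, ?_, ?_⟩
    · refine (SSet.δ_naturality_apply F 1 _).symm.trans ?_
      refine Eq.trans (congrArg (F.app (op ⦋0⦌)) ?_) (app_congr hF₀ (op ⦋0⦌) e)
      exact Prod.ext (SSet.δ_comp_σ_succ_apply 0 e) (by ext i; fin_cases i; rfl)
    · refine (SSet.δ_naturality_apply F 0 _).symm.trans ?_
      refine Eq.trans (congrArg (F.app (op ⦋0⦌)) ?_) (app_congr hF₁ (op ⦋0⦌) e)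
      exact Prod.ext (SSet.δ_comp_σ_self_apply 0 e) (by ext i; fin_cases i; rfl)
    · refine (app_congr hF (op ⦋1⦌) _).trans ?_
      exact SSet.σ_naturality_apply p 0 e
  obtain ⟨g₀, hg₀, hg₀', hg₀''⟩ := path e₀
  obtain ⟨g₁, hg₁, hg₁', hg₁''⟩ := path e₁
  obtain ⟨σ, hσ, hσ'⟩ := horn_lift_two p 1 ![s.app _ γ, s.app _ γ, g₀] (by
      intro j k hj hk hjk
      obtain rfl : j = 0 := by lia
      obtain rfl : k = 2 := by lia
      exact (SSet.δ_naturality_apply s 1 γ).symm.trans ((congrArg _ h₀).trans hg₀'.symm))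
    (B.σ 0 γ) (by
      intro j hj
      obtain rfl | rfl : j = 0 ∨ j = 2 := by lia
      · exact (SSet.δ_comp_σ_self_apply 0 _).trans (hs' _ _).symm
      · refine (SSet.δ_comp_σ_of_gt_apply (i := 1) (j := 0) (by decide) _).trans ?_
        exact (congrArg _ h₀).trans hg₀''.symm)
  have hσ₀ := hσ 0 (by decide)
  have hσ₂ := hσ 2 (by decide)
  obtain ⟨τ, hτ, hτ'⟩ := horn_lift_two p 2 ![g₁, E.δ 1 σ, g₁] (by
      intro j k hj hk hjk
      obtain rfl : j = 0 := by lia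
      obtain rfl : k = 1 := by lia
      refine Eq.trans ?_ (SSet.δ_comp_δ_self_apply (i := 0) σ)
      refine hg₁'.trans (Eq.trans ?_ (congrArg (E.δ 0) hσ₀).symm)
      exact (congrArg _ h₁.symm).trans (SSet.δ_naturality_apply s 0 γ))
    (B.σ 1 γ) (by
      intro j hj
      obtain rfl | rfl : j = 0 ∨ j = 1 := by lia
      · refine (SSet.δ_comp_σ_of_le_apply (i := 0) (j := 0) (by decide) _).trans ?_
        exact (congrArg _ h₁).trans hg₁''.symm
      · refine (SSet.δ_comp_σ_self_apply 1 _).trans (Eq.symm ?_)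
        refine (SSet.δ_naturality_apply p 1 σ).trans ((congrArg _ hσ').trans ?_)
        exact SSet.δ_comp_σ_succ_apply 0 _)
  have hτ₀ := hτ 0 (by decide)
  have hτ₁ := hτ 1 (by decide)
  refine ⟨E.δ 2 τ, ?_, ?_, ?_⟩
  · refine (SSet.δ_comp_δ_self_apply (i := 1) τ).symm.trans ((congrArg (E.δ 1) hτ₁).trans ?_)
    refine (SSet.δ_comp_δ_self_apply (i := 1) σ).trans ((congrArg (E.δ 1) hσ₂).trans hg₀)
  · refine (SSet.δ_comp_δ'_apply (i := 0) (j := 2) (by decide) τ).trans ?_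
    exact (congrArg (E.δ 1) hτ₀).trans hg₁
  · refine (SSet.δ_naturality_apply p 2 τ).trans ((congrArg _ hτ').trans ?_)
    exact SSet.δ_comp_σ_succ_apply 1 _

/-! ### Anodyne extensions -/

lemma mono_of_anodyne {X Y : SSet.{u}} {f : X ⟶ Y} (hf : SSet.anodyneExtensions f) : Mono f := by
  rw [SSet.anodyneExtensions_eq_retracts_transfiniteCompositions] at hf
  have h₁ : MorphismProperty.coproducts.{u} SSet.modelCategoryQuillen.J.{u} ≤
      MorphismProperty.monomorphisms SSet.{u} :=
    (MorphismProperty.coproducts_monotone SSet.modelCategoryQuillen.J_le_monomorphisms).trans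
      (MorphismProperty.coproducts_le _)
  have h₂ := (MorphismProperty.pushouts_monotone h₁).trans MorphismProperty.pushouts_le
  have h₃ := (MorphismProperty.transfiniteCompositions_monotone.{u} h₂).trans
    (MorphismProperty.transfiniteCompositions_le _)
  exact (MorphismProperty.retracts_monotone h₃).trans (MorphismProperty.retracts_le _) _ hf

open SSet.stdSimplex in
lemma boundary_one_const {n : SimplexCategoryᵒᵖ} (z : (SSet.boundary.{u} 1 : SSet.{u}).obj n)
    (a b) : asOrderHom z.1 a = asOrderHom z.1 b := by
  by_contra hab
  refine z.2 fun c ↦ ?_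
  by_cases ha : asOrderHom z.1 a = c
  · exact ⟨a, ha⟩
  · exact ⟨b, by lia⟩

/-- Two maps glue to a map on `Y × ∂Δ[1]`. -/
def boundaryGlue {Y K : SSet.{u}} (h h' : Y ⟶ K) : Y ⊗ (SSet.boundary.{u} 1 : SSet.{u}) ⟶ K where
  app n := ↾fun z ↦ if SSet.stdSimplex.asOrderHom z.2.1 0 = 0 then h.app n z.1 else h'.app n z.1
  naturality {n m} φ := by
    ext z
    have hz : SSet.stdSimplex.asOrderHom
        ((SSet.boundary.{u} 1 : SSet.{u}).map φ z.2).1 0 =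
        SSet.stdSimplex.asOrderHom z.2.1 0 := boundary_one_const z.2 _ 0
    change (if SSet.stdSimplex.asOrderHom
        ((SSet.boundary.{u} 1 : SSet.{u}).map φ z.2).1 0 = 0 then h.app m (Y.map φ z.1) else
          h'.app m (Y.map φ z.1)) = K.map φ (if SSet.stdSimplex.asOrderHom z.2.1 0 = 0 then
          h.app n z.1 else h'.app n z.1)
    rw [hz]
    split_ifs
    · exact NatTrans.naturality_apply h φ z.1
    · exact NatTrans.naturality_apply h' φ z.1

lemma boundaryGlue_pos {Y K : SSet.{u}} (h h' : Y ⟶ K) {n} (z)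
    (hz : SSet.stdSimplex.asOrderHom z.2.1 0 = 0) :
    (boundaryGlue h h').app n z = h.app n z.1 := if_pos hz

lemma boundaryGlue_neg {Y K : SSet.{u}} (h h' : Y ⟶ K) {n} (z)
    (hz : SSet.stdSimplex.asOrderHom z.2.1 0 ≠ 0) :
    (boundaryGlue h h').app n z = h'.app n z.1 := if_neg hz

lemma weakEquiv_of_anodyne {X Y : SSet.{u}} {f : X ⟶ Y} (hf : SSet.anodyneExtensions f) :
    SSetWeakEquiv f where
  surjective K _ g := by
    have := hf (Limits.terminal.from K) (mem_fibrations _)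
    have sq : CommSq g f (Limits.terminal.from K) (Limits.terminal.from Y) := ⟨by simp⟩
    exact ⟨sq.lift, ⟨mkHomotopy (SemiCartesianMonoidalCategory.fst _ _ ≫ g) (by simp) (by simp)⟩⟩
  injective K _ h h' := by
    rintro ⟨H⟩
    let sq := Functor.PushoutObjObj.ofHasPushout (curriedTensor SSet.{u}) f (SSet.boundary.{u} 1).ι
    have hsq := SSet.anodyneExtensions_pushoutObjObjι' sq hf
    have := hsq (Limits.terminal.from K) (mem_fibrations _)
    have hd : f ▷ (SSet.boundary.{u} 1 : SSet.{u}) ≫ boundaryGlue h h' =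
        X ◁ (SSet.boundary.{u} 1).ι ≫ H.h := by
      ext n z
      change (if SSet.stdSimplex.asOrderHom z.2.1 0 = 0 then h.app n (f.app n z.1) else
        h'.app n (f.app n z.1)) = H.h.app n (z.1, z.2.1)
      split_ifs with hz
      · refine (app_congr H.h₀ n z.1).symm.trans ?_
        refine congrArg (H.h.app n) (Prod.ext rfl ?_)
        refine SSet.stdSimplex.objEquiv.injective ?_
        ext i : 3
        exact (hz.symm.trans (boundary_one_const z.2 0 i))
      · refine (app_congr H.h₁ n z.1).symm.trans ?_
        refine congrArg (H.h.app n) (Prod.ext rfl ?_)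
        refine SSet.stdSimplex.objEquiv.injective ?_
        ext i : 3
        exact ((Fin.eq_one_of_ne_zero _ hz).symm.trans (boundary_one_const z.2 0 i))
    let d : sq.pt ⟶ K := sq.isPushout.desc (boundaryGlue h h') H.h hd
    have sq' : CommSq d sq.ι (Limits.terminal.from K) (Limits.terminal.from _) := ⟨by simp⟩
    have hl : Y ◁ (SSet.boundary.{u} 1).ι ≫ sq'.lift = boundaryGlue h h' := by
      have h₁ : sq.inl ≫ sq.ι = Y ◁ (SSet.boundary.{u} 1).ι := sq.inl_ι
      rw [← h₁, Category.assoc, sq'.fac_left]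
      exact sq.isPushout.inl_desc _ _ _
    refine ⟨mkHomotopy sq'.lift ?_ ?_⟩
    · ext n y
      exact (app_congr hl n
        (y, ⟨SSet.stdSimplex.objEquiv.symm (SimplexCategory.const _ _ 0), fun hs ↦
          zero_ne_one (hs 1).choose_spec⟩)).trans (boundaryGlue_pos _ _ _ rfl)
    · ext n y
      exact (app_congr hl n
        (y, ⟨SSet.stdSimplex.objEquiv.symm (SimplexCategory.const _ _ 1), fun hs ↦
          one_ne_zero (hs 0).choose_spec⟩)).trans (boundaryGlue_neg _ _ _ one_ne_zero)

/-! ### Mapping spaces of injectively fibrant objects -/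

section MappingSpaces

variable {D : Type u} [SmallCategory.{u} D]

lemma inj_ext {W A B : Dᵒᵖ ⥤ SSet.{u}} (hW : InjectiveFibrant W) (i : A ⟶ B) [hi : Mono i]
    {K L : SSet.{u}} (j : K ⟶ L) (hj : SSet.anodyneExtensions j)
    (a : (tensorConst B).obj K ⟶ W) (b : (tensorConst A).obj L ⟶ W)
    (h : Functor.whiskerRight i (tensorRight K) ≫ a = (tensorConst A).map j ≫ b) :
    ∃ c : (tensorConst B).obj L ⟶ W, (tensorConst B).map j ≫ c = a ∧
      Functor.whiskerRight i (tensorRight L) ≫ c = b := by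
  have sq : IsPushout (Functor.whiskerRight i (tensorRight K)) ((tensorConst A).map j)
    (Limits.pushout.inl _ _) (Limits.pushout.inr _ _) := IsPushout.of_hasPushout _ _
  obtain ⟨ι, hι₁, hι₂⟩ := sq.exists_desc ((tensorConst B).map j)
    (Functor.whiskerRight i (tensorRight L))
    (by ext d : 2; exact (whisker_exchange (i.app d) j).symm)
  have hι (d) : SSet.anodyneExtensions (ι.app d) := by
    have : Mono (i.app d) := inferInstance
    let P : (curriedTensor SSet.{u}).PushoutObjObj (i.app d) j :=
      { pt := _
        inl := _
        inr := _
        isPushout := sq.map ((evaluation _ _).obj d)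
        ι := ι.app d
        inl_ι := NatTrans.congr_app hι₁ d
        inr_ι := NatTrans.congr_app hι₂ d }
    exact SSet.anodyneExtensions_pushoutObjObjι P hj
  have hm (d) : Mono (ι.app d) := mono_of_anodyne (hι d)
  obtain ⟨c, hc⟩ := hW ι (NatTrans.mono_of_mono_app _) (fun d ↦ weakEquiv_of_anodyne (hι d))
    (sq.desc a b h)
  have h₁ := congrArg (Limits.pushout.inl _ _ ≫ ·) hc
  have h₂ := congrArg (Limits.pushout.inr _ _ ≫ ·) hc
  exact ⟨c, (congrArg (· ≫ c) hι₁.symm).trans ((Category.assoc _ _ _).trans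
      (h₁.trans (sq.inl_desc a b h))),
    (congrArg (· ≫ c) hι₂.symm).trans ((Category.assoc _ _ _).trans
      (h₂.trans (sq.inr_desc a b h)))⟩

/-- Maps `Y × K ⟶ W` give maps `K ⟶ Map(Y, W)`. -/
def mapCurry {Y W : Dᵒᵖ ⥤ SSet.{u}} {K : SSet.{u}} (g : (tensorConst Y).obj K ⟶ W) :
    K ⟶ mapSpace Y W where
  app n := ↾fun k ↦ (tensorConst Y).map ((SSet.yonedaEquiv (X := K) (n := n.unop)).symm k) ≫ g
  naturality {n m} φ := by
    ext k
    refine NatTrans.ext (funext fun d ↦ ?_)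
    ext l z
    refine congrArg (fun x ↦ (g.app d).app l (z.1, x)) ?_
    exact (Functor.map_comp_apply K φ ((SSet.stdSimplex.objEquiv z.2).op) k).symm

lemma mapSpace_naturality {Y W : Dᵒᵖ ⥤ SSet.{u}} {K : SSet.{u}} (φ : K ⟶ mapSpace Y W)
    {n m : SimplexCategoryᵒᵖ} (k : K.obj n) (d : Dᵒᵖ) (y : (Y.obj d).obj m) (s : n ⟶ m) :
    ((φ.app m (K.map s k) : (tensorConst Y).obj Δ[m.unop.len] ⟶ W).app d).app m
      (y, SSet.stdSimplex.objEquiv.symm (𝟙 _)) =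
    ((φ.app n k : (tensorConst Y).obj Δ[n.unop.len] ⟶ W).app d).app m
      (y, SSet.stdSimplex.objEquiv.symm s.unop) :=
  (app_congr (NatTrans.congr_app (NatTrans.naturality_apply φ s k) d) m
    (y, SSet.stdSimplex.objEquiv.symm (𝟙 _))).trans (congrArg
      (fun x ↦ ((φ.app n k : (tensorConst Y).obj Δ[n.unop.len] ⟶ W).app d).app m
        (y, SSet.stdSimplex.objEquiv.symm x)) (Category.id_comp s.unop))

/-- Maps `K ⟶ Map(Y, W)` give maps `Y × K ⟶ W`. -/
def mapUncurry {Y W : Dᵒᵖ ⥤ SSet.{u}} {K : SSet.{u}} (φ : K ⟶ mapSpace Y W) :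
    (tensorConst Y).obj K ⟶ W where
  app d :=
    { app n := ↾fun z ↦ ((φ.app n z.2 : (tensorConst Y).obj Δ[n.unop.len] ⟶ W).app d).app n
        (z.1, SSet.stdSimplex.objEquiv.symm (𝟙 _))
      naturality n m f := by
        ext z
        refine (mapSpace_naturality φ z.2 d ((Y.obj d).map f z.1) f).trans ?_
        refine Eq.trans ?_ (NatTrans.naturality_apply
          ((φ.app n z.2 : (tensorConst Y).obj Δ[n.unop.len] ⟶ W).app d)
          f ((z.1, SSet.stdSimplex.objEquiv.symm (𝟙 _)) :
            (((tensorConst Y).obj Δ[n.unop.len]).obj d).obj n))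
        exact congrArg (fun x ↦ ((φ.app n z.2 : (tensorConst Y).obj Δ[n.unop.len] ⟶ W).app d).app m
          ((Y.obj d).map f z.1, SSet.stdSimplex.objEquiv.symm x)) (Category.comp_id f.unop).symm }
  naturality d e f := by
    ext n z
    exact app_congr ((φ.app n z.2 : (tensorConst Y).obj Δ[n.unop.len] ⟶ W).naturality f) n
      (z.1, SSet.stdSimplex.objEquiv.symm (𝟙 _))

lemma mapCurry_mapUncurry {Y W : Dᵒᵖ ⥤ SSet.{u}} {K : SSet.{u}} (φ : K ⟶ mapSpace Y W) :
    mapCurry (mapUncurry φ) = φ := by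
  ext n k
  refine NatTrans.ext (funext fun d ↦ ?_)
  ext m z
  exact mapSpace_naturality φ k d z.1 (SSet.stdSimplex.objEquiv z.2).op

lemma mapSpacePre_fibration {W A B : Dᵒᵖ ⥤ SSet.{u}} (hW : InjectiveFibrant W) (i : A ⟶ B)
    [Mono i] : Fibration (mapSpacePre i W) := by
  rw [fibration_iff]
  intro _ _ j hj
  have hj' : SSet.anodyneExtensions j := MorphismProperty.le_llp_rlp _ _ hj
  refine ⟨fun {φ ψ} sq ↦ ?_⟩
  obtain ⟨c, hc, hc'⟩ := inj_ext hW i j hj' (mapUncurry φ) (mapUncurry ψ) (by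
    ext d : 2
    ext n z
    have := app_congr sq.w n z.2
    exact app_congr (NatTrans.congr_app this d) n (z.1, SSet.stdSimplex.objEquiv.symm (𝟙 _)))
  refine ⟨⟨⟨mapCurry c, ?_, ?_⟩⟩⟩
  · rw [← mapCurry_mapUncurry φ, ← hc]
    ext n k
    refine NatTrans.ext (funext fun d ↦ ?_)
    ext m z
    exact congrArg (fun x ↦ (c.app d).app m (z.1, x)) (NatTrans.naturality_apply j
      (SSet.stdSimplex.objEquiv z.2).op k).symm
  · rw [← mapCurry_mapUncurry ψ, ← hc']
    rfl

lemma mapSpace_kanComplex {W B : Dᵒᵖ ⥤ SSet.{u}} (hW : InjectiveFibrant W) :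
    SSet.KanComplex (mapSpace B W) := by
  let E : Dᵒᵖ ⥤ SSet.{u} := (Functor.const _).obj ((Functor.const _).obj PEmpty)
  let i : E ⟶ B := { app d := { app n := ↾PEmpty.elim, naturality _ _ _ := by ext x; exact x.elim },
                     naturality _ _ _ := by ext n x; exact PEmpty.elim x }
  have : ∀ d, Mono (i.app d) := fun d ↦ by
    have : ∀ n, Mono ((i.app d).app n) := fun n ↦ (mono_iff_injective _).2 fun x ↦ PEmpty.elim x
    exact NatTrans.mono_of_mono_app _
  have : Mono i := NatTrans.mono_of_mono_app _
  have hT : Limits.IsTerminal (mapSpace E W) := Limits.IsTerminal.ofUniqueHom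
    (fun X ↦ { app n := ↾fun _ ↦
      { app d := { app m := ↾fun z ↦ PEmpty.elim z.1, naturality _ _ _ := by ext z; exact PEmpty.elim z.1 }
        naturality _ _ _ := by ext m z; exact PEmpty.elim z.1 }
               naturality n m f := by
                 ext x
                 refine NatTrans.ext (funext fun d ↦ ?_)
                 ext m z
                 exact PEmpty.elim z.1 })
    fun X f ↦ by
      ext n x
      refine NatTrans.ext (funext fun d ↦ ?_)
      ext m z
      exact PEmpty.elim z.1
  have := mapSpacePre_fibration hW i
  rw [SSet.KanComplex, isFibrant_iff_of_isTerminal (mapSpacePre i W) hT]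
  exact this

end MappingSpaces

/-! ### Points of mapping spaces -/

section
variable {D : Type u} [SmallCategory.{u} D]

/-- The restriction of a simplex along a morphism. -/
def res (W : Dᵒᵖ ⥤ SSet.{u}) {X Y : D} (g : X ⟶ Y) {n : SimplexCategoryᵒᵖ}
    (σ : (W.obj (op Y)).obj n) : (W.obj (op X)).obj n := (W.map g.op).app n σ

lemma res_comp (W : Dᵒᵖ ⥤ SSet.{u}) {X Y Z : D} (g : X ⟶ Y) (h : Y ⟶ Z) {n : SimplexCategoryᵒᵖ}
    (σ : (W.obj (op Z)).obj n) : res W (g ≫ h) σ = res W g (res W h σ) :=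
  app_congr (W.map_comp h.op g.op) n σ

lemma res_id (W : Dᵒᵖ ⥤ SSet.{u}) {X : D} {n : SimplexCategoryᵒᵖ}
    (σ : (W.obj (op X)).obj n) : res W (𝟙 X) σ = σ :=
  app_congr (W.map_id _) n σ

lemma res_map (W : Dᵒᵖ ⥤ SSet.{u}) {X Y : D} (g : X ⟶ Y) {n m : SimplexCategoryᵒᵖ} (θ : n ⟶ m)
    (σ : (W.obj (op Y)).obj n) : res W g ((W.obj _).map θ σ) = (W.obj _).map θ (res W g σ) :=
  NatTrans.naturality_apply (W.map g.op) θ σ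

lemma app_res {W W' : Dᵒᵖ ⥤ SSet.{u}} (f : W ⟶ W') {X Y : D} (g : X ⟶ Y) {n : SimplexCategoryᵒᵖ}
    (σ : (W.obj (op Y)).obj n) :
    (f.app (op X)).app n (res W g σ) = res W' g ((f.app (op Y)).app n σ) :=
  app_congr (f.naturality g.op) n σ

/-- The simplex of `Map(P, W)`, for a discrete `P`, given by a map from `P` to a level of `W`. -/
def mapSpaceMk {P : Dᵒᵖ ⥤ Type u} {W : Dᵒᵖ ⥤ SSet.{u}} {n : SimplexCategoryᵒᵖ}
    (g : P ⟶ W.flip.obj n) : (mapSpace ((discPresheaf D).obj P) W).obj n :=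
  show (tensorConst ((discPresheaf D).obj P)).obj Δ[n.unop.len] ⟶ W from
  { app d :=
      { app m := ↾fun z ↦ (W.obj d).map (SSet.stdSimplex.objEquiv z.2).op (g.app d z.1)
        naturality m l θ := by
          ext z
          exact Functor.map_comp_apply (W.obj d) (SSet.stdSimplex.objEquiv z.2).op θ _ }
    naturality d e φ := by
      ext m z
      refine (congrArg ((W.obj e).map (SSet.stdSimplex.objEquiv z.2).op)
        (NatTrans.naturality_apply g φ z.1)).trans ?_
      exact (NatTrans.naturality_apply (W.map φ) (SSet.stdSimplex.objEquiv z.2).op _).symm }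

/-- The simplex of `W(X)` given by a simplex of `Map(F(X), W)`. -/
def mapSpaceVal {X : D} {W : Dᵒᵖ ⥤ SSet.{u}} {n : SimplexCategoryᵒᵖ}
    (G : (mapSpace ((discYoneda D).obj X) W).obj n) : (W.obj (op X)).obj n :=
  ((G : (tensorConst ((discYoneda D).obj X)).obj Δ[n.unop.len] ⟶ W).app (op X)).app n
    (𝟙 X, SSet.stdSimplex.objEquiv.symm (𝟙 _))

lemma mapSpaceVal_map {X : D} {W : Dᵒᵖ ⥤ SSet.{u}} {n m : SimplexCategoryᵒᵖ} (θ : n ⟶ m)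
    (G : (mapSpace ((discYoneda D).obj X) W).obj n) :
    mapSpaceVal ((mapSpace ((discYoneda D).obj X) W).map θ G) =
      (W.obj (op X)).map θ (mapSpaceVal G) := by
  let G' : (tensorConst ((discYoneda D).obj X)).obj Δ[n.unop.len] ⟶ W := G
  refine Eq.trans ?_ (NatTrans.naturality_apply (G'.app (op X)) θ
    ((𝟙 X, SSet.stdSimplex.objEquiv.symm (𝟙 _)) :
      (((tensorConst ((discYoneda D).obj X)).obj Δ[n.unop.len]).obj (op X)).obj n))
  exact congrArg (fun x ↦ (G'.app (op X)).app m (𝟙 X, SSet.stdSimplex.objEquiv.symm x))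
    ((Category.id_comp θ.unop).trans (Category.comp_id θ.unop).symm)

lemma mapSpaceVal_mk {X : D} {W : Dᵒᵖ ⥤ SSet.{u}} {n : SimplexCategoryᵒᵖ}
    (σ : (W.obj (op X)).obj n) :
    mapSpaceVal (X := X) (mapSpaceMk (yonedaEquiv.symm σ : yoneda.obj X ⟶ W.flip.obj n)) = σ := by
  refine (Functor.map_id_apply (W.obj (op X)) n _).trans ?_
  exact res_id W σ

lemma mapSpaceMk_map {P : Dᵒᵖ ⥤ Type u} {W : Dᵒᵖ ⥤ SSet.{u}} {n m : SimplexCategoryᵒᵖ}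
    (θ : n ⟶ m) (g : P ⟶ W.flip.obj n) :
    (mapSpace ((discPresheaf D).obj P) W).map θ (mapSpaceMk g) =
      mapSpaceMk (g ≫ W.flip.map θ) := by
  refine NatTrans.ext (funext fun d ↦ ?_)
  ext l z
  exact Functor.map_comp_apply (W.obj d) θ (SSet.stdSimplex.objEquiv z.2).op (g.app d z.1)

lemma res_mapSpaceVal {X Y : D} {P : Dᵒᵖ ⥤ Type u} (i : P ⟶ yoneda.obj X) {W : Dᵒᵖ ⥤ SSet.{u}}
    {n : SimplexCategoryᵒᵖ} (G : (mapSpace ((discYoneda D).obj X) W).obj n) (g : P ⟶ W.flip.obj n)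
    (h : (mapSpacePre ((discPresheaf D).map i) W).app n G = mapSpaceMk g) (z : P.obj (op Y)) :
    res W (i.app _ z) (mapSpaceVal G) = g.app (op Y) z := by
  let G' : (tensorConst ((discYoneda D).obj X)).obj Δ[n.unop.len] ⟶ W := G
  have h₁ := app_congr (NatTrans.congr_app h (op Y)) n (z, SSet.stdSimplex.objEquiv.symm (𝟙 _))
  have h₂ := app_congr (G'.naturality (i.app _ z : Y ⟶ X).op) n
    ((𝟙 X, SSet.stdSimplex.objEquiv.symm (𝟙 _)) :
      (((tensorConst ((discYoneda D).obj X)).obj Δ[n.unop.len]).obj (op X)).obj n)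
  refine h₂.symm.trans (Eq.trans ?_ (h₁.trans (Functor.map_id_apply (W.obj (op Y)) n _)))
  exact congrArg (fun x ↦ (G'.app (op Y)).app n (x, SSet.stdSimplex.objEquiv.symm (𝟙 _)))
    (Category.comp_id _)

lemma mapSpacePre_mk {P Q : Dᵒᵖ ⥤ Type u} (i : P ⟶ Q) {W : Dᵒᵖ ⥤ SSet.{u}}
    {n : SimplexCategoryᵒᵖ} (g : Q ⟶ W.flip.obj n) :
    (mapSpacePre ((discPresheaf D).map i) W).app n (mapSpaceMk g) = mapSpaceMk (i ≫ g) := rfl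

end

/-! ### Extending along Segal maps -/

namespace Theta
variable {C : Type u} [SmallCategory.{u} C]

lemma eq_toZero_vertex {X Y : Theta C} (g : Y ⟶ X) (v) (h : ∀ a, g.φ a = v) :
    g = toZero Y ≫ vertex X v :=
  hom_ext h fun i j h₁ h₂ ↦ absurd (h₁.trans_le h₂) (by rw [h, h]; exact lt_irrefl _)

lemma vertex_edge (X : Theta C) (i : Fin X.len) (a : Fin 2) :
    vertex (one (X.label i)) a ≫ edge X i = vertex X (edgeHom i a) :=
  hom_ext (fun _ ↦ rfl) fun k ↦ k.elim0

lemma edgeHom_eq {m : ℕ} (i i' : Fin m) (a b : Fin 2) (h₀ : edgeHom i 0 = edgeHom i' a)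
    (h₁ : edgeHom i 1 = edgeHom i' b) : i = i' := by
  change i.castSucc = (![i'.castSucc, i'.succ] : Fin 2 → _) a at h₀
  change i.succ = (![i'.castSucc, i'.succ] : Fin 2 → _) b at h₁
  fin_cases a <;> fin_cases b <;> simp [Fin.ext_iff] at h₀ h₁ <;> lia

lemma edgeHom_injective {m : ℕ} (i : Fin m) : Function.Injective (edgeHom i) := by
  intro a b h
  change (![i.castSucc, i.succ] : Fin 2 → _) a = (![i.castSucc, i.succ] : Fin 2 → _) b at h
  fin_cases a <;> fin_cases b <;> simp [Fin.ext_iff] at h ⊢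

lemma f_congr {X Y : Theta C} {g h : Y ⟶ X} (e : g = h) (i : Fin Y.len) (j : Fin X.len)
    {h₁ h₂ h₁' h₂'} : g.f i j h₁ h₂ = h.f i j h₁' h₂' := by subst e; rfl

lemma edge_mono {X Y : Theta C} (i : Fin X.len) {g h : Y ⟶ one (X.label i)}
    (e : g ≫ edge X i = h ≫ edge X i) : g = h := by
  have hφ (a) : g.φ a = h.φ a := by
    have h₁ : (g ≫ edge X i).φ a = (h ≫ edge X i).φ a := by rw [e]
    have h₂ : edgeHom i (g.φ a) = edgeHom i (h.φ a) := h₁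
    exact edgeHom_injective i h₂
  refine hom_ext hφ fun k j h₁ h₂ h₁' h₂' ↦ ?_
  obtain rfl : j = (0 : Fin 1) := Subsingleton.elim (α := Fin 1) _ _
  have hk₁ : (edge X i).φ (Fin.castSucc (0 : Fin 1)) < i.succ := Fin.castSucc_lt_succ
  have hk₂ : i.succ ≤ (edge X i).φ (Fin.succ (0 : Fin 1)) := le_rfl
  have aux (g : Y ⟶ one (X.label i)) (h₁) (h₂) (h₃) (h₄) :
      (g ≫ edge X i).f k i h₃ h₄ = g.f k (0 : Fin 1) h₁ h₂ :=
    (comp_f g (edge X i) k (0 : Fin 1) i h₃ h₄ h₁ h₂ hk₁ hk₂).trans (Category.comp_id _)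
  have h₃ : (g ≫ edge X i).φ k.castSucc < i.succ :=
    ((edgeHom i).monotone (Fin.le_castSucc_iff.2 h₁)).trans_lt hk₁
  have h₄ : i.succ ≤ (g ≫ edge X i).φ k.succ := (edgeHom i).monotone h₂
  rw [← aux g h₁ h₂ h₃ h₄]
  rw [← aux h h₁' h₂' (by rwa [← e]) (by rwa [← e])]
  exact f_congr e _ _

lemma edge_dichotomy {Y : Theta C} (c : C) (h : Y ⟶ one c) :
    (∃ a : Fin 2, h = toZero Y ≫ vertex (one c) a) ∨ ∃ a b, h.φ a = (0 : Fin 2) ∧ h.φ b = (1 : Fin 2) := by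
  by_cases h₀ : ∃ a, h.φ a = (0 : Fin 2)
  · by_cases h₁ : ∃ a, h.φ a = (1 : Fin 2)
    · exact Or.inr ⟨_, _, h₀.choose_spec, h₁.choose_spec⟩
    · exact Or.inl ⟨0, eq_toZero_vertex h _ fun a ↦ by
        by_contra h₂
        exact h₁ ⟨a, Fin.eq_one_of_ne_zero (h.φ a : Fin 2) h₂⟩⟩
  · exact Or.inl ⟨1, eq_toZero_vertex h _ fun a ↦ Fin.eq_one_of_ne_zero (h.φ a : Fin 2) fun h₂ ↦ h₀ ⟨a, h₂⟩⟩

/-- `q` is the value on `z : Y ⟶ X` of the map from the spine with given values on vertices and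
edges. -/
def IsSpineValue {X : Theta C} {Q : (Theta C)ᵒᵖ ⥤ Type u} (x : Fin (X.len + 1) → Q.obj (op zero))
    (w : ∀ i, Q.obj (op (one (X.label i)))) {Y : Theta C} (z : Y ⟶ X) (q : Q.obj (op Y)) : Prop :=
  (∃ v, z = toZero Y ≫ vertex X v ∧ q = Q.map (toZero Y).op (x v)) ∨
    ∃ i, ∃ h : Y ⟶ one (X.label i), z = h ≫ edge X i ∧ q = Q.map h.op (w i)

section
variable {X : Theta C} {Q : (Theta C)ᵒᵖ ⥤ Type u} {x : Fin (X.len + 1) → Q.obj (op zero)}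
  {w : ∀ i, Q.obj (op (one (X.label i)))}

lemma IsSpineValue.map {Y Z : Theta C} {z : Y ⟶ X} {q : Q.obj (op Y)} (h : IsSpineValue x w z q)
    (g : Z ⟶ Y) : IsSpineValue x w (g ≫ z) (Q.map g.op q) := by
  obtain ⟨v, rfl, rfl⟩ | ⟨i, h, rfl, rfl⟩ := h
  · refine Or.inl ⟨v, ?_, ?_⟩
    · rw [← Category.assoc, hom_zero_ext (g ≫ toZero Y) (toZero Z)]
    · rw [← Functor.map_comp_apply, ← op_comp, hom_zero_ext (g ≫ toZero Y) (toZero Z)]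
  · exact Or.inr ⟨i, g ≫ h, (Category.assoc _ _ _).symm, by rw [op_comp, Functor.map_comp_apply]⟩

lemma IsSpineValue.unique (h : ∀ i (a : Fin 2), Q.map (vertex (one (X.label i)) a).op (w i) =
      x (edgeHom i a))
    {Y : Theta C} {z : Y ⟶ X} {q q' : Q.obj (op Y)} (hq : IsSpineValue x w z q)
    (hq' : IsSpineValue x w z q') : q = q' := by
  have aux₁ (v) (hz : z = toZero Y ≫ vertex X v) {q : Q.obj (op Y)} (hq : IsSpineValue x w z q) :
      q = Q.map (toZero Y).op (x v) := by
    obtain ⟨v', hz', rfl⟩ | ⟨i, h', hz', rfl⟩ := hq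
    · have : (toZero Y ≫ vertex X v).φ 0 = (toZero Y ≫ vertex X v').φ 0 := by rw [← hz, hz']
      have : v = v' := this
      rw [this]
    · have hv (a) : edgeHom i (h'.φ a) = v := by
        have : (h' ≫ edge X i).φ a = (toZero Y ≫ vertex X v).φ a := by rw [← hz, hz']
        exact this
      obtain ⟨a, rfl⟩ | ⟨a, b, ha, hb⟩ := edge_dichotomy _ h'
      · rw [op_comp, Functor.map_comp_apply, h]
        exact congrArg _ (congrArg x (hv 0))
      · have := (hv a).trans (hv b).symm
        rw [ha, hb] at this
        exact absurd this (Fin.castSucc_lt_succ (i := i)).ne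
  obtain ⟨v, hz, rfl⟩ | ⟨i, h', hz, rfl⟩ := hq
  · exact (aux₁ v hz hq').symm
  obtain ⟨v, hz', rfl⟩ | ⟨i', h'', hz', rfl⟩ := id hq'
  · exact aux₁ v hz' (Or.inr ⟨i, h', hz, rfl⟩)
  obtain ⟨a, ha⟩ | ⟨a, b, ha, hb⟩ := edge_dichotomy _ h'
  · have hz₁ : z = toZero Y ≫ vertex X (edgeHom i a) := by
      rw [hz, ha, Category.assoc, vertex_edge]
    exact (aux₁ _ hz₁ (Or.inr ⟨i, h', hz, rfl⟩)).trans (aux₁ _ hz₁ hq').symm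
  · have e (c) : edgeHom i (h'.φ c) = edgeHom i' (h''.φ c) := by
      have : (h' ≫ edge X i).φ c = (h'' ≫ edge X i').φ c := by rw [← hz, hz']
      exact this
    have e₀ := e a
    have e₁ := e b
    rw [ha] at e₀
    rw [hb] at e₁
    obtain rfl : i = i' := edgeHom_eq i i' _ _ e₀ e₁
    rw [edge_mono i (hz.symm.trans hz')]

end

/-- Values on vertices and edges extend to the spine. -/
lemma exists_spine_map {X : Theta C} {Q : (Theta C)ᵒᵖ ⥤ Type u}
    (x : Fin (X.len + 1) → Q.obj (op zero)) (w : ∀ i, Q.obj (op (one (X.label i))))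
    (h : ∀ i (a : Fin 2), Q.map (vertex (one (X.label i)) a).op (w i) = x (edgeHom i a)) :
    ∃ g : (spine X).toFunctor ⟶ Q, ∀ {Y} (z : (spine X).toFunctor.obj (op Y)),
      IsSpineValue x w (z.1 : Y ⟶ X) (g.app (op Y) z) := by
  have H (Y : (Theta C)ᵒᵖ) (z : (spine X).toFunctor.obj Y) :
      ∃ q, IsSpineValue x w (z.1 : Y.unop ⟶ X) q := by
    obtain ⟨z, hz⟩ := z
    simp only [spine, Subfunctor.max_obj, Subfunctor.iSup_obj, Set.mem_union, Set.mem_iUnion] at hz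
    obtain ⟨v, z, rfl⟩ | ⟨i, z, rfl⟩ := hz
    · exact ⟨_, Or.inl ⟨v, congrArg (· ≫ vertex X v) (hom_zero_ext _ _), rfl⟩⟩
    · exact ⟨_, Or.inr ⟨i, z, rfl, rfl⟩⟩
  refine ⟨{ app Y := ↾fun z ↦ (H Y z).choose
            naturality Y Z g := ?_ }, fun z ↦ (H _ z).choose_spec⟩
  ext z
  exact IsSpineValue.unique h (H Z _).choose_spec ((H Y z).choose_spec.map g.unop)

lemma mem_spine_vertex (X : Theta C) (v) : vertex X v ∈ (spine X).obj (op zero) := by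
  simp only [spine, Subfunctor.max_obj, Subfunctor.iSup_obj, Set.mem_union, Set.mem_iUnion]
  exact Or.inl ⟨v, 𝟙 zero, Category.id_comp (vertex X v)⟩

lemma mem_spine_edge (X : Theta C) (i) : edge X i ∈ (spine X).obj (op (one (X.label i))) := by
  simp only [spine, Subfunctor.max_obj, Subfunctor.iSup_obj, Set.mem_union, Set.mem_iUnion]
  exact Or.inr ⟨i, 𝟙 (one (X.label i)), Category.id_comp (edge X i)⟩

lemma spine_hom_ext {X : Theta C} {Q : (Theta C)ᵒᵖ ⥤ Type u} {g g' : (spine X).toFunctor ⟶ Q}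
    (h₁ : ∀ v, g.app _ ⟨vertex X v, mem_spine_vertex X v⟩ = g'.app _ ⟨vertex X v, mem_spine_vertex X v⟩)
    (h₂ : ∀ i, g.app _ ⟨edge X i, mem_spine_edge X i⟩ = g'.app _ ⟨edge X i, mem_spine_edge X i⟩) :
    g = g' := by
  ext Y ⟨z, hz⟩
  have hz' := hz
  simp only [spine, Subfunctor.max_obj, Subfunctor.iSup_obj, Set.mem_union, Set.mem_iUnion] at hz'
  obtain ⟨v, z, rfl⟩ | ⟨i, z, rfl⟩ := hz'
  · exact (NatTrans.naturality_apply g z.op ⟨vertex X v, mem_spine_vertex X v⟩).trans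
      ((congrArg _ (h₁ v)).trans
        (NatTrans.naturality_apply g' z.op ⟨vertex X v, mem_spine_vertex X v⟩).symm)
  · exact (NatTrans.naturality_apply g z.op ⟨edge X i, mem_spine_edge X i⟩).trans
      ((congrArg _ (h₂ i)).trans
        (NatTrans.naturality_apply g' z.op ⟨edge X i, mem_spine_edge X i⟩).symm)

/-- Values on vertices and edges extend to the spine. -/
lemma exists_spine_map' {X : Theta C} {W : (Theta C)ᵒᵖ ⥤ SSet.{u}} {n : SimplexCategoryᵒᵖ}
    (x : Fin (X.len + 1) → (W.obj (op zero)).obj n) (w : ∀ i, (W.obj (op (one (X.label i)))).obj n)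
    (h : ∀ i (a : Fin 2), res W (vertex (one (X.label i)) a) (w i) = x (edgeHom i a)) :
    ∃ g : (spine X).toFunctor ⟶ W.flip.obj n,
      (∀ v, g.app _ ⟨vertex X v, mem_spine_vertex X v⟩ = x v) ∧
        ∀ i, g.app _ ⟨edge X i, mem_spine_edge X i⟩ = w i := by
  obtain ⟨g, hg⟩ := exists_spine_map (Q := W.flip.obj n) x w h
  refine ⟨g, fun v ↦ ?_, fun i ↦ ?_⟩
  · exact (hg ⟨vertex X v, mem_spine_vertex X v⟩).unique h (Or.inl ⟨v,
      (Category.id_comp (vertex X v)).symm.trans (congrArg (· ≫ vertex X v) (hom_zero_ext _ _)),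
      (res_id W _).symm.trans (congrArg (fun y ↦ res W y (x v)) (hom_zero_ext _ _))⟩)
  · exact (hg ⟨edge X i, mem_spine_edge X i⟩).unique h (Or.inr ⟨i, 𝟙 _,
      (Category.id_comp (edge X i)).symm, (res_id W _).symm⟩)

instance (X : Theta C) : Mono (segalMap X) := by
  have : ∀ d, Mono ((segalMap X).app d) := fun d ↦ by
    have : ∀ n, Mono (((segalMap X).app d).app n) := fun n ↦
      (mono_iff_injective _).2 Subtype.val_injective
    exact NatTrans.mono_of_mono_app _
  exact NatTrans.mono_of_mono_app _

section
variable {W : (Theta C)ᵒᵖ ⥤ SSet.{u}}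

lemma segal_weakEquiv (hW : IsFibrantFor (segalMaps C) W) (X : Theta C) : SSetWeakEquiv (mapSpacePre (segalMap X) W) :=
  hW.isLocal _ (MorphismProperty.ofHoms_iff _ _ |>.2 ⟨X, rfl⟩)

variable {X : Theta C}

lemma fill_zero (hW : IsFibrantFor (segalMaps C) W)
    (x : Fin (X.len + 1) → (W.obj (op zero)).obj (op ⦋0⦌))
    (w : ∀ i, (W.obj (op (one (X.label i)))).obj (op ⦋0⦌))
    (h : ∀ i (a : Fin 2), res W (vertex (one (X.label i)) a) (w i) = x (edgeHom i a)) :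
    ∃ σ : (W.obj (op X)).obj (op ⦋0⦌), (∀ v, res W (vertex X v) σ = x v) ∧
      ∀ i, res W (edge X i) σ = w i := by
  obtain ⟨g, hg₁, hg₂⟩ := exists_spine_map' x w h
  have := mapSpacePre_fibration hW.injectiveFibrant (segalMap X)
  have := mapSpace_kanComplex hW.injectiveFibrant (B := (discYoneda (Theta C)).obj X)
  have := mapSpace_kanComplex hW.injectiveFibrant
    (B := (discPresheaf (Theta C)).obj (spine X).toFunctor)
  obtain ⟨G, hG⟩ := surjective_of_weakEquiv _ (segal_weakEquiv hW X) (mapSpaceMk g)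
  exact ⟨mapSpaceVal G,
    fun v ↦ (res_mapSpaceVal (spine X).ι G g hG ⟨_, mem_spine_vertex X v⟩).trans (hg₁ v),
    fun i ↦ (res_mapSpaceVal (spine X).ι G g hG ⟨_, mem_spine_edge X i⟩).trans (hg₂ i)⟩

lemma fill_one (hW : IsFibrantFor (segalMaps C) W)
    (σ₀ σ₁ : (W.obj (op X)).obj (op ⦋0⦌))
    (x : Fin (X.len + 1) → (W.obj (op zero)).obj (op ⦋1⦌))
    (w : ∀ i, (W.obj (op (one (X.label i)))).obj (op ⦋1⦌))
    (h : ∀ i (a : Fin 2), res W (vertex (one (X.label i)) a) (w i) = x (edgeHom i a))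
    (hx₀ : ∀ v, (W.obj _).δ 1 (x v) = res W (vertex X v) σ₀)
    (hx₁ : ∀ v, (W.obj _).δ 0 (x v) = res W (vertex X v) σ₁)
    (hw₀ : ∀ i, (W.obj _).δ 1 (w i) = res W (edge X i) σ₀)
    (hw₁ : ∀ i, (W.obj _).δ 0 (w i) = res W (edge X i) σ₁) :
    ∃ Γ : (W.obj (op X)).obj (op ⦋1⦌), (W.obj _).δ 1 Γ = σ₀ ∧ (W.obj _).δ 0 Γ = σ₁ ∧
      (∀ v, res W (vertex X v) Γ = x v) ∧ ∀ i, res W (edge X i) Γ = w i := by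
  obtain ⟨g, hg₁, hg₂⟩ := exists_spine_map' x w h
  have := mapSpacePre_fibration hW.injectiveFibrant (segalMap X)
  have := mapSpace_kanComplex hW.injectiveFibrant (B := (discYoneda (Theta C)).obj X)
  have := mapSpace_kanComplex hW.injectiveFibrant
    (B := (discPresheaf (Theta C)).obj (spine X).toFunctor)
  obtain ⟨G, hG₀, hG₁, hG⟩ := lift_edge_of_weakEquiv _ (segal_weakEquiv hW X)
    (mapSpaceMk (yonedaEquiv.symm σ₀ : yoneda.obj X ⟶ W.flip.obj (op ⦋0⦌)))
    (mapSpaceMk (yonedaEquiv.symm σ₁ : yoneda.obj X ⟶ W.flip.obj (op ⦋0⦌)))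
    (mapSpaceMk g) (by
      refine (mapSpaceMk_map _ g).trans (Eq.trans ?_ (mapSpacePre_mk _ _).symm)
      refine congrArg _ (spine_hom_ext (fun v ↦ ?_) fun i ↦ ?_)
      · exact (congrArg _ (hg₁ v)).trans (hx₀ v)
      · exact (congrArg _ (hg₂ i)).trans (hw₀ i)) (by
      refine (mapSpaceMk_map _ g).trans (Eq.trans ?_ (mapSpacePre_mk _ _).symm)
      refine congrArg _ (spine_hom_ext (fun v ↦ ?_) fun i ↦ ?_)
      · exact (congrArg _ (hg₁ v)).trans (hx₁ v)
      · exact (congrArg _ (hg₂ i)).trans (hw₁ i))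
  refine ⟨mapSpaceVal G, ?_, ?_,
    fun v ↦ (res_mapSpaceVal (spine X).ι G g hG ⟨_, mem_spine_vertex X v⟩).trans (hg₁ v),
    fun i ↦ (res_mapSpaceVal (spine X).ι G g hG ⟨_, mem_spine_edge X i⟩).trans (hg₂ i)⟩
  · exact (mapSpaceVal_map _ G).symm.trans ((congrArg mapSpaceVal hG₀).trans (mapSpaceVal_mk σ₀))
  · exact (mapSpaceVal_map _ G).symm.trans ((congrArg mapSpaceVal hG₁).trans (mapSpaceVal_mk σ₁))

end

end Theta

/-! ### Mapping objects -/

section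
variable {C : Type u} [SmallCategory.{u} C]

open Theta

section
variable {W : (Theta C)ᵒᵖ ⥤ SSet.{u}}

lemma map_degen (x : ObjOf W) {p q : SimplexCategoryᵒᵖ} (θ : p ⟶ q) :
    (W.obj _).map θ (degen x p) = degen x q :=
  (Functor.map_comp_apply (W.obj (op Theta.zero)) (SimplexCategory.const p.unop ⦋0⦌ 0).op θ x).symm

lemma degen_zero (x : ObjOf W) : degen x (op ⦋0⦌) = x := by
  refine Eq.trans ?_ (Functor.map_id_apply (W.obj (op Theta.zero)) _ x)
  have : SimplexCategory.const ⦋0⦌ ⦋0⦌ 0 = 𝟙 _ := by ext i; fin_cases i; rfl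
  exact congrArg (fun k ↦ (W.obj (op Theta.zero)).map (Quiver.Hom.op k) x) this

lemma app_degen {U V : (Theta C)ᵒᵖ ⥤ SSet.{u}} (f : U ⟶ V) (x : ObjOf U) (p : SimplexCategoryᵒᵖ) :
    (f.app _).app p (degen x p) = degen ((f.app _).app _ x) p :=
  NatTrans.naturality_apply (f.app (op zero)) (SimplexCategory.const p.unop ⦋0⦌ 0).op x

/-- The fibre of `W_{[1](c)} ⟶ W_{[0]} × W_{[0]}` over `(x, y)`, where both maps are given by the
two vertices of `[1](c)`. -/
def mapFiber (x y : ObjOf W) (c : C) : (W.obj (op (one c))).Subcomplex where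
  obj p := {w | res W (src c) w = degen x p ∧ res W (tgt c) w = degen y p}
  map {p q} θ w hw := by
    refine ⟨(res_map W _ _ _).trans ?_, (res_map W _ _ _).trans ?_⟩
    · rw [hw.1, map_degen]
    · rw [hw.2, map_degen]

/-- The mapping object `map_W(x, y)`, a simplicial presheaf on `C` with value at `c` the fibre
of `W_{[1](c)} ⟶ W_{[0]} × W_{[0]}` over `(x, y)`. -/
def mapObj (x y : ObjOf W) : Cᵒᵖ ⥤ SSet.{u} where
  obj c := (mapFiber x y c.unop).toSSet
  map {c d} g :=
    { app p := ↾fun w ↦ ⟨res W ((oneFunctor C).map g.unop) w.1, by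
        rw [mapFiber]
        refine ⟨(res_comp W _ _ _).symm.trans (Eq.trans ?_ w.2.1),
          (res_comp W _ _ _).symm.trans (Eq.trans ?_ w.2.2)⟩
        · exact congrArg (fun k ↦ res W k w.1) (hom_ext (fun _ ↦ rfl) fun i ↦ i.elim0)
        · exact congrArg (fun k ↦ res W k w.1) (hom_ext (fun _ ↦ rfl) fun i ↦ i.elim0)⟩
      naturality p q θ := by
        ext w
        exact Subtype.ext (res_map W _ _ _) }
  map_id c := by
    ext p w
    refine Subtype.ext ?_
    exact (congrArg (fun k ↦ res W k w.1) ((oneFunctor C).map_id _)).trans (res_id W w.1)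
  map_comp g h := by
    ext p w
    refine Subtype.ext ?_
    exact (congrArg (fun k ↦ res W k w.1) ((oneFunctor C).map_comp _ _)).trans (res_comp W _ _ w.1)

/-- The map `map_U(x, y) ⟶ map_V(f x, f y)` induced by `f : U ⟶ V`. -/
def mapObjMap {U V : (Theta C)ᵒᵖ ⥤ SSet.{u}} (f : U ⟶ V) (x y : ObjOf U) :
    mapObj x y ⟶ mapObj (W := V) ((f.app _).app _ x) ((f.app _).app _ y) where
  app c :=
    { app p := ↾fun w ↦ ⟨(f.app _).app p w.1, by
        rw [mapFiber]
        refine ⟨(app_res f _ _).symm.trans ?_, (app_res f _ _).symm.trans ?_⟩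
        · rw [w.2.1, app_degen]
        · rw [w.2.2, app_degen]⟩
      naturality p q θ := by
        ext w
        refine Subtype.ext ?_
        exact NatTrans.naturality_apply (f.app (op (one c.unop))) θ w.1 }
  naturality c d g := by
    ext p w
    exact Subtype.ext (app_res f _ _)

end

/-! ### The homotopy category -/

namespace Theta

/-- The morphism to `[m](t, …, t)`, where `t` is terminal, with given underlying map. -/
def toDiag {t : C} (ht : Limits.IsTerminal t) (X : Theta C) {m : ℕ}
    (φ : Fin (X.len + 1) →o Fin (m + 1)) : X ⟶ diag t m where
  φ := φ
  f _ _ _ _ := ht.from _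

lemma hom_diag_ext {t : C} (ht : Limits.IsTerminal t) {X : Theta C} {m : ℕ} {g h : X ⟶ diag t m}
    (e : ∀ a, (g.φ a : Fin (m + 1)) = h.φ a) : g = h :=
  hom_ext e fun _ _ _ _ _ _ ↦ ht.hom_ext _ _

/-- The monotone map `[n] → [m]` with given values. -/
def mono₁ {m : ℕ} (a b : Fin (m + 1)) (h : a ≤ b) : Fin (1 + 1) →o Fin (m + 1) where
  toFun := ![a, b]
  monotone' i j hij := by
    fin_cases i <;> fin_cases j <;> first | (exact le_rfl) | (exact h) | (exact absurd hij (by decide))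

/-- The monotone map `[2] → [m]` with given values. -/
def mono₂ {m : ℕ} (a b c : Fin (m + 1)) (h : a ≤ b) (h' : b ≤ c) : Fin (2 + 1) →o Fin (m + 1) where
  toFun := ![a, b, c]
  monotone' i j hij := by
    fin_cases i <;> fin_cases j <;>
      first | (exact le_rfl) | (exact h) | (exact h') | (exact h.trans h') |
      (exact absurd hij (by decide))

variable {t : C} (ht : Limits.IsTerminal t)

/-- The edge `[1](t) ⟶ [m](t, …, t)` with given endpoints. -/
def ed {m : ℕ} (a b : Fin (m + 1)) (h : a ≤ b := by decide) : one t ⟶ diag t m :=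
  toDiag ht (one t) (mono₁ a b h)

/-- The triangle `[2](t, t) ⟶ [m](t, …, t)` with given vertices. -/
def tri {m : ℕ} (a b c : Fin (m + 1)) (h : a ≤ b := by decide) (h' : b ≤ c := by decide) :
    diag t 2 ⟶ diag t m :=
  toDiag ht (diag t 2) (mono₂ a b c h h')

end Theta

section
variable (W : (Theta C)ᵒᵖ ⥤ SSet.{u}) {t : C} (ht : Limits.IsTerminal t)

/-- `h` is a composite of `f` and `g`: there is a point `σ` of `W_{[2](t, t)}` whose edges are
`f`, `g` and `h`. -/
def IsComposite (f g h : (W.obj (op (one t))).obj (op ⦋0⦌)) : Prop :=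
  ∃ σ : (W.obj (op (diag t 2))).obj (op ⦋0⦌),
    res W (ed ht 0 1) σ = f ∧ res W (ed ht 1 2) σ = g ∧ res W (ed ht 0 2) σ = h

/-- A path from `f` to `f'` in the fibre over `(x, y)`. -/
def IsPath (x y : ObjOf W) (f f' : (W.obj (op (one t))).obj (op ⦋0⦌)) : Prop :=
  ∃ γ : (W.obj (op (one t))).obj (op ⦋1⦌), (W.obj _).δ 1 γ = f ∧ (W.obj _).δ 0 γ = f' ∧
    res W (src t) γ = degen x _ ∧ res W (tgt t) γ = degen y _

variable {W}

lemma IsComposite.map {V : (Theta C)ᵒᵖ ⥤ SSet.{u}} (k : W ⟶ V) {f g h}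
    (H : IsComposite W ht f g h) :
    IsComposite V ht ((k.app _).app _ f) ((k.app _).app _ g) ((k.app _).app _ h) := by
  obtain ⟨σ, rfl, rfl, rfl⟩ := H
  exact ⟨(k.app _).app _ σ, (app_res k _ _).symm, (app_res k _ _).symm, (app_res k _ _).symm⟩

lemma edge_diag_two_zero : edge (diag t 2) (0 : Fin 2) = ed ht 0 1 :=
  hom_diag_ext ht fun (a : Fin 2) ↦ by fin_cases a <;> rfl

lemma edge_diag_two_one : edge (diag t 2) (1 : Fin 2) = ed ht 1 2 :=
  hom_diag_ext ht fun (a : Fin 2) ↦ by fin_cases a <;> rfl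

lemma res_congr {X Y : Theta C} {g h : X ⟶ Y} (e : g = h) {p} (σ : (W.obj (op Y)).obj p) :
    res W g σ = res W h σ := by rw [e]

section

lemma exists_isComposite (hW : IsFibrantFor (segalMaps C) W)
    {x y z : ObjOf W} {f g : (W.obj (op (one t))).obj (op ⦋0⦌)}
    (hf₀ : res W (src t) f = x) (hf₁ : res W (tgt t) f = y)
    (hg₀ : res W (src t) g = y) (hg₁ : res W (tgt t) g = z) :
    ∃ h, IsComposite W ht f g h ∧ res W (src t) h = x ∧ res W (tgt t) h = z := by
  obtain ⟨σ, h₁, h₂⟩ := fill_zero hW (X := diag t 2) (![x, y, z] : Fin 3 → _)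
    (![f, g] : Fin 2 → _) (by
      intro (i : Fin 2) a
      fin_cases i <;> fin_cases a
      exacts [hf₀, hf₁, hg₀, hg₁])
  refine ⟨res W (ed ht 0 2) σ, ⟨σ, ?_, ?_, rfl⟩, ?_, ?_⟩
  · rw [← edge_diag_two_zero]
    exact h₂ (0 : Fin 2)
  · rw [← edge_diag_two_one]
    exact h₂ (1 : Fin 2)
  · rw [← res_comp]
    exact (res_congr (hom_diag_ext ht fun (a : Fin 1) ↦ by fin_cases a; rfl) σ).trans (h₁ (0 : Fin 3))
  · rw [← res_comp]
    exact (res_congr (hom_diag_ext ht fun (a : Fin 1) ↦ by fin_cases a; rfl) σ).trans (h₁ (2 : Fin 3))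

lemma IsComposite.path (hW : IsFibrantFor (segalMaps C) W)
    {x y z : ObjOf W} {f g h f' g' h' : (W.obj (op (one t))).obj (op ⦋0⦌)}
    (H : IsComposite W ht f g h) (H' : IsComposite W ht f' g' h') (hf : IsPath W x y f f')
    (hg : IsPath W y z g g') : IsPath W x z h h' := by
  obtain ⟨γ, h₁, h₂, h₃, h₄⟩ := hf
  obtain ⟨δ, h₅, h₆, h₇, h₈⟩ := hg
  obtain ⟨σ, rfl, rfl, rfl⟩ := H
  obtain ⟨σ', rfl, rfl, rfl⟩ := H'
  have hv (θ : op ⦋1⦌ ⟶ op ⦋0⦌) (σ : (W.obj (op (diag t 2))).obj (op ⦋0⦌))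
      (e₁ : (W.obj _).map θ γ = res W (ed ht 0 1) σ) (e₂ : (W.obj _).map θ δ = res W (ed ht 1 2) σ)
      (v : Fin 3) : (W.obj _).map θ (degen ((![x, y, z] : Fin 3 → ObjOf W) v) (op ⦋1⦌)) =
        res W (vertex (diag t 2) v) σ := by
    have aux (c : one t ⟶ diag t 2) (d : zero ⟶ one t) (hd : d ≫ c = vertex (diag t 2) v)
        (ε : (W.obj (op (one t))).obj (op ⦋1⦌)) (hε : (W.obj _).map θ ε = res W c σ) (x : ObjOf W)
        (hx : res W d ε = degen x _) :
        (W.obj _).map θ (degen x (op ⦋1⦌)) = res W (vertex (diag t 2) v) σ := by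
      rw [← hx, ← res_map, hε, ← res_comp, hd]
    fin_cases v
    · exact aux _ (src t) (hom_diag_ext ht fun (a : Fin 1) ↦ by fin_cases a; rfl) _ e₁ _ h₃
    · exact aux _ (tgt t) (hom_diag_ext ht fun (a : Fin 1) ↦ by fin_cases a; rfl) _ e₁ _ h₄
    · exact aux _ (tgt t) (hom_diag_ext ht fun (a : Fin 1) ↦ by fin_cases a; rfl) _ e₂ _ h₈
  obtain ⟨Γ, hΓ₀, hΓ₁, hΓ₂, -⟩ := fill_one hW (X := diag t 2) σ σ'
    (fun v ↦ degen ((![x, y, z] : Fin 3 → _) v) _) (![γ, δ] : Fin 2 → _) (by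
      intro (i : Fin 2) a
      fin_cases i <;> fin_cases a
      exacts [h₃, h₄, h₇, h₈]) (hv _ σ h₁ h₅) (hv _ σ' h₂ h₆) (by
      intro (i : Fin 2)
      fin_cases i
      · exact h₁.trans (res_congr (edge_diag_two_zero ht) σ).symm
      · exact h₅.trans (res_congr (edge_diag_two_one ht) σ).symm) (by
      intro (i : Fin 2)
      fin_cases i
      · exact h₂.trans (res_congr (edge_diag_two_zero ht) σ').symm
      · exact h₆.trans (res_congr (edge_diag_two_one ht) σ').symm)
  refine ⟨res W (ed ht 0 2) Γ, ?_, ?_, ?_, ?_⟩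
  · exact (res_map W _ _ _).symm.trans (congrArg _ hΓ₀)
  · exact (res_map W _ _ _).symm.trans (congrArg _ hΓ₁)
  · rw [← res_comp]
    exact (res_congr (hom_diag_ext ht fun (a : Fin 1) ↦ by fin_cases a; rfl) Γ).trans
      (hΓ₂ (0 : Fin 3))
  · rw [← res_comp]
    exact (res_congr (hom_diag_ext ht fun (a : Fin 1) ↦ by fin_cases a; rfl) Γ).trans
      (hΓ₂ (2 : Fin 3))

lemma exists_assoc (hW : IsFibrantFor (segalMaps C) W)
    {x₀ x₁ x₂ x₃ : ObjOf W} {f g h : (W.obj (op (one t))).obj (op ⦋0⦌)}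
    (hf₀ : res W (src t) f = x₀) (hf₁ : res W (tgt t) f = x₁)
    (hg₀ : res W (src t) g = x₁) (hg₁ : res W (tgt t) g = x₂)
    (hh₀ : res W (src t) h = x₂) (hh₁ : res W (tgt t) h = x₃) :
    ∃ fg gh fgh, IsComposite W ht f g fg ∧ IsComposite W ht g h gh ∧ IsComposite W ht fg h fgh ∧
      IsComposite W ht f gh fgh ∧ res W (src t) fg = x₀ ∧ res W (tgt t) fg = x₂ ∧
      res W (src t) gh = x₁ ∧ res W (tgt t) gh = x₃ ∧
      res W (src t) fgh = x₀ ∧ res W (tgt t) fgh = x₃ := by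
  obtain ⟨σ, h₁, h₂⟩ := fill_zero hW (X := diag t 3) (![x₀, x₁, x₂, x₃] : Fin 4 → _)
    (![f, g, h] : Fin 3 → _) (by
      intro (i : Fin 3) a
      fin_cases i <;> fin_cases a
      exacts [hf₀, hf₁, hg₀, hg₁, hh₀, hh₁])
  have hf : res W (ed ht 0 1) σ = f := (res_congr (hom_diag_ext ht fun (a : Fin 2) ↦ by
    fin_cases a <;> rfl) σ).trans (h₂ (0 : Fin 3))
  have hg : res W (ed ht 1 2) σ = g := (res_congr (hom_diag_ext ht fun (a : Fin 2) ↦ by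
    fin_cases a <;> rfl) σ).trans (h₂ (1 : Fin 3))
  have hh : res W (ed ht 2 3) σ = h := (res_congr (hom_diag_ext ht fun (a : Fin 2) ↦ by
    fin_cases a <;> rfl) σ).trans (h₂ (2 : Fin 3))
  have hc (a b c : Fin 4) (hab : a ≤ b) (hbc : b ≤ c) : IsComposite W ht (res W (ed ht a b hab) σ)
      (res W (ed ht b c hbc) σ) (res W (ed ht a c (hab.trans hbc)) σ) := by
    refine ⟨res W (tri ht a b c hab hbc) σ, ?_, ?_, ?_⟩ <;>
    · rw [← res_comp]
      exact res_congr (hom_diag_ext ht fun (a : Fin 2) ↦ by fin_cases a <;> rfl) σ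
  have hs (a b : Fin 4) (hab : a ≤ b) : res W (src t) (res W (ed ht a b hab) σ) =
      (![x₀, x₁, x₂, x₃] : Fin 4 → _) a := by
    rw [← res_comp]
    exact (res_congr (hom_diag_ext ht fun (a : Fin 1) ↦ by fin_cases a; rfl) σ).trans (h₁ a)
  have ht (a b : Fin 4) (hab : a ≤ b) : res W (tgt t) (res W (ed ht a b hab) σ) =
      (![x₀, x₁, x₂, x₃] : Fin 4 → _) b := by
    rw [← res_comp]
    exact (res_congr (hom_diag_ext ht fun (a : Fin 1) ↦ by fin_cases a; rfl) σ).trans (h₁ b)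
  subst hf hg hh
  exact ⟨_, _, _, hc 0 1 2 (by decide) (by decide), hc 1 2 3 (by decide) (by decide),
    hc 0 2 3 (by decide) (by decide), hc 0 1 3 (by decide) (by decide), hs 0 2 _, ht 0 2 _,
    hs 1 3 _, ht 1 3 _, hs 0 3 _, ht 0 3 _⟩

end

lemma isPath_refl {x y : ObjOf W} {f : (W.obj (op (one t))).obj (op ⦋0⦌)}
    (hf₀ : res W (src t) f = x) (hf₁ : res W (tgt t) f = y) : IsPath W x y f f := by
  refine ⟨(W.obj _).σ 0 f, SSet.δ_comp_σ_succ_apply 0 f, SSet.δ_comp_σ_self_apply 0 f, ?_, ?_⟩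
  · refine (res_map W _ _ _).trans ?_
    rw [hf₀, ← degen_zero x, map_degen, degen_zero]
  · refine (res_map W _ _ _).trans ?_
    rw [hf₁, ← degen_zero y, map_degen, degen_zero]

lemma isComposite_degenerate (s : diag t 2 ⟶ one t) (f : (W.obj (op (one t))).obj (op ⦋0⦌))
    {d₀ d₁ d₂ : one t ⟶ one t} (h₀ : ed ht 0 1 ≫ s = d₀) (h₁ : ed ht 1 2 ≫ s = d₁)
    (h₂ : ed ht 0 2 ≫ s = d₂) : IsComposite W ht (res W d₀ f) (res W d₁ f) (res W d₂ f) := by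
  subst h₀ h₁ h₂
  exact ⟨res W s f, (res_comp W _ _ _).symm, (res_comp W _ _ _).symm, (res_comp W _ _ _).symm⟩

lemma isComposite_id_left {x : ObjOf W} {f : (W.obj (op (one t))).obj (op ⦋0⦌)}
    (hf : res W (src t) f = x) : IsComposite W ht (res W (toZero (one t)) x) f f := by
  have := isComposite_degenerate ht (tri ht (m := 1) 0 0 1) f (d₀ := toZero (one t) ≫ src t)
    (d₁ := 𝟙 _) (d₂ := 𝟙 _)
    (hom_diag_ext ht (m := 1) fun (a : Fin 2) ↦ by fin_cases a <;> rfl)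
    (hom_diag_ext ht (m := 1) fun (a : Fin 2) ↦ by fin_cases a <;> rfl)
    (hom_diag_ext ht (m := 1) fun (a : Fin 2) ↦ by fin_cases a <;> rfl)
  rwa [res_id, res_comp, hf] at this

lemma isComposite_id_right {y : ObjOf W} {f : (W.obj (op (one t))).obj (op ⦋0⦌)}
    (hf : res W (tgt t) f = y) : IsComposite W ht f (res W (toZero (one t)) y) f := by
  have := isComposite_degenerate ht (tri ht (m := 1) 0 1 1) f (d₁ := toZero (one t) ≫ tgt t)
    (d₀ := 𝟙 _) (d₂ := 𝟙 _)
    (hom_diag_ext ht (m := 1) fun (a : Fin 2) ↦ by fin_cases a <;> rfl)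
    (hom_diag_ext ht (m := 1) fun (a : Fin 2) ↦ by fin_cases a <;> rfl)
    (hom_diag_ext ht (m := 1) fun (a : Fin 2) ↦ by fin_cases a <;> rfl)
  rwa [res_id, res_comp, hf] at this

variable (W t) in
/-- The set `π₀ (map_W(x, y)_t)` of morphisms of the homotopy category. -/
abbrev HoHom (x y : ObjOf W) : Type u := SSet.π₀ ((mapObj x y).obj (op t))

/-- The morphism of the homotopy category represented by a point of `W_{[1](t)}`. -/
def HoHom.mk {x y : ObjOf W} (f : (W.obj (op (one t))).obj (op ⦋0⦌)) (hf₀ : res W (src t) f = x)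
    (hf₁ : res W (tgt t) f = y) : HoHom W t x y :=
  SSet.π₀.mk (X := (mapObj x y).obj (op t))
    ⟨f, hf₀.trans (degen_zero x).symm, hf₁.trans (degen_zero y).symm⟩

lemma HoHom.exists_rep {x y : ObjOf W} (f : HoHom W t x y) : ∃ f' hf₀ hf₁, HoHom.mk f' hf₀ hf₁ = f := by
  obtain ⟨⟨f, hf₀, hf₁⟩, rfl⟩ := f.mk_surjective
  exact ⟨f, hf₀.trans (degen_zero x), hf₁.trans (degen_zero y), rfl⟩

lemma HoHom.sound {x y : ObjOf W} {f f' : (W.obj (op (one t))).obj (op ⦋0⦌)}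
    (h : IsPath W x y f f') (hf₀ hf₁ hf₀' hf₁') :
    (HoHom.mk f hf₀ hf₁ : HoHom W t x y) = HoHom.mk f' hf₀' hf₁' := by
  obtain ⟨γ, h₁, h₂, h₃, h₄⟩ := h
  exact SSet.π₀.sound (X := (mapObj x y).obj (op t))
    (.mk ⟨γ, h₃, h₄⟩ (Subtype.ext h₁) (Subtype.ext h₂))

lemma isPath_of_edge {x y : ObjOf W} {f f' : ((mapObj x y).obj (op t)).obj (op ⦋0⦌)}
    (e : ((mapObj x y).obj (op t)).Edge f f') : IsPath W x y f.1 f'.1 :=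
  ⟨e.edge.1, congrArg Subtype.val e.src_eq, congrArg Subtype.val e.tgt_eq, e.edge.2⟩

section
variable (hW : IsFibrantFor (segalMaps C) W)

/-- The composition of morphisms in the homotopy category: if `σ` is a point of `W_{[2](t, t)}`,
then the composite of the classes of the edges `0 → 1` and `1 → 2` of `σ` is the class of the
edge `0 → 2`. -/
def HoHom.comp {x y z : ObjOf W} (f : HoHom W t x y) (g : HoHom W t y z) : HoHom W t x z :=
  let c (f : ((mapObj x y).obj (op t)).obj (op ⦋0⦌)) (g : ((mapObj y z).obj (op t)).obj (op ⦋0⦌)) :=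
    exists_isComposite ht hW (f.2.1.trans (degen_zero x)) (f.2.2.trans (degen_zero y))
      (g.2.1.trans (degen_zero y)) (g.2.2.trans (degen_zero z))
  SSet.π₀.lift (fun f ↦ SSet.π₀.lift (fun g ↦
      HoHom.mk (c f g).choose (c f g).choose_spec.2.1 (c f g).choose_spec.2.2)
    fun _ _ e ↦ HoHom.sound ((c _ _).choose_spec.1.path ht hW (c _ _).choose_spec.1
      (isPath_refl (f.2.1.trans (degen_zero x)) (f.2.2.trans (degen_zero y)))
      (isPath_of_edge e)) _ _ _ _)
    (fun _ _ e ↦ funext fun g ↦ by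
      obtain ⟨g, rfl⟩ := g.mk_surjective
      exact HoHom.sound ((c _ _).choose_spec.1.path ht hW (c _ _).choose_spec.1 (isPath_of_edge e)
        (isPath_refl (g.2.1.trans (degen_zero y)) (g.2.2.trans (degen_zero z))))
        (c _ g).choose_spec.2.1 (c _ g).choose_spec.2.2 (c _ g).choose_spec.2.1
        (c _ g).choose_spec.2.2) f g

lemma HoHom.mk_comp_mk {x y z : ObjOf W} {f g h : (W.obj (op (one t))).obj (op ⦋0⦌)}
    (H : IsComposite W ht f g h) (hf₀ hf₁ hg₀ hg₁ hh₀ hh₁) :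
    HoHom.comp ht hW (HoHom.mk f hf₀ hf₁ : HoHom W t x y) (HoHom.mk g hg₀ hg₁ : HoHom W t y z) =
      HoHom.mk h hh₀ hh₁ :=
  let c := exists_isComposite ht hW hf₀ hf₁ hg₀ hg₁
  HoHom.sound (c.choose_spec.1.path ht hW H (isPath_refl hf₀ hf₁) (isPath_refl hg₀ hg₁))
    c.choose_spec.2.1 c.choose_spec.2.2 hh₀ hh₁

/-- The homotopy category `ho(W)` of a Segal object `W`: the objects are the elements
of `W_{[0],0}`, and the morphisms from `x` to `y` are the elements of `π₀ (map_W(x, y)_t)`, where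
`t` is the terminal object of `C`. -/
structure Ho (ht : Limits.IsTerminal t) (hW : IsFibrantFor (segalMaps C) W) : Type u where
  /-- the underlying element of `W_{[0],0}` -/
  pt : ObjOf W

instance : Category.{u} (Ho ht hW) where
  Hom x y := HoHom W t x.pt y.pt
  id x := HoHom.mk (res W (toZero (one t)) x.pt)
    ((res_comp W _ _ _).symm.trans ((res_congr (hom_zero_ext _ _) _).trans (res_id W x.pt)))
    ((res_comp W _ _ _).symm.trans ((res_congr (hom_zero_ext _ _) _).trans (res_id W x.pt)))
  comp f g := HoHom.comp ht hW f g
  id_comp f := by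
    obtain ⟨f, hf₀, hf₁, rfl⟩ := HoHom.exists_rep f
    exact HoHom.mk_comp_mk ht hW (isComposite_id_left ht hf₀) _ _ _ _ _ _
  comp_id f := by
    obtain ⟨f, hf₀, hf₁, rfl⟩ := HoHom.exists_rep f
    exact HoHom.mk_comp_mk ht hW (isComposite_id_right ht hf₁) _ _ _ _ _ _
  assoc f g h := by
    obtain ⟨f, hf₀, hf₁, rfl⟩ := HoHom.exists_rep f
    obtain ⟨g, hg₀, hg₁, rfl⟩ := HoHom.exists_rep g
    obtain ⟨h, hh₀, hh₁, rfl⟩ := HoHom.exists_rep h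
    obtain ⟨fg, gh, fgh, h₁, h₂, h₃, h₄, h₅, h₆, h₇, h₈, h₉, h₁₀⟩ :=
      exists_assoc ht hW hf₀ hf₁ hg₀ hg₁ hh₀ hh₁
    refine ((congrArg (fun k ↦ HoHom.comp ht hW k _)
      (HoHom.mk_comp_mk ht hW h₁ _ _ _ _ h₅ h₆)).trans
      (HoHom.mk_comp_mk ht hW h₃ _ _ _ _ h₉ h₁₀)).trans ?_
    exact ((congrArg (fun k ↦ HoHom.comp ht hW _ k)
      (HoHom.mk_comp_mk ht hW h₂ _ _ _ _ h₇ h₈)).trans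
      (HoHom.mk_comp_mk ht hW h₄ _ _ _ _ h₉ h₁₀)).symm

/-- The functor `ho(f) : ho(U) ⥤ ho(V)`. -/
def hoFunctor {U V : (Theta C)ᵒᵖ ⥤ SSet.{u}} (hU : IsFibrantFor (segalMaps C) U)
    (hV : IsFibrantFor (segalMaps C) V) (f : U ⟶ V) : Ho ht hU ⥤ Ho ht hV where
  obj x := ⟨(f.app _).app _ x.pt⟩
  map {x y} g := SSet.mapπ₀ ((mapObjMap f x.pt y.pt).app (op t)) g
  map_id x := congrArg SSet.π₀.mk (Subtype.ext (app_res f _ _))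
  map_comp {x y z} g h := by
    obtain ⟨g, hg₀, hg₁, rfl⟩ := HoHom.exists_rep g
    obtain ⟨h, hh₀, hh₁, rfl⟩ := HoHom.exists_rep h
    obtain ⟨gh, H, h₁, h₂⟩ := exists_isComposite ht hU hg₀ hg₁ hh₀ hh₁
    refine (congrArg (SSet.mapπ₀ ((mapObjMap f x.pt z.pt).app (op t)))
      (HoHom.mk_comp_mk ht hU H hg₀ hg₁ hh₀ hh₁ h₁ h₂)).trans ?_
    have e (d : zero ⟶ one t) {w : (U.obj (op (one t))).obj (op ⦋0⦌)} {x : ObjOf U}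
        (h : res U d w = x) : res V d ((f.app _).app _ w) = (f.app _).app _ x :=
      (app_res f _ _).symm.trans (congrArg _ h)
    exact (HoHom.mk_comp_mk ht hV (H.map ht f) (e _ hg₀) (e _ hg₁) (e _ hh₀) (e _ hh₁)
      (e _ h₁) (e _ h₂)).symm

end
end
end

/-! ### DK-equivalences -/

open Theta

section
variable {C : Type u} [SmallCategory.{u} C]

lemma IsFibrantFor.segal {S : MorphismProperty (Cᵒᵖ ⥤ SSet.{u})} {W : (Theta C)ᵒᵖ ⥤ SSet.{u}}
    (hW : IsFibrantFor (se S) W) : IsFibrantFor (segalMaps C) W :=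
  ⟨fun _ _ f hf ↦ hW.isLocal f (Or.inl hf), hW.injectiveFibrant⟩

/-- The maps `f` between `se(S)`-fibrant objects such that the functor `ho(f)` is an equivalence of
categories, and such that all the maps `map_U(x, y) ⟶ map_V(f x, f y)` satisfy `P`. -/
def IsDKWith {t : C} (ht : Limits.IsTerminal t) (S : MorphismProperty (Cᵒᵖ ⥤ SSet.{u}))
    (P : ∀ {A B : Cᵒᵖ ⥤ SSet.{u}}, (A ⟶ B) → Prop)
    {U V : (Theta C)ᵒᵖ ⥤ SSet.{u}} (f : U ⟶ V) : Prop :=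
  ∃ (hU : IsFibrantFor (se S) U) (hV : IsFibrantFor (se S) V),
    (hoFunctor ht hU.segal hV.segal f).IsEquivalence ∧ ∀ x y : ObjOf U, P (mapObjMap f x y)

/-- DK-equivalences between `se(S)`-fibrant objects: the functor `ho(f)` is an equivalence of
categories, and the maps `map_U(x, y) ⟶ map_V(f x, f y)` are levelwise weak equivalences. -/
def IsDK {t : C} (ht : Limits.IsTerminal t) (S : MorphismProperty (Cᵒᵖ ⥤ SSet.{u}))
    {U V : (Theta C)ᵒᵖ ⥤ SSet.{u}} (f : U ⟶ V) : Prop :=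
  IsDKWith ht S LevelwiseWeakEquiv f

end

end Constructions

open Theta

section
variable (C : Type u) [SmallCategory.{u} C]

/-- The iterated category `Θⁿ C`. -/
def ThetaIter : ℕ → Cat.{u, u}
  | 0 => Cat.of C
  | n + 1 => Cat.of (Theta (ThetaIter n))

variable {C}

/-- The terminal object of `Θⁿ C`. -/
def ThetaIter.terminal (t : C) : ∀ n, ThetaIter C n
  | 0 => t
  | n + 1 => (Theta.zero : Theta (ThetaIter C n))

/-- The object `ThetaIter.terminal t n` is terminal. -/
def ThetaIter.isTerminal {t : C} (ht : Limits.IsTerminal t) :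
    ∀ n, Limits.IsTerminal (ThetaIter.terminal t n)
  | 0 => ht
  | n + 1 => isTerminalZero (ThetaIter C n)

/-- The class `seⁿ(S)`. -/
def seIter (S : MorphismProperty (Cᵒᵖ ⥤ SSet.{u})) :
    ∀ n, MorphismProperty ((ThetaIter C n)ᵒᵖ ⥤ SSet.{u})
  | 0 => S
  | n + 1 => se (C := ThetaIter C n) (seIter S n)

/-- The class `cptⁿ(S)`. -/
def cptIter (S : MorphismProperty (Cᵒᵖ ⥤ SSet.{u})) :
    ∀ n, MorphismProperty ((ThetaIter C n)ᵒᵖ ⥤ SSet.{u})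
  | 0 => S
  | n + 1 => cpt (C := ThetaIter C n) (cptIter S n)

/-- DK-equivalences between `seⁿ(S)`-fibrant objects. For `n = 0`, these are the levelwise weak
equivalences between `S`-fibrant objects; for `n + 1`, the functor `ho(f)` has to be an equivalence
of categories and the maps `map_U(x, y) ⟶ map_V(f x, f y)` have to be DK-equivalences between
`seⁿ(S)`-fibrant objects. -/
def IsDKIter {t : C} (ht : Limits.IsTerminal t) (S : MorphismProperty (Cᵒᵖ ⥤ SSet.{u})) :
    ∀ (n : ℕ) {U V : (ThetaIter C n)ᵒᵖ ⥤ SSet.{u}}, (U ⟶ V) → Prop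
  | 0, U, V, f => IsFibrantFor S U ∧ IsFibrantFor S V ∧ LevelwiseWeakEquiv (D := C) f
  | n + 1, _, _, f =>
    IsDKWith (C := ThetaIter C n) (ThetaIter.isTerminal ht n) (seIter S n) (IsDKIter ht S n) f

end

end ThetaSpaces

end

open ThetaSpaces

noncomputable section

namespace ThetaSpaces

section
open Simplicial MonoidalCategory HomotopicalAlgebra SSet.modelCategoryQuillen
open SemiCartesianMonoidalCategory (fst snd)

/-! ### Lifting properties of simplicial sets -/

/-! A levelwise weak equivalence `f : U ⟶ V` is a DK-equivalence because everything in the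
definition is homotopy invariant for injectively fibrant objects. The map from `W_{[1](c)}` to pairs
of objects is a Kan fibration (`ends_fibration`), so its strict fibres, the mapping objects, see
only the homotopy type (`mapObjMap_we`); and objects of `V` joined by a path are isomorphic in the
homotopy category (`nonempty_iso_of_joined`), which gives essential surjectivity in
`hoFunctor_isEquivalence`.

For the converse, `f` is factored through `changeObj`, which is `V` with its space of objects
replaced by that of `U`. The first factor is the identity on objects and is fibrewise `mapObjMap f x
y` on `[1](c)`; hence it is an equivalence there, and by the Segal condition on every `[m](c₁, …,
c_m)` (`toChangeObj_we`). The second factor is a base change of a map depending only on the objects,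
so by right properness (`changeObjFst_we`) all that remains is that `f` is a weak equivalence on
objects. This is `objects_we`, where completeness enters: the space of objects is equivalent to the
space of `E`-diagrams, and this transfers from `U` to `changeObj`. Of `ho(f)` only essential
surjectivity is used. It has to be turned into paths of objects: an isomorphism of `ho(V)` is
represented by an edge along which composition is a homotopy equivalence (`legP_trivFib`); hence the
cones with legs the identity and this edge form a trivial fibration over `π^* E`
(`starProj_trivFib`), a diagram on `π^* E` results, and completeness contracts it to a point
(`joined_of_iso`).

The iterated statement follows by induction, since mapping objects of `cpt(T)`-fibrant objects are
`T`-fibrant (`mapObj_isFibrantFor`): `Map(A, map_W(x, y))` is the part of `Map(V[1](A), W)` with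
ends `x` and `y`.

The underlying homotopy theory of simplicial sets is derived from the definition of weak
equivalences through homotopy classes of maps into Kan complexes. The main tool is `RelLift`:
between Kan fibrations over a base, with Kan middle object, it characterizes weak equivalences, and
it visibly passes to fibres and base changes. -/

/-- Trivial fibrations: the maps with the right lifting property for all monomorphisms. -/
abbrev TrivFib {E B : SSet.{u}} (p : E ⟶ B) : Prop :=
  (MorphismProperty.monomorphisms SSet.{u}).rlp p

lemma TrivFib.exists_lift {E B A L : SSet.{u}} {p : E ⟶ B} (hp : TrivFib p) (i : A ⟶ L) [hi : Mono i]
    (a : A ⟶ E) (b : L ⟶ B) (w : a ≫ p = i ≫ b) : ∃ c : L ⟶ E, i ≫ c = a ∧ c ≫ p = b := by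
  have := hp i hi
  have sq : CommSq a i p b := ⟨w⟩
  exact ⟨sq.lift, sq.fac_left, sq.fac_right⟩

lemma anodyne_exists_lift {E B A L : SSet.{u}} (p : E ⟶ B) [hp : Fibration p] {i : A ⟶ L}
    (hi : SSet.anodyneExtensions i)
    (a : A ⟶ E) (b : L ⟶ B) (w : a ≫ p = i ≫ b) : ∃ c : L ⟶ E, i ≫ c = a ∧ c ≫ p = b := by
  have := hi p (by rwa [← HomotopicalAlgebra.fibration_iff])
  have sq : CommSq a i p b := ⟨w⟩
  exact ⟨sq.lift, sq.fac_left, sq.fac_right⟩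

/-- Unpacks a lift against a pushout product into its two legs, so that maps on `L ⊗ M` are obtained
from data on `L ⊗ K` and `A ⊗ M` without naming the pushout. -/
lemma exists_lift_pushoutProduct {A L K M E Y : SSet.{u}} {i : A ⟶ L} {j : K ⟶ M} {p : E ⟶ Y}
    (h : HasLiftingProperty
      (Functor.PushoutObjObj.ofHasPushout (curriedTensor SSet.{u}) i j).ι p)
    (a : L ⊗ K ⟶ E) (b : A ⊗ M ⟶ E) (y : L ⊗ M ⟶ Y) (hab : i ▷ K ≫ a = A ◁ j ≫ b)
    (ha : a ≫ p = L ◁ j ≫ y) (hb : b ≫ p = i ▷ M ≫ y) :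
    ∃ c : L ⊗ M ⟶ E, L ◁ j ≫ c = a ∧ i ▷ M ≫ c = b ∧ c ≫ p = y := by
  let P := Functor.PushoutObjObj.ofHasPushout (curriedTensor SSet.{u}) i j
  let d : P.pt ⟶ E := P.isPushout.desc a b hab
  have h₁ : P.inl ≫ P.ι = L ◁ j := P.inl_ι
  have h₂ : P.inr ≫ P.ι = i ▷ M := P.inr_ι
  have h₃ : P.inl ≫ d = a := P.isPushout.inl_desc _ _ _
  have h₄ : P.inr ≫ d = b := P.isPushout.inr_desc _ _ _
  have sq : CommSq d P.ι p y := ⟨P.isPushout.hom_ext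
    (by rw [reassoc_of% h₃, reassoc_of% h₁, ha]) (by rw [reassoc_of% h₄, reassoc_of% h₂, hb])⟩
  exact ⟨sq.lift, by rw [← h₁, Category.assoc, sq.fac_left, h₃],
    by rw [← h₂, Category.assoc, sq.fac_left, h₄], sq.fac_right⟩

/-- The pushout product of a monomorphism and an anodyne extension is anodyne. This form gives
relative homotopy lifting; `fib_lift'`, with the anodyne map on the other side, gives homotopies
with both ends prescribed. -/
lemma fib_lift {A L K M E Y : SSet.{u}} (i : A ⟶ L) [Mono i] {j : K ⟶ M}
    (hj : SSet.anodyneExtensions j) (p : E ⟶ Y) [hp : Fibration p]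
    (a : L ⊗ K ⟶ E) (b : A ⊗ M ⟶ E) (y : L ⊗ M ⟶ Y) (hab : i ▷ K ≫ a = A ◁ j ≫ b)
    (ha : a ≫ p = L ◁ j ≫ y) (hb : b ≫ p = i ▷ M ≫ y) :
    ∃ c : L ⊗ M ⟶ E, L ◁ j ≫ c = a ∧ i ▷ M ≫ c = b ∧ c ≫ p = y :=
  exists_lift_pushoutProduct (SSet.anodyneExtensions_pushoutObjObjι _ hj p
    (by rwa [← HomotopicalAlgebra.fibration_iff])) a b y hab ha hb

lemma fib_lift' {A L K M E Y : SSet.{u}} {i : A ⟶ L} (hi : SSet.anodyneExtensions i) (j : K ⟶ M)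
    [Mono j] (p : E ⟶ Y) [hp : Fibration p]
    (a : L ⊗ K ⟶ E) (b : A ⊗ M ⟶ E) (y : L ⊗ M ⟶ Y) (hab : i ▷ K ≫ a = A ◁ j ≫ b)
    (ha : a ≫ p = L ◁ j ≫ y) (hb : b ≫ p = i ▷ M ≫ y) :
    ∃ c : L ⊗ M ⟶ E, L ◁ j ≫ c = a ∧ i ▷ M ≫ c = b ∧ c ≫ p = y :=
  exists_lift_pushoutProduct (SSet.anodyneExtensions_pushoutObjObjι' _ hi p
    (by rwa [← HomotopicalAlgebra.fibration_iff])) a b y hab ha hb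

/-- Exponential adjunctions isolate one factor of the pushout product at a time. As trivial
fibrations are detected by boundary inclusions, both factors may be taken to be boundary inclusions;
there the pushout product is the inclusion of a subcomplex, hence a monomorphism. -/
lemma TrivFib.hasLiftingProperty_pushoutProduct {A L K M E Y : SSet.{u}} (i : A ⟶ L) [hi : Mono i]
    (j : K ⟶ M) [hj : Mono j] {p : E ⟶ Y} (hp : TrivFib p) :
    HasLiftingProperty
      (Functor.PushoutObjObj.ofHasPushout (curriedTensor SSet.{u}) i j).ι p := by
  let sq₁₃ := Functor.PullbackObjObj.ofHasPullback MonoidalClosed.internalHom i p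
  rw [MonoidalClosed.internalHomAdjunction₂.hasLiftingProperty_iff _ sq₁₃]
  suffices (MorphismProperty.monomorphisms _).rlp sq₁₃.π from this _ hj
  rw [SSet.rlp_monomorphisms]
  rintro _ _ _ ⟨n⟩
  let sq := Functor.PushoutObjObj.ofHasPushout (curriedTensor SSet.{u}) i (SSet.boundary.{u} n).ι
  rw [← MonoidalClosed.internalHomAdjunction₂.hasLiftingProperty_iff sq,
    HasLiftingProperty.iff_of_arrow_iso_left
    (show Arrow.mk sq.ι ≅ Arrow.mk sq.flipTensor.ι from Arrow.isoMk (Iso.refl _) (β_ _ _))]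
  let sq' := Functor.PullbackObjObj.ofHasPullback MonoidalClosed.internalHom (SSet.boundary.{u} n).ι p
  rw [MonoidalClosed.internalHomAdjunction₂.hasLiftingProperty_iff _ sq']
  suffices (MorphismProperty.monomorphisms _).rlp sq'.π from this _ hi
  rw [SSet.rlp_monomorphisms]
  rintro _ _ _ ⟨m⟩
  rw [← MonoidalClosed.internalHomAdjunction₂.hasLiftingProperty_iff
    (SSet.Subcomplex.unionProd.pushoutObjObj.{u} _ _)]
  exact hp _ (inferInstanceAs (Mono (SSet.Subcomplex.ι _)))

lemma TrivFib.comp {E B D : SSet.{u}} {p : E ⟶ B} {q : B ⟶ D} (hp : TrivFib p) (hq : TrivFib q) :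
    TrivFib (p ≫ q) :=
  MorphismProperty.comp_mem (MorphismProperty.monomorphisms SSet.{u}).rlp _ _ hp hq

lemma TrivFib.of_iso {E B : SSet.{u}} (p : E ⟶ B) [IsIso p] : TrivFib p :=
  MorphismProperty.rlp_of_isIso _ _

lemma TrivFib.of_isPullback {E B E' B' : SSet.{u}} {p : E ⟶ B} {p' : E' ⟶ B'} {e : E' ⟶ E}
    {b : B' ⟶ B} (h : IsPullback e p' p b) (hp : TrivFib p) : TrivFib p' :=
  MorphismProperty.of_isPullback h hp

lemma fibration_of_isPullback {E B E' B' : SSet.{u}} {p : E ⟶ B} {p' : E' ⟶ B'} {e : E' ⟶ E}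
    {b : B' ⟶ B} (h : IsPullback e p' p b) [hp : Fibration p] : Fibration p' := by
  rw [fibration_iff] at hp ⊢
  exact MorphismProperty.of_isPullback h hp

/-- Generalized `fibration` criterion: lifting against anodyne extensions. -/
lemma fibration_of_exists {E B : SSet.{u}} {p : E ⟶ B}
    (h : ∀ {A L : SSet.{u}} (i : A ⟶ L) (_ : SSet.anodyneExtensions i) (a : A ⟶ E) (b : L ⟶ B),
      a ≫ p = i ≫ b → ∃ c : L ⟶ E, i ≫ c = a ∧ c ≫ p = b) : Fibration p := by
  rw [fibration_iff]
  intro _ _ j hj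
  refine ⟨fun {a b} sq ↦ ?_⟩
  obtain ⟨c, h₁, h₂⟩ := h j (MorphismProperty.le_llp_rlp _ _ hj) a b sq.w
  exact ⟨⟨c, h₁, h₂⟩⟩

lemma TrivFib.of_exists {E B : SSet.{u}} {p : E ⟶ B}
    (h : ∀ {A L : SSet.{u}} (i : A ⟶ L) (_ : Mono i) (a : A ⟶ E) (b : L ⟶ B),
      a ≫ p = i ≫ b → ∃ c : L ⟶ E, i ≫ c = a ∧ c ≫ p = b) : TrivFib p := by
  intro _ _ j hj
  refine ⟨fun {a b} sq ↦ ?_⟩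
  obtain ⟨c, h₁, h₂⟩ := h j hj a b sq.w
  exact ⟨⟨c, h₁, h₂⟩⟩

lemma TrivFib.of_boundary {E B : SSet.{u}} {p : E ⟶ B}
    (h : ∀ (n : ℕ) (a : (SSet.boundary.{u} n : SSet.{u}) ⟶ E) (b : Δ[n] ⟶ B),
      a ≫ p = (SSet.boundary.{u} n).ι ≫ b →
        ∃ c : Δ[n] ⟶ E, (SSet.boundary.{u} n).ι ≫ c = a ∧ c ≫ p = b) : TrivFib p := by
  rw [TrivFib, SSet.rlp_monomorphisms]
  rintro _ _ _ ⟨n⟩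
  refine ⟨fun {a b} sq ↦ ?_⟩
  obtain ⟨c, h₁, h₂⟩ := h n a b sq.w
  exact ⟨⟨c, h₁, h₂⟩⟩

/-! ### Homotopies -/

lemma anodyne_δ (k : Fin 2) :
    SSet.anodyneExtensions (SSet.stdSimplex.{u}.δ k : Δ[0] ⟶ Δ[1]) := by
  intro E B p hp
  have : Fibration p := by rwa [HomotopicalAlgebra.fibration_iff]
  refine ⟨fun {a b} sq ↦ ?_⟩
  -- The horn of `Δ[1]` with index `k.rev` has `δ k` as its only face, so compatibility is void.
  have hc : SSet.horn.IsCompatible (n := 0) (i := k.rev) (fun j _ ↦ a) := trivial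
  obtain ⟨φ, h₁, h₂⟩ := hc.exists_lift p b (by
    intro j hj
    obtain rfl : j = k := by
      fin_cases j <;> fin_cases k <;> simp_all
    exact sq.w)
  exact ⟨⟨φ, h₁ k (by fin_cases k <;> decide), h₂⟩⟩

/-- Lifting of homotopies along Kan fibrations, relative to a subobject, from the start. -/
lemma hlp₀ {A L E Y : SSet.{u}} (i : A ⟶ L) [Mono i] (p : E ⟶ Y) [Fibration p]
    (a : L ⟶ E) (b : A ⊗ Δ[1] ⟶ E) (y : L ⊗ Δ[1] ⟶ Y) (hab : SSet.ι₀ ≫ b = i ≫ a)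
    (ha : SSet.ι₀ ≫ y = a ≫ p) (hb : b ≫ p = i ▷ Δ[1] ≫ y) :
    ∃ c : L ⊗ Δ[1] ⟶ E, SSet.ι₀ ≫ c = a ∧ i ▷ Δ[1] ≫ c = b ∧ c ≫ p = y := by
  obtain ⟨c, h₁, h₂, h₃⟩ := fib_lift i (anodyne_δ 1) p (fst _ _ ≫ a) b y
    (by rw [whiskerLeft_δ_one, Category.assoc, hab]; rfl)
    (by rw [whiskerLeft_δ_one, Category.assoc, Category.assoc, ha]) hb
  refine ⟨c, ?_, h₂, h₃⟩
  rw [whiskerLeft_δ_one, Category.assoc] at h₁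
  -- The lift was found relative to `L ⊗ Δ[0]`; its equation descends to `L` because the projection
  -- is an epimorphism.
  have : Epi (fst L (Δ[0] : SSet.{u})) :=
    ⟨fun f g e ↦ by
      ext n x
      exact app_congr e n (x, SSet.stdSimplex.objEquiv.symm (SimplexCategory.const _ _ 0))⟩
  exact (cancel_epi _).1 h₁

/-- Lifting of homotopies along Kan fibrations, relative to a subobject, from the end. -/
lemma hlp₁ {A L E Y : SSet.{u}} (i : A ⟶ L) [Mono i] (p : E ⟶ Y) [Fibration p]
    (a : L ⟶ E) (b : A ⊗ Δ[1] ⟶ E) (y : L ⊗ Δ[1] ⟶ Y) (hab : SSet.ι₁ ≫ b = i ≫ a)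
    (ha : SSet.ι₁ ≫ y = a ≫ p) (hb : b ≫ p = i ▷ Δ[1] ≫ y) :
    ∃ c : L ⊗ Δ[1] ⟶ E, SSet.ι₁ ≫ c = a ∧ i ▷ Δ[1] ≫ c = b ∧ c ≫ p = y := by
  obtain ⟨c, h₁, h₂, h₃⟩ := fib_lift i (anodyne_δ 0) p (fst _ _ ≫ a) b y
    (by rw [whiskerLeft_δ_zero, Category.assoc, hab]; rfl)
    (by rw [whiskerLeft_δ_zero, Category.assoc, Category.assoc, ha]) hb
  refine ⟨c, ?_, h₂, h₃⟩
  rw [whiskerLeft_δ_zero, Category.assoc] at h₁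
  have : Epi (fst L (Δ[0] : SSet.{u})) :=
    ⟨fun f g e ↦ by
      ext n x
      exact app_congr e n (x, SSet.stdSimplex.objEquiv.symm (SimplexCategory.const _ _ 0))⟩
  exact (cancel_epi _).1 h₁

/-- Two maps are homotopic. -/
def Htpy {X Y : SSet.{u}} (f g : X ⟶ Y) : Prop := Nonempty (SSet.Homotopy f g)

lemma Htpy.mk {X Y : SSet.{u}} {f g : X ⟶ Y} (h : X ⊗ Δ[1] ⟶ Y) (h₀ : SSet.ι₀ ≫ h = f)
    (h₁ : SSet.ι₁ ≫ h = g) : Htpy f g := ⟨mkHomotopy h h₀ h₁⟩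

lemma htpy_iff {X Y : SSet.{u}} {f g : X ⟶ Y} :
    Htpy f g ↔ ∃ h : X ⊗ Δ[1] ⟶ Y, SSet.ι₀ ≫ h = f ∧ SSet.ι₁ ≫ h = g :=
  ⟨fun ⟨H⟩ ↦ ⟨H.h, H.h₀, H.h₁⟩, fun ⟨h, h₀, h₁⟩ ↦ .mk h h₀ h₁⟩

lemma Htpy.refl {X Y : SSet.{u}} (f : X ⟶ Y) : Htpy f f := .mk (fst _ _ ≫ f) rfl rfl

lemma Htpy.of_eq {X Y : SSet.{u}} {f g : X ⟶ Y} (h : f = g) : Htpy f g := h ▸ .refl f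

lemma Htpy.comp_right {X Y Z : SSet.{u}} {f g : X ⟶ Y} (h : Htpy f g) (k : Y ⟶ Z) :
    Htpy (f ≫ k) (g ≫ k) := by
  obtain ⟨H, rfl, rfl⟩ := htpy_iff.1 h
  exact .mk (H ≫ k) (by simp) (by simp)

lemma Htpy.comp_left {X Y Z : SSet.{u}} {f g : X ⟶ Y} (h : Htpy f g) (k : Z ⟶ X) :
    Htpy (k ≫ f) (k ≫ g) := by
  obtain ⟨H, rfl, rfl⟩ := htpy_iff.1 h
  exact .mk (k ▷ _ ≫ H) rfl rfl

/-- Homotopies are edges of the internal hom, which is a Kan complex when `Y` is one; horn filling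
there makes homotopy an equivalence relation. -/
lemma htpy_iff_ihom {X Y : SSet.{u}} {f g : X ⟶ Y} : Htpy f g ↔
    ∃ e : ((ihom X).obj Y : SSet.{u}) _⦋1⦌, ((ihom X).obj Y).δ 1 e = ihomVertex f ∧
      ((ihom X).obj Y).δ 0 e = ihomVertex g := by
  rw [htpy_iff]
  constructor
  · rintro ⟨h, rfl, rfl⟩
    exact ⟨ihomEquiv h, δ_one_ihomEquiv h, δ_zero_ihomEquiv h⟩
  · rintro ⟨e, h₀, h₁⟩
    obtain ⟨h, rfl⟩ := ihomEquiv.surjective e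
    rw [δ_one_ihomEquiv] at h₀
    rw [δ_zero_ihomEquiv] at h₁
    exact ⟨h, ihomVertex_injective h₀, ihomVertex_injective h₁⟩

/-- Horn filling `Λ²₀` in Kan complexes. -/
lemma kan_edge_quotient {K : SSet.{u}} [SSet.KanComplex K] (e e' : K _⦋1⦌) (h : K.δ 1 e = K.δ 1 e') :
    ∃ d : K _⦋1⦌, K.δ 1 d = K.δ 0 e ∧ K.δ 0 d = K.δ 0 e' := by
  -- Faces 1 and 2 are `e'` and `e`; entry 0 of the vector and the simplex of the terminal base are
  -- placeholders.
  obtain ⟨σ, hσ, -⟩ := horn_lift_two (Limits.terminal.from K) 0 ![e, e', e] (by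
      intro j k hj hk hjk
      obtain rfl : j = 1 := by lia
      obtain rfl : k = 2 := by lia
      exact h.symm) ((Limits.terminal.from K).app _ (K.σ 0 e)) (by
      intro j hj
      exact SSet.yonedaEquiv.symm.injective (Limits.terminalIsTerminal.hom_ext _ _))
  have hσ₁ := hσ 1 (by decide)
  have hσ₂ := hσ 2 (by decide)
  refine ⟨K.δ 0 σ, ?_, ?_⟩
  · exact (SSet.δ_comp_δ'_apply (i := 0) (j := 2) (by decide) σ).symm.trans (congrArg _ hσ₂)
  · exact (SSet.δ_comp_δ_self_apply (i := 0) σ).trans (congrArg _ hσ₁)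

lemma Htpy.quotient {X Y : SSet.{u}} [SSet.KanComplex Y] {f g h : X ⟶ Y} (h₁ : Htpy f g)
    (h₂ : Htpy f h) : Htpy g h := by
  rw [htpy_iff_ihom] at h₁ h₂ ⊢
  obtain ⟨e, he, he'⟩ := h₁
  obtain ⟨d, hd, hd'⟩ := h₂
  obtain ⟨c, hc, hc'⟩ := kan_edge_quotient e d (he.trans hd.symm)
  exact ⟨c, hc.trans he', hc'.trans hd'⟩

lemma Htpy.symm {X Y : SSet.{u}} [SSet.KanComplex Y] {f g : X ⟶ Y} (h : Htpy f g) : Htpy g f :=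
  h.quotient (.refl _)

lemma Htpy.trans {X Y : SSet.{u}} [SSet.KanComplex Y] {f g h : X ⟶ Y} (h₁ : Htpy f g)
    (h₂ : Htpy g h) : Htpy f h := h₁.symm.quotient h₂

/-! ### Weak equivalences -/

lemma we_mk {X Y : SSet.{u}} {f : X ⟶ Y}
    (h₁ : ∀ (K : SSet.{u}) [SSet.KanComplex K] (g : X ⟶ K), ∃ h : Y ⟶ K, Htpy (f ≫ h) g)
    (h₂ : ∀ (K : SSet.{u}) [SSet.KanComplex K] (h h' : Y ⟶ K), Htpy (f ≫ h) (f ≫ h') → Htpy h h') :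
    SSetWeakEquiv f := ⟨h₁, h₂⟩

lemma we_of_homotopyInverse {X Y : SSet.{u}} {f : X ⟶ Y} {g : Y ⟶ X} (h₁ : Htpy (f ≫ g) (𝟙 _))
    (h₂ : Htpy (g ≫ f) (𝟙 _)) : SSetWeakEquiv f := by
  refine we_mk (fun K _ k ↦ ⟨g ≫ k, by simpa using h₁.comp_right k⟩) fun K _ h h' e ↦ ?_
  have h₃ := e.comp_left g
  have h₄ := h₂.comp_right h
  have h₅ := h₂.comp_right h'
  simp only [Category.assoc, Category.id_comp] at h₃ h₄ h₅
  exact h₄.symm.trans (h₃.trans h₅)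

lemma SSetWeakEquiv.inj {X Y K : SSet.{u}} [SSet.KanComplex K] {f : X ⟶ Y} (hf : SSetWeakEquiv f)
    {h h' : Y ⟶ K} (H : Htpy (f ≫ h) (f ≫ h')) : Htpy h h' := hf.injective K h h' H

lemma SSetWeakEquiv.surj {X Y K : SSet.{u}} [SSet.KanComplex K] {f : X ⟶ Y} (hf : SSetWeakEquiv f)
    (g : X ⟶ K) : ∃ h : Y ⟶ K, Htpy (f ≫ h) g := hf.surjective K g

lemma we_iso {X Y : SSet.{u}} (f : X ⟶ Y) [IsIso f] : SSetWeakEquiv f :=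
  we_of_homotopyInverse (g := inv f) (.of_eq (by simp)) (.of_eq (by simp))

lemma SSetWeakEquiv.comp {X Y Z : SSet.{u}} {f : X ⟶ Y} {g : Y ⟶ Z} (hf : SSetWeakEquiv f)
    (hg : SSetWeakEquiv g) : SSetWeakEquiv (f ≫ g) := by
  refine we_mk (fun K _ k ↦ ?_) fun K _ h h' e ↦ hg.inj (hf.inj (by simpa using e))
  obtain ⟨h, hh⟩ := hf.surj k
  obtain ⟨l, hl⟩ := hg.surj h
  have := (hl.comp_left f).trans hh
  exact ⟨l, by simpa using this⟩

lemma SSetWeakEquiv.of_comp_left {X Y Z : SSet.{u}} {f : X ⟶ Y} {g : Y ⟶ Z} (hf : SSetWeakEquiv f)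
    (hfg : SSetWeakEquiv (f ≫ g)) : SSetWeakEquiv g where
  surjective K _ k := by
    obtain ⟨l, hl⟩ := hfg.surj (f ≫ k)
    exact ⟨l, hf.inj (by simpa using hl)⟩
  injective K _ h h' e := by
    have := Htpy.comp_left e f
    exact hfg.inj (by simpa using this)

/-- For injectivity, `h` and `h'` are first replaced up to homotopy by `g ≫ l` and `g ≫ l'`, so that
the hypothesis becomes one about `f ≫ g`. -/
lemma SSetWeakEquiv.of_comp_right {X Y Z : SSet.{u}} {f : X ⟶ Y} {g : Y ⟶ Z} (hg : SSetWeakEquiv g)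
    (hfg : SSetWeakEquiv (f ≫ g)) : SSetWeakEquiv f := by
  refine we_mk (fun K _ k ↦ ?_) fun K _ h h' e ↦ ?_
  · obtain ⟨l, hl⟩ := hfg.surj k
    exact ⟨g ≫ l, by simpa using hl⟩
  · obtain ⟨l, hl⟩ := hg.surj h
    obtain ⟨l', hl'⟩ := hg.surj h'
    have := ((hl.comp_left f).trans e).trans (hl'.comp_left f).symm
    have := (hfg.inj (by simpa using this) : Htpy l l')
    exact hl.symm.trans ((this.comp_left g).trans hl')

lemma SSetWeakEquiv.of_retract_section {X Y : SSet.{u}} {s : X ⟶ Y} {p : Y ⟶ X} (h : s ≫ p = 𝟙 X)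
    (hp : SSetWeakEquiv p) : SSetWeakEquiv s :=
  hp.of_comp_right (by rw [h]; exact we_iso _)

lemma SSetWeakEquiv.exists_inverse {X Y : SSet.{u}} [SSet.KanComplex X] [SSet.KanComplex Y]
    {f : X ⟶ Y} (hf : SSetWeakEquiv f) : ∃ g : Y ⟶ X, Htpy (f ≫ g) (𝟙 _) ∧ Htpy (g ≫ f) (𝟙 _) := by
  obtain ⟨g, hg⟩ := hf.surj (𝟙 X)
  refine ⟨g, hg, hf.inj ?_⟩
  simpa using hg.comp_right f

/-- A map inducing bijections on homotopy classes of maps into it is a weak equivalence. -/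
lemma we_of_covariant {X Y : SSet.{u}} [SSet.KanComplex Y] (f : X ⟶ Y)
    (h₁ : ∀ {L : SSet.{u}} (g : L ⟶ Y), ∃ k : L ⟶ X, Htpy (k ≫ f) g)
    (h₂ : ∀ {L : SSet.{u}} (g g' : L ⟶ X), Htpy (g ≫ f) (g' ≫ f) → Htpy g g') :
    SSetWeakEquiv f := by
  obtain ⟨g, hg⟩ := h₁ (𝟙 Y)
  refine we_of_homotopyInverse (g := g) (h₂ _ _ ?_) hg
  simpa using hg.comp_left f

/-! ### Gluing maps on the boundary of the cylinder -/

/-- A homotopy with both ends prescribed is an extension along the monomorphism `L ⊗ ∂Δ[1] ⟶ L ⊗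
Δ[1]`. -/
lemma exists_homotopy_of_trivFib {E B L : SSet.{u}} {p : E ⟶ B} (hp : TrivFib p) (f g : L ⟶ E)
    (h : L ⊗ Δ[1] ⟶ B) (h₀ : SSet.ι₀ ≫ h = f ≫ p) (h₁ : SSet.ι₁ ≫ h = g ≫ p) :
    ∃ H : L ⊗ Δ[1] ⟶ E, SSet.ι₀ ≫ H = f ∧ SSet.ι₁ ≫ H = g ∧ H ≫ p = h := by
  have : Mono (L ◁ (SSet.boundary.{u} 1).ι) := by
    have : ∀ n, Mono ((L ◁ (SSet.boundary.{u} 1).ι).app n) := fun n ↦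
      (mono_iff_injective _).2 fun x y (e : (x.1, x.2.1) = (y.1, y.2.1)) ↦
        Prod.ext (Prod.ext_iff.1 e).1 (Subtype.ext (Prod.ext_iff.1 e).2)
    exact NatTrans.mono_of_mono_app _
  obtain ⟨H, h₂, h₃⟩ := hp.exists_lift (L ◁ (SSet.boundary.{u} 1).ι) (boundaryGlue f g) h (by
    ext n z
    change p.app n (if SSet.stdSimplex.asOrderHom z.2.1 0 = 0 then f.app n z.1 else g.app n z.1) =
      h.app n (z.1, z.2.1)
    split_ifs with hz
    · refine (app_congr h₀ n z.1).symm.trans ?_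
      refine congrArg (h.app n) (Prod.ext rfl ?_)
      refine SSet.stdSimplex.objEquiv.injective ?_
      ext i : 3
      exact (hz.symm.trans (boundary_one_const z.2 0 i))
    · refine (app_congr h₁ n z.1).symm.trans ?_
      refine congrArg (h.app n) (Prod.ext rfl ?_)
      refine SSet.stdSimplex.objEquiv.injective ?_
      ext i : 3
      exact ((Fin.eq_one_of_ne_zero _ hz).symm.trans (boundary_one_const z.2 0 i)))
  refine ⟨H, ?_, ?_, h₃⟩
  · ext n y
    exact (app_congr h₂ n
      (y, ⟨SSet.stdSimplex.objEquiv.symm (SimplexCategory.const _ _ 0), fun hs ↦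
        zero_ne_one (hs 1).choose_spec⟩)).trans (boundaryGlue_pos _ _ _ rfl)
  · ext n y
    exact (app_congr h₂ n
      (y, ⟨SSet.stdSimplex.objEquiv.symm (SimplexCategory.const _ _ 1), fun hs ↦
        one_ne_zero (hs 0).choose_spec⟩)).trans (boundaryGlue_neg _ _ _ one_ne_zero)

lemma TrivFib.exists_section {E B : SSet.{u}} {p : E ⟶ B} (hp : TrivFib p) :
    ∃ s : B ⟶ E, s ≫ p = 𝟙 B := by
  let i : (⊥_ SSet.{u}) ⟶ B := Limits.initial.to B
  obtain ⟨s, -, hs⟩ := hp.exists_lift i (Limits.initial.to E) (𝟙 B)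
    (Limits.initialIsInitial.hom_ext _ _)
  exact ⟨s, hs⟩

lemma TrivFib.htpy {E B L : SSet.{u}} {p : E ⟶ B} (hp : TrivFib p) {f g : L ⟶ E}
    (h : f ≫ p = g ≫ p) : Htpy f g := by
  obtain ⟨H, h₀, h₁, -⟩ := exists_homotopy_of_trivFib hp f g (fst _ _ ≫ f ≫ p) rfl (by rw [h]; rfl)
  exact .mk H h₀ h₁

lemma TrivFib.we {E B : SSet.{u}} {p : E ⟶ B} (hp : TrivFib p) : SSetWeakEquiv p := by
  obtain ⟨s, hs⟩ := hp.exists_section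
  exact we_of_homotopyInverse (g := s) (hp.htpy (by simp [hs])) (.of_eq hs)

/-- Kan fibrations between Kan complexes that are weak equivalences are trivial fibrations. -/
lemma trivFib_of_we {E B : SSet.{u}} (p : E ⟶ B) [Fibration p] [SSet.KanComplex B]
    (hp : SSetWeakEquiv p) : TrivFib p := by
  have : SSet.KanComplex E := isFibrant_of_fibration p
  obtain ⟨s, F, hs, hF₀, hF₁, hF⟩ := exists_section p hp
  refine .of_exists fun {A L} i _ a b w ↦ ?_
  -- `b ≫ s` lifts `b`, but on `A` it is only `a ≫ p ≫ s`. The fibrewise homotopy `F` joins this to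
  -- `a`, and extending that homotopy to `L` over the constant homotopy on `b` corrects the lift.
  obtain ⟨c, h₁, h₂, h₃⟩ := hlp₁ i p (b ≫ s) (a ▷ _ ≫ F) (fst _ _ ≫ b)
    (by rw [SSet.ι₁_comp_assoc, hF₁, reassoc_of% w]) (by rw [Category.assoc, hs]; rfl)
    (by rw [Category.assoc, hF]; change fst _ _ ≫ a ≫ p = _; rw [w]; rfl)
  refine ⟨SSet.ι₀ ≫ c, ?_, ?_⟩
  · rw [← SSet.ι₀_comp_assoc, h₂, SSet.ι₀_comp_assoc, hF₀, Category.comp_id]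
  · rw [Category.assoc, h₃]; rfl

/-! ### Contracting homotopies -/

lemma stdSimplex_ext {n : ℕ} {m : SimplexCategoryᵒᵖ} {x y : (Δ[n] : SSet.{u}).obj m}
    (h : ∀ i, SSet.stdSimplex.asOrderHom x i = SSet.stdSimplex.asOrderHom y i) : x = y := by
  refine SSet.stdSimplex.objEquiv.injective ?_
  ext i : 3
  exact h i

/-- The contraction of `Δ[n]` to the vertex `0`. -/
def contraction (n : ℕ) : (Δ[n] ⊗ Δ[1] : SSet.{u}) ⟶ Δ[n] where
  app m := ↾fun z ↦ SSet.stdSimplex.objEquiv.symm (SimplexCategory.Hom.mk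
    { toFun := fun i ↦ if SSet.stdSimplex.asOrderHom z.2 i = 0 then 0 else SSet.stdSimplex.asOrderHom z.1 i
      monotone' := fun i j hij ↦ by
        have h₁ := (SSet.stdSimplex.asOrderHom z.1).monotone hij
        have h₂ := (SSet.stdSimplex.asOrderHom z.2).monotone hij
        dsimp only
        split_ifs with h h'
        · exact le_rfl
        · exact Fin.zero_le _
        · rename_i h'
          rw [h'] at h₂
          exact absurd (le_antisymm h₂ (Fin.zero_le _)) h
        · exact h₁ })
  naturality m m' φ := by ext z; exact stdSimplex_ext fun i ↦ rfl

lemma ι₁_contraction (n : ℕ) : SSet.ι₁ ≫ contraction.{u} n = 𝟙 _ := by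
  ext m z
  exact stdSimplex_ext fun i ↦ (if_neg (by decide) :
    (if (1 : Fin 2) = 0 then 0 else SSet.stdSimplex.asOrderHom z i) = _)

lemma ι₀_contraction (n : ℕ) : SSet.ι₀ ≫ contraction.{u} n =
    SSet.const (SSet.yonedaEquiv (SSet.stdSimplex.map (SimplexCategory.const ⦋0⦌ ⦋n⦌ 0))) := by
  ext m z
  exact stdSimplex_ext fun i ↦ (if_pos rfl :
    (if (0 : Fin 2) = 0 then 0 else SSet.stdSimplex.asOrderHom z i) = _)

/-- The minimum. -/
def minMap : (Δ[1] ⊗ Δ[1] : SSet.{u}) ⟶ Δ[1] where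
  app m := ↾fun z ↦ SSet.stdSimplex.objEquiv.symm (SimplexCategory.Hom.mk
    (SSet.stdSimplex.asOrderHom z.1 ⊓ SSet.stdSimplex.asOrderHom z.2))
  naturality m m' φ := by ext z; exact stdSimplex_ext fun i ↦ rfl

/-- The homotopy `(a, s, t) ↦ γ(a, min s t)`. -/
def minHomotopy {A Q : SSet.{u}} (γ : A ⊗ Δ[1] ⟶ Q) : (A ⊗ Δ[1]) ⊗ Δ[1] ⟶ Q :=
  (α_ _ _ _).hom ≫ A ◁ minMap ≫ γ

section
variable {A Q : SSet.{u}} (γ : A ⊗ Δ[1] ⟶ Q)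

lemma ι₀_minHomotopy : SSet.ι₀ ≫ minHomotopy γ = fst _ _ ≫ SSet.ι₀ ≫ γ := by
  ext m z
  exact congrArg (γ.app m) (Prod.ext rfl (stdSimplex_ext fun i ↦ inf_eq_right.2 (Fin.zero_le _)))

lemma ι₁_minHomotopy : SSet.ι₁ ≫ minHomotopy γ = γ := by
  ext m z
  exact congrArg (γ.app m) (Prod.ext rfl (stdSimplex_ext fun i ↦ inf_eq_left.2 (Fin.le_last _)))

lemma ι₀_whiskerRight_minHomotopy : SSet.ι₀ ▷ _ ≫ minHomotopy γ = fst _ _ ≫ SSet.ι₀ ≫ γ := by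
  ext m z
  exact congrArg (γ.app m) (Prod.ext rfl (stdSimplex_ext fun i ↦ inf_eq_left.2 (Fin.zero_le _)))

lemma ι₁_whiskerRight_minHomotopy : SSet.ι₁ ▷ _ ≫ minHomotopy γ = γ := by
  ext m z
  exact congrArg (γ.app m) (Prod.ext rfl (stdSimplex_ext fun i ↦ inf_eq_right.2 (Fin.le_last _)))

lemma minHomotopy_comp {R : SSet.{u}} (p : Q ⟶ R) : minHomotopy γ ≫ p = minHomotopy (γ ≫ p) := by
  simp [minHomotopy]

lemma minHomotopy_fst (f : A ⟶ Q) : minHomotopy (fst _ _ ≫ f) = fst _ _ ≫ fst _ _ ≫ f := rfl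

end

/-! ### Solvability of lifting problems -/

/-- Every lifting problem along `i` with bottom map `β` has a solution. -/
def Solv {E B A L : SSet.{u}} (p : E ⟶ B) (i : A ⟶ L) (β : L ⟶ B) : Prop :=
  ∀ a : A ⟶ E, a ≫ p = i ≫ β → ∃ c : L ⟶ E, i ≫ c = a ∧ c ≫ p = β

section
variable {E B A L : SSet.{u}} {p : E ⟶ B} [Fibration p] {i : A ⟶ L} [Mono i]

instance isEmpty_initial (n : SimplexCategoryᵒᵖ) : IsEmpty ((⊥_ SSet.{u}).obj n) :=
  ⟨fun x ↦ by
    have k : (⊥_ SSet.{u}) ⟶ (Functor.const _).obj PEmpty := Limits.initial.to _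
    exact (k.app _ x).elim⟩

lemma initial_tensor_ext {X Y : SSet.{u}} (f g : (⊥_ SSet.{u}) ⊗ Y ⟶ X) : f = g := by
  ext n x
  exact isEmptyElim x.1

instance mono_of_initial (X : SSet.{u}) : Mono (Limits.initial.to X) :=
  ⟨fun f g _ ↦ by
    ext n x
    exact isEmptyElim (f.app n x)⟩

lemma exists_homotopy_lift₀ (p : E ⟶ B) [Fibration p] (a : A ⟶ E) (y : A ⊗ Δ[1] ⟶ B)
    (h : SSet.ι₀ ≫ y = a ≫ p) :
    ∃ c : A ⊗ Δ[1] ⟶ E, SSet.ι₀ ≫ c = a ∧ c ≫ p = y := by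
  obtain ⟨c, h₁, -, h₂⟩ := hlp₀ (Limits.initial.to A) p a (fst _ _ ≫ Limits.initial.to E) y
    (Limits.initialIsInitial.hom_ext _ _) h (initial_tensor_ext _ _)
  exact ⟨c, h₁, h₂⟩

lemma exists_homotopy_lift₁ (p : E ⟶ B) [Fibration p] (a : A ⟶ E) (y : A ⊗ Δ[1] ⟶ B)
    (h : SSet.ι₁ ≫ y = a ≫ p) :
    ∃ c : A ⊗ Δ[1] ⟶ E, SSet.ι₁ ≫ c = a ∧ c ≫ p = y := by
  obtain ⟨c, h₁, -, h₂⟩ := hlp₁ (Limits.initial.to A) p a (fst _ _ ≫ Limits.initial.to E) y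
    (Limits.initialIsInitial.hom_ext _ _) h (initial_tensor_ext _ _)
  exact ⟨c, h₁, h₂⟩

/-- The problem is carried along `H` by lifting a homotopy of its top map, solved at the other end,
and the solution is carried back by homotopy lifting relative to `A`. With `Solv.of_ι₀`, solvability
is invariant under homotopies of the bottom map. -/
lemma Solv.of_ι₁ (H : L ⊗ Δ[1] ⟶ B) (h : Solv p i (SSet.ι₁ ≫ H)) : Solv p i (SSet.ι₀ ≫ H) := by
  intro a ha
  obtain ⟨b, hb₀, hb⟩ := exists_homotopy_lift₀ p a (i ▷ _ ≫ H) (by rw [SSet.ι₀_comp_assoc, ha])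
  obtain ⟨c, hc, hc'⟩ := h (SSet.ι₁ ≫ b) (by rw [Category.assoc, hb, SSet.ι₁_comp_assoc])
  obtain ⟨d, hd₁, hd, hd'⟩ := hlp₁ i p c b H hc.symm hc'.symm hb
  exact ⟨SSet.ι₀ ≫ d, by rw [← SSet.ι₀_comp_assoc, hd, hb₀], by rw [Category.assoc, hd']⟩

lemma Solv.of_ι₀ (H : L ⊗ Δ[1] ⟶ B) (h : Solv p i (SSet.ι₀ ≫ H)) : Solv p i (SSet.ι₁ ≫ H) := by
  intro a ha
  obtain ⟨b, hb₀, hb⟩ := exists_homotopy_lift₁ p a (i ▷ _ ≫ H) (by rw [SSet.ι₁_comp_assoc, ha])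
  obtain ⟨c, hc, hc'⟩ := h (SSet.ι₀ ≫ b) (by rw [Category.assoc, hb, SSet.ι₀_comp_assoc])
  obtain ⟨d, hd₁, hd, hd'⟩ := hlp₀ i p c b H hc.symm hc'.symm hb
  exact ⟨SSet.ι₁ ≫ d, by rw [← SSet.ι₁_comp_assoc, hd, hb₀], by rw [Category.assoc, hd']⟩

/-- A Kan fibration is trivial if every component of the base has a vertex over which all lifting
problems can be solved. -/
lemma trivFib_of_fibers (h : ∀ b : B _⦋0⦌, ∃ e : B _⦋1⦌, B.δ 1 e = b ∧
    ∀ n, Solv p (SSet.boundary.{u} n).ι (SSet.const (B.δ 0 e))) : TrivFib p := by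
  refine .of_boundary fun n a b hab ↦ ?_
  suffices H : Solv p (SSet.boundary.{u} n).ι b from H a hab
  -- Contracting the simplex to its vertex `0` replaces `b` by a constant map.
  have h₁ := Solv.of_ι₀ (p := p) (i := (SSet.boundary.{u} n).ι) (contraction n ≫ b)
  have e₁ : SSet.ι₁ ≫ contraction n ≫ b = b := congrArg (· ≫ b) (ι₁_contraction n)
  have e₀ : SSet.ι₀ ≫ contraction n ≫ b = _ :=
    (congrArg (· ≫ b) (ι₀_contraction n)).trans (SSet.const_comp _ _)
  rw [e₀, e₁] at h₁
  refine h₁ ?_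
  obtain ⟨e, he, H⟩ := h (b.app _ (SSet.yonedaEquiv (SSet.stdSimplex.map
    (SimplexCategory.const ⦋0⦌ ⦋n⦌ 0))))
  rw [← he]
  -- The edge `e` is a homotopy between the constant maps at its two ends, so the problem moves to
  -- the vertex where it can be solved.
  have h₂ := Solv.of_ι₁ (p := p) (i := (SSet.boundary.{u} n).ι) (snd _ _ ≫ SSet.yonedaEquiv.symm e)
  have e₁ : SSet.ι₁ ≫ snd _ _ ≫ SSet.yonedaEquiv.symm e =
      (SSet.const (B.δ 0 e) : (Δ[n] : SSet.{u}) ⟶ B) := by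
    ext m z
    refine Eq.trans ?_ (Functor.map_comp_apply B (SimplexCategory.δ 0).op
      (SimplexCategory.const m.unop ⦋0⦌ 0).op e)
    refine congrArg (fun k ↦ B.map (Quiver.Hom.op k) e) ?_
    ext i : 3
    rfl
  have e₀ : SSet.ι₀ ≫ snd _ _ ≫ SSet.yonedaEquiv.symm e =
      (SSet.const (B.δ 1 e) : (Δ[n] : SSet.{u}) ⟶ B) := by
    ext m z
    refine Eq.trans ?_ (Functor.map_comp_apply B (SimplexCategory.δ 1).op
      (SimplexCategory.const m.unop ⦋0⦌ 0).op e)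
    refine congrArg (fun k ↦ B.map (Quiver.Hom.op k) e) ?_
    ext i : 3
    rfl
  rw [e₀, e₁] at h₂
  exact h₂ (H n)

end

/-! ### Path objects -/

/-- Together with `ι₀_of_boundary` and `ι₁_of_boundary`, this translates between prescribing the
ends of a homotopy and prescribing its restriction to `A ⊗ ∂Δ[1]`. -/
lemma whiskerLeft_boundary_ι {A E : SSet.{u}} {f g : A ⟶ E} {H : A ⊗ Δ[1] ⟶ E}
    (h₀ : SSet.ι₀ ≫ H = f) (h₁ : SSet.ι₁ ≫ H = g) :
    A ◁ (SSet.boundary.{u} 1).ι ≫ H = boundaryGlue f g := by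
  ext n z
  change H.app n (z.1, z.2.1) =
    if SSet.stdSimplex.asOrderHom z.2.1 0 = 0 then f.app n z.1 else g.app n z.1
  split_ifs with hz
  · refine Eq.trans ?_ (app_congr h₀ n z.1)
    refine congrArg (H.app n) (Prod.ext rfl ?_)
    exact stdSimplex_ext fun i ↦ (boundary_one_const z.2 i 0).trans hz
  · refine Eq.trans ?_ (app_congr h₁ n z.1)
    refine congrArg (H.app n) (Prod.ext rfl ?_)
    exact stdSimplex_ext fun i ↦ (boundary_one_const z.2 i 0).trans (Fin.eq_one_of_ne_zero _ hz)

lemma ι₀_of_boundary {A E : SSet.{u}} {f g : A ⟶ E} {H : A ⊗ Δ[1] ⟶ E}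
    (h : A ◁ (SSet.boundary.{u} 1).ι ≫ H = boundaryGlue f g) : SSet.ι₀ ≫ H = f := by
  ext n y
  exact (app_congr h n
    (y, ⟨SSet.stdSimplex.objEquiv.symm (SimplexCategory.const _ _ 0), fun hs ↦
      zero_ne_one (hs 1).choose_spec⟩)).trans (boundaryGlue_pos _ _ _ rfl)

lemma ι₁_of_boundary {A E : SSet.{u}} {f g : A ⟶ E} {H : A ⊗ Δ[1] ⟶ E}
    (h : A ◁ (SSet.boundary.{u} 1).ι ≫ H = boundaryGlue f g) : SSet.ι₁ ≫ H = g := by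
  ext n y
  exact (app_congr h n
    (y, ⟨SSet.stdSimplex.objEquiv.symm (SimplexCategory.const _ _ 1), fun hs ↦
      one_ne_zero (hs 0).choose_spec⟩)).trans (boundaryGlue_neg _ _ _ one_ne_zero)

/-- A homotopy between two maps extending a given one along an anodyne extension. -/
lemma exists_homotopy_of_anodyne {A L E B : SSet.{u}} {i : A ⟶ L} (hi : SSet.anodyneExtensions i)
    (r : E ⟶ B) [Fibration r] (f g : L ⟶ E) (H : A ⊗ Δ[1] ⟶ E) (y : L ⊗ Δ[1] ⟶ B)
    (h₀ : SSet.ι₀ ≫ H = i ≫ f) (h₁ : SSet.ι₁ ≫ H = i ≫ g) (hy₀ : SSet.ι₀ ≫ y = f ≫ r)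
    (hy₁ : SSet.ι₁ ≫ y = g ≫ r) (hy : H ≫ r = i ▷ _ ≫ y) :
    ∃ G : L ⊗ Δ[1] ⟶ E, SSet.ι₀ ≫ G = f ∧ SSet.ι₁ ≫ G = g ∧ i ▷ _ ≫ G = H ∧ G ≫ r = y := by
  obtain ⟨G, h₂, h₃, h₄⟩ := fib_lift' hi (SSet.boundary.{u} 1).ι r (boundaryGlue f g) H y
    (by
      rw [whiskerLeft_boundary_ι h₀ h₁]
      ext n z
      rfl)
    (by
      rw [whiskerLeft_boundary_ι hy₀ hy₁]
      ext n z
      exact apply_ite (r.app n) _ _ _) hy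
  exact ⟨G, ι₀_of_boundary h₂, ι₁_of_boundary h₂, h₃, h₄⟩

/-- The object `P` represents triples of a map `c` to `E` and a homotopy starting at `c ≫ f`, which
is constant over `B`. -/
structure PathObject {E Q B : SSet.{u}} (f : E ⟶ Q) (r : Q ⟶ B) where
  /-- the path object -/
  pt : SSet.{u}
  /-- the start -/
  start : pt ⟶ E
  /-- the universal homotopy -/
  h : pt ⊗ Δ[1] ⟶ Q
  ι₀_h : SSet.ι₀ ≫ h = start ≫ f
  h_comp : h ≫ r = fst _ _ ≫ start ≫ f ≫ r
  exists_lift {K : SSet.{u}} (c : K ⟶ E) (H : K ⊗ Δ[1] ⟶ Q) (h₀ : SSet.ι₀ ≫ H = c ≫ f)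
    (h₁ : H ≫ r = fst _ _ ≫ c ≫ f ≫ r) : ∃ k : K ⟶ pt, k ≫ start = c ∧ k ▷ _ ≫ h = H
  hom_ext {K : SSet.{u}} {k k' : K ⟶ pt} (h₀ : k ≫ start = k' ≫ start)
    (h₁ : k ▷ _ ≫ h = k' ▷ _ ≫ h) : k = k'

/-- Currying. -/
def curryRight {K L Q : SSet.{u}} : (K ⊗ L ⟶ Q) ≃ (K ⟶ (ihom L).obj Q) :=
  (Iso.homFromEquiv (β_ _ _)).trans ((ihom.adjunction L).homEquiv _ _)

lemma curryRight_naturality_left {K K' L Q : SSet.{u}} (k : K' ⟶ K) (h : K ⊗ L ⟶ Q) :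
    curryRight (k ▷ _ ≫ h) = k ≫ curryRight h := by
  refine Eq.trans ?_ (Adjunction.homEquiv_naturality_left _ _ _)
  refine congrArg ((ihom.adjunction L).homEquiv _ _) ?_
  simp [Iso.homFromEquiv]

lemma curryRight_naturality_right {K L Q B : SSet.{u}} (h : K ⊗ L ⟶ Q) (r : Q ⟶ B) :
    curryRight (h ≫ r) = curryRight h ≫ (ihom _).map r := by
  refine Eq.trans ?_ (Adjunction.homEquiv_naturality_right _ _ _)
  refine congrArg ((ihom.adjunction L).homEquiv _ _) ?_
  simp [Iso.homFromEquiv]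

/-- The path object is the pullback of `E` and `Q^Δ[1]` over `Q × B^Δ[1]`: the first component fixes
the start of the path, the second makes its image in `B` constant. -/
lemma exists_pathObject {E Q B : SSet.{u}} (f : E ⟶ Q) (r : Q ⟶ B) :
    Nonempty (PathObject f r) := by
  let ev : (ihom (Δ[1] : SSet.{u})).obj Q ⟶ Q := SSet.ι₀ ≫ curryRight.symm (𝟙 _)
  have hev {K : SSet.{u}} (k : K ⟶ (ihom (Δ[1] : SSet.{u})).obj Q) :
      k ≫ ev = SSet.ι₀ ≫ curryRight.symm k := by
    obtain ⟨h, rfl⟩ := curryRight.surjective k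
    rw [Equiv.symm_apply_apply]
    conv_rhs => rw [show h = curryRight h ▷ _ ≫ curryRight.symm (𝟙 _) from
      curryRight.injective (by rw [curryRight_naturality_left]; simp)]
    simp [ev]
  let a : E ⟶ Q ⊗ (ihom (Δ[1] : SSet.{u})).obj B :=
    CartesianMonoidalCategory.lift f (curryRight (fst _ _ ≫ f ≫ r))
  let b : (ihom (Δ[1] : SSet.{u})).obj Q ⟶ Q ⊗ (ihom (Δ[1] : SSet.{u})).obj B :=
    CartesianMonoidalCategory.lift ev ((ihom _).map r)
  -- The two conditions on a pair `(c, H)` are the two components of one equation of maps into `Q ×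
  -- B^Δ[1]`.
  have key {K : SSet.{u}} (c : K ⟶ E) (H : K ⊗ Δ[1] ⟶ Q) : c ≫ a = curryRight H ≫ b ↔
      SSet.ι₀ ≫ H = c ≫ f ∧ H ≫ r = fst _ _ ≫ c ≫ f ≫ r := by
    have e : (fst K (Δ[1] : SSet.{u}) ≫ c ≫ f ≫ r) = c ▷ _ ≫ fst _ _ ≫ f ≫ r := rfl
    rw [e, ← curryRight.injective.eq_iff (a := H ≫ r), curryRight_naturality_left,
      curryRight_naturality_right]
    rw [CartesianMonoidalCategory.comp_lift, CartesianMonoidalCategory.comp_lift, hev,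
      Equiv.symm_apply_apply]
    constructor
    · intro h
      have h₁ := congrArg (· ≫ fst _ _) h
      have h₂ := congrArg (· ≫ snd _ _) h
      simp at h₁ h₂
      exact ⟨h₁.symm, h₂.symm⟩
    · rintro ⟨h₁, h₂⟩
      rw [h₁, h₂]
  have hp := (key (Limits.pullback.fst a b) (curryRight.symm (Limits.pullback.snd a b))).1
    (by rw [Equiv.apply_symm_apply, Limits.pullback.condition])
  refine ⟨⟨Limits.pullback a b, Limits.pullback.fst a b, curryRight.symm (Limits.pullback.snd a b),
    hp.1, hp.2, fun c H h₀ h₁ ↦ ⟨Limits.pullback.lift c (curryRight H) ((key c H).2 ⟨h₀, h₁⟩),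
      Limits.pullback.lift_fst _ _ _, curryRight.injective ?_⟩, fun h₀ h₁ ↦
      Limits.pullback.hom_ext h₀ ?_⟩⟩
  · rw [curryRight_naturality_left, Equiv.apply_symm_apply, Limits.pullback.lift_snd]
  · have := congrArg curryRight h₁
    rwa [curryRight_naturality_left, curryRight_naturality_left, Equiv.apply_symm_apply] at this

namespace PathObject
variable {E Q B : SSet.{u}} {f : E ⟶ Q} {r : Q ⟶ B} (P : PathObject f r)

/-- The end of a path. -/
def endpoint : P.pt ⟶ Q := SSet.ι₁ ≫ P.h

lemma comp_endpoint {K : SSet.{u}} (k : K ⟶ P.pt) : k ≫ P.endpoint = SSet.ι₁ ≫ k ▷ _ ≫ P.h := rfl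

lemma ι₀_comp {K : SSet.{u}} (k : K ⟶ P.pt) : SSet.ι₀ ≫ k ▷ _ ≫ P.h = k ≫ P.start ≫ f := by
  rw [SSet.ι₀_comp_assoc, P.ι₀_h]

lemma comp_comp {K : SSet.{u}} (k : K ⟶ P.pt) :
    (k ▷ _ ≫ P.h) ≫ r = fst _ _ ≫ k ≫ P.start ≫ f ≫ r := by
  rw [Category.assoc, P.h_comp]; rfl

lemma endpoint_comp {K : SSet.{u}} (k : K ⟶ P.pt) : k ≫ P.endpoint ≫ r = k ≫ P.start ≫ f ≫ r := by
  rw [← Category.assoc, comp_endpoint, Category.assoc, comp_comp]; rfl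

/-- Homotopies of maps to the path object, up to interchanging the two intervals. -/
lemma exists_lift_endpoint {A L : SSet.{u}} (i : A ⟶ L) (k : A ⟶ P.pt) (c : L ⟶ E)
    (H : L ⊗ Δ[1] ⟶ Q) (h₀ : SSet.ι₀ ≫ H = c ≫ f) (h₁ : H ≫ r = fst _ _ ≫ c ≫ f ≫ r)
    (hc : i ≫ c = k ≫ P.start) (hH : i ▷ _ ≫ H = k ▷ _ ≫ P.h) :
    ∃ l : L ⟶ P.pt, i ≫ l = k ∧ l ≫ P.endpoint = SSet.ι₁ ≫ H ∧ l ≫ P.start = c ∧ l ▷ _ ≫ P.h = H := by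
  obtain ⟨l, h₂, h₃⟩ := P.exists_lift c H h₀ h₁
  exact ⟨l, P.hom_ext (by rw [Category.assoc, h₂, hc])
    (by rw [comp_whiskerRight, Category.assoc, h₃, hH]), by rw [comp_endpoint, h₃], h₂, h₃⟩

/-- Only the start of the path is prescribed on `L`, so homotopy lifting against `r`, relative to
the subobject, extends the path. -/
lemma trivFib_start [Fibration r] : TrivFib P.start := by
  refine .of_exists fun i _ k c w ↦ ?_
  obtain ⟨H, h₁, h₂, h₃⟩ := hlp₀ i r (c ≫ f) (k ▷ _ ≫ P.h) (fst _ _ ≫ c ≫ f ≫ r)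
    (by rw [P.ι₀_comp, reassoc_of% w]) (by rw [Category.assoc]; rfl)
    (by rw [P.comp_comp, reassoc_of% w]; rfl)
  obtain ⟨l, h₄, -, h₅, -⟩ := P.exists_lift_endpoint i k c H h₁ h₃ w.symm h₂
  exact ⟨l, h₄, h₅⟩

/-- The start is lifted first, because `f ≫ r` is a fibration. Then both ends of the path are known
on `L`, and the path itself on `A`; the rest is `exists_homotopy_of_anodyne`. -/
lemma fibration_endpoint [Fibration r] [Fibration (f ≫ r)] : Fibration P.endpoint := by
  refine fibration_of_exists fun i hi k y w ↦ ?_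
  obtain ⟨c, hc, hc'⟩ := anodyne_exists_lift (f ≫ r) hi (k ≫ P.start) (y ≫ r)
    (by rw [← reassoc_of% w, P.endpoint_comp, Category.assoc])
  obtain ⟨H, h₁, h₂, h₃, h₄⟩ := exists_homotopy_of_anodyne hi r (c ≫ f) y (k ▷ _ ≫ P.h)
    (fst _ _ ≫ c ≫ f ≫ r) (by rw [P.ι₀_comp, reassoc_of% hc]) w
    (by rw [Category.assoc]; rfl) (by rw [hc']; rfl) (by rw [P.comp_comp, ← reassoc_of% hc]; rfl)
  obtain ⟨l, h₅, h₆, -, -⟩ := P.exists_lift_endpoint i k c H h₁ h₄ hc h₃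
  exact ⟨l, h₅, h₆.trans h₂⟩

end PathObject

/-- The homotopy lifting-extension property of a map over `B`, for lifting problems with a
given right hand side. -/
def RelLiftAt {E Q B : SSet.{u}} (f : E ⟶ Q) (r : Q ⟶ B) {A L : SSet.{u}} (i : A ⟶ L) (y : L ⟶ Q) :
    Prop :=
  ∀ a : A ⟶ E, a ≫ f = i ≫ y → ∃ (c : L ⟶ E) (h : L ⊗ Δ[1] ⟶ Q), i ≫ c = a ∧ SSet.ι₀ ≫ h = c ≫ f ∧
    SSet.ι₁ ≫ h = y ∧ h ≫ r = fst _ _ ≫ y ≫ r ∧ i ▷ _ ≫ h = fst _ _ ≫ a ≫ f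

/-- The homotopy lifting-extension property of a map over `B`. -/
def RelLift {E Q B : SSet.{u}} (f : E ⟶ Q) (r : Q ⟶ B) : Prop :=
  ∀ ⦃A L : SSet.{u}⦄ (i : A ⟶ L) [Mono i] (y : L ⟶ Q), RelLiftAt f r i y

section
variable {E Q B : SSet.{u}} {f : E ⟶ Q} {r : Q ⟶ B}

/-- The top map `a` is read as a family of constant paths; a lift of it is a map to `E` with a
homotopy to `y` that is constant on `A`. -/
lemma PathObject.relLiftAt (P : PathObject f r) {A L : SSet.{u}} {i : A ⟶ L} {y : L ⟶ Q}
    (h : Solv P.endpoint i y) : RelLiftAt f r i y := by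
  intro a ha
  obtain ⟨k, hk₀, hk₁⟩ := P.exists_lift a (fst _ _ ≫ a ≫ f) rfl (by simp)
  obtain ⟨l, h₁, h₂⟩ := h k (by rw [P.comp_endpoint, hk₁, ← ha]; rfl)
  refine ⟨l ≫ P.start, l ▷ _ ≫ P.h, by rw [reassoc_of% h₁, hk₀], by rw [P.ι₀_comp, Category.assoc],
    h₂, by rw [P.comp_comp, ← h₂, Category.assoc, P.endpoint_comp], ?_⟩
  rw [← comp_whiskerRight_assoc, h₁, hk₁]

/-- Here the top map is a family `k` of possibly nonconstant paths on `A`. They are extended to a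
homotopy `H` on `L` ending at `y`, and the hypothesis is applied at the start of `H`, where constant
paths suffice on `A`; this is why it must cover every `y'` with the same image in `B`. Growing the
constant paths into `k` by `minHomotopy` carries the solution along `H` back to `y`. -/
lemma PathObject.solv (P : PathObject f r) [Fibration r] [Fibration (f ≫ r)] {A L : SSet.{u}}
    {i : A ⟶ L} [Mono i] {y : L ⟶ Q} (h : ∀ y' : L ⟶ Q, y' ≫ r = y ≫ r → RelLiftAt f r i y') :
    Solv P.endpoint i y := by
  have := P.fibration_endpoint
  intro k hk
  obtain ⟨H, h₁, h₂, h₃⟩ := hlp₁ i r y (k ▷ _ ≫ P.h) (fst _ _ ≫ y ≫ r) hk rfl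
    (by rw [P.comp_comp, ← P.endpoint_comp, reassoc_of% hk]; rfl)
  have e₀ : i ≫ SSet.ι₀ ≫ H = k ≫ P.start ≫ f := by
    rw [← SSet.ι₀_comp_assoc, h₂, P.ι₀_comp]
  obtain ⟨c, h, hc₁, hc₂, hc₃, hc₄, hc₅⟩ := h (SSet.ι₀ ≫ H) (by rw [Category.assoc, h₃]; rfl)
    (k ≫ P.start) (by rw [e₀, Category.assoc])
  rw [Category.assoc, h₃] at hc₄
  have e₁ : c ≫ f ≫ r = y ≫ r := by
    rw [← reassoc_of% hc₂, hc₄]; rfl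
  obtain ⟨l, hl₁, hl₂⟩ := P.exists_lift c h hc₂ (by rw [hc₄, e₁]; rfl)
  -- the path from the constant path to the given one
  obtain ⟨m, hm₁, hm₂⟩ := P.exists_lift (fst A Δ[1] ≫ k ≫ P.start) (minHomotopy (k ▷ _ ≫ P.h))
    (by rw [ι₀_minHomotopy, P.ι₀_comp]; simp)
    (by rw [minHomotopy_comp, P.comp_comp, minHomotopy_fst]; simp)
  obtain ⟨G, hG₁, hG₂, hG₃⟩ := hlp₀ i P.endpoint l m H
    (P.hom_ext (by rw [Category.assoc, hm₁, Category.assoc, hl₁, hc₁]; rfl) (by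
      rw [comp_whiskerRight_assoc, hm₂, ι₀_whiskerRight_minHomotopy, comp_whiskerRight_assoc, hl₂,
        hc₅, P.ι₀_comp, Category.assoc]))
    (by rw [P.comp_endpoint, hl₂, hc₃])
    (by rw [P.comp_endpoint, hm₂, ι₁_minHomotopy, h₂])
  refine ⟨SSet.ι₁ ≫ G, ?_, by rw [Category.assoc, hG₃, h₁]⟩
  rw [← SSet.ι₁_comp_assoc, hG₂]
  refine P.hom_ext (by rw [Category.assoc, hm₁]; rfl) ?_
  rw [comp_whiskerRight_assoc, hm₂, ι₁_whiskerRight_minHomotopy]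

lemma PathObject.exists_refl (P : PathObject f r) :
    ∃ s : E ⟶ P.pt, s ≫ P.start = 𝟙 _ ∧ s ≫ P.endpoint = f := by
  obtain ⟨s, h₁, h₂⟩ := P.exists_lift (𝟙 E) (fst _ _ ≫ f) (by rw [Category.id_comp]; rfl) (by simp)
  exact ⟨s, h₁, by rw [P.comp_endpoint, h₂]; rfl⟩

/-- `f` is a section of the trivial fibration `start`, followed by `endpoint`; so two out of three
compares `f` with `endpoint`, in this direction and in `PathObject.we_of_trivFib_endpoint`. -/
lemma PathObject.trivFib_endpoint (P : PathObject f r) [SSet.KanComplex Q] [Fibration r]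
    [Fibration (f ≫ r)] (hf : SSetWeakEquiv f) : TrivFib P.endpoint := by
  have := P.fibration_endpoint
  obtain ⟨s, h₁, h₂⟩ := P.exists_refl
  refine trivFib_of_we _ ((SSetWeakEquiv.of_retract_section h₁ P.trivFib_start.we).of_comp_left ?_)
  rwa [h₂]

lemma PathObject.we_of_trivFib_endpoint (P : PathObject f r) [Fibration r] (h : TrivFib P.endpoint) :
    SSetWeakEquiv f := by
  obtain ⟨s, h₁, h₂⟩ := P.exists_refl
  rw [← h₂]
  exact (SSetWeakEquiv.of_retract_section h₁ P.trivFib_start.we).comp h.we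

/-- With `RelLift.we` as a converse, this trades weak equivalences over `B` for a lifting property
whose stability under base change in `B` is a formal matter. -/
lemma RelLift.of_we (r : Q ⟶ B) [SSet.KanComplex Q] [Fibration r] [Fibration (f ≫ r)]
    (hf : SSetWeakEquiv f) : RelLift f r := by
  obtain ⟨P⟩ := exists_pathObject f r
  exact fun A L i _ y ↦ P.relLiftAt fun a w ↦ (P.trivFib_endpoint hf).exists_lift i a y w

lemma RelLift.we [Fibration r] [Fibration (f ≫ r)] (h : RelLift f r) : SSetWeakEquiv f := by
  obtain ⟨P⟩ := exists_pathObject f r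
  exact P.we_of_trivFib_endpoint (.of_exists fun i _ a y w ↦ P.solv (fun y' _ ↦ h i y') a w)

/-- A map between Kan fibrations over `B` is a weak equivalence if it is one fibrewise, over one
vertex in each component. -/
lemma we_of_relLiftAt [Fibration r] [Fibration (f ≫ r)]
    (h : ∀ b : B _⦋0⦌, ∃ e : B _⦋1⦌, B.δ 1 e = b ∧ ∀ (n : ℕ) (y : Δ[n] ⟶ Q),
      y ≫ r = SSet.const (B.δ 0 e) → RelLiftAt f r (SSet.boundary.{u} n).ι y) :
    SSetWeakEquiv f := by
  obtain ⟨P⟩ := exists_pathObject f r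
  have := P.fibration_endpoint
  refine P.we_of_trivFib_endpoint (trivFib_of_fibers fun q ↦ ?_)
  obtain ⟨e, h₁, h₂⟩ := h (r.app _ q)
  -- Lifting the edge of `B` through `r` moves the vertex `q` into the fibre where the hypothesis
  -- applies.
  obtain ⟨e', h₃, h₄⟩ := horn_lift_one r q e h₁
  refine ⟨e', h₃, fun n ↦ P.solv fun y' hy' ↦ h₂ n y' ?_⟩
  rw [hy', SSet.const_comp]
  exact congrArg _ ((SSet.δ_naturality_apply r 0 e').trans (congrArg _ h₄))

end

/-! ### Base change -/

lemma terminal_fibration (X : SSet.{u}) [SSet.KanComplex X] : Fibration (Limits.terminal.from X) :=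
  (isFibrant_iff _).1 ‹_›

lemma we_iff_relLift {X Y : SSet.{u}} [SSet.KanComplex X] [SSet.KanComplex Y] (f : X ⟶ Y) :
    SSetWeakEquiv f ↔ RelLift f (Limits.terminal.from Y) := by
  have := terminal_fibration Y
  have : Fibration (f ≫ Limits.terminal.from Y) := by
    rw [Limits.terminalIsTerminal.hom_ext (f ≫ Limits.terminal.from Y) (Limits.terminal.from X)]
    exact terminal_fibration X
  exact ⟨fun h ↦ .of_we _ h, fun h ↦ h.we⟩

/-- Right properness: weak equivalences between Kan complexes are stable by base change along Kan
fibrations. -/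
lemma we_of_isPullback {X' X Y' Y : SSet.{u}} {f : X' ⟶ X} {p' : X' ⟶ Y'} {p : X ⟶ Y} {b : Y' ⟶ Y}
    (sq : IsPullback f p' p b) [Fibration p] [SSet.KanComplex Y'] [SSet.KanComplex Y]
    (hb : SSetWeakEquiv b) : SSetWeakEquiv f := by
  have : SSet.KanComplex X := isFibrant_of_fibration p
  have : Fibration p' := fibration_of_isPullback sq
  have : SSet.KanComplex X' := isFibrant_of_fibration p'
  rw [we_iff_relLift] at hb ⊢
  intro A L i _ y a ha
  obtain ⟨c, h, h₁, h₂, h₃, -, h₄⟩ := hb i (y ≫ p) (a ≫ p')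
    (by rw [Category.assoc, ← sq.w, reassoc_of% ha])
  -- The component of the lift in `Y'` is `c`. Its homotopy in `Y` is lifted backwards from `y`
  -- along `p`, constantly on `A`; the start of the lifted homotopy is the component in `X`.
  obtain ⟨H, h₅, h₆, h₇⟩ := hlp₁ i p y (fst _ _ ≫ a ≫ f) h (by rw [← ha]; rfl) h₃
    (by rw [h₄, Category.assoc, Category.assoc, Category.assoc, sq.w])
  refine ⟨sq.lift (SSet.ι₀ ≫ H) c (by rw [Category.assoc, h₇, h₂]), H, sq.hom_ext ?_ ?_, ?_, h₅,
    Limits.terminalIsTerminal.hom_ext _ _, h₆⟩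
  · rw [Category.assoc, sq.lift_fst, ← SSet.ι₀_comp_assoc, h₆]; rfl
  · rw [Category.assoc, sq.lift_snd, h₁]
  · rw [sq.lift_fst]

/-- Maps over `B` with the homotopy lifting-extension property are stable by base change. -/
lemma RelLift.of_isPullback {E Q B E' Q' B' : SSet.{u}} {f : E ⟶ Q} {r : Q ⟶ B} {f' : E' ⟶ Q'}
    {r' : Q' ⟶ B'} {e : E' ⟶ E} {q : Q' ⟶ Q} {b : B' ⟶ B} (h : RelLift f r)
    (sq : IsPullback q r' r b) (sq' : IsPullback e f' f q) : RelLift f' r' := by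
  intro A L i _ y a ha
  obtain ⟨c, H, h₁, h₂, h₃, h₄, h₅⟩ := h i (y ≫ q) (a ≫ e)
    (by rw [Category.assoc, sq'.w, reassoc_of% ha])
  have hH : H ≫ r = (fst _ _ ≫ y ≫ r') ≫ b := by
    rw [h₄, Category.assoc, Category.assoc, Category.assoc, sq.w]
  have e₁ : SSet.ι₀ ≫ sq.lift H (fst _ _ ≫ y ≫ r') hH ≫ q = c ≫ f := by rw [sq.lift_fst, h₂]
  refine ⟨sq'.lift c (SSet.ι₀ ≫ sq.lift H (fst _ _ ≫ y ≫ r') hH) (by rw [Category.assoc, e₁]),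
    sq.lift H (fst _ _ ≫ y ≫ r') hH, sq'.hom_ext ?_ ?_, ?_, sq.hom_ext ?_ ?_, ?_, sq.hom_ext ?_ ?_⟩
  · rw [Category.assoc, sq'.lift_fst, h₁]
  · rw [Category.assoc, sq'.lift_snd, ← SSet.ι₀_comp_assoc, ha]
    refine sq.hom_ext ?_ ?_
    · rw [Category.assoc, Category.assoc, sq.lift_fst, h₅, Category.assoc, sq'.w, reassoc_of% ha, Category.assoc]
      rfl
    · rw [Category.assoc, Category.assoc, sq.lift_snd]; rfl
  · rw [sq'.lift_snd]
  · rw [Category.assoc, sq.lift_fst, h₃]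
  · rw [Category.assoc, sq.lift_snd]; rfl
  · rw [sq.lift_snd]
  · rw [Category.assoc, sq.lift_fst, h₅, Category.assoc, Category.assoc, Category.assoc, sq'.w]
  · rw [Category.assoc, sq.lift_snd, Category.assoc, Category.assoc, reassoc_of% ha]; rfl

/-- The lifting problems in a map over `B` that lie over a base change can be solved there. -/
lemma RelLiftAt.of_isPullback {E Q B E' Q' B' : SSet.{u}} {f : E ⟶ Q} {r : Q ⟶ B} {f' : E' ⟶ Q'}
    {r' : Q' ⟶ B'} {e : E' ⟶ E} {q : Q' ⟶ Q} {b : B' ⟶ B}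
    (sq : IsPullback q r' r b) (sq' : IsPullback e f' f q) {A L : SSet.{u}} {i : A ⟶ L} {y : L ⟶ Q'}
    (h : RelLiftAt f' r' i y) : RelLiftAt f r i (y ≫ q) := by
  intro a ha
  obtain ⟨c, H, h₁, h₂, h₃, h₄, h₅⟩ := h (sq'.lift a (i ≫ y) (by rw [ha, Category.assoc]))
    (sq'.lift_snd _ _ _)
  refine ⟨c ≫ e, H ≫ q, ?_, ?_, ?_, ?_, ?_⟩
  · rw [reassoc_of% h₁, sq'.lift_fst]
  · rw [reassoc_of% h₂, Category.assoc, sq'.w]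
  · rw [reassoc_of% h₃]
  · rw [Category.assoc, sq.w, reassoc_of% h₄, Category.assoc, sq.w]
  · rw [reassoc_of% h₅, sq'.lift_snd_assoc, ha, Category.assoc]

/-! ### Products and pushouts of weak equivalences -/

lemma curryRight_whiskerLeft {K A B Z : SSet.{u}} (i : A ⟶ B) (h : K ⊗ B ⟶ Z) :
    curryRight (K ◁ i ≫ h) = curryRight h ≫ (MonoidalClosed.pre i).app Z := by
  refine Eq.trans ?_ (MonoidalClosed.curry_pre_app i ((Iso.homFromEquiv (β_ K B)) h)).symm
  refine congrArg ((ihom.adjunction A).homEquiv _ _) ?_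
  simp [Iso.homFromEquiv]

/-- The interchange of the last two factors of a product. -/
def swapRight (A L K : SSet.{u}) : (A ⊗ L) ⊗ K ≅ (A ⊗ K) ⊗ L :=
  α_ _ _ _ ≪≫ (Iso.refl _ ⊗ᵢ β_ _ _) ≪≫ (α_ _ _ _).symm

/-- Interchanging `L` with the interval turns homotopies of maps on `A ⊗ L` into homotopies of their
transposes. -/
lemma htpy_curryRight {A L Z : SSet.{u}} {f g : A ⊗ L ⟶ Z} :
    Htpy f g ↔ Htpy (curryRight f) (curryRight g) := by
  rw [htpy_iff, htpy_iff]
  have key (H : (A ⊗ Δ[1]) ⊗ L ⟶ Z) :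
      (SSet.ι₀ ≫ (swapRight A L Δ[1]).hom ≫ H = f ↔ SSet.ι₀ ≫ curryRight H = curryRight f) ∧
      (SSet.ι₁ ≫ (swapRight A L Δ[1]).hom ≫ H = g ↔ SSet.ι₁ ≫ curryRight H = curryRight g) := by
    rw [← curryRight_naturality_left, ← curryRight_naturality_left, curryRight.injective.eq_iff,
      curryRight.injective.eq_iff]
    exact ⟨Iff.rfl, Iff.rfl⟩
  constructor
  · rintro ⟨H, h₀, h₁⟩
    refine ⟨curryRight ((swapRight A L Δ[1]).inv ≫ H), (key _).1.1 ?_, (key _).2.1 ?_⟩ <;> simpa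
  · rintro ⟨H, h₀, h₁⟩
    obtain ⟨H, rfl⟩ := curryRight.surjective H
    exact ⟨_, (key _).1.2 h₀, (key _).2.2 h₁⟩

/-- By transposition, since the internal hom into a Kan complex is a Kan complex. -/
lemma SSetWeakEquiv.whiskerRight {A B : SSet.{u}} {f : A ⟶ B} (hf : SSetWeakEquiv f)
    (L : SSet.{u}) : SSetWeakEquiv (f ▷ L) := by
  refine we_mk (fun K _ g ↦ ?_) fun K _ h h' e ↦ ?_
  · obtain ⟨h, hh⟩ := hf.surj (curryRight g)
    obtain ⟨h, rfl⟩ := curryRight.surjective h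
    exact ⟨h, by rwa [htpy_curryRight, curryRight_naturality_left]⟩
  · rw [htpy_curryRight, curryRight_naturality_left, curryRight_naturality_left] at e
    exact htpy_curryRight.2 (hf.inj e)

lemma SSetWeakEquiv.whiskerLeft {A B : SSet.{u}} {f : A ⟶ B} (hf : SSetWeakEquiv f)
    (L : SSet.{u}) : SSetWeakEquiv (L ◁ f) := by
  have : L ◁ f = (β_ _ _).hom ≫ f ▷ L ≫ (β_ _ _).inv := by simp
  rw [this]
  exact (we_iso _).comp ((hf.whiskerRight L).comp (we_iso _))

/-- Maps `L ⟶ Z^B` up to homotopy are maps `L ⊗ B ⟶ Z` up to homotopy, so the definition of weak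
equivalence for `L ◁ i` becomes the covariant criterion `we_of_covariant`. -/
lemma SSetWeakEquiv.pre {A B : SSet.{u}} {i : A ⟶ B} (hi : SSetWeakEquiv i) (Z : SSet.{u})
    [SSet.KanComplex Z] : SSetWeakEquiv ((MonoidalClosed.pre i).app Z) := by
  refine we_of_covariant _ (fun {L} g ↦ ?_) fun {L} g g' e ↦ ?_
  · obtain ⟨g, rfl⟩ := curryRight.surjective g
    obtain ⟨h, hh⟩ := (hi.whiskerLeft L).surj g
    exact ⟨curryRight h, by rwa [← curryRight_whiskerLeft, ← htpy_curryRight]⟩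
  · obtain ⟨g, rfl⟩ := curryRight.surjective g
    obtain ⟨g', rfl⟩ := curryRight.surjective g'
    rw [← curryRight_whiskerLeft, ← curryRight_whiskerLeft, ← htpy_curryRight] at e
    exact htpy_curryRight.1 ((hi.whiskerLeft L).inj e)

lemma SSetWeakEquiv.trivFib_pre {A B : SSet.{u}} {i : A ⟶ B} [Mono i] (hi : SSetWeakEquiv i)
    (Z : SSet.{u}) [SSet.KanComplex Z] : TrivFib ((MonoidalClosed.pre i).app Z) :=
  trivFib_of_we _ (hi.pre Z)

/-- Maps to Kan complexes extend from the pushout product of a monomorphism with a trivial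
cofibration. -/
lemma exists_extension_of_we {A B K M Z : SSet.{u}} [SSet.KanComplex Z] {i : A ⟶ B} [Mono i]
    (hi : SSetWeakEquiv i) (j : K ⟶ M) [Mono j] (a : B ⊗ K ⟶ Z) (b : A ⊗ M ⟶ Z)
    (hab : i ▷ K ≫ a = A ◁ j ≫ b) : ∃ c : B ⊗ M ⟶ Z, B ◁ j ≫ c = a ∧ i ▷ M ≫ c = b := by
  obtain ⟨c, h₁, h₂⟩ := (hi.trivFib_pre Z).exists_lift j (curryRight ((β_ _ _).hom ≫ a))
    (curryRight ((β_ _ _).hom ≫ b)) (by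
      rw [← curryRight_whiskerLeft, ← curryRight_naturality_left]
      congr 1
      simp [hab])
  obtain ⟨c, rfl⟩ := curryRight.surjective c
  rw [← curryRight_naturality_left, curryRight.injective.eq_iff] at h₁
  rw [← curryRight_whiskerLeft, curryRight.injective.eq_iff] at h₂
  refine ⟨(β_ _ _).hom ≫ c, ?_, ?_⟩
  · rw [← cancel_epi (β_ _ _).hom, ← h₁]
    simp
  · rw [← cancel_epi (β_ _ _).hom, ← h₂]
    simp

/-- An extension up to homotopy exists by definition; the homotopy extension property makes it
strict. -/
lemma SSetWeakEquiv.exists_extension {A B Z : SSet.{u}} [SSet.KanComplex Z] {i : A ⟶ B} [Mono i]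
    (hi : SSetWeakEquiv i) (a : A ⟶ Z) : ∃ b : B ⟶ Z, i ≫ b = a := by
  obtain ⟨b, hb⟩ := hi.surj a
  obtain ⟨H, h₀, h₁⟩ := htpy_iff.1 hb
  have := terminal_fibration Z
  obtain ⟨G, h₂, h₃, -⟩ := hlp₀ i (Limits.terminal.from Z) b H (Limits.terminal.from _) h₀
    (Limits.terminalIsTerminal.hom_ext _ _) (Limits.terminalIsTerminal.hom_ext _ _)
  exact ⟨SSet.ι₁ ≫ G, by rw [← SSet.ι₁_comp_assoc, h₃, h₁]⟩

lemma SSetWeakEquiv.exists_homotopy_extension {A B Z : SSet.{u}} [SSet.KanComplex Z] {i : A ⟶ B}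
    [Mono i] (hi : SSetWeakEquiv i) (f g : B ⟶ Z) (H : A ⊗ Δ[1] ⟶ Z) (h₀ : SSet.ι₀ ≫ H = i ≫ f)
    (h₁ : SSet.ι₁ ≫ H = i ≫ g) :
    ∃ G : B ⊗ Δ[1] ⟶ Z, SSet.ι₀ ≫ G = f ∧ SSet.ι₁ ≫ G = g ∧ i ▷ _ ≫ G = H := by
  obtain ⟨G, h₂, h₃⟩ := exists_extension_of_we hi (SSet.boundary.{u} 1).ι (boundaryGlue f g) H (by
    rw [whiskerLeft_boundary_ι h₀ h₁]
    ext n z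
    rfl)
  exact ⟨G, ι₀_of_boundary h₂, ι₁_of_boundary h₂, h₃⟩

lemma isPushout_whiskerRight {A B A' P : SSet.{u}} {i : A ⟶ B} {f : A ⟶ A'} {g : B ⟶ P} {i' : A' ⟶ P}
    (sq : IsPushout i f g i') (L : SSet.{u}) : IsPushout (i ▷ L) (f ▷ L) (g ▷ L) (i' ▷ L) :=
  sq.map (tensorRight L)

/-- Pushouts of trivial cofibrations are weak equivalences. -/
lemma SSetWeakEquiv.of_isPushout {A B A' P : SSet.{u}} {i : A ⟶ B} {f : A ⟶ A'} {g : B ⟶ P}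
    {i' : A' ⟶ P} (sq : IsPushout i f g i') [Mono i] (hi : SSetWeakEquiv i) :
    SSetWeakEquiv i' := by
  refine we_mk (fun K _ a ↦ ?_) fun K _ h h' e ↦ ?_
  · obtain ⟨b, hb⟩ := hi.exists_extension (f ≫ a)
    exact ⟨sq.desc b a hb, .of_eq (sq.inr_desc _ _ _)⟩
  · obtain ⟨H, h₀, h₁⟩ := htpy_iff.1 e
    obtain ⟨G, h₂, h₃, h₄⟩ := hi.exists_homotopy_extension (g ≫ h) (g ≫ h') (f ▷ _ ≫ H)
      (by rw [SSet.ι₀_comp_assoc, h₀, sq.w_assoc]) (by rw [SSet.ι₁_comp_assoc, h₁, sq.w_assoc])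
    have sq' := isPushout_whiskerRight sq Δ[1]
    refine .mk (sq'.desc G H h₄) ?_ ?_ <;> apply sq.hom_ext
    · rw [← SSet.ι₀_comp_assoc, sq'.inl_desc, h₂]
    · rw [← SSet.ι₀_comp_assoc, sq'.inr_desc, h₀]
    · rw [← SSet.ι₁_comp_assoc, sq'.inl_desc, h₃]
    · rw [← SSet.ι₁_comp_assoc, sq'.inr_desc, h₁]

/-- The predicate of lying in one of the two images and the true predicate agree on both legs of the
pushout, so they are equal. -/
lemma types_isPushout_surjective {A B A' P : Type u} {i : A ⟶ B} {f : A ⟶ A'} {g : B ⟶ P}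
    {i' : A' ⟶ P} (sq : IsPushout i f g i') (x : P) : (∃ b, g b = x) ∨ ∃ a, i' a = x := by
  have : (↾fun x ↦ ULift.up ((∃ b, g b = x) ∨ ∃ a, i' a = x) : P ⟶ ULift.{u} Prop) =
      ↾fun _ ↦ ULift.up True :=
    sq.hom_ext
      (by ext b; exact iff_true_intro (Or.inl ⟨b, rfl⟩ : (∃ b', g b' = g b) ∨ ∃ a, i' a = g b))
      (by ext b; exact iff_true_intro (Or.inr ⟨b, rfl⟩ : (∃ b', g b' = i' b) ∨ ∃ a, i' a = i' b))
  exact of_eq_true (congrArg ULift.down (ConcreteCategory.congr_hom this x))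

/-- A map from a pushout of subobjects along their intersection is a monomorphism. -/
lemma mono_of_isPushout {A B A' P Q : SSet.{u}} {i : A ⟶ B} {f : A ⟶ A'} {g : B ⟶ P}
    {i' : A' ⟶ P} (sq : IsPushout i f g i') (p : P ⟶ Q) [Mono (g ≫ p)] [Mono (i' ≫ p)]
    (h : ∀ n x y, (g ≫ p).app n x = (i' ≫ p).app n y → ∃ a, i.app n a = x ∧ f.app n a = y) :
    Mono p := by
  have : ∀ n, Mono (p.app n) := fun n ↦ (mono_iff_injective _).2 fun x y e ↦ by
    have h₁ : Function.Injective ((g ≫ p).app n) := (mono_iff_injective _).1 inferInstance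
    have h₂ : Function.Injective ((i' ≫ p).app n) := (mono_iff_injective _).1 inferInstance
    have hP : ∀ x, (∃ b, g.app n b = x) ∨ ∃ a, i'.app n a = x :=
      types_isPushout_surjective (sq.map ((evaluation _ _).obj n))
    have key (x) (y) (e : (g ≫ p).app n x = (i' ≫ p).app n y) : g.app n x = i'.app n y := by
      obtain ⟨a, rfl, rfl⟩ := h n x y e
      exact app_congr sq.w n a
    obtain ⟨x, rfl⟩ | ⟨x, rfl⟩ := hP x <;> obtain ⟨y, rfl⟩ | ⟨y, rfl⟩ := hP y
    · exact congrArg _ (h₁ e)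
    · exact key _ _ e
    · exact (key _ _ e.symm).symm
    · exact congrArg _ (h₂ e)
  exact NatTrans.mono_of_mono_app _

variable {D : Type u} [SmallCategory.{u} D]

/-! ### Mapping spaces and levelwise weak equivalences -/

lemma mono_presheaf {X Y : Dᵒᵖ ⥤ SSet.{u}} (f : X ⟶ Y)
    (h : ∀ d n, Function.Injective ((f.app d).app n)) : Mono f := by
  have : ∀ d, Mono (f.app d) := fun d ↦ by
    have : ∀ n, Mono ((f.app d).app n) := fun n ↦ (mono_iff_injective _).2 (h d n)
    exact NatTrans.mono_of_mono_app _
  exact NatTrans.mono_of_mono_app _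

lemma app_injective {X Y : Dᵒᵖ ⥤ SSet.{u}} (f : X ⟶ Y) [Mono f] (d n) :
    Function.Injective ((f.app d).app n) :=
  (mono_iff_injective _).1 inferInstance

lemma sset_injective {X Y : SSet.{u}} (f : X ⟶ Y) [Mono f] (n) :
    Function.Injective (f.app n) :=
  (mono_iff_injective _).1 inferInstance

lemma mono_sset {X Y : SSet.{u}} (f : X ⟶ Y) (h : ∀ n, Function.Injective (f.app n)) : Mono f := by
  have : ∀ n, Mono (f.app n) := fun n ↦ (mono_iff_injective _).2 (h n)
  exact NatTrans.mono_of_mono_app _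

instance {X Y : SSet.{u}} (f : X ⟶ Y) [Mono f] (L : SSet.{u}) : Mono (f ▷ L) :=
  mono_sset _ fun n _ _ e ↦ Prod.ext (sset_injective f n (Prod.ext_iff.1 e).1) (Prod.ext_iff.1 e).2

instance {X Y : SSet.{u}} (f : X ⟶ Y) [Mono f] (L : SSet.{u}) : Mono (L ◁ f) :=
  mono_sset _ fun n _ _ e ↦ Prod.ext (Prod.ext_iff.1 e).1 (sset_injective f n (Prod.ext_iff.1 e).2)

/-- The pushout product of a trivial cofibration and a monomorphism is a trivial cofibration. -/
lemma pushoutProduct_we {A B K L P : SSet.{u}} {i : A ⟶ B} [Mono i] (hi : SSetWeakEquiv i)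
    {j : K ⟶ L} [Mono j] {inl : B ⊗ K ⟶ P} {inr : A ⊗ L ⟶ P}
    (sq : IsPushout (i ▷ K) (A ◁ j) inl inr) (p : P ⟶ B ⊗ L) (h₁ : inl ≫ p = B ◁ j)
    (h₂ : inr ≫ p = i ▷ L) : Mono p ∧ SSetWeakEquiv p := by
  have h₃ : Mono (inl ≫ p) := by rw [h₁]; infer_instance
  have h₄ : Mono (inr ≫ p) := by rw [h₂]; infer_instance
  refine ⟨mono_of_isPushout sq p fun n x y e ↦ ?_,
    (SSetWeakEquiv.of_isPushout sq (hi.whiskerRight K)).of_comp_left ?_⟩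
  · rw [h₁, h₂] at e
    exact ⟨(y.1, x.2), Prod.ext (Prod.ext_iff.1 e).1.symm rfl, Prod.ext rfl (Prod.ext_iff.1 e).2⟩
  · rw [h₂]
    exact hi.whiskerRight L

/-- Counterpart of `inj_ext` with the weak equivalence on the side of the presheaves; the pushout
product is then levelwise a trivial cofibration by `pushoutProduct_we`. -/
lemma inj_ext_of_we {W A B : Dᵒᵖ ⥤ SSet.{u}} (hW : InjectiveFibrant W) (i : A ⟶ B) [hi : Mono i]
    (hi' : LevelwiseWeakEquiv i) {K L : SSet.{u}} (j : K ⟶ L) [Mono j]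
    (a : (tensorConst B).obj K ⟶ W) (b : (tensorConst A).obj L ⟶ W)
    (h : Functor.whiskerRight i (tensorRight K) ≫ a = (tensorConst A).map j ≫ b) :
    ∃ c : (tensorConst B).obj L ⟶ W, (tensorConst B).map j ≫ c = a ∧
      Functor.whiskerRight i (tensorRight L) ≫ c = b := by
  obtain ⟨P, inl, inr, sq⟩ : ∃ (P : Dᵒᵖ ⥤ SSet.{u}) (inl : (tensorConst B).obj K ⟶ P)
      (inr : (tensorConst A).obj L ⟶ P), IsPushout
        (Functor.whiskerRight i (tensorRight K)) ((tensorConst A).map j) inl inr :=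
    ⟨_, _, _, IsPushout.of_hasPushout _ _⟩
  obtain ⟨ι, hι₁, hι₂⟩ := sq.exists_desc ((tensorConst B).map j)
    (Functor.whiskerRight i (tensorRight L))
    (by ext d : 2; exact (whisker_exchange (i.app d) j).symm)
  have key (d) := pushoutProduct_we (hi' d) (sq.map ((evaluation _ _).obj d)) (ι.app d)
    (NatTrans.congr_app hι₁ d) (NatTrans.congr_app hι₂ d)
  have hm (d) : Mono (ι.app d) := (key d).1
  obtain ⟨c, hc⟩ := hW ι (NatTrans.mono_of_mono_app _) (fun d ↦ (key d).2) (sq.desc a b h)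
  have h₁ := congrArg (inl ≫ ·) hc
  have h₂ := congrArg (inr ≫ ·) hc
  exact ⟨c, (congrArg (· ≫ c) hι₁.symm).trans ((Category.assoc _ _ _).trans
      (h₁.trans (sq.inl_desc a b h))),
    (congrArg (· ≫ c) hι₂.symm).trans ((Category.assoc _ _ _).trans
      (h₂.trans (sq.inr_desc a b h)))⟩

lemma mapCurry_map {W B : Dᵒᵖ ⥤ SSet.{u}} {K L : SSet.{u}} (j : K ⟶ L)
    (c : (tensorConst B).obj L ⟶ W) : mapCurry ((tensorConst B).map j ≫ c) = j ≫ mapCurry c := by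
  ext n k
  refine NatTrans.ext (funext fun d ↦ ?_)
  ext m z
  exact congrArg (fun x ↦ (c.app d).app m (z.1, x)) (NatTrans.naturality_apply j
    (SSet.stdSimplex.objEquiv z.2).op k)

lemma mapUncurry_comp_pre {W A B : Dᵒᵖ ⥤ SSet.{u}} (i : A ⟶ B) {L : SSet.{u}}
    (φ : L ⟶ mapSpace B W) :
    mapUncurry (φ ≫ mapSpacePre i W) = Functor.whiskerRight i (tensorRight L) ≫ mapUncurry φ := rfl

lemma mapUncurry_comp {W B : Dᵒᵖ ⥤ SSet.{u}} {K L : SSet.{u}} (j : K ⟶ L)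
    (φ : L ⟶ mapSpace B W) : mapUncurry (j ≫ φ) = (tensorConst B).map j ≫ mapUncurry φ := rfl

/-- Restriction along a trivial cofibration is a trivial fibration of mapping spaces. -/
lemma mapSpacePre_trivFib {W A B : Dᵒᵖ ⥤ SSet.{u}} (hW : InjectiveFibrant W) (i : A ⟶ B)
    [Mono i] (hi : LevelwiseWeakEquiv i) : TrivFib (mapSpacePre i W) := by
  refine .of_exists fun j _ φ ψ w ↦ ?_
  obtain ⟨c, hc, hc'⟩ := inj_ext_of_we hW i hi j (mapUncurry φ) (mapUncurry ψ)
    (by rw [← mapUncurry_comp_pre, w, mapUncurry_comp])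
  exact ⟨mapCurry c, by rw [← mapCurry_map, hc, mapCurry_mapUncurry],
    (congrArg mapCurry hc').trans (mapCurry_mapUncurry ψ)⟩

/-! ### Cofree simplicial presheaves, and homotopy invariance of mapping spaces in the source -/

/-- The cofree simplicial presheaf on a family of sets. -/
def cofree (T : D → SimplexCategory → Type u) : Dᵒᵖ ⥤ SSet.{u} where
  obj d :=
    { obj n := ∀ e m, (e ⟶ d.unop) → (m ⟶ n.unop) → T e m
      map θ := ↾fun r e m φ ψ ↦ r e m φ (ψ ≫ θ.unop)
      map_id n := by ext r e m φ ψ; exact congrArg (r e m φ) (Category.comp_id _)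
      map_comp _ _ := by
        ext r e m φ ψ; exact congrArg (r e m φ) (Category.assoc _ _ _).symm }
  map g :=
    { app n := ↾fun r e m φ ψ ↦ r e m (φ ≫ g.unop) ψ
      naturality _ _ _ := rfl }
  map_id d := by ext n r e m φ ψ; exact congrArg (r e m · ψ) (Category.comp_id _)
  map_comp _ _ := by
    ext n r e m φ ψ; exact congrArg (r e m · ψ) (Category.assoc _ _ _).symm

variable (T : D → SimplexCategory → Type u)

/-- Maps to a cofree simplicial presheaf are families of functions. -/
def cofreeLift {Y : Dᵒᵖ ⥤ SSet.{u}} (F : ∀ e m, (Y.obj (op e)).obj (op m) → T e m) :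
    Y ⟶ cofree T where
  app d :=
    { app n := ↾fun y e m φ ψ ↦ F e m ((Y.obj (op e)).map ψ.op ((Y.map φ.op).app n y))
      naturality n n' θ := by
        ext y
        funext e m φ ψ
        refine congrArg (F e m) ?_
        refine (congrArg _ (NatTrans.naturality_apply (Y.map φ.op) θ y)).trans ?_
        exact (Functor.map_comp_apply (Y.obj (op e)) θ ψ.op _).symm }
  naturality d d' g := by
    ext n y
    funext e m φ ψ
    exact congrArg (fun z ↦ F e m ((Y.obj (op e)).map ψ.op z))
      (app_congr (Y.map_comp g φ.op) n y).symm

-- A map into the cofree presheaf amounts to a family of functions subject to no condition, so it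
-- extends along an injection: take the given value on the image, and an arbitrary one elsewhere.
open Classical in
lemma cofree_exists_extension' [∀ e m, Nonempty (T e m)] {d : Dᵒᵖ} {A B : SSet.{u}} (i : A ⟶ B)
    [Mono i] (a : A ⟶ (cofree T).obj d) : ∃ b : B ⟶ (cofree T).obj d, i ≫ b = a := by
  let F (e m) (φ : e ⟶ d.unop) (y : B.obj (op m)) : T e m := if h : ∃ x, i.app (op m) x = y then
    a.app (op m) h.choose e m φ (𝟙 _) else Classical.arbitrary _
  refine ⟨{ app n := ↾fun y e m φ ψ ↦ F e m φ (B.map ψ.op y), naturality n n' θ := ?_ }, ?_⟩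
  · ext y
    funext e m φ ψ
    exact congrArg (F e m φ) (Functor.map_comp_apply B θ ψ.op _).symm
  · ext n x
    funext e m φ ψ
    have e₁ := NatTrans.naturality_apply i ψ.op x
    have h : ∃ x', i.app (op m) x' = B.map ψ.op (i.app n x) := ⟨_, e₁⟩
    refine (dif_pos h).trans ?_
    have : h.choose = A.map ψ.op x := sset_injective i _ (h.choose_spec.trans e₁.symm)
    rw [this]
    refine (congrFun (congrFun (congrFun (congrFun
      (NatTrans.naturality_apply a ψ.op x) e) m) φ) (𝟙 m)).trans ?_
    exact congrArg (a.app n x e m φ) (Category.id_comp _)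

/-- The product of simplicial presheaves. -/
def prodPresheaf (Y Z : Dᵒᵖ ⥤ SSet.{u}) : Dᵒᵖ ⥤ SSet.{u} where
  obj d := Y.obj d ⊗ Z.obj d
  map g := Y.map g ⊗ₘ Z.map g

lemma trivFib_fst_cofree [∀ e m, Nonempty (T e m)] (d : Dᵒᵖ) (Y : SSet.{u}) :
    TrivFib (fst Y ((cofree T).obj d)) := by
  refine .of_exists fun i _ a b w ↦ ?_
  obtain ⟨c, hc⟩ := cofree_exists_extension' T i (a ≫ snd _ _)
  refine ⟨CartesianMonoidalCategory.lift b c, ?_, CartesianMonoidalCategory.lift_fst _ _⟩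
  rw [CartesianMonoidalCategory.comp_lift, ← w, hc]
  exact CartesianMonoidalCategory.hom_ext _ _ (CartesianMonoidalCategory.lift_fst _ _)
    (CartesianMonoidalCategory.lift_snd _ _)

lemma mapSpacePre_comp {X Y Z : Dᵒᵖ ⥤ SSet.{u}} (f : X ⟶ Y) (g : Y ⟶ Z) (W : Dᵒᵖ ⥤ SSet.{u}) :
    mapSpacePre (f ≫ g) W = mapSpacePre g W ≫ mapSpacePre f W := rfl

/-- Levelwise weak equivalences induce weak equivalences of mapping spaces to injectively fibrant
objects. -/
lemma mapSpacePre_we {W X Y : Dᵒᵖ ⥤ SSet.{u}} (hW : InjectiveFibrant W) (f : X ⟶ Y)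
    (hf : LevelwiseWeakEquiv f) : SSetWeakEquiv (mapSpacePre f W) := by
  -- The extra point `none` makes all the sets nonempty and provides the section `s` of `p`, while
  -- `some` makes `g` a monomorphism. As in Ken Brown's lemma, `f` is a trivial cofibration followed
  -- by a map that has a trivial cofibration as a section.
  let T (e : D) (m : SimplexCategory) : Type u := Option ((X.obj (op e)).obj (op m))
  have : ∀ e m, Nonempty (T e m) := fun _ _ ↦ ⟨none⟩
  let η : X ⟶ cofree T := cofreeLift T fun e m x ↦ some x
  let Z := prodPresheaf Y (cofree T)
  let g : X ⟶ Z := { app d := CartesianMonoidalCategory.lift (f.app d) (η.app d)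
                     naturality d e φ := by
                       ext n x
                       exact Prod.ext (app_congr (f.naturality φ) n x)
                         (app_congr (η.naturality φ) n x) }
  let p : Z ⟶ Y := { app d := fst _ _, naturality _ _ _ := rfl }
  let s : Y ⟶ Z := { app d := CartesianMonoidalCategory.lift (𝟙 _)
                                ((cofreeLift T fun e m x ↦ none).app d)
                     naturality d e φ := rfl }
  have hp : LevelwiseWeakEquiv p := fun d ↦ (trivFib_fst_cofree T d _).we
  have hgp : g ≫ p = f := rfl
  have hsp : s ≫ p = 𝟙 _ := rfl
  have : Mono g := mono_presheaf _ fun d n x y e ↦ by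
    have h : some ((X.obj d).map (𝟙 n.unop).op ((X.map (𝟙 d.unop).op).app n x)) =
        some ((X.obj d).map (𝟙 n.unop).op ((X.map (𝟙 d.unop).op).app n y)) :=
      congrFun (congrFun (congrFun (congrFun (Prod.ext_iff.1 e).2 d.unop) n.unop) (𝟙 _)) (𝟙 _)
    have key (x : (X.obj d).obj n) : (X.obj d).map (𝟙 n.unop).op ((X.map (𝟙 d.unop).op).app n x) = x :=
      (Functor.map_id_apply (X.obj d) n _).trans (res_id X (X := d.unop) _)
    rw [key, key] at h
    exact Option.some.inj h
  have : Mono s := ⟨fun a b e ↦ by simpa [hsp] using congrArg (· ≫ p) e⟩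
  have hg : LevelwiseWeakEquiv g := fun d ↦ (hp d).of_comp_right (hf d)
  have hs : LevelwiseWeakEquiv s := fun d ↦ (hp d).of_comp_right (we_iso (𝟙 _))
  have h₁ := (mapSpacePre_trivFib hW g hg).we
  have h₂ := (mapSpacePre_trivFib hW s hs).we
  have h₃ : SSetWeakEquiv (mapSpacePre p W) := h₂.of_comp_right (by
    rw [← mapSpacePre_comp, hsp]; exact we_iso (𝟙 _))
  exact h₃.comp h₁

/-! ### Homotopies of simplicial presheaves, and invariance of mapping spaces in the target -/

/-- Postcomposition on mapping spaces. -/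
def mapSpacePost (A : Dᵒᵖ ⥤ SSet.{u}) {U V : Dᵒᵖ ⥤ SSet.{u}} (f : U ⟶ V) :
    mapSpace A U ⟶ mapSpace A V where
  app p := ↾fun g ↦ g ≫ f

/-- The homotopy of mapping spaces induced by a homotopy. -/
def mapSpaceHomotopy (A : Dᵒᵖ ⥤ SSet.{u}) {U V : Dᵒᵖ ⥤ SSet.{u}} (H : (tensorConst U).obj Δ[1] ⟶ V) :
    mapSpace A U ⊗ Δ[1] ⟶ mapSpace A V where
  app n := ↾fun z ↦
    (show (tensorConst A).obj Δ[n.unop.len] ⟶ (tensorConst U).obj Δ[1] from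
      { app d := CartesianMonoidalCategory.lift
          ((show (tensorConst A).obj Δ[n.unop.len] ⟶ U from z.1).app d)
          (snd _ _ ≫ SSet.yonedaEquiv.symm z.2)
        naturality d e φ := by
          ext m x
          exact Prod.ext (app_congr ((show (tensorConst A).obj Δ[n.unop.len] ⟶ U from
            z.1).naturality φ) m x) rfl }) ≫ H
  naturality n m θ := by
    ext z
    refine NatTrans.ext (funext fun d ↦ ?_)
    ext l x
    refine congrArg ((H.app d).app l) (Prod.ext rfl ?_)
    exact (Functor.map_comp_apply (Δ[1] : SSet.{u}) θ (SSet.stdSimplex.objEquiv x.2).op z.2).symm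

/-- The two ends of a cylinder. -/
def cylEnd (U : Dᵒᵖ ⥤ SSet.{u}) (k : Fin 2) : U ⟶ (tensorConst U).obj Δ[1] where
  app d := CartesianMonoidalCategory.lift (𝟙 _)
    (SSet.const (SSet.stdSimplex.objEquiv.symm (SimplexCategory.const ⦋0⦌ ⦋1⦌ k)))

lemma htpy_mapSpacePost (A : Dᵒᵖ ⥤ SSet.{u}) {U V : Dᵒᵖ ⥤ SSet.{u}} {f g : U ⟶ V}
    (H : (tensorConst U).obj Δ[1] ⟶ V) (h₀ : cylEnd U 0 ≫ H = f) (h₁ : cylEnd U 1 ≫ H = g) :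
    Htpy (mapSpacePost A f) (mapSpacePost A g) := by
  subst h₀ h₁
  refine .mk (mapSpaceHomotopy A H) ?_ ?_ <;>
  · ext n z
    refine NatTrans.ext (funext fun d ↦ ?_)
    ext l x
    refine congrArg ((H.app d).app l) (Prod.ext rfl ?_)
    exact stdSimplex_ext fun i ↦ rfl

/-- A vertex of a mapping space. -/
def mapVertex {X W : Dᵒᵖ ⥤ SSet.{u}} (f : X ⟶ W) : (mapSpace X W) _⦋0⦌ :=
  (show (tensorConst X).obj Δ[0] ⟶ W from
    { app d := fst _ _ ≫ f.app d
      naturality d e φ := by ext n z; exact app_congr (f.naturality φ) n z.1 })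

lemma exists_eq_mapVertex {X W : Dᵒᵖ ⥤ SSet.{u}} (v : (mapSpace X W) _⦋0⦌) : ∃ g, v = mapVertex g := by
  let v' : (tensorConst X).obj Δ[0] ⟶ W := v
  refine ⟨{ app d := CartesianMonoidalCategory.lift (𝟙 _) (SSet.const
    (SSet.stdSimplex.objEquiv.symm (SimplexCategory.const ⦋0⦌ ⦋0⦌ 0))) ≫ v'.app d,
            naturality d e φ := ?_ }, ?_⟩
  · ext n x
    exact app_congr (v'.naturality φ) n (x, _)
  · refine NatTrans.ext (funext fun d ↦ ?_)
    ext n z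
    refine congrArg ((v'.app d).app n) (Prod.ext rfl ?_)
    exact stdSimplex_ext fun i ↦ Subsingleton.elim (α := Fin 1) _ _

lemma exists_cylinder_of_edge {X W : Dᵒᵖ ⥤ SSet.{u}} {f g : X ⟶ W} (e : (mapSpace X W) _⦋1⦌)
    (h₁ : (mapSpace X W).δ 1 e = mapVertex f) (h₀ : (mapSpace X W).δ 0 e = mapVertex g) :
    ∃ H : (tensorConst X).obj Δ[1] ⟶ W, cylEnd X 0 ≫ H = f ∧ cylEnd X 1 ≫ H = g := by
  let e' : (tensorConst X).obj Δ[1] ⟶ W := e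
  refine ⟨e', ?_, ?_⟩
  · ext d n x
    refine Eq.trans ?_ (app_congr (NatTrans.congr_app h₁ d) n
      (x, SSet.stdSimplex.objEquiv.symm (SimplexCategory.const _ _ 0)))
    refine congrArg ((e'.app d).app n) (Prod.ext rfl ?_)
    exact stdSimplex_ext fun i ↦ rfl
  · ext d n x
    refine Eq.trans ?_ (app_congr (NatTrans.congr_app h₀ d) n
      (x, SSet.stdSimplex.objEquiv.symm (SimplexCategory.const _ _ 0)))
    refine congrArg ((e'.app d).app n) (Prod.ext rfl ?_)
    exact stdSimplex_ext fun i ↦ rfl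

/-! ### Paths in Kan complexes -/

/-- Two vertices are joined by a path. -/
def Joined {K : SSet.{u}} (x y : K _⦋0⦌) : Prop := ∃ e : K _⦋1⦌, K.δ 1 e = x ∧ K.δ 0 e = y

lemma Joined.quotient {K : SSet.{u}} [SSet.KanComplex K] {x y z : K _⦋0⦌} (h : Joined x y)
    (h' : Joined x z) : Joined y z := by
  obtain ⟨e, he, he'⟩ := h
  obtain ⟨d, hd, hd'⟩ := h'
  obtain ⟨c, hc, hc'⟩ := kan_edge_quotient e d (he.trans hd.symm)
  exact ⟨c, hc.trans he', hc'.trans hd'⟩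

lemma Joined.refl {K : SSet.{u}} (x : K _⦋0⦌) : Joined x x :=
  ⟨K.σ 0 x, SSet.δ_comp_σ_succ_apply 0 x, SSet.δ_comp_σ_self_apply 0 x⟩

lemma Joined.symm {K : SSet.{u}} [SSet.KanComplex K] {x y : K _⦋0⦌} (h : Joined x y) : Joined y x :=
  h.quotient (.refl _)

lemma Joined.trans {K : SSet.{u}} [SSet.KanComplex K] {x y z : K _⦋0⦌} (h : Joined x y)
    (h' : Joined y z) : Joined x z := h.symm.quotient h'

lemma Joined.map {K L : SSet.{u}} {x y : K _⦋0⦌} (h : Joined x y) (f : K ⟶ L) :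
    Joined (f.app _ x) (f.app _ y) := by
  obtain ⟨e, rfl, rfl⟩ := h
  exact ⟨f.app _ e, (SSet.δ_naturality_apply f 1 e).symm, (SSet.δ_naturality_apply f 0 e).symm⟩

lemma Htpy.joined {K L : SSet.{u}} {f g : K ⟶ L} (h : Htpy f g) (x : K _⦋0⦌) :
    Joined (f.app _ x) (g.app _ x) := by
  obtain ⟨H, rfl, rfl⟩ := htpy_iff.1 h
  refine ⟨H.app _ (K.σ 0 x, SSet.stdSimplex.objEquiv.symm (𝟙 _)), ?_, ?_⟩
  · refine (SSet.δ_naturality_apply H 1 _).symm.trans ?_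
    exact congrArg (H.app (op ⦋0⦌)) (Prod.ext (SSet.δ_comp_σ_succ_apply 0 x)
      (stdSimplex_ext fun i ↦ by fin_cases i; rfl))
  · refine (SSet.δ_naturality_apply H 0 _).symm.trans ?_
    exact congrArg (H.app (op ⦋0⦌)) (Prod.ext (SSet.δ_comp_σ_self_apply 0 x)
      (stdSimplex_ext fun i ↦ by fin_cases i; rfl))

lemma SSetWeakEquiv.exists_joined {K L : SSet.{u}} [SSet.KanComplex K] [SSet.KanComplex L]
    {f : K ⟶ L} (hf : SSetWeakEquiv f) (y : L _⦋0⦌) : ∃ x, Joined (f.app _ x) y := by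
  obtain ⟨g, -, hg⟩ := hf.exists_inverse
  exact ⟨_, hg.joined y⟩

lemma SSetWeakEquiv.joined {K L : SSet.{u}} [SSet.KanComplex K] [SSet.KanComplex L]
    {f : K ⟶ L} (hf : SSetWeakEquiv f) {x y : K _⦋0⦌} (h : Joined (f.app _ x) (f.app _ y)) :
    Joined x y := by
  obtain ⟨g, hg, -⟩ := hf.exists_inverse
  exact (hg.joined x).symm.trans ((h.map g).trans (hg.joined y))

/-- A levelwise weak equivalence between injectively fibrant objects induces weak equivalences of
mapping spaces. -/
lemma mapSpacePost_we {U V : Dᵒᵖ ⥤ SSet.{u}} (hU : InjectiveFibrant U) (hV : InjectiveFibrant V)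
    {f : U ⟶ V} (hf : LevelwiseWeakEquiv f) (A : Dᵒᵖ ⥤ SSet.{u}) :
    SSetWeakEquiv (mapSpacePost A f) := by
  have hUU := mapSpace_kanComplex hU (B := U)
  have hVU := mapSpace_kanComplex hU (B := V)
  have hUV := mapSpace_kanComplex hV (B := U)
  have hVV := mapSpace_kanComplex hV (B := V)
  have hAU := mapSpace_kanComplex hU (B := A)
  have hAV := mapSpace_kanComplex hV (B := A)
  -- Surjectivity of `f^*` on components gives `g` with `f ≫ g` homotopic to the identity of `U`.
  -- Then `f ≫ g ≫ f` is homotopic to `f`, and injectivity of `f^*` on the components of `Map(V, V)`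
  -- gives the other homotopy.
  obtain ⟨g, hg⟩ := (mapSpacePre_we hU f hf).exists_joined (mapVertex (𝟙 U))
  obtain ⟨g, rfl⟩ := exists_eq_mapVertex g
  have h₁ : Joined (mapVertex (f ≫ g)) (mapVertex (𝟙 U)) := hg
  have h₂ : Joined (mapVertex (g ≫ f)) (mapVertex (𝟙 V)) :=
    (mapSpacePre_we hV f hf).joined (h₁.map (mapSpacePost U f))
  obtain ⟨e, he, he'⟩ := h₁
  obtain ⟨d, hd, hd'⟩ := h₂
  obtain ⟨H, hH, hH'⟩ := exists_cylinder_of_edge e he he'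
  obtain ⟨G, hG, hG'⟩ := exists_cylinder_of_edge d hd hd'
  exact we_of_homotopyInverse (g := mapSpacePost A g) (htpy_mapSpacePost A H hH hH')
    (htpy_mapSpacePost A G hG hG')

/-! ### Mapping spaces out of presheaves of sets -/

section
variable {D : Type u} [SmallCategory.{u} D]

/-- The simplicial set of maps from a presheaf of sets to a simplicial presheaf. -/
def homSpace (P : Dᵒᵖ ⥤ Type u) (W : Dᵒᵖ ⥤ SSet.{u}) : SSet.{u} := W.flip ⋙ coyoneda.obj (op P)

/-- Restriction of maps out of presheaves of sets. -/
def homPre {P Q : Dᵒᵖ ⥤ Type u} (i : P ⟶ Q) (W : Dᵒᵖ ⥤ SSet.{u}) : homSpace Q W ⟶ homSpace P W :=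
  Functor.whiskerLeft W.flip (coyoneda.map i.op)

/-- Postcomposition of maps out of presheaves of sets. -/
def homPost (P : Dᵒᵖ ⥤ Type u) {W W' : Dᵒᵖ ⥤ SSet.{u}} (f : W ⟶ W') : homSpace P W ⟶ homSpace P W' :=
  Functor.whiskerRight ((flipFunctor _ _ _).map f) (coyoneda.obj (op P))

/-- Maps out of presheaves of sets are mapping spaces. -/
def homSpaceIso (P : Dᵒᵖ ⥤ Type u) (W : Dᵒᵖ ⥤ SSet.{u}) :
    homSpace P W ≅ mapSpace ((discPresheaf D).obj P) W where
  hom := { app n := ↾fun g ↦ mapSpaceMk g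
           naturality n m θ := by
             ext g
             exact (mapSpaceMk_map θ g).symm }
  inv := { app n := ↾fun G ↦
            { app d := ↾fun z ↦ ((show (tensorConst ((discPresheaf D).obj P)).obj Δ[n.unop.len] ⟶ W
                from G).app d).app n (z, SSet.stdSimplex.objEquiv.symm (𝟙 _))
              naturality d e φ := by
                ext z
                exact app_congr ((show (tensorConst ((discPresheaf D).obj P)).obj Δ[n.unop.len] ⟶ W
                  from G).naturality φ) n (z, SSet.stdSimplex.objEquiv.symm (𝟙 _)) }
           naturality n m θ := by
             ext G
             refine NatTrans.ext (funext fun d ↦ ?_)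
             ext z
             let G' : (tensorConst ((discPresheaf D).obj P)).obj Δ[n.unop.len] ⟶ W := G
             refine Eq.trans ?_ (NatTrans.naturality_apply (G'.app d) θ
               ((z, SSet.stdSimplex.objEquiv.symm (𝟙 _)) :
                 (((tensorConst ((discPresheaf D).obj P)).obj Δ[n.unop.len]).obj d).obj n))
             exact congrArg (fun x ↦ (G'.app d).app m (z, SSet.stdSimplex.objEquiv.symm x))
               ((Category.id_comp θ.unop).trans (Category.comp_id θ.unop).symm) }
  hom_inv_id := by
    ext n g
    refine NatTrans.ext (funext fun d ↦ ?_)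
    ext z
    exact Functor.map_id_apply (W.obj d) n _
  inv_hom_id := by
    ext n G
    refine NatTrans.ext (funext fun d ↦ ?_)
    ext m z
    let G' : (tensorConst ((discPresheaf D).obj P)).obj Δ[n.unop.len] ⟶ W := G
    refine (NatTrans.naturality_apply (G'.app d) (SSet.stdSimplex.objEquiv z.2).op
      ((z.1, SSet.stdSimplex.objEquiv.symm (𝟙 _)) :
        (((tensorConst ((discPresheaf D).obj P)).obj Δ[n.unop.len]).obj d).obj n)).symm.trans ?_
    exact congrArg (fun x ↦ (G'.app d).app m (z.1, x)) (stdSimplex_ext fun i ↦ rfl)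

lemma homPre_eq {P Q : Dᵒᵖ ⥤ Type u} (i : P ⟶ Q) (W : Dᵒᵖ ⥤ SSet.{u}) :
    homPre i W = (homSpaceIso Q W).hom ≫ mapSpacePre ((discPresheaf D).map i) W ≫
      (homSpaceIso P W).inv := by
  rw [← Category.assoc, Iso.eq_comp_inv]
  rfl

lemma homPost_eq (P : Dᵒᵖ ⥤ Type u) {W W' : Dᵒᵖ ⥤ SSet.{u}} (f : W ⟶ W') :
    homPost P f = (homSpaceIso P W).hom ≫ mapSpacePost _ f ≫ (homSpaceIso P W').inv := by
  rw [← Category.assoc, Iso.eq_comp_inv]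
  ext n g
  refine NatTrans.ext (funext fun d ↦ ?_)
  ext m z
  exact (NatTrans.naturality_apply (f.app d) (SSet.stdSimplex.objEquiv z.2).op _).symm

lemma homPre_fibration {P Q : Dᵒᵖ ⥤ Type u} (i : P ⟶ Q) [Mono i] {W : Dᵒᵖ ⥤ SSet.{u}}
    (hW : InjectiveFibrant W) : Fibration (homPre i W) := by
  have h : ∀ d, Function.Injective (i.app d) := fun d ↦ (mono_iff_injective _).1 inferInstance
  have : Mono ((discPresheaf D).map i) := mono_presheaf _ fun d n ↦ h d
  have := mapSpacePre_fibration hW ((discPresheaf D).map i)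
  rw [homPre_eq]
  infer_instance

lemma homSpace_kanComplex (P : Dᵒᵖ ⥤ Type u) {W : Dᵒᵖ ⥤ SSet.{u}} (hW : InjectiveFibrant W) :
    SSet.KanComplex (homSpace P W) := by
  have := mapSpace_kanComplex hW (B := (discPresheaf D).obj P)
  exact isFibrant_of_fibration (homSpaceIso P W).hom

lemma homPre_we_iff {P Q : Dᵒᵖ ⥤ Type u} (i : P ⟶ Q) (W : Dᵒᵖ ⥤ SSet.{u}) :
    SSetWeakEquiv (homPre i W) ↔ SSetWeakEquiv (mapSpacePre ((discPresheaf D).map i) W) := by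
  rw [homPre_eq]
  exact ⟨fun h ↦ (we_iso (homSpaceIso P W).inv).of_comp_right
    ((we_iso (homSpaceIso Q W).hom).of_comp_left h), fun h ↦ (we_iso _).comp (h.comp (we_iso _))⟩

lemma homPost_we (P : Dᵒᵖ ⥤ Type u) {W W' : Dᵒᵖ ⥤ SSet.{u}} (hW : InjectiveFibrant W)
    (hW' : InjectiveFibrant W') {f : W ⟶ W'} (hf : LevelwiseWeakEquiv f) :
    SSetWeakEquiv (homPost P f) := by
  rw [homPost_eq]
  exact (we_iso _).comp ((mapSpacePost_we hW hW' hf _).comp (we_iso _))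

/-- The Yoneda lemma. -/
def homYoneda (X : D) (W : Dᵒᵖ ⥤ SSet.{u}) : homSpace (yoneda.obj X) W ≅ W.obj (op X) :=
  NatIso.ofComponents (fun n ↦ (yonedaEquiv (F := W.flip.obj n)).toIso) fun {n m} θ ↦ by
    ext g
    rfl

lemma homPre_homYoneda {X Y : D} (g : X ⟶ Y) (W : Dᵒᵖ ⥤ SSet.{u}) :
    homPre (yoneda.map g) W ≫ (homYoneda X W).hom = (homYoneda Y W).hom ≫ W.map g.op := by
  ext n k
  refine Eq.trans ?_ (NatTrans.naturality_apply (show yoneda.obj Y ⟶ W.flip.obj n from k) g.op (𝟙 Y))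
  exact congrArg ((show yoneda.obj Y ⟶ W.flip.obj n from k).app (op X))
    ((Category.id_comp g).trans (Category.comp_id g).symm)

lemma kanComplex_obj {W : Dᵒᵖ ⥤ SSet.{u}} (hW : InjectiveFibrant W) (d : Dᵒᵖ) :
    SSet.KanComplex (W.obj d) := by
  have := homSpace_kanComplex (yoneda.obj d.unop) hW
  exact isFibrant_of_fibration (homYoneda d.unop W).inv

lemma homSpace_isPullback {P₀ P₁ P₂ P : Dᵒᵖ ⥤ Type u} {f₁ : P₀ ⟶ P₁} {f₂ : P₀ ⟶ P₂} {g₁ : P₁ ⟶ P}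
    {g₂ : P₂ ⟶ P} (sq : IsPushout f₁ f₂ g₁ g₂) (W : Dᵒᵖ ⥤ SSet.{u}) :
    IsPullback (homPre g₁ W) (homPre g₂ W) (homPre f₁ W) (homPre f₂ W) := by
  refine .of_forall_isPullback_app fun n ↦ ?_
  rw [Limits.Types.isPullback_iff]
  refine ⟨?_, fun x y h ↦ sq.hom_ext h.1 h.2, fun x y h ↦ ⟨sq.desc x y h, sq.inl_desc _ _ _, sq.inr_desc _ _ _⟩⟩
  ext x
  exact sq.w_assoc x

/-- The restriction to a union of two representable subobjects is a Kan fibration. -/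
lemma union_fibration {W : Dᵒᵖ ⥤ SSet.{u}} (hW : InjectiveFibrant W) {P₀ : Dᵒᵖ ⥤ Type u} {Y₁ Y₂ Z : D}
    {f₁ : P₀ ⟶ yoneda.obj Y₁} {f₂ : P₀ ⟶ yoneda.obj Y₂} (g₁ : Y₁ ⟶ Z) (g₂ : Y₂ ⟶ Z) [Mono g₁] [Mono g₂]
    (w : f₁ ≫ yoneda.map g₁ = f₂ ≫ yoneda.map g₂)
    (h : ∀ {T : D} (h₁ : T ⟶ Y₁) (h₂ : T ⟶ Y₂), h₁ ≫ g₁ = h₂ ≫ g₂ →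
      ∃ h₀ : P₀.obj (op T), f₁.app _ h₀ = h₁ ∧ f₂.app _ h₀ = h₂)
    {Q : SSet.{u}} {q₁ : Q ⟶ W.obj (op Y₁)} {q₂ : Q ⟶ W.obj (op Y₂)}
    (sq : IsPullback q₁ q₂ ((homYoneda Y₁ W).inv ≫ homPre f₁ W) ((homYoneda Y₂ W).inv ≫ homPre f₂ W))
    (p : W.obj (op Z) ⟶ Q) (h₁ : p ≫ q₁ = W.map g₁.op) (h₂ : p ≫ q₂ = W.map g₂.op) :
    Fibration p := by
  obtain ⟨P, inl, inr, sq'⟩ : ∃ (P : Dᵒᵖ ⥤ Type u) (inl : yoneda.obj Y₁ ⟶ P)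
      (inr : yoneda.obj Y₂ ⟶ P), IsPushout f₁ f₂ inl inr :=
    ⟨_, _, _, IsPushout.of_hasPushout _ _⟩
  obtain ⟨ι, hι₁, hι₂⟩ := sq'.exists_desc (yoneda.map g₁) (yoneda.map g₂) w
  -- By `h`, `P₀` is the intersection of the two subobjects, so the pushout is their union inside
  -- the presheaf represented by `Z`.
  have : Mono ι := by
    have : ∀ d, Mono (ι.app d) := fun d ↦ (mono_iff_injective _).2 fun x y e ↦ by
      have hP : ∀ x, (∃ b, inl.app d b = x) ∨ ∃ a, inr.app d a = x :=
        types_isPushout_surjective (sq'.map ((evaluation _ _).obj d))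
      have e₁ (x) : ι.app d (inl.app d x) = x ≫ g₁ :=
        ConcreteCategory.congr_hom (NatTrans.congr_app hι₁ d) x
      have e₂ (x) : ι.app d (inr.app d x) = x ≫ g₂ :=
        ConcreteCategory.congr_hom (NatTrans.congr_app hι₂ d) x
      have key (x) (y) (e : ι.app d (inl.app d x) = ι.app d (inr.app d y)) :
          inl.app d x = inr.app d y := by
        rw [e₁, e₂] at e
        obtain ⟨h₀, rfl, rfl⟩ := h x y e
        exact ConcreteCategory.congr_hom (NatTrans.congr_app sq'.w d) h₀
      obtain ⟨x, rfl⟩ | ⟨x, rfl⟩ := hP x <;> obtain ⟨y, rfl⟩ | ⟨y, rfl⟩ := hP y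
      · rw [e₁, e₁, cancel_mono] at e
        rw [e]
      · exact key _ _ e
      · exact (key _ _ e.symm).symm
      · rw [e₂, e₂, cancel_mono] at e
        rw [e]
    exact NatTrans.mono_of_mono_app _
  have := homPre_fibration ι hW
  -- Maps out of the pushout form the same pullback as `Q`, so up to isomorphism `p` is restriction
  -- along `ι`.
  have sq'' := (homSpace_isPullback sq' W).of_iso (Iso.refl _) (homYoneda Y₁ W) (homYoneda Y₂ W)
    (Iso.refl _) (fst' := (homPre inl W ≫ (homYoneda Y₁ W).hom))
    (snd' := (homPre inr W ≫ (homYoneda Y₂ W).hom)) (f' := (homYoneda Y₁ W).inv ≫ homPre f₁ W)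
    (g' := (homYoneda Y₂ W).inv ≫ homPre f₂ W) (by simp) (by simp) (by simp) (by simp)
  let e : homSpace P W ≅ Q := sq''.isoIsPullback _ _ sq
  have : p = (homYoneda Z W).inv ≫ homPre ι W ≫ e.hom := by
    rw [Iso.eq_inv_comp]
    refine sq.hom_ext ?_ ?_
    · rw [Category.assoc, Category.assoc, h₁, sq''.isoIsPullback_hom_fst, ← homPre_homYoneda, ← hι₁]
      rfl
    · rw [Category.assoc, Category.assoc, h₂, sq''.isoIsPullback_hom_snd, ← homPre_homYoneda, ← hι₂]
      rfl
  rw [this]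
  infer_instance

/-- The restriction to a union of two subobjects with representable intersection is a Kan
fibration. -/
lemma corner_fibration {W : Dᵒᵖ ⥤ SSet.{u}} (hW : InjectiveFibrant W) {Y₀ Y₁ Y₂ Z : D} {f₁ : Y₀ ⟶ Y₁}
    {f₂ : Y₀ ⟶ Y₂} (g₁ : Y₁ ⟶ Z) (g₂ : Y₂ ⟶ Z) [Mono g₁] [Mono g₂] (w : f₁ ≫ g₁ = f₂ ≫ g₂)
    (h : ∀ {T : D} (h₁ : T ⟶ Y₁) (h₂ : T ⟶ Y₂), h₁ ≫ g₁ = h₂ ≫ g₂ → ∃ h₀, h₀ ≫ f₁ = h₁ ∧ h₀ ≫ f₂ = h₂)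
    {Q : SSet.{u}} {q₁ : Q ⟶ W.obj (op Y₁)} {q₂ : Q ⟶ W.obj (op Y₂)}
    (sq : IsPullback q₁ q₂ (W.map f₁.op) (W.map f₂.op)) (p : W.obj (op Z) ⟶ Q)
    (h₁ : p ≫ q₁ = W.map g₁.op) (h₂ : p ≫ q₂ = W.map g₂.op) : Fibration p := by
  refine union_fibration hW (f₁ := yoneda.map f₁) (f₂ := yoneda.map f₂) g₁ g₂
    (by rw [← Functor.map_comp, ← Functor.map_comp, w]) h
    (sq.of_iso (Iso.refl _) (Iso.refl _) (Iso.refl _) (homYoneda Y₀ W).symm (by simp) (by simp) ?_ ?_)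
    p h₁ h₂
  · rw [Iso.symm_hom, Iso.comp_inv_eq, Iso.refl_hom, Category.id_comp, Category.assoc, Iso.eq_inv_comp]
    exact (homPre_homYoneda _ _).symm
  · rw [Iso.symm_hom, Iso.comp_inv_eq, Iso.refl_hom, Category.id_comp, Category.assoc, Iso.eq_inv_comp]
    exact (homPre_homYoneda _ _).symm

/-- The restriction to a union of two disjoint representable subobjects is a Kan fibration. -/
lemma disjoint_fibration {W : Dᵒᵖ ⥤ SSet.{u}} (hW : InjectiveFibrant W) {Y₁ Y₂ Z : D}
    (g₁ : Y₁ ⟶ Z) (g₂ : Y₂ ⟶ Z) [Mono g₁] [Mono g₂]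
    (h : ∀ {T : D} (h₁ : T ⟶ Y₁) (h₂ : T ⟶ Y₂), h₁ ≫ g₁ ≠ h₂ ≫ g₂) :
    Fibration (CartesianMonoidalCategory.lift (W.map g₁.op) (W.map g₂.op)) := by
  -- The intersection is the empty presheaf, whose space of maps is terminal; the pullback over it
  -- is the product.
  let Z₀ : SSet.{u} := homSpace (⊥_ (Dᵒᵖ ⥤ Type u)) W
  have hZ₀ : Limits.IsTerminal Z₀ := Limits.IsTerminal.ofUniqueHom
    (fun X ↦ { app n := ↾fun _ ↦ Limits.initial.to _
               naturality _ _ _ := by ext; exact Limits.initialIsInitial.hom_ext _ _ })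
    (fun X m ↦ by ext n x; exact Limits.initialIsInitial.hom_ext _ _)
  exact union_fibration hW (f₁ := Limits.initial.to _) (f₂ := Limits.initial.to _) g₁ g₂
    (Limits.initialIsInitial.hom_ext _ _) (fun h₁ h₂ e ↦ absurd e (h h₁ h₂))
    (by
      rw [hZ₀.hom_ext ((homYoneda Y₁ W).inv ≫ homPre (Limits.initial.to _) W) (hZ₀.from _),
        hZ₀.hom_ext ((homYoneda Y₂ W).inv ≫ homPre (Limits.initial.to _) W) (hZ₀.from _)]
      exact IsPullback.of_is_product (CartesianMonoidalCategory.tensorProductIsBinaryProduct _ _) hZ₀)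
    _ (CartesianMonoidalCategory.lift_fst _ _) (CartesianMonoidalCategory.lift_snd _ _)

end

/-! ### Spines -/

section
variable {C : Type u} [SmallCategory.{u} C]

open Theta

/-- The map from a level of a simplicial presheaf to its spines. -/
def toSpine (W : (Theta C)ᵒᵖ ⥤ SSet.{u}) (X : Theta C) :
    W.obj (op X) ⟶ homSpace (spine X).toFunctor W :=
  (homYoneda X W).inv ≫ homPre (spine X).ι W

/-- The Segal maps are monomorphisms, so restriction along them is a Kan fibration by injective
fibrancy, and a trivial one by locality. -/
lemma toSpine_trivFib {W : (Theta C)ᵒᵖ ⥤ SSet.{u}} (hW : IsFibrantFor (segalMaps C) W)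
    (X : Theta C) : TrivFib (toSpine W X) := by
  have := homPre_fibration (spine X).ι hW.injectiveFibrant
  have := homSpace_kanComplex (spine X).toFunctor hW.injectiveFibrant
  have h := trivFib_of_we (homPre (spine X).ι W) ((homPre_we_iff _ _).2 (segal_weakEquiv hW X))
  exact (TrivFib.of_iso _).comp h

/-- The vertices of a spine. -/
def spineVertex (W : (Theta C)ᵒᵖ ⥤ SSet.{u}) (X : Theta C) (v : Fin (X.len + 1)) :
    homSpace (spine X).toFunctor W ⟶ W.obj (op zero) where
  app n := ↾fun g ↦ (show (spine X).toFunctor ⟶ W.flip.obj n from g).app _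
    ⟨vertex X v, mem_spine_vertex X v⟩

/-- The edges of a spine. -/
def spineEdge (W : (Theta C)ᵒᵖ ⥤ SSet.{u}) (X : Theta C) (i : Fin X.len) :
    homSpace (spine X).toFunctor W ⟶ W.obj (op (one (X.label i))) where
  app n := ↾fun g ↦ (show (spine X).toFunctor ⟶ W.flip.obj n from g).app _
    ⟨edge X i, mem_spine_edge X i⟩

lemma toSpine_vertex (W : (Theta C)ᵒᵖ ⥤ SSet.{u}) (X : Theta C) (v) :
    toSpine W X ≫ spineVertex W X v = W.map (vertex X v).op := rfl

lemma toSpine_edge (W : (Theta C)ᵒᵖ ⥤ SSet.{u}) (X : Theta C) (i) :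
    toSpine W X ≫ spineEdge W X i = W.map (edge X i).op := rfl

lemma spineEdge_vertex (W : (Theta C)ᵒᵖ ⥤ SSet.{u}) (X : Theta C) (i) (a : Fin 2) :
    spineEdge W X i ≫ W.map (vertex (one (X.label i)) a).op = spineVertex W X (edgeHom i a) := by
  ext n g
  refine (NatTrans.naturality_apply (show (spine X).toFunctor ⟶ W.flip.obj n from g)
    (vertex (one (X.label i)) a).op ⟨edge X i, mem_spine_edge X i⟩).symm.trans ?_
  exact congrArg (ConcreteCategory.hom ((show (spine X).toFunctor ⟶ W.flip.obj n from g).app (op zero)))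
    (Subtype.ext (vertex_edge X i a))

lemma spineSpace_hom_ext {W : (Theta C)ᵒᵖ ⥤ SSet.{u}} {X : Theta C} {L : SSet.{u}}
    {g g' : L ⟶ homSpace (spine X).toFunctor W}
    (h₁ : ∀ v, g ≫ spineVertex W X v = g' ≫ spineVertex W X v)
    (h₂ : ∀ i, g ≫ spineEdge W X i = g' ≫ spineEdge W X i) : g = g' := by
  ext n x
  exact spine_hom_ext (fun v ↦ app_congr (h₁ v) n x) fun i ↦ app_congr (h₂ i) n x

/-- Spines with given vertices and edges. -/
lemma exists_spineSpace_lift {W : (Theta C)ᵒᵖ ⥤ SSet.{u}} {X : Theta C} {L : SSet.{u}}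
    (x : Fin (X.len + 1) → (L ⟶ W.obj (op zero)))
    (w : ∀ i, L ⟶ W.obj (op (one (X.label i))))
    (h : ∀ i (a : Fin 2), w i ≫ W.map (vertex (one (X.label i)) a).op = x (edgeHom i a)) :
    ∃ g : L ⟶ homSpace (spine X).toFunctor W, (∀ v, g ≫ spineVertex W X v = x v) ∧
      ∀ i, g ≫ spineEdge W X i = w i := by
  have H (n) (l : L.obj n) := exists_spine_map' (W := W) (n := n) (fun v ↦ (x v).app n l)
    (fun i ↦ (w i).app n l) fun i a ↦ app_congr (h i a) n l
  choose g hg₁ hg₂ using H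
  refine ⟨{ app n := ↾fun l ↦ g n l, naturality n m θ := ?_ }, fun v ↦ ?_, fun i ↦ ?_⟩
  · ext l
    refine spine_hom_ext (fun v ↦ (hg₁ m _ v).trans ?_) (fun i ↦ (hg₂ m _ i).trans ?_)
    · exact (NatTrans.naturality_apply (x v) θ l).trans (congrArg _ (hg₁ n l v).symm)
    · exact (NatTrans.naturality_apply (w i) θ l).trans (congrArg _ (hg₂ n l i).symm)
  · ext n l
    exact hg₁ n l v
  · ext n l
    exact hg₂ n l i

end

/-! ### Corners -/

section
variable {D : Type u} [SmallCategory.{u} D]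

section
variable (W : Dᵒᵖ ⥤ SSet.{u}) {Y₀ Y₁ Y₂ Z : D} {f₁ : Y₀ ⟶ Y₁} {f₂ : Y₀ ⟶ Y₂} {g₁ : Y₁ ⟶ Z}
  {g₂ : Y₂ ⟶ Z} (w : f₁ ≫ g₁ = f₂ ≫ g₂)

/-- The restriction to the union of `Y₁` and `Y₂` along `Y₀`. -/
def cornerMap : W.obj (op Z) ⟶ Limits.pullback (W.map f₁.op) (W.map f₂.op) :=
  Limits.pullback.lift (W.map g₁.op) (W.map g₂.op) (by
    rw [← Functor.map_comp, ← Functor.map_comp, ← op_comp, ← op_comp, w])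

lemma cornerMap_fst : cornerMap W w ≫ Limits.pullback.fst _ _ = W.map g₁.op :=
  Limits.pullback.lift_fst _ _ _

lemma cornerMap_snd : cornerMap W w ≫ Limits.pullback.snd _ _ = W.map g₂.op :=
  Limits.pullback.lift_snd _ _ _

variable {W}

lemma cornerMap_lift {A L : SSet.{u}} {i : A ⟶ L} (h : HasLiftingProperty i (cornerMap W w))
    (α : A ⟶ W.obj (op Z)) (β₁ : L ⟶ W.obj (op Y₁)) (β₂ : L ⟶ W.obj (op Y₂))
    (hβ : β₁ ≫ W.map f₁.op = β₂ ≫ W.map f₂.op) (h₁ : i ≫ β₁ = α ≫ W.map g₁.op)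
    (h₂ : i ≫ β₂ = α ≫ W.map g₂.op) :
    ∃ β : L ⟶ W.obj (op Z), i ≫ β = α ∧ β ≫ W.map g₁.op = β₁ ∧ β ≫ W.map g₂.op = β₂ := by
  have sq : CommSq α i (cornerMap W w) (Limits.pullback.lift β₁ β₂ hβ) := ⟨Limits.pullback.hom_ext
    (by rw [Category.assoc, cornerMap_fst, Category.assoc, Limits.pullback.lift_fst, h₁])
    (by rw [Category.assoc, cornerMap_snd, Category.assoc, Limits.pullback.lift_snd, h₂])⟩
  refine ⟨sq.lift, sq.fac_left, ?_, ?_⟩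
  · rw [← cornerMap_fst W w, sq.fac_right_assoc, Limits.pullback.lift_fst]
  · rw [← cornerMap_snd W w, sq.fac_right_assoc, Limits.pullback.lift_snd]

lemma cornerMap_fibration (hW : InjectiveFibrant W) [Mono g₁] [Mono g₂]
    (h : ∀ {T : D} (h₁ : T ⟶ Y₁) (h₂ : T ⟶ Y₂), h₁ ≫ g₁ = h₂ ≫ g₂ →
      ∃ h₀, h₀ ≫ f₁ = h₁ ∧ h₀ ≫ f₂ = h₂) : Fibration (cornerMap W w) :=
  corner_fibration hW g₁ g₂ w h (IsPullback.of_hasPullback _ _) _ (cornerMap_fst W w)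
    (cornerMap_snd W w)

lemma restrict_fibration (hW : InjectiveFibrant W) {X Y : D} (f : X ⟶ Y) [Mono f] :
    Fibration (W.map f.op) := by
  have := homPre_fibration (yoneda.map f) hW
  have h : W.map f.op = (homYoneda Y W).inv ≫ homPre (yoneda.map f) W ≫ (homYoneda X W).hom := by
    rw [homPre_homYoneda, Iso.inv_hom_id_assoc]
  rw [h]
  infer_instance

lemma corner_kanComplex (hW : InjectiveFibrant W) (f₁ : Y₀ ⟶ Y₁) (f₂ : Y₀ ⟶ Y₂) [Mono f₁] :
    SSet.KanComplex (Limits.pullback (W.map f₁.op) (W.map f₂.op)) := by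
  have := kanComplex_obj hW
  have := restrict_fibration hW f₁
  have : Fibration (Limits.pullback.snd (W.map f₁.op) (W.map f₂.op)) :=
    fibration_of_isPullback (IsPullback.of_hasPullback _ _)
  exact isFibrant_of_fibration (Limits.pullback.snd (W.map f₁.op) (W.map f₂.op))

end
end

/-! ### Segal objects -/

section
variable {C : Type u} [SmallCategory.{u} C]

open Theta

lemma mono_toDiag {t : C} (ht : Limits.IsTerminal t) {m n : ℕ} (φ : Fin (m + 1) →o Fin (n + 1))
    (hφ : Function.Injective φ) : Mono (toDiag ht (diag t m) φ) where
  right_cancellation _ _ e := hom_diag_ext ht fun a ↦ hφ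
    (congrArg (fun k : _ ⟶ diag t n ↦ (k.φ a : Fin (n + 1))) e)

instance {X : Theta C} (f : zero ⟶ X) : Mono f := ⟨fun _ _ _ ↦ hom_zero_ext _ _⟩

lemma mono_ed {t : C} (ht : Limits.IsTerminal t) {m : ℕ} (a b : Fin (m + 1)) (h : a ≤ b) (h' : a ≠ b) :
    Mono (ed ht a b h) := by
  refine mono_toDiag ht (m := 1) _ fun i j hij ↦ ?_
  fin_cases i <;> fin_cases j
  exacts [rfl, absurd hij h', absurd hij.symm h', rfl]

lemma mono_tri {t : C} (ht : Limits.IsTerminal t) {m : ℕ} (a b c : Fin (m + 1)) (h : a ≤ b)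
    (h' : b ≤ c) (hab : a ≠ b) (hbc : b ≠ c) : Mono (tri ht a b c h h') := by
  have hac : a ≠ c := fun e ↦ hab (le_antisymm h (h'.trans e.ge))
  refine mono_toDiag ht (m := 2) _ fun i j hij ↦ ?_
  fin_cases i <;> fin_cases j
  exacts [rfl, absurd hij hab, absurd hij hac, absurd hij.symm hab, rfl, absurd hij hbc,
    absurd hij.symm hac, absurd hij.symm hbc, rfl]

/-- The vertices of `[n](t, …, t)`. -/
def dvert (t : C) {n : ℕ} (v : Fin (n + 1)) : zero ⟶ diag t n := vertex (diag t n) v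

/-- The edges of the spine of `[n](t, …, t)`. -/
def dedge (t : C) {n : ℕ} (i : Fin n) : one t ⟶ diag t n := edge (diag t n) i

/-- The simplicial set of spines of shape `[n](t, …, t)`. -/
structure SpineSpace (W : (Theta C)ᵒᵖ ⥤ SSet.{u}) (t : C) (n : ℕ) where
  /-- the space -/
  pt : SSet.{u}
  /-- the vertices -/
  v : Fin (n + 1) → (pt ⟶ W.obj (op zero))
  /-- the edges -/
  e : Fin n → (pt ⟶ W.obj (op (one t)))
  /-- the spine of an element -/
  toPt : W.obj (op (diag t n)) ⟶ pt
  e_src i : e i ≫ W.map (src t).op = v i.castSucc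
  e_tgt i : e i ≫ W.map (tgt t).op = v i.succ
  toPt_v i : toPt ≫ v i = W.map (dvert t i).op
  toPt_e i : toPt ≫ e i = W.map (dedge t i).op
  hom_ext {L : SSet.{u}} {f g : L ⟶ pt} (_ : ∀ i, f ≫ v i = g ≫ v i) (_ : ∀ i, f ≫ e i = g ≫ e i) :
    f = g
  exists_lift {L : SSet.{u}} (x : Fin (n + 1) → (L ⟶ W.obj (op zero)))
    (w : Fin n → (L ⟶ W.obj (op (one t)))) (_ : ∀ i, w i ≫ W.map (src t).op = x i.castSucc)
    (_ : ∀ i, w i ≫ W.map (tgt t).op = x i.succ) :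
    ∃ g : L ⟶ pt, (∀ i, g ≫ v i = x i) ∧ ∀ i, g ≫ e i = w i
  trivFib (_ : IsFibrantFor (segalMaps C) W) : TrivFib toPt

/-- The simplicial set of spines of shape `[n](t, …, t)`. -/
def spineSpace (W : (Theta C)ᵒᵖ ⥤ SSet.{u}) (t : C) (n : ℕ) : SpineSpace W t n where
  pt := homSpace (spine (diag t n)).toFunctor W
  v := spineVertex W (diag t n)
  e := spineEdge W (diag t n)
  toPt := toSpine W (diag t n)
  e_src i := spineEdge_vertex W (diag t n) i 0
  e_tgt i := spineEdge_vertex W (diag t n) i 1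
  toPt_v _ := rfl
  toPt_e _ := rfl
  hom_ext := spineSpace_hom_ext (X := diag t n)
  exists_lift x w h₁ h₂ := exists_spineSpace_lift (X := diag t n) x w fun i a ↦ by
    fin_cases a
    exacts [h₁ i, h₂ i]
  trivFib hW := toSpine_trivFib hW (diag t n)

section
variable {t : C} (ht : Limits.IsTerminal t) (n : ℕ)

/-- The inclusion of the first vertices. -/
def initHom : diag t n ⟶ diag t (n + 1) :=
  toDiag ht (diag t n) ⟨Fin.castSucc, Fin.strictMono_castSucc.monotone⟩

instance : Mono (initHom ht n) := mono_toDiag ht _ (Fin.castSucc_injective _)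

/-- The last edge. -/
def lastEdge : one t ⟶ diag t (n + 1) := ed ht (Fin.last n).castSucc (Fin.last (n + 1)) (Fin.le_last _)

lemma segal_w : dvert t (Fin.last n) ≫ initHom ht n = src t ≫ lastEdge ht n :=
  hom_diag_ext ht fun (a : Fin 1) ↦ by fin_cases a; rfl

variable {n} in
lemma dvert_castSucc (v : Fin (n + 1)) : dvert t v ≫ initHom ht n = dvert t v.castSucc :=
  hom_diag_ext ht fun (a : Fin 1) ↦ by fin_cases a; rfl

variable {n} in
lemma dedge_castSucc (i : Fin n) : dedge t i ≫ initHom ht n = dedge t i.castSucc :=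
  hom_diag_ext ht fun (a : Fin 2) ↦ by fin_cases a <;> rfl

lemma dvert_last : tgt t ≫ lastEdge ht n = dvert t (Fin.last (n + 1)) :=
  hom_diag_ext ht fun (a : Fin 1) ↦ by fin_cases a; rfl

lemma dedge_last : lastEdge ht n = dedge t (Fin.last n) :=
  hom_diag_ext ht fun (a : Fin 2) ↦ by fin_cases a <;> rfl

variable {W : (Theta C)ᵒᵖ ⥤ SSet.{u}}

/-- Since the labels are terminal, morphisms into `[m](t, …, t)` are just monotone maps, so
intersections can be computed on vertices; here the two faces meet in a single vertex, that is in
`[0]`. -/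
lemma vertex_corner_fibration (hW : InjectiveFibrant W) {m₁ m₂ m : ℕ}
    (φ₁ : Fin (m₁ + 1) →o Fin (m + 1)) (φ₂ : Fin (m₂ + 1) →o Fin (m + 1)) (x₀ y₀)
    (h₁ : Function.Injective φ₁) (h₂ : Function.Injective φ₂)
    (h : ∀ x y, φ₁ x = φ₂ y → x = x₀ ∧ y = y₀)
    (w : dvert t x₀ ≫ toDiag ht (diag t m₁) φ₁ = dvert t y₀ ≫ toDiag ht (diag t m₂) φ₂) :
    Fibration (cornerMap W w) := by
  have := mono_toDiag ht φ₁ h₁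
  have := mono_toDiag ht φ₂ h₂
  have e {T : Theta C} {k₁ : T ⟶ diag t m₁} {k₂ : T ⟶ diag t m₂}
      (e : k₁ ≫ toDiag ht (diag t m₁) φ₁ = k₂ ≫ toDiag ht (diag t m₂) φ₂) (a) :
      (k₁.φ a : Fin (m₁ + 1)) = x₀ ∧ (k₂.φ a : Fin (m₂ + 1)) = y₀ :=
    h _ _ (congrArg (fun k : _ ⟶ diag t m ↦ (k.φ a : Fin (m + 1))) e)
  exact cornerMap_fibration _ hW fun {T} _ _ e' ↦ ⟨toZero T, hom_diag_ext ht fun a ↦ (e e' a).1.symm,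
    hom_diag_ext ht fun a ↦ (e e' a).2.symm⟩

lemma segal_fibration (hW : InjectiveFibrant W) : Fibration (cornerMap W (segal_w ht n)) := by
  refine vertex_corner_fibration (m₁ := n) (m₂ := 1) ht hW ⟨Fin.castSucc, Fin.strictMono_castSucc.monotone⟩
    (mono₁ (Fin.last n).castSucc (Fin.last (n + 1)) (Fin.le_last _)) (Fin.last n) 0
    (Fin.castSucc_injective _) (fun i j hij ↦ ?_) (fun x y hxy ↦ ?_) (segal_w ht n)
  · fin_cases i <;> fin_cases j
    exacts [rfl, absurd hij (Fin.castSucc_lt_last _).ne, absurd hij.symm (Fin.castSucc_lt_last _).ne, rfl]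
  · fin_cases y
    · exact ⟨Fin.castSucc_injective _ hxy, rfl⟩
    · exact absurd hxy (Fin.castSucc_lt_last _).ne

/-- The map `r` to spines of length `n + 1` replaces the part on `[n](t, …, t)` by its spine, so it
is trivial by the Segal condition for `n`. Its composite with the corner map is the Segal map for `n
+ 1`, and two out of three applies. -/
lemma segal_trivFib (hW : IsFibrantFor (segalMaps C) W) : TrivFib (cornerMap W (segal_w ht n)) := by
  have := corner_kanComplex hW.injectiveFibrant (dvert t (Fin.last n)) (src t)
  have := segal_fibration ht n hW.injectiveFibrant
  let Q := Limits.pullback (W.map (dvert t (Fin.last n)).op) (W.map (src t).op)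
  let q₁ : Q ⟶ W.obj (op (diag t n)) := Limits.pullback.fst _ _
  let q₂ : Q ⟶ W.obj (op (one t)) := Limits.pullback.snd _ _
  have hq : q₁ ≫ W.map (dvert t (Fin.last n)).op = q₂ ≫ W.map (src t).op :=
    Limits.pullback.condition
  let S := spineSpace W t n
  let S' := spineSpace W t (n + 1)
  let x : Fin (n + 2) → (Q ⟶ W.obj (op zero)) :=
    Fin.lastCases (q₂ ≫ W.map (tgt t).op) fun v ↦ q₁ ≫ W.map (dvert t v).op
  let w : Fin (n + 1) → (Q ⟶ W.obj (op (one t))) :=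
    Fin.lastCases q₂ fun i ↦ q₁ ≫ W.map (dedge t i).op
  have hx₁ : x (Fin.last _) = q₂ ≫ W.map (tgt t).op := Fin.lastCases_last ..
  have hx₂ (v) : x (Fin.castSucc v) = q₁ ≫ W.map (dvert t v).op := Fin.lastCases_castSucc ..
  have hw₁ : w (Fin.last _) = q₂ := Fin.lastCases_last ..
  have hw₂ (i) : w (Fin.castSucc i) = q₁ ≫ W.map (dedge t i).op := Fin.lastCases_castSucc ..
  obtain ⟨r, hr₁, hr₂⟩ := S'.exists_lift x w
    (fun i ↦ by
      refine Fin.lastCases ?_ (fun j ↦ ?_) i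
      · rw [hw₁, hx₂, hq]
      · rw [hw₂, hx₂, ← S.toPt_v, ← S.toPt_e, Category.assoc, Category.assoc, S.e_src])
    (fun i ↦ by
      refine Fin.lastCases ?_ (fun j ↦ ?_) i
      · rw [hw₁, Fin.succ_last, hx₁]
      · rw [hw₂, Fin.succ_castSucc, hx₂, ← S.toPt_v, ← S.toPt_e, Category.assoc, Category.assoc, S.e_tgt])
  have h₁ : cornerMap W (segal_w ht n) ≫ r = S'.toPt := by
    refine S'.hom_ext (fun v ↦ ?_) fun i ↦ ?_
    · rw [Category.assoc, hr₁, S'.toPt_v]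
      refine Fin.lastCases ?_ (fun j ↦ ?_) v
      · rw [hx₁, ← Category.assoc, cornerMap_snd, ← Functor.map_comp, ← op_comp, dvert_last]
      · rw [hx₂, ← Category.assoc, cornerMap_fst, ← Functor.map_comp, ← op_comp, dvert_castSucc]
    · rw [Category.assoc, hr₂, S'.toPt_e]
      refine Fin.lastCases ?_ (fun j ↦ ?_) i
      · rw [hw₁, cornerMap_snd, dedge_last]
      · rw [hw₂, ← Category.assoc, cornerMap_fst, ← Functor.map_comp, ← op_comp, dedge_castSucc]
  have h₂ : TrivFib r := by
    refine .of_exists fun {A L} i _ a b hab ↦ ?_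
    obtain ⟨g, hg₁, hg₂⟩ := S.exists_lift (fun v ↦ b ≫ S'.v v.castSucc) (fun i ↦ b ≫ S'.e i.castSucc)
      (fun i ↦ by rw [Category.assoc, S'.e_src]) (fun i ↦ by rw [Category.assoc, S'.e_tgt, Fin.succ_castSucc])
    obtain ⟨β, hβ₁, hβ₂⟩ := (S.trivFib hW).exists_lift i (a ≫ q₁) g (by
      refine S.hom_ext (fun v ↦ ?_) fun j ↦ ?_
      · rw [Category.assoc, Category.assoc, S.toPt_v, Category.assoc, hg₁, ← reassoc_of% hab, hr₁, hx₂]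
      · rw [Category.assoc, Category.assoc, S.toPt_e, Category.assoc, hg₂, ← reassoc_of% hab, hr₂, hw₂])
    have hβ₃ : β ≫ W.map (dvert t (Fin.last n)).op = (b ≫ S'.e (Fin.last n)) ≫ W.map (src t).op := by
      rw [Category.assoc, S'.e_src, ← S.toPt_v, reassoc_of% hβ₂, hg₁]
    refine ⟨Limits.pullback.lift β _ hβ₃, Limits.pullback.hom_ext ?_ ?_, S'.hom_ext (fun v ↦ ?_) fun j ↦ ?_⟩
    · rw [Category.assoc, Limits.pullback.lift_fst, hβ₁]
    · rw [Category.assoc, Limits.pullback.lift_snd, ← reassoc_of% hab, hr₂, hw₁]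
    · rw [Category.assoc, hr₁]
      refine Fin.lastCases ?_ (fun j ↦ ?_) v
      · rw [hx₁, ← Fin.succ_last, ← S'.e_tgt, Limits.pullback.lift_snd_assoc, Category.assoc]
      · rw [hx₂, Limits.pullback.lift_fst_assoc, ← S.toPt_v, reassoc_of% hβ₂, hg₁]
    · rw [Category.assoc, hr₂]
      refine Fin.lastCases ?_ (fun j ↦ ?_) j
      · rw [hw₁, Limits.pullback.lift_snd]
      · rw [hw₂, Limits.pullback.lift_fst_assoc, ← S.toPt_e, reassoc_of% hβ₂, hg₂]
  exact trivFib_of_we _ (h₂.we.of_comp_right (h₁ ▸ (S'.trivFib hW).we))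

lemma source_corner_w : src t ≫ (ed ht 0 1 : one t ⟶ diag t 2) = src t ≫ ed ht 0 2 :=
  hom_diag_ext ht fun (a : Fin 1) ↦ by fin_cases a; rfl

lemma source_corner_fibration (hW : InjectiveFibrant W) :
    Fibration (cornerMap W (source_corner_w ht)) :=
  vertex_corner_fibration (m₁ := 1) (m₂ := 1) (m := 2) ht hW (mono₁ 0 1 (by decide))
    (mono₁ 0 2 (by decide)) 0 0 (by decide) (by decide) (by decide) (source_corner_w ht)

lemma target_corner_w : tgt t ≫ (ed ht 1 2 : one t ⟶ diag t 2) = tgt t ≫ ed ht 0 2 :=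
  hom_diag_ext ht fun (a : Fin 1) ↦ by fin_cases a; rfl

lemma target_corner_fibration (hW : InjectiveFibrant W) :
    Fibration (cornerMap W (target_corner_w ht)) :=
  vertex_corner_fibration (m₁ := 1) (m₂ := 1) (m := 2) ht hW (mono₁ 1 2 (by decide))
    (mono₁ 0 2 (by decide)) 1 1 (by decide) (by decide) (by decide) (target_corner_w ht)

lemma decomp_w : ed ht 0 (Fin.last (n + 1)) (Fin.zero_le _) ≫ initHom ht (n + 1) =
    (ed ht 0 1 : one t ⟶ diag t 2) ≫
      tri ht 0 (Fin.last (n + 1)).castSucc (Fin.last (n + 2)) (Fin.zero_le _) (Fin.le_last _) :=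
  hom_diag_ext ht fun (a : Fin 2) ↦ by fin_cases a <;> rfl

/-- The case `n = 1` of `segal_trivFib` as a lifting statement; the initial face is then the edge `0
→ 1`. -/
lemma triangle_lift (hW : IsFibrantFor (segalMaps C) W) {A L : SSet.{u}} (i : A ⟶ L) [hi : Mono i]
    (α : A ⟶ W.obj (op (diag t 2))) (f g : L ⟶ W.obj (op (one t)))
    (hfg : f ≫ W.map (tgt t).op = g ≫ W.map (src t).op) (hf : i ≫ f = α ≫ W.map (ed ht 0 1).op)
    (hg : i ≫ g = α ≫ W.map (ed ht 1 2).op) :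
    ∃ β : L ⟶ W.obj (op (diag t 2)), i ≫ β = α ∧ β ≫ W.map (ed ht 0 1).op = f ∧
      β ≫ W.map (ed ht 1 2).op = g := by
  have e : initHom ht 1 = ed ht 0 1 := hom_diag_ext ht fun (a : Fin 2) ↦ by fin_cases a <;> rfl
  have := cornerMap_lift (segal_w ht 1) (segal_trivFib ht 1 hW i hi) α f g hfg
    (by rw [e]; exact hf) hg
  rw [e] at this
  exact this

/-- `[n + 2]` is cut along the edge from `0` to `n + 1` into the face without the last vertex and
the triangle on `0`, `n + 1`, `n + 2`. Keeping only the last edge of the triangle is a trivial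
fibration by `triangle_lift`, and leads to the decomposition of `segal_trivFib`; two out of three
applies again. -/
lemma decomp_trivFib (hW : IsFibrantFor (segalMaps C) W) : TrivFib (cornerMap W (decomp_w ht n)) := by
  have h0 : (0 : Fin (n + 3)) ≠ (Fin.last (n + 1)).castSucc := fun h ↦
    absurd (congrArg Fin.val h) (Nat.succ_ne_zero n).symm
  have hl : (Fin.last (n + 1)).castSucc ≠ Fin.last (n + 2) := (Fin.castSucc_lt_last _).ne
  have : Mono (ed ht 0 (Fin.last (n + 1)) (Fin.zero_le _)) := mono_ed ht _ _ _ (Fin.last_pos).ne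
  have := mono_tri ht 0 (Fin.last (n + 1)).castSucc (Fin.last (n + 2)) (Fin.zero_le _) (Fin.le_last _)
    h0 hl
  have := corner_kanComplex hW.injectiveFibrant (ed ht 0 (Fin.last (n + 1)) (Fin.zero_le _))
    (ed ht 0 1 : one t ⟶ diag t 2)
  have : Fibration (cornerMap W (decomp_w ht n)) := by
    refine cornerMap_fibration _ hW.injectiveFibrant fun {T} h₁ h₂ e ↦ ?_
    -- A point of the intersection uses only the vertices `0` and `1` of the triangle, since `2`
    -- goes to the last vertex, which the other face omits.
    have key (a) : (h₁.φ a : Fin (n + 2)) = ![0, Fin.last (n + 1), 0] (h₂.φ a : Fin 3) ∧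
        (h₂.φ a : Fin 3) ≠ 2 := by
      have e : Fin.castSucc (h₁.φ a : Fin (n + 2)) =
          ![0, (Fin.last (n + 1)).castSucc, Fin.last (n + 2)] (h₂.φ a : Fin 3) :=
        congrArg (fun k : _ ⟶ diag t (n + 2) ↦ (k.φ a : Fin (n + 3))) e
      revert e
      generalize (h₁.φ a : Fin (n + 2)) = x
      generalize (h₂.φ a : Fin 3) = y
      intro e
      fin_cases y
      · exact ⟨Fin.castSucc_injective _ e, nofun⟩
      · exact ⟨Fin.castSucc_injective _ e, nofun⟩
      · exact absurd e (Fin.castSucc_lt_last _).ne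
    have aux₁ (y : Fin 3) (p : y.1 < 1 + 1) (hy : y ≠ 2) :
        mono₁ 0 (Fin.last (n + 1)) (Fin.zero_le _) ⟨y.1, p⟩ = ![0, Fin.last (n + 1), 0] y := by
      fin_cases y
      exacts [rfl, rfl, absurd rfl hy]
    have aux₂ (y : Fin 3) (p : y.1 < 1 + 1) (hy : y ≠ 2) :
        mono₁ (m := 2) 0 1 (by decide) ⟨y.1, p⟩ = y := by
      fin_cases y
      exacts [rfl, rfl, absurd rfl hy]
    -- The factorization through the common edge is `h₂` itself, read with values in `Fin 2`.
    refine ⟨toDiag ht T (m := 1) ⟨fun a ↦ ⟨(h₂.φ a : Fin 3).1, ?_⟩, fun a b hab ↦ h₂.φ.monotone hab⟩,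
      hom_diag_ext ht fun a ↦ ?_, hom_diag_ext ht fun a ↦ ?_⟩
    · have := (key a).2
      have h3 : (h₂.φ a : Fin 3).1 < 3 := (h₂.φ a).2
      have h2 : (h₂.φ a : Fin 3).1 ≠ 2 := fun h ↦ this (Fin.ext h)
      change (h₂.φ a : Fin 3).1 < 2
      omega
    · exact (aux₁ _ _ (key a).2).trans (key a).1.symm
    · exact aux₂ _ _ (key a).2
  let Q := Limits.pullback (W.map (ed ht 0 (Fin.last (n + 1)) (Fin.zero_le _)).op)
    (W.map (ed ht 0 1 : one t ⟶ diag t 2).op)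
  let q₁ : Q ⟶ W.obj (op (diag t (n + 1))) := Limits.pullback.fst _ _
  let q₂ : Q ⟶ W.obj (op (diag t 2)) := Limits.pullback.snd _ _
  have hq : q₁ ≫ W.map (ed ht 0 (Fin.last (n + 1)) (Fin.zero_le _)).op =
      q₂ ≫ W.map (ed ht 0 1).op := Limits.pullback.condition
  have e₁ : dvert t (Fin.last (n + 1)) = tgt t ≫ ed ht 0 (Fin.last (n + 1)) (Fin.zero_le _) :=
    hom_diag_ext ht fun (a : Fin 1) ↦ by fin_cases a; rfl
  have e₂ : src t ≫ (ed ht 1 2 : one t ⟶ diag t 2) = tgt t ≫ ed ht 0 1 :=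
    hom_diag_ext ht fun (a : Fin 1) ↦ by fin_cases a; rfl
  have hr : q₁ ≫ W.map (dvert t (Fin.last (n + 1))).op =
      (q₂ ≫ W.map (ed ht 1 2).op) ≫ W.map (src t).op := by
    rw [Category.assoc, ← Functor.map_comp, ← op_comp, e₂, e₁, op_comp, op_comp, Functor.map_comp,
      Functor.map_comp, reassoc_of% hq]
  let r : Q ⟶ Limits.pullback (W.map (dvert t (Fin.last (n + 1))).op) (W.map (src t).op) :=
    Limits.pullback.lift q₁ (q₂ ≫ W.map (ed ht 1 2).op) hr
  have hr₁ : r ≫ Limits.pullback.fst _ _ = q₁ := Limits.pullback.lift_fst _ _ _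
  have hr₂ : r ≫ Limits.pullback.snd _ _ = q₂ ≫ W.map (ed ht 1 2).op := Limits.pullback.lift_snd _ _ _
  have h₁ : cornerMap W (decomp_w ht n) ≫ r = cornerMap W (segal_w ht (n + 1)) := by
    refine Limits.pullback.hom_ext ?_ ?_
    · rw [Category.assoc, hr₁, cornerMap_fst, cornerMap_fst]
    · rw [Category.assoc, hr₂, cornerMap_snd, ← Category.assoc, cornerMap_snd, ← Functor.map_comp,
        ← op_comp]
      congr 2
      exact hom_diag_ext ht fun (a : Fin 2) ↦ by fin_cases a <;> rfl
  have h₂ : TrivFib r := by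
    refine .of_exists fun {A L} i _ a b hab ↦ ?_
    obtain ⟨β, hβ₁, hβ₂, hβ₃⟩ := triangle_lift ht hW i (a ≫ q₂)
      (b ≫ Limits.pullback.fst _ _ ≫ W.map (ed ht 0 (Fin.last (n + 1)) (Fin.zero_le _)).op)
      (b ≫ Limits.pullback.snd _ _)
      (by
        rw [Category.assoc, Category.assoc, Category.assoc, ← Functor.map_comp, ← op_comp, ← e₁,
          Limits.pullback.condition])
      (by rw [← reassoc_of% hab, reassoc_of% hr₁, hq, Category.assoc])
      (by rw [← reassoc_of% hab, hr₂, Category.assoc])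
    refine ⟨Limits.pullback.lift (b ≫ Limits.pullback.fst _ _) β (by rw [hβ₂, Category.assoc]),
      Limits.pullback.hom_ext ?_ ?_, Limits.pullback.hom_ext ?_ ?_⟩
    · rw [Category.assoc, Limits.pullback.lift_fst, ← reassoc_of% hab, hr₁]
    · rw [Category.assoc, Limits.pullback.lift_snd, hβ₁]
    · rw [Category.assoc, hr₁, Limits.pullback.lift_fst]
    · rw [Category.assoc, hr₂, Limits.pullback.lift_snd_assoc, hβ₃]
  exact trivFib_of_we _ (h₂.we.of_comp_right (h₁ ▸ (segal_trivFib ht (n + 1) hW).we))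

end
end

/-! ### Fibres -/

/-- The fibre of a map over a vertex. -/
def fibre {E B : SSet.{u}} (p : E ⟶ B) (b : B _⦋0⦌) : SSet.{u} :=
  Limits.pullback p (SSet.const b : ⊤_ SSet.{u} ⟶ B)

section
variable {E B : SSet.{u}} (p : E ⟶ B) (b : B _⦋0⦌)

/-- The inclusion of a fibre. -/
def fibreι : fibre p b ⟶ E := Limits.pullback.fst _ _

lemma fibre_isPullback : IsPullback (fibreι p b) (Limits.terminal.from _) p (SSet.const b) := by
  have h := IsPullback.of_hasPullback p (SSet.const b : ⊤_ SSet.{u} ⟶ B)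
  rwa [Limits.terminalIsTerminal.hom_ext (Limits.pullback.snd p (SSet.const b : ⊤_ SSet.{u} ⟶ B))
    (Limits.terminal.from _)] at h

lemma fibreι_comp : fibreι p b ≫ p = SSet.const b := by
  rw [(fibre_isPullback p b).w, SSet.comp_const]

lemma fibre_kanComplex [Fibration p] : SSet.KanComplex (fibre p b) := by
  have : Fibration (Limits.terminal.from (fibre p b)) := fibration_of_isPullback (fibre_isPullback p b)
  exact (isFibrant_iff _).2 this

variable {p b}

/-- The map to a fibre. -/
def fibreLift {L : SSet.{u}} (k : L ⟶ E) (h : k ≫ p = SSet.const b) : L ⟶ fibre p b :=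
  (fibre_isPullback p b).lift k (Limits.terminal.from _) (by rw [h, SSet.comp_const])

lemma fibreLift_ι {L : SSet.{u}} (k : L ⟶ E) (h : k ≫ p = SSet.const b) : fibreLift k h ≫ fibreι p b = k :=
  (fibre_isPullback p b).lift_fst _ _ _

lemma fibre_hom_ext {L : SSet.{u}} {k k' : L ⟶ fibre p b} (h : k ≫ fibreι p b = k' ≫ fibreι p b) :
    k = k' :=
  (fibre_isPullback p b).hom_ext h (Limits.terminalIsTerminal.hom_ext _ _)

end

/-! ### The action of morphisms -/

section
variable {C : Type u} [SmallCategory.{u} C]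

open Theta

section
variable {t : C} (ht : Limits.IsTerminal t) {W : (Theta C)ᵒᵖ ⥤ SSet.{u}}

lemma src_const {X Y : Theta C} (g : X ⟶ Y) {L : SSet.{u}} (s : (W.obj (op Y)) _⦋0⦌) :
    (SSet.const s : L ⟶ _) ≫ W.map g.op = SSet.const (res W g s) := SSet.const_comp _ _

lemma map_map {X Y Z : Theta C} {g : X ⟶ Y} {h : Y ⟶ Z} {k : X ⟶ Z} (e : g ≫ h = k) :
    W.map h.op ≫ W.map g.op = W.map k.op := by
  rw [← Functor.map_comp, ← op_comp, e]

/-- The edges with a given source. -/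
abbrev Out (W : (Theta C)ᵒᵖ ⥤ SSet.{u}) (t : C) (a : ObjOf W) : SSet.{u} := fibre (W.map (src t).op) a

/-- The triangles with a given first edge. -/
abbrev TriOn (s : (W.obj (op (one t))) _⦋0⦌) : SSet.{u} :=
  fibre (W.map (ed ht 0 1 : one t ⟶ diag t 2).op) s

variable {a b c : ObjOf W} {s : (W.obj (op (one t))) _⦋0⦌}

/-- The leg opposite to the first vertex. -/
def legL (hs : res W (tgt t) s = b) : TriOn ht s ⟶ Out W t b :=
  fibreLift (fibreι _ _ ≫ W.map (ed ht 1 2).op) (by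
    have e : src t ≫ (ed ht 1 2 : one t ⟶ diag t 2) = tgt t ≫ ed ht 0 1 :=
      hom_diag_ext ht fun (a : Fin 1) ↦ by fin_cases a; rfl
    rw [Category.assoc, map_map e, ← map_map rfl, ← Category.assoc, fibreι_comp, src_const, hs])

/-- The leg starting at the first vertex. -/
def legP (hs : res W (src t) s = a) : TriOn ht s ⟶ Out W t a :=
  fibreLift (fibreι _ _ ≫ W.map (ed ht 0 2).op) (by
    have e : src t ≫ (ed ht 0 2 : one t ⟶ diag t 2) = src t ≫ ed ht 0 1 :=
      hom_diag_ext ht fun (a : Fin 1) ↦ by fin_cases a; rfl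
    rw [Category.assoc, map_map e, ← map_map rfl, ← Category.assoc, fibreι_comp, src_const, hs])

lemma legL_ι (hs : res W (tgt t) s = b) : legL ht hs ≫ fibreι _ _ = fibreι _ _ ≫ W.map (ed ht 1 2).op :=
  fibreLift_ι _ _

lemma legP_ι (hs : res W (src t) s = a) : legP ht hs ≫ fibreι _ _ = fibreι _ _ ≫ W.map (ed ht 0 2).op :=
  fibreLift_ι _ _

/-- By the Segal condition a triangle amounts to its first two edges, and here the first one is
fixed. -/
lemma legL_trivFib (hW : IsFibrantFor (segalMaps C) W) (hs : res W (tgt t) s = b) :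
    TrivFib (legL ht hs) := by
  refine .of_exists fun {A L} i _ α β h ↦ ?_
  obtain ⟨γ, h₁, h₂, h₃⟩ := triangle_lift ht hW i (α ≫ fibreι _ _) (SSet.const s) (β ≫ fibreι _ _)
    (by rw [Category.assoc, fibreι_comp, src_const, hs, SSet.comp_const])
    (by rw [Category.assoc, fibreι_comp, SSet.comp_const, SSet.comp_const])
    (by rw [← reassoc_of% h, legL_ι, Category.assoc])
  refine ⟨fibreLift γ h₂, fibre_hom_ext ?_, fibre_hom_ext ?_⟩
  · rw [Category.assoc, fibreLift_ι, h₁]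
  · rw [Category.assoc, legL_ι, ← Category.assoc, fibreLift_ι, h₃]

lemma legP_fibration (hW : InjectiveFibrant W) (hs : res W (src t) s = a) : Fibration (legP ht hs) := by
  have := source_corner_fibration (t := t) ht hW
  refine fibration_of_exists fun {A L} i hi α β h ↦ ?_
  obtain ⟨γ, h₁, h₂, h₃⟩ := cornerMap_lift (source_corner_w ht)
    (hi _ (by rwa [← HomotopicalAlgebra.fibration_iff])) (α ≫ fibreι _ _) (SSet.const s) (β ≫ fibreι _ _)
    (by rw [Category.assoc, fibreι_comp, src_const, hs, SSet.comp_const])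
    (by rw [Category.assoc, fibreι_comp, SSet.comp_const, SSet.comp_const])
    (by rw [← reassoc_of% h, legP_ι, Category.assoc])
  refine ⟨fibreLift γ h₂, fibre_hom_ext ?_, fibre_hom_ext ?_⟩
  · rw [Category.assoc, fibreLift_ι, h₁]
  · rw [Category.assoc, legP_ι, ← Category.assoc, fibreLift_ι, h₃]

variable (hW : IsFibrantFor (segalMaps C) W)

/-- The action of an edge on edges, by composition. -/
def act (hs₀ : res W (src t) s = a) (hs₁ : res W (tgt t) s = b) : Out W t b ⟶ Out W t a :=
  (legL_trivFib ht hW hs₁).exists_section.choose ≫ legP ht hs₀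

/-- Any two lifts along the trivial fibration `legL` are homotopic, so the action can be computed
with whatever family of triangles is at hand instead of the chosen section. -/
lemma act_unique (hs₀ : res W (src t) s = a) (hs₁ : res W (tgt t) s = b) {L : SSet.{u}}
    (k : L ⟶ TriOn ht s) : Htpy (k ≫ legL ht hs₁ ≫ act ht hW hs₀ hs₁) (k ≫ legP ht hs₀) := by
  have h := (legL_trivFib ht hW hs₁).htpy
    (f := k ≫ legL ht hs₁ ≫ (legL_trivFib ht hW hs₁).exists_section.choose) (g := k) (by
      rw [Category.assoc, Category.assoc, (legL_trivFib ht hW hs₁).exists_section.choose_spec]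
      rw [Category.comp_id])
  have := h.comp_right (legP ht hs₀)
  rwa [Category.assoc, Category.assoc] at this

lemma out_kanComplex (a : ObjOf W) (hW : InjectiveFibrant W) : SSet.KanComplex (Out W t a) := by
  have := restrict_fibration hW (src t)
  exact fibre_kanComplex _ _

/-- By the Segal condition `τ` extends, along with any edge out of its last vertex, to a simplex on
four vertices, in a family over `Out W t c`. Its faces `023`, `123` and `013` compute the actions of
`h`, `k` and `s`, and the edges they share identify the two sides. -/
lemma act_comp {k h : (W.obj (op (one t))) _⦋0⦌} (τ : (W.obj (op (diag t 2))) _⦋0⦌)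
    (hs : res W (ed ht 0 1) τ = s) (hk : res W (ed ht 1 2) τ = k) (hh : res W (ed ht 0 2) τ = h)
    (hs₀ : res W (src t) s = a) (hs₁ : res W (tgt t) s = b) (hk₀ : res W (src t) k = b)
    (hk₁ : res W (tgt t) k = c) (hh₀ : res W (src t) h = a) (hh₁ : res W (tgt t) h = c) :
    Htpy (act ht hW hk₀ hk₁ ≫ act ht hW hs₀ hs₁) (act ht hW hh₀ hh₁) := by
  have := out_kanComplex (t := t) a hW.injectiveFibrant
  have hv : dvert t (Fin.last 2) = tgt t ≫ ed ht 1 2 :=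
    hom_diag_ext ht fun (a : Fin 1) ↦ by fin_cases a; rfl
  obtain ⟨β, -, h₁, h₂⟩ := cornerMap_lift (segal_w ht 2)
    (segal_trivFib ht 2 hW (Limits.initial.to _) inferInstance) (Limits.initial.to _)
    (SSet.const τ : Out W t c ⟶ _) (fibreι _ _) (by
      rw [fibreι_comp, src_const, hv, res_comp, hk, hk₁])
    (Limits.initialIsInitial.hom_ext _ _) (Limits.initialIsInitial.hom_ext _ _)
  have E {X : Theta C} {f : X ⟶ diag t 2} {g : X ⟶ diag t 3} (e : f ≫ initHom ht 2 = g) :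
      β ≫ W.map g.op = SSet.const (res W f τ) := by
    rw [← src_const, ← h₁, Category.assoc, map_map e]
  have E' : (ed ht 2 3 : one t ⟶ diag t 3) = lastEdge ht 2 :=
    hom_diag_ext ht fun (a : Fin 2) ↦ by fin_cases a <;> rfl
  have F (x y z : Fin 4) (hxy : x ≤ y) (hyz : y ≤ z) :
      ed ht 0 1 ≫ tri ht x y z hxy hyz = ed ht x y hxy ∧
      ed ht 1 2 ≫ tri ht x y z hxy hyz = ed ht y z hyz ∧
      ed ht 0 2 ≫ tri ht x y z hxy hyz = ed ht x z (hxy.trans hyz) := by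
    refine ⟨hom_diag_ext ht fun (a : Fin 2) ↦ ?_, hom_diag_ext ht fun (a : Fin 2) ↦ ?_,
      hom_diag_ext ht fun (a : Fin 2) ↦ ?_⟩ <;> fin_cases a <;> rfl
  have H (x y z : Fin 3) (hxy : x ≤ y) {w : (W.obj (op (one t))) _⦋0⦌}
      (hw : res W (ed ht x y hxy) τ = w) : β ≫ W.map (ed ht x.castSucc y.castSucc hxy).op =
        SSet.const w := by
    rw [← hw]
    exact E (hom_diag_ext ht fun (a : Fin 2) ↦ by fin_cases a <;> rfl)
  let k₀₂₃ : Out W t c ⟶ TriOn ht h := fibreLift (β ≫ W.map (tri ht 0 2 3).op) (by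
    rw [Category.assoc, map_map (F 0 2 3 (by decide) (by decide)).1]
    exact H 0 2 2 (by decide) hh)
  let k₁₂₃ : Out W t c ⟶ TriOn ht k := fibreLift (β ≫ W.map (tri ht 1 2 3).op) (by
    rw [Category.assoc, map_map (F 1 2 3 (by decide) (by decide)).1]
    exact H 1 2 2 (by decide) hk)
  let k₀₁₃ : Out W t c ⟶ TriOn ht s := fibreLift (β ≫ W.map (tri ht 0 1 3).op) (by
    rw [Category.assoc, map_map (F 0 1 3 (by decide) (by decide)).1]
    exact H 0 1 2 (by decide) hs)
  have e₁ : k₀₂₃ ≫ legL ht hh₁ = 𝟙 _ := fibre_hom_ext (by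
    rw [Category.assoc, legL_ι, ← Category.assoc, fibreLift_ι, Category.assoc,
      map_map (F 0 2 3 (by decide) (by decide)).2.1, E', h₂, Category.id_comp])
  have e₂ : k₁₂₃ ≫ legL ht hk₁ = 𝟙 _ := fibre_hom_ext (by
    rw [Category.assoc, legL_ι, ← Category.assoc, fibreLift_ι, Category.assoc,
      map_map (F 1 2 3 (by decide) (by decide)).2.1, E', h₂, Category.id_comp])
  have e₃ : k₀₁₃ ≫ legL ht hs₁ = k₁₂₃ ≫ legP ht hk₀ := fibre_hom_ext (by
    rw [Category.assoc, legL_ι, ← Category.assoc, fibreLift_ι, Category.assoc,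
      map_map (F 0 1 3 (by decide) (by decide)).2.1, Category.assoc, legP_ι, ← Category.assoc,
      fibreLift_ι, Category.assoc, map_map (F 1 2 3 (by decide) (by decide)).2.2])
  have e₄ : k₀₁₃ ≫ legP ht hs₀ = k₀₂₃ ≫ legP ht hh₀ := fibre_hom_ext (by
    rw [Category.assoc, legP_ι, ← Category.assoc, fibreLift_ι, Category.assoc,
      map_map (F 0 1 3 (by decide) (by decide)).2.2, Category.assoc, legP_ι, ← Category.assoc,
      fibreLift_ι, Category.assoc, map_map (F 0 2 3 (by decide) (by decide)).2.2])
  have i₁ := act_unique ht hW hh₀ hh₁ k₀₂₃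
  rw [reassoc_of% e₁] at i₁
  have i₂ := (act_unique ht hW hk₀ hk₁ k₁₂₃).comp_right (act ht hW hs₀ hs₁)
  rw [reassoc_of% e₂, Category.assoc, ← reassoc_of% e₃] at i₂
  have i₃ := act_unique ht hW hs₀ hs₁ k₀₁₃
  rw [e₄] at i₃
  exact i₂.trans (i₃.trans i₁.symm)

/-- A degenerate triangle whose first edge is an identity has its other two edges equal. -/
lemma act_id (hs : res W (toZero (one t)) b = s) (hs₀ : res W (src t) s = b) (hs₁ : res W (tgt t) s = b) :
    Htpy (act ht hW hs₀ hs₁) (𝟙 _) := by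
  obtain ⟨d, e₀, e₁, e₂⟩ : ∃ d : diag t 2 ⟶ one t, ed ht 0 1 ≫ d = toZero (one t) ≫ src t ∧
      ed ht 1 2 ≫ d = 𝟙 (one t) ∧ ed ht 0 2 ≫ d = 𝟙 (one t) :=
    ⟨tri ht (m := 1) 0 0 1, hom_diag_ext ht (m := 1) fun (a : Fin 2) ↦ by fin_cases a <;> rfl,
      hom_diag_ext ht (m := 1) fun (a : Fin 2) ↦ by fin_cases a <;> rfl,
      hom_diag_ext ht (m := 1) fun (a : Fin 2) ↦ by fin_cases a <;> rfl⟩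
  let k : Out W t b ⟶ TriOn ht s := fibreLift (fibreι _ _ ≫ W.map d.op) (by
    rw [Category.assoc, map_map e₀, ← map_map rfl, ← Category.assoc, fibreι_comp, src_const, hs])
  have h₁ : k ≫ legL ht hs₁ = 𝟙 _ := fibre_hom_ext (by
    rw [Category.assoc, legL_ι, ← Category.assoc, fibreLift_ι, Category.assoc, map_map e₁, op_id,
      CategoryTheory.Functor.map_id, Category.comp_id, Category.id_comp])
  have h₂ : k ≫ legP ht hs₀ = 𝟙 _ := fibre_hom_ext (by
    rw [Category.assoc, legP_ι, ← Category.assoc, fibreLift_ι, Category.assoc, map_map e₂, op_id,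
      CategoryTheory.Functor.map_id, Category.comp_id, Category.id_comp])
  have := act_unique ht hW hs₀ hs₁ k
  rwa [reassoc_of% h₁, h₂] at this

/-- The triangles `σ` and `σ'` provide inverses of `s` on both sides, so by `act_comp` and `act_id`
the action of `s` is a homotopy equivalence. The action is a section of the trivial fibration `legL`
followed by `legP`; hence `legP` is a weak equivalence, besides being a fibration. -/
lemma legP_trivFib (hW : IsFibrantFor (segalMaps C) W) {σ σ' : (W.obj (op (diag t 2))) _⦋0⦌}
    (hs₀ : res W (src t) s = a) (hs₁ : res W (tgt t) s = b) (h₁ : res W (ed ht 0 1) σ = s)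
    (h₂ : res W (ed ht 0 2) σ = res W (toZero (one t)) a) (h₃ : res W (ed ht 1 2) σ' = s)
    (h₄ : res W (ed ht 0 2) σ' = res W (toZero (one t)) b) : TrivFib (legP ht hs₀) := by
  have hid (d : zero ⟶ one t) (x : ObjOf W) : res W d (res W (toZero (one t)) x) = x := by
    rw [← res_comp, res_congr (hom_zero_ext _ (𝟙 _)), res_id]
  have E {d d' : zero ⟶ one t} {e e' : one t ⟶ diag t 2} (h : d ≫ e = d' ≫ e') (τ : (W.obj (op (diag t 2))) _⦋0⦌) :
      res W d (res W e τ) = res W d' (res W e' τ) := by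
    rw [← res_comp, ← res_comp, h]
  have e₀ : tgt t ≫ (ed ht 0 1 : one t ⟶ diag t 2) = src t ≫ ed ht 1 2 :=
    hom_diag_ext ht fun (a : Fin 1) ↦ by fin_cases a; rfl
  have c₁ := act_comp ht hW σ h₁ rfl h₂ hs₀ hs₁ (by rw [← hs₁, ← h₁, E e₀])
    (by rw [E (target_corner_w ht), h₂, hid]) (hid _ _) (hid _ _)
  have c₂ := act_comp ht hW σ' rfl h₃ h₄ (by rw [E (source_corner_w ht), h₄, hid])
    (by rw [E e₀, h₃, hs₀]) hs₀ hs₁ (hid _ _) (hid _ _)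
  have := out_kanComplex (t := t) a hW.injectiveFibrant
  have := out_kanComplex (t := t) b hW.injectiveFibrant
  have d₁ := c₁.trans (act_id ht hW rfl (hid _ _) (hid _ _))
  have d₂ := c₂.trans (act_id ht hW rfl (hid _ _) (hid _ _))
  -- The two one-sided inverses of the action of `s` are homotopic to each other.
  have d₃ := (d₁.comp_right (act ht hW (by rw [E (source_corner_w ht), h₄, hid])
    (by rw [E e₀, h₃, hs₀]))).symm.trans ((Htpy.of_eq (Category.assoc _ _ _)).trans
    ((d₂.comp_left _).trans (.of_eq (Category.comp_id _))))
  have d₄ := ((d₃.symm.trans (.of_eq (Category.id_comp _))).comp_left (act ht hW hs₀ hs₁)).trans d₂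
  have hw := we_of_homotopyInverse d₄ d₁
  have hl := (legL_trivFib ht hW hs₁).we
  have hsec : SSetWeakEquiv (legL_trivFib ht hW hs₁).exists_section.choose :=
    hl.of_comp_right (by
      rw [(legL_trivFib ht hW hs₁).exists_section.choose_spec]
      exact we_iso _)
  have := legP_fibration ht hW.injectiveFibrant hs₀
  exact trivFib_of_we _ (hsec.of_comp_left hw)

end
end

section
variable {C : Type u} [SmallCategory.{u} C]

open Theta

/-! ### Mapping objects as fibres -/

/-- The two endpoints of an edge. -/
def ends (W : (Theta C)ᵒᵖ ⥤ SSet.{u}) (c : C) :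
    W.obj (op (one c)) ⟶ W.obj (op zero) ⊗ W.obj (op zero) :=
  CartesianMonoidalCategory.lift (W.map (src c).op) (W.map (tgt c).op)

/-- The two vertices are disjoint subobjects of `[1](c)`. This is what gives the strict fibres of
`ends`, the mapping objects, a homotopical meaning. -/
lemma ends_fibration {W : (Theta C)ᵒᵖ ⥤ SSet.{u}} (hW : InjectiveFibrant W) (c : C) :
    Fibration (ends W c) :=
  disjoint_fibration hW _ _ fun h₁ h₂ h ↦ by
    have : (0 : Fin 2) = 1 := congrArg (fun k : _ ⟶ one c ↦ (k.φ 0 : Fin 2)) h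
    exact absurd this (by decide)

section
variable {W : (Theta C)ᵒᵖ ⥤ SSet.{u}} (x y : ObjOf W)

/-- The inclusion of a mapping space. -/
def mapObjι (c : Cᵒᵖ) : (mapObj x y).obj c ⟶ W.obj (op (one c.unop)) := (mapFiber x y c.unop).ι

lemma mapObj_isPullback (c : Cᵒᵖ) : IsPullback (mapObjι x y c) (Limits.terminal.from _) (ends W c.unop)
    (SSet.const (show (W.obj (op zero) ⊗ W.obj (op zero)) _⦋0⦌ from (x, y))) := by
  refine .of_forall_isPullback_app fun n ↦ ?_
  rw [Limits.Types.isPullback_iff]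
  refine ⟨?_, fun _ _ h ↦ Subtype.ext h.1, fun w z h ↦ ⟨(⟨w, congrArg Prod.fst h, congrArg Prod.snd h⟩ :
    (mapFiber x y c.unop).toSSet.obj n), rfl, ?_⟩⟩
  · ext w
    exact Prod.ext w.2.1 w.2.2
  · exact SSet.yonedaEquiv.symm.injective (Limits.terminalIsTerminal.hom_ext _ _)

lemma mapObj_kanComplex (hW : InjectiveFibrant W) (c : Cᵒᵖ) : SSet.KanComplex ((mapObj x y).obj c) := by
  have := ends_fibration hW c.unop
  have : Fibration (Limits.terminal.from ((mapObj x y).obj c)) :=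
    fibration_of_isPullback (mapObj_isPullback x y c)
  exact (isFibrant_iff _).2 this

end

/-- `π₀` is the quotient by the equivalence relation generated by the edges, and in a Kan complex
the edges already define an equivalence relation. -/
lemma joined_of_mk_eq {K : SSet.{u}} [SSet.KanComplex K] {x y : K _⦋0⦌}
    (h : SSet.π₀.mk x = SSet.π₀.mk y) : Joined x y := by
  rw [SSet.π₀.mk_eq_mk_iff] at h
  induction h with
  | rel _ _ h => exact ⟨h.some.edge, h.some.src_eq, h.some.tgt_eq⟩
  | refl => exact .refl _
  | symm _ _ _ h => exact h.symm
  | trans _ _ _ _ _ h h' => exact h.trans h'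

/-! ### Isomorphisms of the homotopy category as edges with strict inverse triangles -/

section
variable {t : C} (ht : Limits.IsTerminal t) {W : (Theta C)ᵒᵖ ⥤ SSet.{u}}
  (hW : IsFibrantFor (segalMaps C) W)

include hW in
lemma HoHom.isPath {x y : ObjOf W} {f f' : (W.obj (op (one t))) _⦋0⦌} {hf₀ hf₁ hf₀' hf₁'}
    (h : (HoHom.mk f hf₀ hf₁ : HoHom W t x y) = HoHom.mk f' hf₀' hf₁') : IsPath W x y f f' := by
  have := mapObj_kanComplex x y hW.injectiveFibrant (op t)
  obtain ⟨e, h₁, h₂⟩ := joined_of_mk_eq h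
  exact ⟨e.1, congrArg Subtype.val h₁, congrArg Subtype.val h₂, e.2⟩

/-- Lifting of edges to triangles. -/
lemma exists_triangle_edge {Y₀ Y₁ Y₂ Z : Theta C} {f₁ : Y₀ ⟶ Y₁} {f₂ : Y₀ ⟶ Y₂} {g₁ : Y₁ ⟶ Z}
    {g₂ : Y₂ ⟶ Z} (w : f₁ ≫ g₁ = f₂ ≫ g₂) [Fibration (cornerMap W w)] (σ : (W.obj (op Z)) _⦋0⦌)
    (e₁ : (W.obj (op Y₁)) _⦋1⦌) (e₂ : (W.obj (op Y₂)) _⦋1⦌) (he : res W f₁ e₁ = res W f₂ e₂)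
    (h₁ : (W.obj _).δ 1 e₁ = res W g₁ σ) (h₂ : (W.obj _).δ 1 e₂ = res W g₂ σ) :
    ∃ e : (W.obj (op Z)) _⦋1⦌, (W.obj _).δ 1 e = σ ∧ res W g₁ e = e₁ ∧ res W g₂ e = e₂ := by
  obtain ⟨β, h₃, h₄, h₅⟩ := cornerMap_lift w (anodyne_δ 1 _ (by rwa [← HomotopicalAlgebra.fibration_iff]))
    (SSet.yonedaEquiv.symm σ) (SSet.yonedaEquiv.symm e₁) (SSet.yonedaEquiv.symm e₂)
    (by rw [SSet.yonedaEquiv_symm_comp, SSet.yonedaEquiv_symm_comp]; exact congrArg _ he)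
    (by rw [SSet.stdSimplex.δ_comp_yonedaEquiv_symm, SSet.yonedaEquiv_symm_comp, h₁]; rfl)
    (by rw [SSet.stdSimplex.δ_comp_yonedaEquiv_symm, SSet.yonedaEquiv_symm_comp, h₂]; rfl)
  refine ⟨SSet.yonedaEquiv β, ?_, ?_, ?_⟩
  · rw [← SSet.stdSimplex.yonedaEquiv_δ_comp, h₃, Equiv.apply_symm_apply]
  · exact ((SSet.yonedaEquiv_comp _ _).symm.trans (congrArg _ h₄)).trans (Equiv.apply_symm_apply _ _)
  · exact ((SSet.yonedaEquiv_comp _ _).symm.trans (congrArg _ h₅)).trans (Equiv.apply_symm_apply _ _)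

/-- An isomorphism of the homotopy category is represented by an edge with inverses on both sides. -/
lemma exists_inverse_triangles {x y : Ho ht hW} (g : x ≅ y) :
    ∃ (s : (W.obj (op (one t))) _⦋0⦌) (σ σ' : (W.obj (op (diag t 2))) _⦋0⦌),
      res W (src t) s = x.pt ∧ res W (tgt t) s = y.pt ∧ res W (ed ht 0 1) σ = s ∧
      res W (ed ht 0 2) σ = res W (toZero (one t)) x.pt ∧ res W (ed ht 1 2) σ' = s ∧
      res W (ed ht 0 2) σ' = res W (toZero (one t)) y.pt := by
  obtain ⟨s, hs₀, hs₁, hs⟩ := HoHom.exists_rep g.hom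
  obtain ⟨k, hk₀, hk₁, hk⟩ := HoHom.exists_rep g.inv
  have := source_corner_fibration (t := t) ht hW.injectiveFibrant
  have := target_corner_fibration (t := t) ht hW.injectiveFibrant
  have hdeg {K : SSet.{u}} (z : K _⦋0⦌) : K.δ 1 (K.σ 0 z) = z := SSet.δ_comp_σ_succ_apply 0 z
  have hdeg₀ {K : SSet.{u}} (z : K _⦋0⦌) : K.δ 0 (K.σ 0 z) = z := SSet.δ_comp_σ_self_apply 0 z
  have hσ (z : ObjOf W) : degen z _ = (W.obj (op zero)).σ 0 z :=
    ((congrArg ((W.obj _).map (SimplexCategory.σ 0).op) (degen_zero z).symm).trans (map_degen z _)).symm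
  obtain ⟨h, ⟨σ, hσ₁, hσ₂, hσ₃⟩, hh₀, hh₁⟩ := exists_isComposite ht hW hs₀ hs₁ hk₀ hk₁
  have e : (HoHom.mk h hh₀ hh₁ : HoHom W t x.pt x.pt) = 𝟙 x := by
    rw [← HoHom.mk_comp_mk ht hW ⟨σ, hσ₁, hσ₂, hσ₃⟩ hs₀ hs₁ hk₀ hk₁, hs, hk]
    exact g.hom_inv_id
  obtain ⟨γ, hγ₀, hγ₁, hγ₂, hγ₃⟩ := HoHom.isPath hW e
  -- The composite of `s` with a representative of the inverse is only joined to the identity by the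
  -- path `γ`. The triangle is moved along `γ` on its long edge while `s` stays fixed and the
  -- remaining edge follows; at the end the long edge is strictly an identity.
  obtain ⟨e, he₁, he₂, he₃⟩ := exists_triangle_edge (source_corner_w ht) σ ((W.obj _).σ 0 s) γ
    (by rw [hγ₂, hσ, ← hs₀]; exact res_map W _ _ _) (by rw [hσ₁, hdeg]) (by rw [hσ₃, hγ₀])
  obtain ⟨h', ⟨σ', hσ₁', hσ₂', hσ₃'⟩, hh₀', hh₁'⟩ := exists_isComposite ht hW hk₀ hk₁ hs₀ hs₁
  have e' : (HoHom.mk h' hh₀' hh₁' : HoHom W t y.pt y.pt) = 𝟙 y := by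
    rw [← HoHom.mk_comp_mk ht hW ⟨σ', hσ₁', hσ₂', hσ₃'⟩ hk₀ hk₁ hs₀ hs₁, hs, hk]
    exact g.inv_hom_id
  obtain ⟨γ', hγ₀', hγ₁', hγ₂', hγ₃'⟩ := HoHom.isPath hW e'
  obtain ⟨e', he₁', he₂', he₃'⟩ := exists_triangle_edge (target_corner_w ht) σ' ((W.obj _).σ 0 s) γ'
    (by rw [hγ₃', hσ, ← hs₁]; exact res_map W _ _ _) (by rw [hσ₂', hdeg]) (by rw [hσ₃', hγ₀'])
  refine ⟨s, (W.obj _).δ 0 e, (W.obj _).δ 0 e', hs₀, hs₁, ?_, ?_, ?_, ?_⟩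
  · exact (res_map W _ _ _).trans ((congrArg _ he₂).trans (hdeg₀ s))
  · exact (res_map W _ _ _).trans ((congrArg _ he₃).trans hγ₁)
  · exact (res_map W _ _ _).trans ((congrArg _ he₂').trans (hdeg₀ s))
  · exact (res_map W _ _ _).trans ((congrArg _ he₃').trans hγ₁')

/-! ### Stars -/

/-- The edge from the initial vertex to another one. -/
def starEdge {n : ℕ} (j : Fin (n + 1)) : one t ⟶ diag t (n + 1) := ed ht 0 j.succ (Fin.zero_le _)

/-- Cones with prescribed legs form a contractible space if composition with each leg is invertible.
A new vertex is added by gluing a triangle along the previous leg (`decomp_trivFib`); two edges of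
that triangle are prescribed, and `h` fills it. -/
lemma star_lift (hW : IsFibrantFor (segalMaps C) W) {a : ObjOf W} {n : ℕ}
    (e : Fin (n + 1) → (W.obj (op (one t))) _⦋0⦌) (he : ∀ j, res W (src t) (e j) = a)
    (h : ∀ j, TrivFib (legP ht (he j))) {A L : SSet.{u}} (i : A ⟶ L) [hi : Mono i]
    (α : A ⟶ W.obj (op (diag t (n + 1))))
    (hα : ∀ j, α ≫ W.map (starEdge ht j).op = SSet.const (e j)) :
    ∃ β, i ≫ β = α ∧ ∀ j, β ≫ W.map (starEdge ht j).op = SSet.const (e j) := by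
  induction n with
  | zero =>
    -- A cone on one vertex is its leg: `[1](t)` occurs under two names.
    obtain ⟨d, h₁, h₂⟩ : ∃ d : diag t 1 ⟶ one t, starEdge ht (0 : Fin 1) ≫ d = 𝟙 _ ∧
        d ≫ starEdge ht (0 : Fin 1) = 𝟙 _ :=
      ⟨𝟙 (one t), hom_diag_ext ht (m := 1) fun (a : Fin 2) ↦ by fin_cases a <;> rfl,
        hom_diag_ext ht (m := 1) fun (a : Fin 2) ↦ by fin_cases a <;> rfl⟩
    refine ⟨SSet.const (e 0) ≫ W.map d.op, ?_, fun j ↦ ?_⟩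
    · rw [← Category.assoc, SSet.comp_const, ← hα 0, Category.assoc, map_map h₂, op_id,
        CategoryTheory.Functor.map_id, Category.comp_id]
    · obtain rfl : j = 0 := Subsingleton.elim (α := Fin 1) _ _
      rw [Category.assoc, map_map h₁, op_id, CategoryTheory.Functor.map_id, Category.comp_id]
  | succ n ih =>
    have e₁ (j : Fin (n + 1)) : starEdge ht j ≫ initHom ht (n + 1) = starEdge ht j.castSucc :=
      hom_diag_ext ht fun (a : Fin 2) ↦ by fin_cases a <;> rfl
    obtain ⟨β₁, hβ₁, hβ₁'⟩ := ih (fun j ↦ e j.castSucc) (fun j ↦ he _) (fun j ↦ h _)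
      (α ≫ W.map (initHom ht (n + 1)).op) (fun j ↦ by rw [Category.assoc, map_map (e₁ j), hα])
    let d := tri ht (0 : Fin (n + 3)) (Fin.last (n + 1)).castSucc (Fin.last (n + 2)) (Fin.zero_le _) (Fin.le_last _)
    have e₂ : ed ht 0 1 ≫ d = starEdge ht (Fin.last n).castSucc :=
      hom_diag_ext ht fun (a : Fin 2) ↦ by fin_cases a <;> rfl
    have e₃ : ed ht 0 2 ≫ d = starEdge ht (Fin.last (n + 1)) :=
      hom_diag_ext ht fun (a : Fin 2) ↦ by fin_cases a <;> rfl
    -- In the triangle on `0` and the last two vertices, both edges at `0` are prescribed legs.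
    obtain ⟨β₂, hβ₂, hβ₂'⟩ := (h (Fin.last n).castSucc).exists_lift i
      (fibreLift (α ≫ W.map d.op) (by rw [Category.assoc, map_map e₂, hα]))
      (fibreLift (SSet.const (e (Fin.last _))) (by rw [src_const, he])) (fibre_hom_ext (by
        rw [Category.assoc, legP_ι, ← Category.assoc, fibreLift_ι, Category.assoc, map_map e₃, hα,
          Category.assoc, fibreLift_ι, SSet.comp_const]))
    have e₄ : ed ht 0 (Fin.last (n + 1)) (Fin.zero_le _) = starEdge ht (Fin.last n) :=
      hom_diag_ext ht fun (a : Fin 2) ↦ by fin_cases a <;> rfl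
    obtain ⟨β, h₁, h₂, h₃⟩ := cornerMap_lift (decomp_w ht n) (decomp_trivFib ht n hW i hi) α β₁
      (β₂ ≫ fibreι _ _) (by rw [e₄, hβ₁', Category.assoc, fibreι_comp, SSet.comp_const]) hβ₁
      (by rw [← Category.assoc, hβ₂, fibreLift_ι])
    refine ⟨β, h₁, fun j ↦ ?_⟩
    refine Fin.lastCases ?_ (fun j ↦ ?_) j
    · rw [← map_map e₃, ← Category.assoc, h₃, Category.assoc, ← legP_ι ht (he _), ← Category.assoc, hβ₂',
        fibreLift_ι]
    · rw [← map_map (e₁ j), ← Category.assoc, h₂, hβ₁']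

end

end

lemma joined_of_mapVertex {D : Type u} [SmallCategory.{u} D] {X W : Dᵒᵖ ⥤ SSet.{u}} {f g : X ⟶ W}
    (h : Joined (mapVertex f) (mapVertex g)) (d : Dᵒᵖ) (x : (X.obj d) _⦋0⦌) :
    Joined ((f.app d).app _ x) ((g.app d).app _ x) := by
  obtain ⟨e, h₁, h₀⟩ := h
  obtain ⟨H, rfl, rfl⟩ := exists_cylinder_of_edge e h₁ h₀
  have : Htpy ((cylEnd X 0 ≫ H).app d) ((cylEnd X 1 ≫ H).app d) := by
    refine .mk (H.app d) ?_ ?_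
    · ext n y
      exact congrArg ((H.app d).app n) (Prod.ext rfl (stdSimplex_ext fun i ↦ rfl))
    · ext n y
      exact congrArg ((H.app d).app n) (Prod.ext rfl (stdSimplex_ext fun i ↦ rfl))
  exact this.joined x

section
variable {C : Type u} [SmallCategory.{u} C]

open Theta

/-! ### Completeness -/

section
variable {t : C} (ht : Limits.IsTerminal t)

/-- The map of cones induced by a morphism. -/
def coneHom {X Y : Theta C} (g : X ⟶ Y) : diag t (X.len + 1) ⟶ diag t (Y.len + 1) :=
  toDiag ht (diag t (X.len + 1)) ⟨Fin.cases 0 fun i ↦ (g.φ i).succ, fun i j h ↦ by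
    induction i using Fin.cases with
    | zero => exact Fin.zero_le _
    | succ i =>
      induction j using Fin.cases with
      | zero => exact absurd h (not_le.2 (Fin.succ_pos i))
      | succ j => exact Fin.succ_le_succ_iff.2 (g.φ.monotone (Fin.succ_le_succ_iff.1 h))⟩

lemma coneHom_id (X : Theta C) : coneHom ht (𝟙 X) = 𝟙 _ :=
  hom_diag_ext ht fun (a : Fin (X.len + 2)) ↦ by
    induction a using Fin.cases <;> rfl

lemma coneHom_comp {X Y Z : Theta C} (g : X ⟶ Y) (h : Y ⟶ Z) :
    coneHom ht (g ≫ h) = coneHom ht g ≫ coneHom ht h :=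
  hom_diag_ext ht fun (a : Fin (X.len + 2)) ↦ by
    induction a using Fin.cases <;> rfl

lemma starEdge_coneHom {X Y : Theta C} (g : X ⟶ Y) (j : Fin (X.len + 1)) :
    starEdge ht j ≫ coneHom ht g = starEdge ht (g.φ j) :=
  hom_diag_ext ht fun (a : Fin 2) ↦ by fin_cases a <;> rfl

/-- The inclusion into the cone. -/
def toCone (X : Theta C) : X ⟶ diag t (X.len + 1) :=
  toDiag ht X ⟨Fin.succ, Fin.strictMono_succ.monotone⟩

lemma toCone_coneHom {X Y : Theta C} (g : X ⟶ Y) : toCone ht X ≫ coneHom ht g = g ≫ toCone ht Y :=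
  hom_diag_ext ht fun _ ↦ rfl

variable (C) in
/-- The discrete simplicial presheaf `π^* E`. -/
abbrev isoPresheaf : (Theta C)ᵒᵖ ⥤ SSet.{u} :=
  (discPresheaf (Theta C)).obj ((proj C).op ⋙ nerve WalkingIso.{u})

/-- The vertices of an element of `π^* E`. -/
def isoVertex {X : (Theta C)ᵒᵖ} {n} (z : ((isoPresheaf C).obj X).obj n) (j : Fin (X.unop.len + 1)) :
    WalkingIso.{u} :=
  (show ComposableArrows WalkingIso.{u} X.unop.len from z).obj j

variable (W : (Theta C)ᵒᵖ ⥤ SSet.{u}) (s : WalkingIso.{u} → (W.obj (op (one t))) _⦋0⦌)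

/-- The elements of `π^* E` with a cone whose legs are given by the vertices. -/
def starSub (X : (Theta C)ᵒᵖ) :
    ((isoPresheaf C).obj X ⊗ W.obj (op (diag t (X.unop.len + 1)))).Subcomplex where
  obj n := {z | ∀ j, res W (starEdge ht j) z.2 =
    (W.obj (op (one t))).map (SimplexCategory.const n.unop ⦋0⦌ 0).op (s (isoVertex z.1 j))}
  map {n m} θ z hz j := by
    refine (res_map W _ _ _).trans ((congrArg _ (hz j)).trans ?_)
    exact (Functor.map_comp_apply (W.obj (op (one t))) (SimplexCategory.const n.unop ⦋0⦌ 0).op θ _).symm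

/-- The elements of `π^* E` with a cone whose legs are given by the vertices. -/
def starPresheaf : (Theta C)ᵒᵖ ⥤ SSet.{u} where
  obj X := (starSub ht W s X).toSSet
  map {X Y} g :=
    { app n := ↾fun z ↦ ⟨(((isoPresheaf C).map g).app n z.1.1, res W (coneHom ht g.unop) z.1.2),
        fun j ↦ (res_comp W _ _ _).symm.trans ((res_congr (starEdge_coneHom ht g.unop j) _).trans (z.2 _))⟩
      naturality n m θ := by
        ext z
        exact Subtype.ext (Prod.ext rfl (res_map W _ _ _)) }
  map_id X := by
    ext n z
    refine Subtype.ext (Prod.ext ?_ ?_)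
    · exact app_congr ((isoPresheaf C).map_id X) n z.1.1
    · exact (res_congr (coneHom_id ht X.unop) z.1.2).trans (res_id W _)
  map_comp {X Y Z} g h := by
    ext n z
    refine Subtype.ext (Prod.ext ?_ ?_)
    · exact app_congr ((isoPresheaf C).map_comp g h) n z.1.1
    · exact (res_congr (coneHom_comp ht h.unop g.unop) z.1.2).trans (res_comp W _ _ _)

/-- The projection to `π^* E`. -/
def starProj : starPresheaf ht W s ⟶ isoPresheaf C where
  app X := (starSub ht W s X).ι ≫ fst _ _

/-- The map which forgets the cone point. -/
def starBase : starPresheaf ht W s ⟶ W where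
  app X := (starSub ht W s X).ι ≫ snd _ _ ≫ W.map (toCone ht X.unop).op
  naturality X Y g := by
    ext n z
    refine (res_comp W _ _ _).symm.trans ((res_congr (toCone_coneHom ht g.unop) _).trans ?_)
    exact res_comp W _ _ _

variable {W s}

/-- The base is discrete, so a simplex of it is a single element `v` of `π^* E`; the lifting problem
then concerns cones with the fixed legs `s (v_j)`, which is `star_lift`. -/
lemma starProj_trivFib (hW : IsFibrantFor (segalMaps C) W) {a : ObjOf W}
    (hs : ∀ v, res W (src t) (s v) = a) (h : ∀ v, TrivFib (legP ht (hs v))) (X : (Theta C)ᵒᵖ) :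
    TrivFib ((starProj ht W s).app X) := by
  refine .of_boundary fun n α b hab ↦ ?_
  let v : ((isoPresheaf C).obj X).obj (op ⦋n⦌) := SSet.yonedaEquiv b
  have hv (m) (x : (Δ[n] : SSet.{u}).obj m) : b.app m x = v := by
    refine Eq.trans ?_ (NatTrans.naturality_apply b (SSet.stdSimplex.objEquiv x).op
      (SSet.stdSimplex.objEquiv.symm (𝟙 ⦋n⦌)))
    exact congrArg (b.app m) (stdSimplex_ext fun i ↦ rfl)
  have hα (m) (x) : (α.app m x).1.1 = v :=
    (app_congr hab m x).trans (hv m _)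
  obtain ⟨β, hβ₁, hβ₂⟩ := star_lift ht hW (fun j ↦ s (isoVertex v j)) (fun j ↦ hs _) (fun j ↦ h _)
    (SSet.boundary.{u} n).ι (α ≫ (starSub ht W s X).ι ≫ snd _ _) (fun j ↦ by
      ext m x
      refine ((α.app m x).2 j).trans ?_
      exact congrArg (fun v ↦ (W.obj (op (one t))).map (SimplexCategory.const m.unop ⦋0⦌ 0).op
        (s (isoVertex (n := m) v j))) (hα m x))
  refine ⟨{ app m := ↾fun x ↦ ⟨(b.app m x, β.app m x), fun j ↦ ?_⟩
            naturality m k θ := ?_ }, ?_, ?_⟩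
  · refine (app_congr (hβ₂ j) m x).trans ?_
    exact congrArg (fun v ↦ (W.obj (op (one t))).map (SimplexCategory.const m.unop ⦋0⦌ 0).op
        (s (isoVertex (n := m) v j))) (hv m x).symm
  · ext x
    refine Subtype.ext (Prod.ext ?_ ?_)
    · exact NatTrans.naturality_apply b θ x
    · exact NatTrans.naturality_apply β θ x
  · ext m x
    exact Subtype.ext (Prod.ext (app_congr hab m x).symm (app_congr hβ₁ m x))
  · rfl

/-- Isomorphic objects of the homotopy category of a complete Segal object are joined by a path. -/
lemma joined_of_iso (hW : IsFibrantFor (segalMaps C) W)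
    (hc : SSetWeakEquiv (mapSpacePre (completenessMap C) W)) {x y : Ho ht hW} (g : x ≅ y) :
    Joined x.pt y.pt := by
  obtain ⟨s, σ, σ', h₀, h₁, h₂, h₃, h₄, h₅⟩ := exists_inverse_triangles ht hW g
  have hid (z : ObjOf W) (d : zero ⟶ one t) : res W d (res W (toZero (one t)) z) = z := by
    rw [← res_comp, res_congr (hom_zero_ext _ (𝟙 _)), res_id]
  have hid' (z : ObjOf W) (d : one t ⟶ diag t 2) :
      res W d (res W (toZero (diag t 2)) z) = res W (toZero (one t)) z := by
    rw [← res_comp, res_congr (hom_zero_ext _ (toZero _))]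
  -- The two objects of `E` index two legs out of `x`: the identity, and the edge `s` representing
  -- `g`.
  let s' : WalkingIso.{u} → (W.obj (op (one t))) _⦋0⦌ :=
    WalkingIso.rec (res W (toZero (one t)) x.pt) s
  have hs : ∀ v, res W (src t) (s' v) = x.pt := WalkingIso.rec (hid _ _) h₀
  -- The identity is its own inverse through totally degenerate triangles; for `s` the triangles
  -- come from `g`.
  have hs' : ∀ v, TrivFib (legP ht (hs v)) :=
    WalkingIso.rec
      (legP_trivFib ht hW (σ := res W (toZero (diag t 2)) x.pt) (σ' := res W (toZero (diag t 2)) x.pt) _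
        (hid _ _) (hid' _ _) (hid' _ _) (hid' _ _) (hid' _ _))
      (legP_trivFib ht hW _ h₁ h₂ h₃ h₄ h₅)
  have := kanComplex_obj hW.injectiveFibrant
  have := mapSpace_kanComplex hW.injectiveFibrant (B := starPresheaf ht W s')
  have := mapSpace_kanComplex hW.injectiveFibrant (B := isoPresheaf C)
  have := mapSpace_kanComplex hW.injectiveFibrant (B := (discYoneda (Theta C)).obj zero)
  -- Forgetting the cone points maps the cones to `W`; since cones are equivalent to `π^* E`, this
  -- descends up to homotopy to a diagram `k` on `π^* E`. Completeness makes `k` homotopic to a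
  -- constant diagram `c`.
  obtain ⟨k, hk⟩ := (mapSpacePre_we hW.injectiveFibrant (starProj ht W s') fun X ↦
    (starProj_trivFib ht hW hs hs' X).we).exists_joined (mapVertex (starBase ht W s'))
  obtain ⟨k, rfl⟩ := exists_eq_mapVertex k
  obtain ⟨c, hc⟩ := hc.exists_joined (mapVertex k)
  obtain ⟨c, rfl⟩ := exists_eq_mapVertex c
  have key (v : WalkingIso.{u}) : Joined
      ((c.app (op zero)).app (op ⦋0⦌) (𝟙 zero)) (res W (tgt t) (s' v)) := by
    let z : ((isoPresheaf C).obj (op zero)).obj (op ⦋0⦌) := ComposableArrows.mk₀ v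
    -- The cone with the single leg `s' v` lies over the object `v`, and its base is the target of
    -- that leg.
    let y : ((starPresheaf ht W s').obj (op zero)).obj (op ⦋0⦌) :=
      ⟨(z, (s' v : (W.obj (op (diag t 1))) _⦋0⦌)), fun j ↦ by
        obtain rfl : j = 0 := Subsingleton.elim (α := Fin 1) _ _
        have e : SimplexCategory.const ⦋0⦌ ⦋0⦌ 0 = 𝟙 _ := by ext i; fin_cases i; rfl
        have e' : starEdge ht (0 : Fin 1) = 𝟙 (diag t 1) :=
          hom_diag_ext ht fun (a : Fin 2) ↦ by fin_cases a <;> rfl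
        refine ((res_congr e' _).trans (res_id W _)).trans ?_
        refine (Functor.map_id_apply (W.obj (op (one t))) _ (s' v)).symm.trans ?_
        exact congrArg (fun k ↦ (W.obj (op (one t))).map (Quiver.Hom.op k) (s' v)) e.symm⟩
    have i₁ : Joined ((c.app (op zero)).app (op ⦋0⦌) (𝟙 zero)) ((k.app (op zero)).app (op ⦋0⦌) z) := by
      have := joined_of_mapVertex (f := completenessMap C ≫ c) hc (op zero) z
      rwa [show 𝟙 zero = toZero zero from hom_zero_ext _ _]
    have i₂ : Joined ((k.app (op zero)).app (op ⦋0⦌) z) (res W (tgt t) (s' v)) := by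
      have := joined_of_mapVertex (f := starProj ht W s' ≫ k) hk (op zero) y
      rwa [res_congr (show tgt t = toCone ht zero from hom_diag_ext ht (m := 1) fun (a : Fin 1) ↦ by
        fin_cases a; rfl)]
    exact i₁.trans i₂
  have k₀ := key .zero
  have k₁ := key .one
  rw [show s' .zero = res W (toZero (one t)) x.pt from rfl, hid] at k₀
  rw [show s' .one = s from rfl, h₁] at k₁
  exact k₀.quotient k₁

end

end

section
variable {C : Type u} [SmallCategory.{u} C]

open Theta

/-! ### Change of objects -/

/-- The simplicial presheaf with values the families of elements of `K` indexed by vertices. -/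
def coconst (C : Type u) [SmallCategory.{u} C] (K : SSet.{u}) : (Theta C)ᵒᵖ ⥤ SSet.{u} where
  obj X :=
    { obj n := (zero ⟶ X.unop) → K.obj n
      map θ := ↾fun w v ↦ K.map θ (w v)
      map_id n := by ext w v; exact Functor.map_id_apply K n (w v)
      map_comp θ η := by ext w v; exact Functor.map_comp_apply K θ η (w v) }
  map g :=
    { app n := ↾fun w v ↦ w (v ≫ g.unop)
      naturality _ _ _ := rfl }
  map_id X := by
    ext n w
    exact congrArg w (Category.comp_id _)
  map_comp g h := by
    ext n w
    exact congrArg w (Category.assoc _ h.unop g.unop).symm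

/-- The functoriality of `coconst`. -/
def coconstMap {K K' : SSet.{u}} (k : K ⟶ K') : coconst C K ⟶ coconst C K' where
  app X :=
    { app n := ↾fun w v ↦ k.app n (w v)
      naturality n m θ := by ext w; exact funext fun v ↦ NatTrans.naturality_apply k θ (w v) }

/-- The evaluation at a vertex. -/
def coev {K : SSet.{u}} {X : Theta C} (v : zero ⟶ X) : (coconst C K).obj (op X) ⟶ K where
  app n := ↾fun w ↦ w v

lemma coconst_ext {K L : SSet.{u}} {X : Theta C} {a b : L ⟶ (coconst C K).obj (op X)}
    (h : ∀ v, a ≫ coev v = b ≫ coev v) : a = b := by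
  ext n x
  exact funext fun v ↦ app_congr (h v) n x

/-- The map to a family. -/
def coconstLift {K L : SSet.{u}} {X : Theta C} (k : (zero ⟶ X) → (L ⟶ K)) :
    L ⟶ (coconst C K).obj (op X) where
  app n := ↾fun x v ↦ (k v).app n x
  naturality n m θ := by ext x; exact funext fun v ↦ NatTrans.naturality_apply (k v) θ x

lemma coconstMap_coev {K K' : SSet.{u}} (k : K ⟶ K') {X : Theta C} (v : zero ⟶ X) :
    (coconstMap k).app (op X) ≫ coev v = coev v ≫ k := rfl

lemma coconst_map_coev {K : SSet.{u}} {X Y : Theta C} (g : X ⟶ Y) (v : zero ⟶ X) :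
    (coconst C K).map g.op ≫ coev v = coev (v ≫ g) := rfl

/-- The vertices of a simplicial presheaf. -/
def toCoconst (W : (Theta C)ᵒᵖ ⥤ SSet.{u}) : W ⟶ coconst C (W.obj (op zero)) where
  app X := coconstLift (X := X.unop) fun v ↦ W.map v.op
  naturality X Y g := by
    ext n x
    exact funext fun v ↦ (res_comp W v g.unop x).symm

lemma toCoconst_coev (W : (Theta C)ᵒᵖ ⥤ SSet.{u}) {X : Theta C} (v : zero ⟶ X) :
    (toCoconst W).app (op X) ≫ coev v = W.map v.op := rfl

/-- The map to `coconst` given by a map of objects. -/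
def coconstAdj {A : (Theta C)ᵒᵖ ⥤ SSet.{u}} {K : SSet.{u}} (k : A.obj (op zero) ⟶ K) : A ⟶ coconst C K :=
  toCoconst A ≫ coconstMap k

/-- `coconst C K` is the right Kan extension of `K` from `[0]`, so maps into it are determined by
their values on objects. -/
lemma coconstAdj_ext {A : (Theta C)ᵒᵖ ⥤ SSet.{u}} {K : SSet.{u}} {a b : A ⟶ coconst C K}
    (h : a.app (op zero) ≫ coev (𝟙 zero) = b.app (op zero) ≫ coev (𝟙 zero)) : a = b := by
  refine NatTrans.ext (funext fun X ↦ coconst_ext (X := X.unop) fun v ↦ ?_)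
  have e (c : A ⟶ coconst C K) : c.app X ≫ coev v = A.map v.op ≫ c.app (op zero) ≫ coev (𝟙 zero) := by
    rw [← Category.assoc, c.naturality, Category.assoc, coconst_map_coev, Category.id_comp]
  rw [e, e, h]

lemma toCoconst_naturality {U V : (Theta C)ᵒᵖ ⥤ SSet.{u}} (f : U ⟶ V) :
    f ≫ toCoconst V = toCoconst U ≫ coconstMap (f.app (op zero)) :=
  coconstAdj_ext (by
    ext n x
    exact (app_res f (𝟙 zero) x).symm)

lemma htpy_coconstMap {K K' : SSet.{u}} {k k' : K ⟶ K'} (h : Htpy k k') (X : (Theta C)ᵒᵖ) :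
    Htpy ((coconstMap (C := C) k).app X) ((coconstMap k').app X) := by
  obtain ⟨H, rfl, rfl⟩ := htpy_iff.1 h
  exact .mk (coconstLift (X := X.unop) fun v ↦ coev v ▷ _ ≫ H) rfl rfl

/-- The values are powers of `K`, so a homotopy inverse of `k` can be applied factor by factor. -/
lemma coconstMap_we {K K' : SSet.{u}} [SSet.KanComplex K] [SSet.KanComplex K'] {k : K ⟶ K'}
    (hk : SSetWeakEquiv k) (X : (Theta C)ᵒᵖ) : SSetWeakEquiv ((coconstMap k).app X) := by
  obtain ⟨g, h₁, h₂⟩ := hk.exists_inverse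
  exact we_of_homotopyInverse (g := (coconstMap g).app X) (htpy_coconstMap h₁ X) (htpy_coconstMap h₂ X)

/-- The families of vertices as maps from a constant presheaf. -/
def coconstIso (W : (Theta C)ᵒᵖ ⥤ SSet.{u}) (X : Theta C) :
    homSpace ((Functor.const _).obj (zero ⟶ X)) W ≅ (coconst C (W.obj (op zero))).obj (op X) where
  hom := { app n := ↾fun g v ↦ g.app (op zero) v }
  inv := { app n := ↾fun w ↦
            { app Y := ↾fun v ↦ res W (toZero Y.unop) (w v)
              naturality Y Z g := by
                ext v
                exact (res_congr (hom_zero_ext _ _) _).trans (res_comp W _ _ _) }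
           naturality n m θ := by
             ext w
             refine NatTrans.ext (funext fun Y ↦ ?_)
             ext v
             exact res_map W _ _ _ }
  hom_inv_id := by
    ext n g
    refine NatTrans.ext (funext fun Y ↦ ?_)
    ext v
    exact (NatTrans.naturality_apply (show (Functor.const _).obj (zero ⟶ X) ⟶ W.flip.obj n from g)
      (toZero Y.unop).op v).symm
  inv_hom_id := by
    ext n w
    exact funext fun v ↦ (res_congr (hom_zero_ext _ (𝟙 _)) _).trans (res_id W _)

/-- As `[0]` is terminal, the vertices of `X` span a constant subpresheaf of the presheaf
represented by `X`, and `toCoconst` is restriction to it. -/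
lemma toCoconst_fibration {W : (Theta C)ᵒᵖ ⥤ SSet.{u}} (hW : InjectiveFibrant W) (X : (Theta C)ᵒᵖ) :
    Fibration ((toCoconst W).app X) := by
  let i : (Functor.const _).obj (zero ⟶ X.unop) ⟶ yoneda.obj X.unop :=
    { app Y := ↾fun v ↦ toZero Y.unop ≫ v
      naturality Y Z g := by
        ext v
        exact (congrArg (· ≫ v) (hom_zero_ext _ _)).trans (Category.assoc g.unop _ v) }
  have : ∀ Y, Mono (i.app Y) := fun Y ↦ (mono_iff_injective _).2 fun v v' h ↦ by
    have h : toZero Y.unop ≫ v = toZero Y.unop ≫ v' := h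
    have e : vertex Y.unop 0 ≫ toZero Y.unop = 𝟙 zero := hom_zero_ext _ _
    rw [← Category.id_comp v, ← e, Category.assoc, h, ← Category.assoc, e, Category.id_comp]
  have : Mono i := NatTrans.mono_of_mono_app _
  have := homPre_fibration i hW
  have h : (toCoconst W).app X = (homYoneda X.unop W).inv ≫ homPre i W ≫ (coconstIso W X.unop).hom := by
    ext n x
    exact funext fun v ↦ res_congr (show v = toZero zero ≫ v by
      rw [hom_zero_ext (toZero zero) (𝟙 _), Category.id_comp]) x
  rw [h]
  infer_instance

lemma coconst_kanComplex {W : (Theta C)ᵒᵖ ⥤ SSet.{u}} (hW : InjectiveFibrant W) (X : (Theta C)ᵒᵖ) :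
    SSet.KanComplex ((coconst C (W.obj (op zero))).obj X) := by
  have := homSpace_kanComplex ((Functor.const _).obj (zero ⟶ X.unop)) hW
  exact isFibrant_of_fibration (coconstIso W X.unop).inv

end

/-! ### Replacing the space of objects, and comparison of mapping objects -/

section
variable {C : Type u} [SmallCategory.{u} C]

open Theta

/-- The constant presheaf on the objects of a simplicial presheaf. -/
def constTo (A : (Theta C)ᵒᵖ ⥤ SSet.{u}) : (Functor.const _).obj (A.obj (op zero)) ⟶ A where
  app X := A.map (toZero X.unop).op
  naturality X Y g := by
    ext n x
    exact (res_congr (hom_zero_ext _ _) x).trans (res_comp A g.unop (toZero X.unop) x)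

lemma constTo_comp {A : (Theta C)ᵒᵖ ⥤ SSet.{u}} {X : Theta C} (v : zero ⟶ X) :
    (constTo A).app (op X) ≫ A.map v.op = 𝟙 _ := by
  ext n x
  exact (res_comp A _ _ x).symm.trans ((res_congr (hom_zero_ext _ (𝟙 _)) x).trans (res_id A x))

variable {V : (Theta C)ᵒᵖ ⥤ SSet.{u}} {K : SSet.{u}} (k : K ⟶ V.obj (op zero))

/-- The simplicial presheaf obtained from `V` by changing the objects along `k`. -/
def changeObj : (Theta C)ᵒᵖ ⥤ SSet.{u} := Limits.pullback (toCoconst V) (coconstMap k)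

/-- The projection to `V`. -/
def changeObjFst : changeObj k ⟶ V := Limits.pullback.fst _ _

/-- The objects. -/
def changeObjSnd : changeObj k ⟶ coconst C K := Limits.pullback.snd _ _

lemma changeObj_isPullback :
    IsPullback (changeObjFst k) (changeObjSnd k) (toCoconst V) (coconstMap k) :=
  IsPullback.of_hasPullback _ _

lemma changeObj_isPullback_app (X : (Theta C)ᵒᵖ) : IsPullback ((changeObjFst k).app X)
    ((changeObjSnd k).app X) ((toCoconst V).app X) ((coconstMap k).app X) :=
  (changeObj_isPullback k).map ((evaluation _ _).obj X)

/-- The identification of the objects. -/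
def changeObjZero : (changeObj k).obj (op zero) ⟶ K := (changeObjSnd k).app (op zero) ≫ coev (𝟙 zero)

lemma changeObjZero_comp : changeObjZero k ≫ k = (changeObjFst k).app (op zero) := by
  have h : (changeObjSnd k).app (op zero) ≫ coev (𝟙 zero) ≫ k = _ :=
    congrArg (· ≫ coev (𝟙 zero)) (changeObj_isPullback_app k (op zero)).w.symm
  refine (Category.assoc _ _ _).trans (h.trans ?_)
  ext n x
  exact res_id V _

/-- An extension to the pullback consists of a map to `V` and a map on objects to `K` that are
compatible. The latter is chosen first, as `K` is a Kan complex. The former is then extended from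
the union of `A` with the constant presheaf on the objects of `B`, where it is already prescribed.
-/
lemma changeObj_injectiveFibrant [SSet.KanComplex K] (hV : InjectiveFibrant V) :
    InjectiveFibrant (changeObj k) := by
  intro A B i hi hi' a
  obtain ⟨b₀, hb₀⟩ := (hi' (op zero)).exists_extension (a.app (op zero) ≫ changeObjZero k)
  obtain ⟨P, inl, inr, sq⟩ : ∃ (P : (Theta C)ᵒᵖ ⥤ SSet.{u}) (inl : _ ⟶ P) (inr : _ ⟶ P),
      IsPushout ((Functor.const _).map (i.app (op zero))) (constTo A) inl inr :=
    ⟨_, _, _, IsPushout.of_hasPushout _ _⟩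
  obtain ⟨p, hp₁, hp₂⟩ := sq.exists_desc (constTo B) i (by
    ext X : 2
    exact (i.naturality (toZero X.unop).op).symm)
  have hp : Mono p := by
    have (X : (Theta C)ᵒᵖ) : Mono (p.app X) := by
      have : Mono (inl.app X ≫ p.app X) := by
        rw [← NatTrans.comp_app, hp₁]
        have : Mono ((constTo B).app X ≫ B.map (vertex X.unop 0).op) := by
          rw [constTo_comp (X := X.unop)]
          infer_instance
        exact mono_of_mono _ (B.map (vertex X.unop 0).op)
      have : Mono (inr.app X ≫ p.app X) := by
        rw [← NatTrans.comp_app, hp₂]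
        infer_instance
      refine mono_of_isPushout (g := inl.app X) (i' := inr.app X) (sq.map ((evaluation _ _).obj X)) _ fun n x y h ↦ ?_
      have h : res B (toZero X.unop) x = (i.app X).app n y :=
        (app_congr (NatTrans.congr_app hp₁ X) n x).symm.trans
          (h.trans (app_congr (NatTrans.congr_app hp₂ X) n y))
      -- An element of `A` that is constant in `B` is recovered from its value at a vertex, so the
      -- intersection is the constant presheaf on the objects of `A`.
      have e : (i.app (op zero)).app n (res A (vertex X.unop 0) y) = x := by
        rw [app_res, ← h, ← res_comp, res_congr (hom_zero_ext _ (𝟙 _)), res_id]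
      refine ⟨_, e, app_injective i X n ?_⟩
      refine (app_res i (toZero X.unop) _).trans ((congrArg (res B _) e).trans h)
    exact NatTrans.mono_of_mono_app _
  have hp' : LevelwiseWeakEquiv p := fun X ↦ by
    -- `inr` is levelwise a pushout of the trivial cofibration on objects, so two out of three
    -- applies to `inr ≫ p = i`.
    refine (SSetWeakEquiv.of_isPushout (sq.map ((evaluation _ _).obj X)) (hi' (op zero))).of_comp_left ?_
    have := hi' X
    rw [← hp₂] at this
    exact this
  obtain ⟨b₁, hb₁⟩ := hV p hp hp' (sq.desc ((Functor.const _).map (b₀ ≫ k) ≫ constTo V)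
    (a ≫ changeObjFst k) (by
      rw [← Category.assoc, ← Functor.map_comp, ← Category.assoc, hb₀, Category.assoc,
        changeObjZero_comp]
      ext X : 2
      exact ((a ≫ changeObjFst k).naturality (toZero X.unop).op).symm))
  have h₁ : constTo B ≫ b₁ = (Functor.const _).map (b₀ ≫ k) ≫ constTo V := by
    rw [← hp₁, Category.assoc, hb₁, sq.inl_desc]
  have h₂ : i ≫ b₁ = a ≫ changeObjFst k := by
    rw [← hp₂, Category.assoc, hb₁, sq.inr_desc]
  have h₃ : b₁.app (op zero) = b₀ ≫ k := by
    have := congrArg (· ≫ V.map (𝟙 zero).op) (NatTrans.congr_app h₁ (op zero))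
    ext n x
    have e := app_congr this n x
    refine Eq.trans (congrArg ((b₁.app (op zero)).app n) (res_id B x).symm) ?_
    refine Eq.trans (congrArg (fun g ↦ (b₁.app (op zero)).app n (res B g x)) (hom_zero_ext _ (toZero zero))) ?_
    exact (res_id V _).symm.trans (e.trans (app_congr (constTo_comp (A := V) (𝟙 zero)) n _))
  refine ⟨(changeObj_isPullback k).lift b₁ (coconstAdj b₀) (coconstAdj_ext ?_), ?_⟩
  · ext n x
    exact (res_id V _).trans ((app_congr h₃ n x).trans
      (congrArg (fun y ↦ k.app n (b₀.app n y)) (res_id B x).symm))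
  · refine (changeObj_isPullback k).hom_ext ?_ (coconstAdj_ext ?_)
    · rw [Category.assoc, IsPullback.lift_fst, h₂]
    · rw [Category.assoc, IsPullback.lift_snd]
      ext n x
      refine (congrArg (fun y ↦ b₀.app n y) (res_id B _)).trans ?_
      exact app_congr hb₀ n x

/-- Vertices of `[1](c)`. -/
lemma eq_src_or_eq_tgt {c : C} (v : zero ⟶ one c) : v = src c ∨ v = tgt c := by
  have h : ∀ a : Fin 2, v.φ 0 = a → v = vertex (one c) a := fun a h ↦
    hom_ext (fun (b : Fin 1) ↦ by obtain rfl := Subsingleton.elim b 0; exact h) fun i ↦ i.elim0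
  have key : ∀ a : Fin 2, a = 0 ∨ a = 1 := by decide
  obtain h' | h' := key (v.φ (0 : Fin 1))
  · exact .inl (h _ h')
  · exact .inr (h _ h')

lemma eq_vertex {X : Theta C} (v : zero ⟶ X) : v = vertex X (v.φ (0 : Fin 1)) :=
  hom_ext (fun (b : Fin 1) ↦ by obtain rfl := Subsingleton.elim b 0; rfl) fun i ↦ i.elim0

/-- `[1](c)` has exactly the two vertices `src c` and `tgt c`, so a vertex of `coconst` at `[1](c)`
is a pair of objects. -/
lemma mapObj_isPullback_coconst {W : (Theta C)ᵒᵖ ⥤ SSet.{u}} {c : C}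
    {b : ((coconst C (W.obj (op zero))).obj (op (one c))) _⦋0⦌} {x y : ObjOf W}
    (hx : (coev (src c)).app _ b = x) (hy : (coev (tgt c)).app _ b = y) :
    IsPullback (mapObjι x y (op c)) (Limits.terminal.from _) ((toCoconst W).app (op (one c)))
      (SSet.const b) := by
  have sq := mapObj_isPullback x y (op c)
  have w : mapObjι x y (op c) ≫ (toCoconst W).app (op (one c)) =
      Limits.terminal.from _ ≫ SSet.const b := by
    refine coconst_ext fun v ↦ ?_
    subst hx hy
    obtain rfl | rfl := eq_src_or_eq_tgt v
    · exact (congrArg (· ≫ fst _ _) sq.w :)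
    · exact (congrArg (· ≫ snd _ _) sq.w :)
  refine ⟨⟨w⟩, ⟨Limits.PullbackCone.IsLimit.mk w (fun s ↦ sq.lift s.fst s.snd ?_)
    (fun s ↦ sq.lift_fst _ _ _) (fun s ↦ Limits.terminal.hom_ext _ _)
    (fun s m h _ ↦ sq.hom_ext (h.trans (sq.lift_fst _ _ _).symm) (Limits.terminal.hom_ext _ _))⟩⟩
  have h := s.condition
  subst hx hy
  refine CartesianMonoidalCategory.hom_ext _ _ ?_ ?_
  · exact (congrArg (· ≫ coev (src c)) h :)
  · exact (congrArg (· ≫ coev (tgt c)) h :)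

variable {U : (Theta C)ᵒᵖ ⥤ SSet.{u}} (f : U ⟶ V)

/-- The map to the presheaf with changed objects. -/
def toChangeObj : U ⟶ changeObj (f.app (op zero)) :=
  (changeObj_isPullback _).lift f (toCoconst U) (toCoconst_naturality f)

lemma toChangeObj_fst : toChangeObj f ≫ changeObjFst _ = f := IsPullback.lift_fst _ _ _ _

lemma toChangeObj_snd : toChangeObj f ≫ changeObjSnd _ = toCoconst U := IsPullback.lift_snd _ _ _ _

lemma changeObjSnd_fibration (hV : InjectiveFibrant V) (X) : Fibration ((changeObjSnd k).app X) :=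
  have := toCoconst_fibration hV X
  fibration_of_isPullback (changeObj_isPullback_app k X)

/-- Pasting of pullbacks: over a pair of objects of `U`, the fibre of `changeObj` is the mapping
object of `V` between their images. -/
lemma mapObjMap_isPullback {c : C} {b : ((coconst C (U.obj (op zero))).obj (op (one c))) _⦋0⦌}
    {x z : ObjOf U} (hx : (coev (src c)).app _ b = x) (hz : (coev (tgt c)).app _ b = z) :
    ∃ q, IsPullback q (Limits.terminal.from _) ((changeObjSnd (f.app (op zero))).app (op (one c)))
        (SSet.const b) ∧
      IsPullback (mapObjι x z (op c)) ((mapObjMap f x z).app (op c))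
        ((toChangeObj f).app (op (one c))) q := by
  have e : (toChangeObj f).app (op (one c)) ≫ (changeObjSnd _).app (op (one c)) =
      (toCoconst U).app (op (one c)) := NatTrans.congr_app (toChangeObj_snd f) _
  have sU := mapObj_isPullback_coconst hx hz
  have sV := mapObj_isPullback_coconst (W := V)
    (b := ((coconstMap (f.app (op zero))).app (op (one c))).app _ b)
    (congrArg ((f.app (op zero)).app _) hx) (congrArg ((f.app (op zero)).app _) hz)
  have sQ := changeObj_isPullback_app (f.app (op zero)) (op (one c))
  have e₁ : SSet.const b ≫ (coconstMap (f.app (op zero))).app (op (one c)) =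
      SSet.const (X := ⊤_ SSet.{u}) (((coconstMap (f.app (op zero))).app (op (one c))).app _ b) := by
    rw [SSet.const_comp]
  rw [← e₁] at sV
  have hq := IsPullback.of_right' sV sQ
  refine ⟨_, hq, IsPullback.of_bot (v₁₁ := (mapObjMap f x z).app (op c))
    (v₂₁ := Limits.terminal.from _)
    (v₂₂ := (changeObjSnd (f.app (op zero))).app (op (one c)))
    (v₁₂ := (toChangeObj f).app (op (one c))) (h₁₁ := mapObjι _ _ (op c))
    (h₃₁ := SSet.const b)
    (by rw [e, Limits.terminal.comp_from]; exact sU) (by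
      refine sQ.hom_ext ?_ ?_
      · rw [Category.assoc, Category.assoc, sQ.lift_fst, ← NatTrans.comp_app, toChangeObj_fst]
        rfl
      · rw [Category.assoc, Category.assoc, sQ.lift_snd, e, sU.w, ← Category.assoc,
          Limits.terminal.comp_from]) hq⟩

lemma toChangeObj_comp_fibration (hU : InjectiveFibrant U) (X) :
    Fibration ((toChangeObj f).app X ≫ (changeObjSnd _).app X) := by
  rw [← NatTrans.comp_app, toChangeObj_snd]
  exact toCoconst_fibration hU _

/-- Over a pair `(x, z)` of objects of `U` the map of fibres is `mapObjMap f x z`; fibrewise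
equivalences of fibrations are equivalences by `we_of_relLiftAt`. -/
lemma toChangeObj_one_relLift (hU : InjectiveFibrant U) (hV : InjectiveFibrant V)
    (h : ∀ x y : ObjOf U, LevelwiseWeakEquiv (mapObjMap f x y)) (c : C) :
    RelLift ((toChangeObj f).app (op (one c))) ((changeObjSnd _).app (op (one c))) := by
  have hr := changeObjSnd_fibration (f.app (op zero)) hV (op (one c))
  have hr' := toChangeObj_comp_fibration f hU (op (one c))
  have := kanComplex_obj hU (op zero)
  have := kanComplex_obj (changeObj_injectiveFibrant (f.app (op zero)) hV) (op (one c))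
  -- A degenerate edge will do: the fibres over all vertices are under control, not just over one in
  -- each component.
  refine RelLift.of_we _ (we_of_relLiftAt (r := (changeObjSnd _).app (op (one c))) fun b ↦
    ⟨((coconst C (U.obj (op zero))).obj (op (one c))).σ 0 b, SSet.δ_comp_σ_succ_apply 0 b, fun n y hy ↦ ?_⟩)
  rw [show ((coconst C (U.obj (op zero))).obj (op (one c))).δ 0
    (((coconst C (U.obj (op zero))).obj (op (one c))).σ 0 b) = b from SSet.δ_comp_σ_self_apply 0 b] at hy
  obtain ⟨x, hx⟩ : ∃ x : ObjOf U, (coev (src c)).app _ b = x := ⟨_, rfl⟩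
  obtain ⟨z, hz⟩ : ∃ z : ObjOf U, (coev (tgt c)).app _ b = z := ⟨_, rfl⟩
  obtain ⟨q, hq, hq'⟩ := mapObjMap_isPullback f hx hz
  have hy' : y ≫ (changeObjSnd (f.app (op zero))).app (op (one c)) =
      Limits.terminal.from _ ≫ SSet.const b := by
    rw [hy, SSet.comp_const]
  have h₀ := mapObj_kanComplex x z hU (op c)
  have h₁ := mapObj_kanComplex ((f.app _).app _ x) ((f.app _).app _ z) hV (op c)
  rw [← hq.lift_fst _ _ hy']
  exact RelLiftAt.of_isPullback hq hq' ((we_iff_relLift _).1 (h x z (op c)) _ _)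

/-- Relative form of `exists_homotopy_of_trivFib`, from the pushout product of `i` with the boundary
inclusion of `Δ[1]`. -/
lemma TrivFib.exists_homotopy_lift {A L E B : SSet.{u}} {r : E ⟶ B} (hr : TrivFib r) (i : A ⟶ L)
    [Mono i] (f g : L ⟶ E) (H : A ⊗ Δ[1] ⟶ E) (y : L ⊗ Δ[1] ⟶ B)
    (h₀ : SSet.ι₀ ≫ H = i ≫ f) (h₁ : SSet.ι₁ ≫ H = i ≫ g) (hy₀ : SSet.ι₀ ≫ y = f ≫ r)
    (hy₁ : SSet.ι₁ ≫ y = g ≫ r) (hy : H ≫ r = i ▷ _ ≫ y) :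
    ∃ G : L ⊗ Δ[1] ⟶ E, SSet.ι₀ ≫ G = f ∧ SSet.ι₁ ≫ G = g ∧ i ▷ _ ≫ G = H ∧ G ≫ r = y := by
  obtain ⟨G, h₂, h₃, h₄⟩ := exists_lift_pushoutProduct
    (TrivFib.hasLiftingProperty_pushoutProduct i (SSet.boundary.{u} 1).ι hr) (boundaryGlue f g) H y
    (by
      rw [whiskerLeft_boundary_ι h₀ h₁]
      ext n z
      rfl)
    (by
      rw [whiskerLeft_boundary_ι hy₀ hy₁]
      ext n z
      exact apply_ite (r.app n) _ _ _) hy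
  exact ⟨G, ι₀_of_boundary h₂, ι₁_of_boundary h₂, h₃, h₄⟩

/-- The Segal condition reduces the problem to edges. The homotopies found on edges lie over
`coconst`, so they keep the vertices fixed; hence they agree at common vertices and glue to spines.
The spines are filled by the trivial fibrations `toSpine`, first for the lift in `U` and then for
the homotopy in `V`. -/
lemma toChangeObj_relLift (hU : IsFibrantFor (segalMaps C) U) (hV : IsFibrantFor (segalMaps C) V)
    (h : ∀ c, RelLift ((toChangeObj f).app (op (one c))) ((changeObjSnd _).app (op (one c))))
    (X : Theta C) : RelLift ((toChangeObj f).app (op X)) ((changeObjSnd _).app (op X)) := by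
  intro A L i _ y a ha
  have eψ (Y) : (toChangeObj f).app Y ≫ (changeObjSnd _).app Y = (toCoconst U).app Y :=
    NatTrans.congr_app (toChangeObj_snd f) _
  have eψ' (Y) : (toChangeObj f).app Y ≫ (changeObjFst _).app Y = f.app Y :=
    NatTrans.congr_app (toChangeObj_fst f) _
  have sQ := fun Y ↦ changeObj_isPullback_app (f.app (op zero)) (op Y)
  choose c h hc h₀ h₁ h₂ h₃ using fun j ↦ h (X.label j) i (y ≫ (changeObj _).map (edge X j).op)
    (a ≫ U.map (edge X j).op) (by
      rw [Category.assoc, (toChangeObj f).naturality, reassoc_of% ha])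
  -- the vertices
  let x (v : Fin (X.len + 1)) : L ⟶ U.obj (op zero) := y ≫ (changeObjSnd _).app _ ≫ coev (vertex X v)
  have hedge (j) (v : zero ⟶ one (X.label j)) : (y ≫ (changeObj (f.app (op zero))).map (edge X j).op) ≫
      (changeObjSnd _).app _ ≫ coev v = y ≫ (changeObjSnd _).app _ ≫ coev (v ≫ edge X j) := by
    rw [Category.assoc, (changeObjSnd (f.app (op zero))).naturality_assoc, coconst_map_coev]
  have hx (v) : i ≫ x v = a ≫ U.map (vertex X v).op := by
    rw [← Category.assoc, ← ha, Category.assoc, reassoc_of% (eψ (op X)), toCoconst_coev]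
  have hcx (j) (v) : c j ≫ U.map (Quiver.Hom.op v) = y ≫ (changeObjSnd _).app _ ≫ coev (v ≫ edge X j) := by
    have := congrArg (SSet.ι₀ ≫ · ≫ coev v) (h₂ j)
    simp only [reassoc_of% (h₀ j), Category.assoc, SSet.ι₀_fst_assoc] at this
    rw [reassoc_of% (eψ (op (one (X.label j)))), toCoconst_coev] at this
    rw [this]
    simpa only [Category.assoc] using hedge j v
  have hhx (j) (v : zero ⟶ one (X.label j)) : h j ≫ (changeObjFst _).app _ ≫ V.map v.op =
      fst _ _ ≫ y ≫ (changeObjSnd _).app _ ≫ coev (v ≫ edge X j) ≫ f.app (op zero) := by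
    rw [← toCoconst_coev V v, reassoc_of% (sQ (one (X.label j))).w, coconstMap_coev,
      reassoc_of% (h₂ j), reassoc_of% (hedge j v)]
  -- The edges `c j` have the vertices `x` already determined by `y`, so they form a spine in `U`.
  obtain ⟨g, hg, hg'⟩ := exists_spineSpace_lift (W := U) x c fun j b ↦ by
    rw [hcx, vertex_edge]
  obtain ⟨c', hc', hc''⟩ := (toSpine_trivFib hU X).exists_lift i a g (by
    refine spineSpace_hom_ext (fun v ↦ ?_) fun j ↦ ?_
    · rw [Category.assoc, Category.assoc, toSpine_vertex, hg, hx]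
    · rw [Category.assoc, Category.assoc, toSpine_edge, hg', hc])
  obtain ⟨G, hG, hG'⟩ := exists_spineSpace_lift (W := V) (X := X) (fun v ↦ fst L Δ[1] ≫ x v ≫ f.app _)
    (fun j ↦ h j ≫ (changeObjFst _).app _) fun j b ↦ by
      rw [Category.assoc, hhx, vertex_edge]
      simp only [x, Category.assoc]
  have hcv (v) : c' ≫ U.map (vertex X v).op = x v := by
    rw [← toSpine_vertex, reassoc_of% hc'', hg]
  have hce (j) : c' ≫ U.map (edge X j).op = c j := by
    rw [← toSpine_edge, reassoc_of% hc'', hg']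
  have hyv (v : zero ⟶ X) : y ≫ (changeObjFst _).app _ ≫ V.map v.op =
      y ≫ (changeObjSnd _).app _ ≫ coev v ≫ f.app (op zero) := by
    rw [← toCoconst_coev V v, reassoc_of% (sQ X).w, coconstMap_coev]
  -- The homotopy in `V` has its two ends, its restriction to `A` and its spine prescribed; it
  -- exists because `toSpine` is a trivial fibration.
  obtain ⟨H, hH₀, hH₁, hH₂, hH₃⟩ := (toSpine_trivFib hV X).exists_homotopy_lift i (c' ≫ f.app (op X))
    (y ≫ (changeObjFst _).app _) (fst _ _ ≫ a ≫ f.app _) G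
    (by rw [SSet.ι₀_fst_assoc, reassoc_of% hc'])
    (by rw [SSet.ι₁_fst_assoc, ← reassoc_of% ha, eψ'])
    (by
      refine spineSpace_hom_ext (fun v ↦ ?_) fun j ↦ ?_
      · simp only [Category.assoc, toSpine_vertex, hG, SSet.ι₀_fst_assoc, ← f.naturality,
          reassoc_of% (hcv v)]
      · simp only [Category.assoc, toSpine_edge, hG', reassoc_of% (h₀ j), eψ', ← f.naturality,
          reassoc_of% (hce j)])
    (by
      refine spineSpace_hom_ext (fun v ↦ ?_) fun j ↦ ?_
      · simp only [Category.assoc, toSpine_vertex, hG, SSet.ι₁_fst_assoc, hyv, x]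
      · simp only [Category.assoc, toSpine_edge, hG', reassoc_of% (h₁ j), NatTrans.naturality])
    (by
      refine spineSpace_hom_ext (fun v ↦ ?_) fun j ↦ ?_
      · simp only [Category.assoc, toSpine_vertex, hG, CartesianMonoidalCategory.whiskerRight_fst_assoc,
          reassoc_of% (hx v), ← f.naturality]
      · simp only [Category.assoc, toSpine_edge, hG', reassoc_of% (h₃ j), eψ', ← f.naturality])
  refine ⟨c', (sQ X).lift H (fst _ _ ≫ y ≫ (changeObjSnd _).app _) (coconst_ext fun v ↦ ?_), hc', ?_, ?_,
    (sQ X).lift_snd _ _ _, ?_⟩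
  · rw [Category.assoc, toCoconst_coev, eq_vertex v, ← toSpine_vertex, reassoc_of% hH₃, hG]
    simp only [x, Category.assoc, coconstMap_coev]
  · refine (sQ X).hom_ext ?_ ?_
    · rw [Category.assoc, IsPullback.lift_fst, hH₀, Category.assoc, eψ']
    · rw [Category.assoc, IsPullback.lift_snd, Category.assoc, eψ, SSet.ι₀_fst_assoc]
      refine coconst_ext fun v ↦ ?_
      rw [Category.assoc, Category.assoc, toCoconst_coev, eq_vertex v, hcv]
  · refine (sQ X).hom_ext ?_ ?_
    · rw [Category.assoc, IsPullback.lift_fst, hH₁]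
    · rw [Category.assoc, IsPullback.lift_snd, SSet.ι₁_fst_assoc]
  · refine (sQ X).hom_ext ?_ ?_
    · rw [Category.assoc, IsPullback.lift_fst, hH₂, Category.assoc, Category.assoc, eψ']
    · rw [Category.assoc, IsPullback.lift_snd, Category.assoc, Category.assoc, reassoc_of% ha,
        CartesianMonoidalCategory.whiskerRight_fst_assoc]

/-- A map that is a weak equivalence on mapping objects is a weak equivalence up to the change of
objects. -/
lemma toChangeObj_we (hU : IsFibrantFor (segalMaps C) U) (hV : IsFibrantFor (segalMaps C) V)
    (h : ∀ x y : ObjOf U, LevelwiseWeakEquiv (mapObjMap f x y)) : LevelwiseWeakEquiv (toChangeObj f) := by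
  intro X
  have hr := changeObjSnd_fibration (f.app (op zero)) hV.injectiveFibrant X
  have hr' := toChangeObj_comp_fibration f hU.injectiveFibrant X
  exact (toChangeObj_relLift f hU hV
    (toChangeObj_one_relLift f hU.injectiveFibrant hV.injectiveFibrant h) X.unop).we

/-- Right properness: this is a base change of `coconstMap k` along the fibration `toCoconst V`. -/
lemma changeObjFst_we (hV : InjectiveFibrant V) {V₀ : (Theta C)ᵒᵖ ⥤ SSet.{u}}
    (hV₀ : InjectiveFibrant V₀) {k : V₀.obj (op zero) ⟶ V.obj (op zero)} (hk : SSetWeakEquiv k) :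
    LevelwiseWeakEquiv (changeObjFst k) := by
  intro X
  have := kanComplex_obj hV₀ (op zero)
  have := kanComplex_obj hV (op zero)
  have := coconst_kanComplex hV₀ X
  have := coconst_kanComplex hV X
  have := toCoconst_fibration hV X
  exact we_of_isPullback (changeObj_isPullback_app k X) (coconstMap_we hk X)

/-- Levelwise weak equivalences induce weak equivalences of mapping objects. -/
lemma mapObjMap_we (hU : InjectiveFibrant U) (hV : InjectiveFibrant V) (hf : LevelwiseWeakEquiv f)
    (x y : ObjOf U) : LevelwiseWeakEquiv (mapObjMap f x y) := by
  intro c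
  have hr := changeObjSnd_fibration (f.app (op zero)) hV (op (one c.unop))
  have hr' := toChangeObj_comp_fibration f hU (op (one c.unop))
  have := kanComplex_obj hU (op zero)
  have := kanComplex_obj (changeObj_injectiveFibrant (f.app (op zero)) hV) (op (one c.unop))
  -- `f` and `changeObjFst` are equivalences, hence so is `toChangeObj f`; being a map of fibrations
  -- over `coconst`, it then is an equivalence on the fibre over `(x, y)`.
  have h : SSetWeakEquiv ((toChangeObj f).app (op (one c.unop))) := by
    refine (changeObjFst_we hV hU (hf (op zero)) _).of_comp_right ?_
    have := hf (op (one c.unop))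
    rwa [← toChangeObj_fst f] at this
  let b : ((coconst C (U.obj (op zero))).obj (op (one c.unop))) _⦋0⦌ := fun v ↦
    (![x, y] : Fin 2 → ObjOf U) (v.φ (0 : Fin 1))
  obtain ⟨q, hq, hq'⟩ := mapObjMap_isPullback f (c := c.unop) (b := b) (x := x) (z := y) rfl rfl
  have h₀ := mapObj_kanComplex x y hU c
  have h₁ := mapObj_kanComplex ((f.app _).app _ x) ((f.app _).app _ y) hV c
  exact (we_iff_relLift _).2 ((RelLift.of_we _ h).of_isPullback hq hq')

end

/-! ### Evaluation of maps out of presheaves of sets -/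

section
variable {D : Type u} [SmallCategory.{u} D]

/-- The evaluation at an element of a presheaf. -/
def evalAt {P : Dᵒᵖ ⥤ Type u} {X : D} (z : P.obj (op X)) (W : Dᵒᵖ ⥤ SSet.{u}) :
    homSpace P W ⟶ W.obj (op X) where
  app n := ↾fun g ↦ (show P ⟶ W.flip.obj n from g).app _ z

lemma homPost_evalAt {P : Dᵒᵖ ⥤ Type u} {X : D} (z : P.obj (op X)) {W W' : Dᵒᵖ ⥤ SSet.{u}}
    (f : W ⟶ W') : homPost P f ≫ evalAt z W' = evalAt z W ≫ f.app _ := rfl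

lemma homPre_evalAt {P P' : Dᵒᵖ ⥤ Type u} (i : P ⟶ P') {X : D} (z : P.obj (op X))
    (W : Dᵒᵖ ⥤ SSet.{u}) : homPre i W ≫ evalAt z W = evalAt (i.app _ z) W := rfl

lemma homPre_yonedaEquiv {P : Dᵒᵖ ⥤ Type u} {X : D} (z : P.obj (op X)) (W : Dᵒᵖ ⥤ SSet.{u}) :
    homPre (yonedaEquiv.symm z) W ≫ (homYoneda X W).hom = evalAt z W := by
  ext n g
  exact congrArg ((show P ⟶ W.flip.obj n from g).app _) (Functor.map_id_apply P (op X) z)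

lemma homPost_isPullback (P : Dᵒᵖ ⥤ Type u) {W W₁ W₂ W₃ : Dᵒᵖ ⥤ SSet.{u}} {f₁ : W ⟶ W₁} {f₂ : W ⟶ W₂}
    {g₁ : W₁ ⟶ W₃} {g₂ : W₂ ⟶ W₃} (sq : IsPullback f₁ f₂ g₁ g₂) :
    IsPullback (homPost P f₁) (homPost P f₂) (homPost P g₁) (homPost P g₂) := by
  have sq' (n) : IsPullback (((flipFunctor _ _ _).map f₁).app n) (((flipFunctor _ _ _).map f₂).app n)
      (((flipFunctor _ _ _).map g₁).app n) (((flipFunctor _ _ _).map g₂).app n) :=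
    IsPullback.of_forall_isPullback_app fun d ↦
      (sq.map ((evaluation _ _).obj d)).map ((evaluation _ _).obj n)
  refine IsPullback.of_forall_isPullback_app fun n ↦ (Limits.Types.isPullback_iff _ _ _ _).2 ⟨?_, ?_, ?_⟩
  · ext g
    exact congrArg (g ≫ ·) (sq' n).w
  · intro g g' h
    exact (sq' n).hom_ext h.1 h.2
  · intro g₁ g₂ h
    exact ⟨(sq' n).lift g₁ g₂ h, (sq' n).lift_fst _ _ _, (sq' n).lift_snd _ _ _⟩

end

/-! ### Completeness and the map on objects -/

section
variable {C : Type u} [SmallCategory.{u} C]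

open Theta

lemma homSpace_coconst_ext {P : (Theta C)ᵒᵖ ⥤ Type u} {K L : SSet.{u}}
    {a b : L ⟶ homSpace P (coconst C K)}
    (h : ∀ z : P.obj (op zero), a ≫ evalAt z _ ≫ coev (𝟙 zero) = b ≫ evalAt z _ ≫ coev (𝟙 zero)) :
    a = b := by
  ext n x
  refine NatTrans.ext (funext fun X ↦ ?_)
  ext z
  refine funext fun v ↦ ?_
  have key (c : P ⟶ (coconst C K).flip.obj n) :
      (show (zero ⟶ X.unop) → K.obj n from c.app X z) v =
        (show (zero ⟶ (zero : Theta C)) → K.obj n from c.app (op zero) (P.map v.op z)) (𝟙 zero) :=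
    (congrArg (show (zero ⟶ X.unop) → K.obj n from c.app X z) (Category.id_comp v)).symm.trans
      (congrFun (NatTrans.naturality_apply c v.op z) (𝟙 zero)).symm
  exact (key _).trans ((app_congr (h (P.map v.op z)) n x).trans (key _).symm)

lemma exists_homSpace_coconst_lift {P : (Theta C)ᵒᵖ ⥤ Type u} {K L : SSet.{u}}
    (k : P.obj (op zero) → (L ⟶ K)) :
    ∃ a : L ⟶ homSpace P (coconst C K), ∀ z, a ≫ evalAt z _ ≫ coev (𝟙 zero) = k z := by
  refine ⟨{ app n := ↾fun x ↦
              { app Y := ↾fun z v ↦ (k (P.map (Quiver.Hom.op v) z)).app n x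
                naturality Y Y' g := ?_ }
            naturality n m θ := ?_ }, fun z ↦ ?_⟩
  · ext z
    exact funext fun v ↦ congrArg (fun z ↦ (k z).app n x) (Functor.map_comp_apply P g v.op z).symm
  · ext x
    refine NatTrans.ext (funext fun Y ↦ ?_)
    ext z
    exact funext fun v ↦ NatTrans.naturality_apply (k (P.map (Quiver.Hom.op v) z)) θ x
  · ext n x
    exact congrArg (fun z ↦ (k z).app n x) (Functor.map_id_apply P _ z)

/-- Lifting anodyne extensions against the evaluations at all objects. -/
lemma exists_lift_evalAt {V : (Theta C)ᵒᵖ ⥤ SSet.{u}} (hV : InjectiveFibrant V)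
    {P : (Theta C)ᵒᵖ ⥤ Type u} {A L : SSet.{u}} {i : A ⟶ L} (hi : SSet.anodyneExtensions i)
    (a : A ⟶ homSpace P V) (b : P.obj (op zero) → (L ⟶ V.obj (op zero)))
    (h : ∀ z, a ≫ evalAt z V = i ≫ b z) : ∃ c, i ≫ c = a ∧ ∀ z, c ≫ evalAt z V = b z := by
  -- The objects of `P` span a constant subpresheaf, so prescribing all evaluations amounts to
  -- prescribing the restriction along a monomorphism.
  let j : (Functor.const _).obj (P.obj (op zero)) ⟶ P :=
    { app Y := ↾fun z ↦ P.map (toZero Y.unop).op z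
      naturality Y Y' g := by
        ext z
        refine Eq.trans ?_ (Functor.map_comp_apply P (toZero Y.unop).op g z)
        exact congrArg (fun k ↦ P.map (Quiver.Hom.op k) z) (hom_zero_ext _ (g.unop ≫ toZero Y.unop)) }
  have : ∀ Y, Mono (j.app Y) := fun Y ↦ (mono_iff_injective _).2 fun z z' h ↦ by
    have e (z) : P.map (vertex Y.unop 0).op (j.app Y z) = z :=
      (Functor.map_comp_apply P (toZero Y.unop).op (vertex Y.unop 0).op z).symm.trans
        ((congrArg (fun k ↦ P.map (Quiver.Hom.op k) z) (hom_zero_ext _ (𝟙 zero))).trans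
          (Functor.map_id_apply P _ z))
    rw [← e z, h, e]
  have : Mono j := NatTrans.mono_of_mono_app _
  have := homPre_fibration j hV
  let b' : L ⟶ homSpace ((Functor.const _).obj (P.obj (op zero))) V :=
    { app n := ↾fun x ↦
        { app Y := ↾fun z ↦ res V (toZero Y.unop) ((b z).app n x)
          naturality Y Y' g := by
            ext z
            exact (res_congr (hom_zero_ext _ _) _).trans (res_comp V g.unop (toZero Y.unop) _) }
      naturality n m θ := by
        ext x
        refine NatTrans.ext (funext fun Y ↦ ?_)
        ext z
        exact (congrArg (res V _) (NatTrans.naturality_apply (b z) θ x)).trans (res_map V _ _ _) }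
  obtain ⟨c, hc, hc'⟩ := anodyne_exists_lift (homPre j V) hi a b' (by
    ext n x
    refine NatTrans.ext (funext fun Y ↦ ?_)
    ext z
    refine (NatTrans.naturality_apply (show P ⟶ V.flip.obj n from a.app n x) (toZero Y.unop).op z).trans ?_
    exact congrArg (res V (toZero Y.unop)) (app_congr (h z) n x))
  refine ⟨c, hc, fun z ↦ ?_⟩
  have e : j.app (op zero) z = z :=
    (congrArg (fun k ↦ P.map (Quiver.Hom.op k) z) (hom_zero_ext _ (𝟙 zero))).trans
      (Functor.map_id_apply P _ z)
  rw [← e, ← homPre_evalAt, reassoc_of% hc']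
  ext n x
  refine (res_congr (hom_zero_ext _ (𝟙 _)) _).trans ((res_id V _).trans ?_)
  rw [e]
  rfl

variable (C) in
/-- The presheaf `π^* E`. -/
abbrev isoPSh : (Theta C)ᵒᵖ ⥤ Type u := (proj C).op ⋙ nerve WalkingIso.{u}

variable (C) in
/-- The map to the terminal presheaf. -/
def isoToPoint : isoPSh C ⟶ yoneda.obj zero where
  app X := ↾fun _ ↦ X.unop.toZero
  naturality _ _ _ := by ext; exact hom_zero_ext _ _

/-- The objects of `π^* E`. -/
def isoPt (v : WalkingIso.{u}) : (isoPSh C).obj (op zero) := ComposableArrows.mk₀ v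

lemma homPre_isoToPoint_evalAt (W : (Theta C)ᵒᵖ ⥤ SSet.{u}) (z : (isoPSh C).obj (op zero)) :
    homPre (isoToPoint C) W ≫ evalAt z W = (homYoneda zero W).hom := by
  ext n g
  exact congrArg ((show yoneda.obj zero ⟶ W.flip.obj n from g).app _) (hom_zero_ext _ _)

/-- Completeness of a simplicial presheaf. -/
def IsComplete (W : (Theta C)ᵒᵖ ⥤ SSet.{u}) : Prop := SSetWeakEquiv (homPre (isoToPoint C) W)

lemma isComplete_iff (W : (Theta C)ᵒᵖ ⥤ SSet.{u}) :
    IsComplete W ↔ SSetWeakEquiv (mapSpacePre (completenessMap C) W) :=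
  homPre_we_iff _ _

/-- Up to the Yoneda isomorphism, evaluation is a retraction of the map from objects to
`E`-diagrams, which is an equivalence by completeness; and it is a fibration, as restriction along a
monomorphism from `F[0]`. -/
lemma IsComplete.evalAt_trivFib {W : (Theta C)ᵒᵖ ⥤ SSet.{u}} (hc : IsComplete W)
    (hW : InjectiveFibrant W) (z : (isoPSh C).obj (op zero)) : TrivFib (evalAt z W) := by
  have h : SSetWeakEquiv (evalAt z W) := hc.of_comp_left (by
    rw [homPre_isoToPoint_evalAt]
    exact we_iso _)
  have : ∀ Y, Mono ((yonedaEquiv.symm z).app Y) := fun Y ↦ (mono_iff_injective _).2 fun g g' _ ↦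
    hom_zero_ext g g'
  have : Mono (yonedaEquiv.symm z) := NatTrans.mono_of_mono_app _
  have := homPre_fibration (yonedaEquiv.symm z) hW
  have : Fibration (evalAt z W) := by
    rw [← homPre_yonedaEquiv]
    infer_instance
  have := kanComplex_obj hW (op zero)
  exact trivFib_of_we _ h

/-- Spaces of maps out of both sides of the completeness map preserve levelwise weak equivalences
between injectively fibrant objects. -/
lemma IsComplete.of_we {W W' : (Theta C)ᵒᵖ ⥤ SSet.{u}} (hc : IsComplete W) (hW : InjectiveFibrant W)
    (hW' : InjectiveFibrant W') {f : W ⟶ W'} (hf : LevelwiseWeakEquiv f) : IsComplete W' := by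
  refine (homPost_we (yoneda.obj zero) hW hW' hf).of_comp_left ?_
  exact SSetWeakEquiv.comp (f := homPre (isoToPoint C) W) hc (homPost_we (isoPSh C) hW hW' hf)

/-- `toCoconst V` is an isomorphism at `[0]`, hence so is its base change. -/
instance {V : (Theta C)ᵒᵖ ⥤ SSet.{u}} {K : SSet.{u}} (k : K ⟶ V.obj (op zero)) :
    IsIso (changeObjZero k) := by
  have h (v : zero ⟶ (zero : Theta C)) : v = 𝟙 zero := hom_zero_ext _ _
  let g : K ⟶ (changeObj k).obj (op zero) := (changeObj_isPullback_app k (op zero)).lift k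
    (coconstLift (X := zero) fun _ ↦ 𝟙 K) (coconst_ext fun v ↦ by
      rw [h v]
      ext n x
      exact res_id V _)
  have hg : g ≫ changeObjZero k = 𝟙 K := by
    rw [changeObjZero, ← Category.assoc, IsPullback.lift_snd]
    rfl
  refine ⟨g, ?_, hg⟩
  refine (changeObj_isPullback_app k (op zero)).hom_ext ?_ (coconst_ext fun v ↦ ?_)
  · rw [← changeObjZero_comp, Category.assoc, reassoc_of% hg, Category.id_comp]
  · rw [h v]
    change (changeObjZero k ≫ g) ≫ changeObjZero k = 𝟙 _ ≫ changeObjZero k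
    rw [Category.assoc, hg, Category.comp_id, Category.id_comp]

variable {t : C} (ht : Limits.IsTerminal t)

/-- `N` is the space of pairs of an object `u` of `U` and an `E`-diagram in `V` starting at `f u`.
Its projection `n₂` to `u` is a trivial fibration, as `V` is complete, and `f` on objects is the
section `s` of `n₂` by constant diagrams, followed by evaluation at the other end. That evaluation
is a trivial fibration as well: essential surjectivity and `joined_of_iso` reduce this to the
vertices `f x`. A point over `f x`, together with `u` and `x`, is an `E`-diagram in `changeObj`
ending at `x`, and `changeObj` is complete because it is levelwise equivalent to `U`. -/
lemma objects_we {U V : (Theta C)ᵒᵖ ⥤ SSet.{u}} (hU : IsFibrantFor (segalMaps C) U)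
    (hV : IsFibrantFor (segalMaps C) V) (hcU : IsComplete U) (hcV : IsComplete V) (f : U ⟶ V)
    (hf : (hoFunctor ht hU hV f).EssSurj) (h : ∀ x y : ObjOf U, LevelwiseWeakEquiv (mapObjMap f x y)) :
    SSetWeakEquiv (f.app (op zero)) := by
  have hU' := hU.injectiveFibrant
  have hV' := hV.injectiveFibrant
  obtain ⟨f₀, hf₀⟩ : ∃ f₀, f₀ = f.app (op zero) := ⟨_, rfl⟩
  have := kanComplex_obj hU' (op zero)
  have := kanComplex_obj hV' (op zero)
  have hQ : InjectiveFibrant (changeObj f₀) := changeObj_injectiveFibrant _ hV'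
  have hcQ : IsComplete (changeObj f₀) := by
    subst hf₀
    exact hcU.of_we hU' hQ (toChangeObj_we f hU hV h)
  let z₀ : (isoPSh C).obj (op zero) := isoPt .zero
  let z₁ : (isoPSh C).obj (op zero) := isoPt .one
  let k {A : SSet.{u}} {K : SSet.{u}} (a b : A ⟶ K) (z : (isoPSh C).obj (op zero)) : A ⟶ K :=
    WalkingIso.rec a b ((show ComposableArrows WalkingIso.{u} 0 from z).obj 0)
  have hk {A K : SSet.{u}} {a b : A ⟶ K} {c : (isoPSh C).obj (op zero) → (A ⟶ K)}
      (h₀ : c z₀ = a) (h₁ : c z₁ = b) (z) : c z = k a b z := by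
    obtain ⟨v, rfl⟩ : ∃ v, z = isoPt v :=
      ⟨(show ComposableArrows WalkingIso.{u} 0 from z).obj 0, ComposableArrows.ext₀ rfl⟩
    obtain _ | _ := v
    · exact h₀
    · exact h₁
  obtain ⟨N, n₁, n₂, sqN⟩ : ∃ (N : SSet.{u}) (n₁ : N ⟶ _) (n₂ : N ⟶ _),
    IsPullback n₁ n₂ (evalAt z₀ V) f₀ := ⟨_, _, _, IsPullback.of_hasPullback _ _⟩
  have hn₂ : TrivFib n₂ := (hcV.evalAt_trivFib hV' z₀).of_isPullback sqN
  -- Evaluations at all objects can be lifted simultaneously, so the object `u` is lifted first, in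
  -- the Kan complex of objects of `U`, and its image is prescribed at `zero`.
  have hp : Fibration (n₁ ≫ evalAt z₁ V) := fibration_of_exists fun i hi a b hab ↦ by
    have := terminal_fibration (U.obj (op zero))
    obtain ⟨b₀, hb₀, -⟩ := anodyne_exists_lift (Limits.terminal.from (U.obj (op zero))) hi (a ≫ n₂)
      (Limits.terminal.from _) (Limits.terminal.hom_ext _ _)
    obtain ⟨c, hc, hc'⟩ := exists_lift_evalAt hV' hi (a ≫ n₁) (k (b₀ ≫ f₀) b) fun z ↦ by
      refine (hk (c := fun z ↦ (a ≫ n₁) ≫ evalAt z V) (a := i ≫ b₀ ≫ f₀) (b := i ≫ b)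
        ?_ ?_ z).trans (hk (c := fun z ↦ i ≫ k (b₀ ≫ f₀) b z) rfl rfl z).symm
      · simp only [Category.assoc, sqN.w, reassoc_of% hb₀]
      · simpa only [Category.assoc] using hab
    have hc₀ : c ≫ evalAt z₀ V = b₀ ≫ f₀ := hc' z₀
    have hc₁ : c ≫ evalAt z₁ V = b := hc' z₁
    refine ⟨sqN.lift c b₀ hc₀, sqN.hom_ext ?_ ?_, ?_⟩
    · rw [Category.assoc, sqN.lift_fst, hc]
    · rw [Category.assoc, sqN.lift_snd, hb₀]
    · rw [sqN.lift_fst_assoc, hc₁]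
  have hp' : TrivFib (n₁ ≫ evalAt z₁ V) := by
    refine trivFib_of_fibers fun b ↦ ?_
    obtain ⟨x, ⟨g⟩⟩ := hf.mem_essImage ⟨b⟩
    obtain ⟨e, he, he'⟩ := (joined_of_iso ht hV ((isComplete_iff V).1 hcV) g).symm
    refine ⟨e, he, fun n a ha ↦ ?_⟩
    obtain ⟨x, hx⟩ : ∃ x' : ObjOf U, x' = x.pt := ⟨_, rfl⟩
    have he' : (V.obj (op zero)).δ 0 e = f₀.app _ x := by
      subst hf₀ hx
      exact he'
    rw [he'] at ha ⊢
    -- The diagrams in `V` are lifted to `changeObj` by recording objects of `U` over their ends: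
    -- the component `a ≫ n₂` at `zero` and `x` at `one`.
    obtain ⟨w, hw⟩ := exists_homSpace_coconst_lift (C := C) (k (a ≫ n₂) (SSet.const x))
    have sq := homPost_isPullback (isoPSh C) (changeObj_isPullback f₀)
    have e₁ (z) : homPost (isoPSh C) (toCoconst V) ≫ evalAt z _ ≫ coev (𝟙 zero) = evalAt z V := by
      ext n g
      exact res_id V _
    have e₂ (z) : homPost (isoPSh C) (changeObjSnd f₀) ≫ evalAt z _ ≫ coev (𝟙 zero) =
      evalAt z _ ≫ changeObjZero f₀ := rfl
    have e₃ (z) : homPost (isoPSh C) (changeObjFst f₀) ≫ evalAt z _ =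
        evalAt z _ ≫ changeObjZero f₀ ≫ f₀ := by
      rw [changeObjZero_comp, homPost_evalAt]
    obtain ⟨a', ha₁, ha₂⟩ : ∃ a', a' ≫ homPost (isoPSh C) (changeObjFst f₀) = a ≫ n₁ ∧
        a' ≫ homPost (isoPSh C) (changeObjSnd f₀) = w :=
      ⟨sq.lift (a ≫ n₁) w (homSpace_coconst_ext fun z ↦ by
        rw [Category.assoc, e₁, show (w ≫ homPost (isoPSh C) (coconstMap f₀)) ≫ evalAt z _ ≫
          coev (𝟙 zero) = (w ≫ evalAt z _ ≫ coev (𝟙 zero)) ≫ f₀ from rfl, hw]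
        refine (hk (c := fun z ↦ (a ≫ n₁) ≫ evalAt z V) (a := a ≫ n₂ ≫ f₀)
          (b := SSet.const (f₀.app _ x))
          ?_ ?_ z).trans (hk (c := fun z ↦ k (a ≫ n₂) (SSet.const x) z ≫ f₀) rfl ?_ z).symm
        · simp only [Category.assoc, sqN.w]
        · simpa only [Category.assoc, SSet.comp_const] using ha
        · exact SSet.const_comp _ _), sq.lift_fst _ _ _, sq.lift_snd _ _ _⟩
    have hev (z) : TrivFib (evalAt z _ ≫ changeObjZero f₀) :=
      (hcQ.evalAt_trivFib hQ z).comp (.of_iso _)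
    have ha₃ (z) : a' ≫ evalAt z _ ≫ changeObjZero f₀ = k (a ≫ n₂) (SSet.const x) z := by
      rw [← hw, ← ha₂, ← e₂, Category.assoc]
    -- Evaluation at `one` is a trivial fibration on diagrams in `changeObj`; the object at `zero`
    -- of the lifted diagram is the missing component in `U`.
    obtain ⟨c, hc, hc'⟩ := (hev z₁).exists_lift (SSet.boundary.{u} n).ι a' (SSet.const x) (by
      rw [ha₃, SSet.comp_const]
      rfl)
    refine ⟨sqN.lift (c ≫ homPost (isoPSh C) (changeObjFst f₀)) (c ≫ evalAt z₀ _ ≫ changeObjZero f₀) ?_,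
      sqN.hom_ext ?_ ?_, ?_⟩
    · simp only [Category.assoc, e₃]
    · rw [Category.assoc, sqN.lift_fst, reassoc_of% hc, ha₁]
    · rw [Category.assoc, sqN.lift_snd, reassoc_of% hc, ha₃]
      rfl
    · rw [sqN.lift_fst_assoc, Category.assoc, e₃, reassoc_of% hc', SSet.const_comp]
  let s : U.obj (op zero) ⟶ N := sqN.lift (f₀ ≫ (homYoneda zero V).inv ≫ homPre (isoToPoint C) V) (𝟙 _) (by
    rw [Category.assoc, Category.assoc, homPre_isoToPoint_evalAt, Iso.inv_hom_id, Category.comp_id,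
      Category.id_comp])
  have hs : f₀ = s ≫ n₁ ≫ evalAt z₁ V := by
    rw [sqN.lift_fst_assoc, Category.assoc, Category.assoc, homPre_isoToPoint_evalAt, Iso.inv_hom_id,
      Category.comp_id]
  rw [← hf₀, hs]
  exact (SSetWeakEquiv.of_retract_section (sqN.lift_snd _ _ _) hn₂.we).comp hp'.we

/-- A map between complete objects which is essentially surjective and a weak equivalence on mapping
objects is a levelwise weak equivalence. -/
lemma levelwiseWeakEquiv_of_essSurj {U V : (Theta C)ᵒᵖ ⥤ SSet.{u}} (hU : IsFibrantFor (segalMaps C) U)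
    (hV : IsFibrantFor (segalMaps C) V) (hcU : IsComplete U) (hcV : IsComplete V) (f : U ⟶ V)
    (hf : (hoFunctor ht hU hV f).EssSurj) (h : ∀ x y : ObjOf U, LevelwiseWeakEquiv (mapObjMap f x y)) :
    LevelwiseWeakEquiv f := by
  intro X
  have h₁ := changeObjFst_we hV.injectiveFibrant hU.injectiveFibrant
    (objects_we ht hU hV hcU hcV f hf h) X
  rw [← toChangeObj_fst f]
  exact (toChangeObj_we f hU hV h X).comp h₁

end

/-! ### Paths of objects give isomorphisms of the homotopy category -/

section
variable {C : Type u} [SmallCategory.{u} C] {t : C} (ht : Limits.IsTerminal t)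
  {W : (Theta C)ᵒᵖ ⥤ SSet.{u}}

open Theta

lemma middle_corner_w : tgt t ≫ (ed ht 0 1 : one t ⟶ diag t 2) = src t ≫ ed ht 1 2 :=
  hom_diag_ext ht fun (a : Fin 1) ↦ by fin_cases a; rfl

lemma middle_corner_fibration (hW : InjectiveFibrant W) :
    Fibration (cornerMap W (middle_corner_w ht)) :=
  vertex_corner_fibration (m₁ := 1) (m₂ := 1) (m := 2) ht hW (mono₁ 0 1 (by decide))
    (mono₁ 1 2 (by decide)) 1 0 (by decide) (by decide) (by decide) (middle_corner_w ht)

/-- Composites can be moved along paths. -/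
lemma IsComposite.exists_move (hW : InjectiveFibrant W) {f g h : (W.obj (op (one t))) _⦋0⦌}
    (H : IsComposite W ht f g h) {φ ψ : (W.obj (op (one t))) _⦋1⦌} (hφ : (W.obj _).δ 1 φ = f)
    (hψ : (W.obj _).δ 1 ψ = g) (hm : res W (tgt t) φ = res W (src t) ψ) :
    ∃ χ : (W.obj (op (one t))) _⦋1⦌, (W.obj _).δ 1 χ = h ∧ res W (src t) χ = res W (src t) φ ∧
      res W (tgt t) χ = res W (tgt t) ψ ∧
      IsComposite W ht ((W.obj _).δ 0 φ) ((W.obj _).δ 0 ψ) ((W.obj _).δ 0 χ) := by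
  have := middle_corner_fibration ht hW
  obtain ⟨σ, rfl, rfl, rfl⟩ := H
  obtain ⟨e, rfl, rfl, rfl⟩ := exists_triangle_edge (middle_corner_w ht) σ φ ψ hm hφ hψ
  refine ⟨res W (ed ht 0 2) e, (res_map W _ _ _).symm, ?_, ?_, (W.obj _).δ 0 e, res_map W _ _ _,
    res_map W _ _ _, res_map W _ _ _⟩
  · rw [← res_comp, ← res_comp, source_corner_w]
  · rw [← res_comp, ← res_comp, target_corner_w]

/-- Paths with the same start and the same endpoints have equivalent ends. -/
lemma isPath_of_parallel (hW : InjectiveFibrant W) {e e' : (W.obj (op (one t))) _⦋1⦌} {x y : ObjOf W}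
    (h : (W.obj _).δ 1 e = (W.obj _).δ 1 e') (h₀ : res W (src t) e = res W (src t) e')
    (h₁ : res W (tgt t) e = res W (tgt t) e') (hx : (W.obj _).δ 0 (res W (src t) e) = x)
    (hy : (W.obj _).δ 0 (res W (tgt t) e) = y) : IsPath W x y ((W.obj _).δ 0 e) ((W.obj _).δ 0 e') := by
  have := ends_fibration hW t
  -- The horn with faces `e'` and `e` opposite to `1` and `2` is filled over a degenerate triangle
  -- of endpoints; the new face joins the two ends while the endpoints stay fixed.
  obtain ⟨τ, hτ, hτ'⟩ := horn_lift_two (ends W t) 0 ![e, e', e] (by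
      intro j k hj hk hjk
      obtain rfl : j = 1 := by lia
      obtain rfl : k = 2 := by lia
      exact h.symm)
    ((W.obj (op zero) ⊗ W.obj (op zero)).σ 1 ((ends W t).app _ e)) (by
      intro j hj
      obtain rfl | rfl : j = 1 ∨ j = 2 := by lia
      · refine (SSet.δ_comp_σ_self_apply 1 _).trans ?_
        exact Prod.ext h₀ h₁
      · exact SSet.δ_comp_σ_succ_apply 1 _)
  have hτ₁ := hτ 1 (by decide)
  have hτ₂ := hτ 2 (by decide)
  have hσ (z : ObjOf W) : degen z _ = (W.obj (op zero)).σ 0 z :=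
    ((congrArg ((W.obj _).map (SimplexCategory.σ 0).op) (degen_zero z).symm).trans (map_degen z _)).symm
  have hend : (ends W t).app _ ((W.obj _).δ 0 τ) =
      (W.obj (op zero) ⊗ W.obj (op zero)).σ 0
        ((W.obj (op zero) ⊗ W.obj (op zero)).δ 0 ((ends W t).app _ e)) := by
    refine (SSet.δ_naturality_apply (ends W t) 0 τ).trans ((congrArg _ hτ').trans ?_)
    exact SSet.δ_comp_σ_of_le_apply (i := 0) (j := 0) (by decide) _
  refine ⟨(W.obj _).δ 0 τ, ?_, ?_, ?_, ?_⟩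
  · refine (SSet.δ_comp_δ'_apply (i := 0) (j := 2) (by decide) τ).symm.trans ?_
    exact congrArg _ hτ₂
  · refine (SSet.δ_comp_δ_self_apply (i := 0) τ).trans ?_
    exact congrArg _ hτ₁
  · rw [hσ, ← hx]
    exact congrArg Prod.fst hend
  · rw [hσ, ← hy]
    exact congrArg Prod.snd hend

variable (hW : IsFibrantFor (segalMaps C) W)

/-- Points in the same component are isomorphic in the homotopy category. -/
lemma nonempty_iso_of_joined {a b : Ho ht hW} (h : Joined a.pt b.pt) : Nonempty (a ≅ b) := by
  obtain ⟨γ, hγ, hγ'⟩ := h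
  have hW' := hW.injectiveFibrant
  have := ends_fibration hW' t
  have hid (z : ObjOf W) (d : zero ⟶ one t) : res W d (res W (toZero (one t)) z) = z := by
    rw [← res_comp, res_congr (hom_zero_ext _ (𝟙 _)), res_id]
  have hid' (z : (W.obj (op zero)) _⦋1⦌) (d : zero ⟶ one t) :
      res W d (res W (toZero (one t)) z) = z := by
    rw [← res_comp, res_congr (hom_zero_ext _ (𝟙 _)), res_id]
  have hd₁ {K : SSet.{u}} (z : K _⦋0⦌) : K.δ 1 (K.σ 0 z) = z := SSet.δ_comp_σ_succ_apply 0 z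
  have hd₀ {K : SSet.{u}} (z : K _⦋0⦌) : K.δ 0 (K.σ 0 z) = z := SSet.δ_comp_σ_self_apply 0 z
  obtain ⟨i, hi⟩ : ∃ i, i = res W (toZero (one t)) a.pt := ⟨_, rfl⟩
  -- As `ends` is a fibration, the identity edge `i` at `a` can be moved along any two paths of its
  -- endpoints.
  have lift (γ₁ γ₂ : (W.obj (op zero)) _⦋1⦌) (h₁ : (W.obj _).δ 1 γ₁ = a.pt)
      (h₂ : (W.obj _).δ 1 γ₂ = a.pt) : ∃ e : (W.obj (op (one t))) _⦋1⦌, (W.obj _).δ 1 e = i ∧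
        res W (src t) e = γ₁ ∧ res W (tgt t) e = γ₂ := by
    obtain ⟨e, he, he'⟩ := horn_lift_one (ends W t) i
      (show (W.obj (op zero) ⊗ W.obj (op zero) : SSet.{u}) _⦋1⦌ from (γ₁, γ₂))
      (Prod.ext (h₁.trans (by rw [hi]; exact (hid _ _).symm))
        (h₂.trans (by rw [hi]; exact (hid _ _).symm)))
    exact ⟨e, he, congrArg Prod.fst he', congrArg Prod.snd he'⟩
  -- Moving only the target along `γ` ends at an edge from `a` to `b`; moving only the source ends
  -- at an edge from `b` to `a`.
  obtain ⟨e₁, h₁, h₂, h₃⟩ := lift ((W.obj _).σ 0 a.pt) γ (hd₁ _) hγ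
  obtain ⟨e₂, h₄, h₅, h₆⟩ := lift γ ((W.obj _).σ 0 a.pt) hγ (hd₁ _)
  have hc : IsComposite W ht i i i := by
    have := isComposite_id_left ht (W := W) (x := a.pt) (f := i) (by rw [hi]; exact hid _ _)
    rwa [← hi] at this
  have hg₀ : res W (src t) ((W.obj _).δ 0 e₁) = a.pt := by
    refine (res_map W _ _ _).trans ((congrArg _ h₂).trans (hd₀ _))
  have hg₁ : res W (tgt t) ((W.obj _).δ 0 e₁) = b.pt := by
    refine (res_map W _ _ _).trans ((congrArg _ h₃).trans hγ')
  have hh₀ : res W (src t) ((W.obj _).δ 0 e₂) = b.pt := by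
    refine (res_map W _ _ _).trans ((congrArg _ h₅).trans hγ')
  have hh₁ : res W (tgt t) ((W.obj _).δ 0 e₂) = a.pt := by
    refine (res_map W _ _ _).trans ((congrArg _ h₆).trans (hd₀ _))
  -- The relation that `i` composed with `i` is `i` is moved along these two paths, in both orders.
  obtain ⟨χ, c₁, c₂, c₃, c₄⟩ := hc.exists_move ht hW' h₁ h₄ (h₃.trans h₅.symm)
  obtain ⟨χ', c₁', c₂', c₃', c₄'⟩ := hc.exists_move ht hW' h₄ h₁ (h₆.trans h₂.symm)
  refine ⟨⟨HoHom.mk _ hg₀ hg₁, HoHom.mk _ hh₀ hh₁, ?_, ?_⟩⟩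
  · have hk₀ : res W (src t) ((W.obj _).δ 0 χ) = a.pt :=
      (res_map W _ _ _).trans ((congrArg _ (c₂.trans h₂)).trans (hd₀ _))
    have hk₁ : res W (tgt t) ((W.obj _).δ 0 χ) = a.pt :=
      (res_map W _ _ _).trans ((congrArg _ (c₃.trans h₆)).trans (hd₀ _))
    refine (HoHom.mk_comp_mk ht hW c₄ hg₀ hg₁ hh₀ hh₁ hk₀ hk₁).trans (HoHom.sound ?_ _ _ _ _)
    have hs (d : zero ⟶ one t) : res W d ((W.obj _).σ 0 i) = (W.obj _).σ 0 a.pt :=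
      (res_map W _ _ _).trans (congrArg _ (by rw [hi]; exact hid _ _))
    -- `χ` and the constant path at `i` start at `i` and move the endpoints alike, so their ends
    -- represent the same morphism.
    have := isPath_of_parallel hW' (e := χ) (e' := (W.obj _).σ 0 i) (x := a.pt) (y := a.pt)
      (c₁.trans (hd₁ _).symm) (c₂.trans (h₂.trans (hs _).symm)) (c₃.trans (h₆.trans (hs _).symm))
      ((congrArg _ (c₂.trans h₂)).trans (hd₀ _)) ((congrArg _ (c₃.trans h₆)).trans (hd₀ _))
    rwa [hd₀, hi] at this
  · have hk₀ : res W (src t) ((W.obj _).δ 0 χ') = b.pt :=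
      (res_map W _ _ _).trans ((congrArg _ (c₂'.trans h₅)).trans hγ')
    have hk₁ : res W (tgt t) ((W.obj _).δ 0 χ') = b.pt :=
      (res_map W _ _ _).trans ((congrArg _ (c₃'.trans h₃)).trans hγ')
    refine (HoHom.mk_comp_mk ht hW c₄' hh₀ hh₁ hg₀ hg₁ hk₀ hk₁).trans (HoHom.sound ?_ _ _ _ _)
    -- The comparison is now with the path of identity edges along `γ`, which ends at the identity
    -- of `b`.
    have := isPath_of_parallel hW' (e := χ') (e' := res W (toZero (one t)) γ) (x := b.pt) (y := b.pt)
      (c₁'.trans (hi.trans (by rw [← hγ]; exact res_map W _ _ _)))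
      (c₂'.trans (h₅.trans (hid' _ _).symm)) (c₃'.trans (h₃.trans (hid' _ _).symm))
      ((congrArg _ (c₂'.trans h₅)).trans hγ') ((congrArg _ (c₃'.trans h₃)).trans hγ')
    rwa [show (W.obj _).δ 0 (res W (toZero (one t)) γ) = res W (toZero (one t)) b.pt by
      rw [← hγ']; exact (res_map W _ _ _).symm] at this

end

/-! ### DK-equivalences between complete Segal objects -/

section
variable {C : Type u} [SmallCategory.{u} C] {t : C} (ht : Limits.IsTerminal t)

open Theta

lemma SSetWeakEquiv.mapπ₀_bijective {K L : SSet.{u}} [SSet.KanComplex K] [SSet.KanComplex L]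
    {f : K ⟶ L} (hf : SSetWeakEquiv f) : Function.Bijective (SSet.mapπ₀ f) := by
  have sound {M : SSet.{u}} {x y : M _⦋0⦌} (h : Joined x y) : SSet.π₀.mk x = SSet.π₀.mk y := by
    obtain ⟨e, h₁, h₂⟩ := h
    exact SSet.π₀.sound (.mk e h₁ h₂)
  constructor
  · intro x y h
    obtain ⟨x, rfl⟩ := x.mk_surjective
    obtain ⟨y, rfl⟩ := y.mk_surjective
    rw [SSet.mapπ₀_mk, SSet.mapπ₀_mk] at h
    exact sound (hf.joined (joined_of_mk_eq h))
  · intro y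
    obtain ⟨y, rfl⟩ := y.mk_surjective
    obtain ⟨x, h⟩ := hf.exists_joined y
    exact ⟨SSet.π₀.mk x, by rw [SSet.mapπ₀_mk, sound h]⟩

/-- Levelwise weak equivalences induce equivalences of homotopy categories. -/
lemma hoFunctor_isEquivalence {U V : (Theta C)ᵒᵖ ⥤ SSet.{u}} (hU : IsFibrantFor (segalMaps C) U)
    (hV : IsFibrantFor (segalMaps C) V) (f : U ⟶ V) (hf : LevelwiseWeakEquiv f) :
    (hoFunctor ht hU hV f).IsEquivalence := by
  have := kanComplex_obj hU.injectiveFibrant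
  have := kanComplex_obj hV.injectiveFibrant
  have h (x y : Ho ht hU) : Function.Bijective ((hoFunctor ht hU hV f).map (X := x) (Y := y)) := by
    have := mapObj_kanComplex x.pt y.pt hU.injectiveFibrant (op t)
    have := mapObj_kanComplex ((f.app _).app _ x.pt) ((f.app _).app _ y.pt) hV.injectiveFibrant (op t)
    exact (mapObjMap_we f hU.injectiveFibrant hV.injectiveFibrant hf x.pt y.pt (op t)).mapπ₀_bijective
  exact
    { faithful := ⟨fun {x y} ↦ @(h x y).1⟩
      full := ⟨fun {x y} ↦ (h x y).2⟩
      essSurj := ⟨fun y ↦ by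
        obtain ⟨x, hx⟩ := (hf (op zero)).exists_joined y.pt
        exact ⟨⟨x⟩, nonempty_iso_of_joined ht hV (a := (hoFunctor ht hU hV f).obj ⟨x⟩) hx⟩⟩ }

lemma IsFibrantFor.se_of_cpt {S : MorphismProperty (Cᵒᵖ ⥤ SSet.{u})} {W : (Theta C)ᵒᵖ ⥤ SSet.{u}}
    (hW : IsFibrantFor (cpt S) W) : IsFibrantFor (se S) W :=
  ⟨fun _ _ f hf ↦ hW.isLocal f (hf.imp_left .inr), hW.injectiveFibrant⟩

lemma IsFibrantFor.isComplete {S : MorphismProperty (Cᵒᵖ ⥤ SSet.{u})} {W : (Theta C)ᵒᵖ ⥤ SSet.{u}}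
    (hW : IsFibrantFor (cpt S) W) : IsComplete W :=
  (isComplete_iff W).2 (hW.isLocal _ (.inl (.inl ⟨()⟩)))

lemma levelwiseWeakEquiv_iff_isDK (S : MorphismProperty (Cᵒᵖ ⥤ SSet.{u}))
    {U V : (Theta C)ᵒᵖ ⥤ SSet.{u}} (f : U ⟶ V) (hU : IsFibrantFor (cpt S) U)
    (hV : IsFibrantFor (cpt S) V) : LevelwiseWeakEquiv f ↔ IsDK ht S f := by
  refine ⟨fun hf ↦ ⟨hU.se_of_cpt, hV.se_of_cpt, hoFunctor_isEquivalence ht _ _ f hf,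
    mapObjMap_we f hU.injectiveFibrant hV.injectiveFibrant hf⟩, fun ⟨hU', hV', h, h'⟩ ↦ ?_⟩
  exact levelwiseWeakEquiv_of_essSurj ht hU'.segal hV'.segal hU.isComplete hV.isComplete f h.essSurj h'

end

/-! ### Coproduct decompositions of simplicial sets -/

/-- The maps `ι j` exhibit `Z` as a disjoint union. -/
def IsDisjointUnion {J : Type u} {F : J → SSet.{u}} {Z : SSet.{u}} (ι : ∀ j, F j ⟶ Z) : Prop :=
  ∀ n, Function.Bijective fun p : Σ j, (F j).obj n ↦ (ι p.1).app n p.2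

namespace IsDisjointUnion

variable {J : Type u} {F : J → SSet.{u}} {Z : SSet.{u}} {ι : ∀ j, F j ⟶ Z} (hι : IsDisjointUnion ι)
include hι

lemma exists_desc {K : SSet.{u}} (g : ∀ j, F j ⟶ K) : ∃ G : Z ⟶ K, ∀ j, ι j ≫ G = g j := by
  let e (n) := Equiv.ofBijective _ (hι n)
  let val (n) (z : Z.obj n) : K.obj n := (g ((e n).symm z).1).app n ((e n).symm z).2
  have hval (n) (j) (y : (F j).obj n) : val n ((ι j).app n y) = (g j).app n y :=
    congrArg (fun p : Σ j, (F j).obj n ↦ (g p.1).app n p.2) ((e n).symm_apply_apply ⟨j, y⟩)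
  refine ⟨{ app n := ↾(val n), naturality n m θ := ?_ }, fun j ↦ ?_⟩
  · ext z
    obtain ⟨⟨j, y⟩, rfl⟩ := (hι n).2 z
    change val m (Z.map θ ((ι j).app n y)) = K.map θ (val n ((ι j).app n y))
    rw [← NatTrans.naturality_apply (ι j) θ y, hval, hval]
    exact NatTrans.naturality_apply (g j) θ y
  · ext n y
    exact hval n j y

lemma hom_ext {K : SSet.{u}} {g h : Z ⟶ K} (H : ∀ j, ι j ≫ g = ι j ≫ h) : g = h := by
  ext n z
  obtain ⟨⟨j, y⟩, rfl⟩ := (hι n).2 z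
  exact app_congr (H j) n y

lemma whiskerRight (L : SSet.{u}) : IsDisjointUnion fun j ↦ ι j ▷ L := by
  refine fun n ↦ ⟨?_, ?_⟩
  · rintro ⟨j, y, l⟩ ⟨j', y', l'⟩ h
    have h₁ : (ι j).app n y = (ι j').app n y' := congrArg Prod.fst h
    have h₂ : l = l' := congrArg Prod.snd h
    obtain ⟨rfl, h₃⟩ := Sigma.mk.inj_iff.1 ((hι n).1 (a₁ := ⟨j, y⟩) (a₂ := ⟨j', y'⟩) h₁)
    obtain rfl := eq_of_heq h₃
    rw [h₂]
  · rintro ⟨z, l⟩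
    obtain ⟨⟨j, y⟩, rfl⟩ := (hι n).2 z
    exact ⟨⟨j, y, l⟩, rfl⟩

lemma htpy {K : SSet.{u}} {g h : Z ⟶ K} (H : ∀ j, Htpy (ι j ≫ g) (ι j ≫ h)) : Htpy g h := by
  simp only [htpy_iff] at H
  choose k h₀ h₁ using H
  obtain ⟨G, hG⟩ := (hι.whiskerRight Δ[1]).exists_desc k
  refine .mk G (hι.hom_ext fun j ↦ ?_) (hι.hom_ext fun j ↦ ?_)
  · rw [← h₀, ← hG]; rfl
  · rw [← h₁, ← hG]; rfl

/-- A disjoint union of weak equivalences is a weak equivalence. -/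
lemma we {F' : J → SSet.{u}} {Z' : SSet.{u}} {ι' : ∀ j, F' j ⟶ Z'} (hι' : IsDisjointUnion ι')
    {α : ∀ j, F j ⟶ F' j} (hα : ∀ j, SSetWeakEquiv (α j)) {f : Z ⟶ Z'}
    (w : ∀ j, ι j ≫ f = α j ≫ ι' j) : SSetWeakEquiv f := by
  refine we_mk (fun K _ g ↦ ?_) fun K _ h h' H ↦ hι'.htpy fun j ↦ ?_
  · choose h hh using fun j ↦ (hα j).surjective K (ι j ≫ g)
    obtain ⟨h', hh'⟩ := hι'.exists_desc h
    refine ⟨h', hι.htpy fun j ↦ ?_⟩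
    rw [reassoc_of% w, hh']
    exact hh j
  · refine (hα j).injective K _ _ ?_
    have := H.comp_left (ι j)
    rwa [reassoc_of% w, reassoc_of% w] at this

end IsDisjointUnion

/-! ### The suspension of a presheaf of sets -/

namespace Theta

variable {C : Type u} [SmallCategory.{u} C]

/-- The morphism onto the `i`-th step, sending the vertices up to `i - 1` to `0`, and the others
to `1`. -/
def stepHom (X : Theta C) (i : Fin X.len) : X ⟶ one (X.label i) where
  φ :=
    { toFun a := if a ≤ i.castSucc then (0 : Fin 2) else 1
      monotone' a b h := by
        by_cases hb : b ≤ i.castSucc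
        · simp [hb, h.trans hb]
        · exact (Fin.le_last (n := 1) _).trans (if_neg hb).ge }
  f j := fun (k : Fin 1) h₁ h₂ ↦ eqToHom (by
    obtain rfl := Subsingleton.elim k 0
    refine congrArg X.label (le_antisymm ?_ ?_)
    · by_contra h
      have : ¬ j.castSucc ≤ i.castSucc := h
      exact absurd h₁ (not_lt.2 (if_neg this).ge)
    · by_contra h
      have : j.succ ≤ i.castSucc := Fin.succ_le_castSucc_iff.2 (not_le.1 h)
      exact absurd h₂ (not_le.2 ((if_pos this).trans_lt Fin.zero_lt_one)))

lemma stepHom_φ_le {X : Theta C} {i : Fin X.len} {a} (h : a ≤ i.castSucc) :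
    (stepHom X i).φ a = (0 : Fin 2) := if_pos h

lemma stepHom_φ_lt {X : Theta C} {i : Fin X.len} {a} (h : i.castSucc < a) :
    (stepHom X i).φ a = (1 : Fin 2) := if_neg (not_le.2 h)

/-- A monotone map to `[1]` jumps at most once; this splits the suspension into two ends and one
summand for each step. -/
lemma exists_step_or_const {m : ℕ} (φ : Fin (m + 1) →o Fin 2) :
    (∃ v, ∀ a, φ a = v) ∨ ∃ i : Fin m, (∀ a ≤ i.castSucc, φ a = 0) ∧ ∀ a, i.castSucc < a → φ a = 1 := by
  by_cases h : φ 0 < φ (Fin.last m)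
  · have h₀ : φ 0 < Fin.succ (0 : Fin 1) := h.trans_le (Fin.le_last _)
    have h₁ : Fin.succ (0 : Fin 1) ≤ φ (Fin.last m) := by
      have : ∀ x y : Fin 2, x < y → Fin.succ (0 : Fin 1) ≤ y := by decide
      exact this _ _ h
    obtain ⟨i, -, -, h₂, h₃⟩ := exists_step φ 0 (Fin.last m) 0 h₀ h₁
    have key₀ : ∀ x : Fin 2, x < Fin.succ (0 : Fin 1) → x = 0 := by decide
    have key₁ : ∀ x : Fin 2, Fin.succ (0 : Fin 1) ≤ x → x = 1 := by decide
    exact Or.inr ⟨i, fun a ha ↦ key₀ _ ((φ.monotone ha).trans_lt h₂), fun a ha ↦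
      key₁ _ (h₃.trans (φ.monotone (Fin.castSucc_lt_iff_succ_le.1 ha)))⟩
  · refine Or.inl ⟨φ 0, fun a ↦ le_antisymm ?_ (φ.monotone (Fin.zero_le a))⟩
    exact (φ.monotone (Fin.le_last a)).trans (not_lt.1 h)

variable {P Q : Cᵒᵖ ⥤ Type u}

lemma hom_f_congr {E : Type*} [Category* E] {X Y : Theta E} {g h : Y ⟶ X} (e : g = h)
    (i : Fin Y.len) (j : Fin X.len) (h₁ h₂ h₁' h₂') : g.f i j h₁ h₂ = h.f i j h₁' h₂' := by
  subst e
  rfl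

lemma yonedaEquiv_symm_map {c d e : C} (f : c ⟶ d) (g : d ⟶ e) (a : P.obj (op e)) :
    yonedaEquiv.symm (P.map (f ≫ g).op a) = yoneda.map f ≫ yonedaEquiv.symm (P.map g.op a) := by
  rw [op_comp, Functor.map_comp_apply]
  exact (yonedaEquiv_symm_naturality_left _ _ _).symm

/-- The element of the suspension of `P` given by a morphism to `[1](c)` and an element of `P c`. -/
def suspElt {X : Theta C} {c : C} (h : X ⟶ one c) (a : P.obj (op c)) :
    ((suspPresheaf C).obj P).obj (op X) :=
  show (map yoneda).obj X ⟶ one P from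
  { φ := h.φ
    f i j h₁ h₂ := yonedaEquiv.symm (P.map (h.f i j h₁ h₂).op a) }

variable (P) in
/-- The constant elements of the suspension. -/
def suspEnd (X : Theta C) (v : Fin 2) : ((suspPresheaf C).obj P).obj (op X) :=
  show (map yoneda).obj X ⟶ one P from
  { φ := OrderHom.const _ v
    f _ _ h₁ h₂ := absurd (lt_of_lt_of_le h₁ h₂) (lt_irrefl _) }

lemma suspElt_comp {X Y : Theta C} {c : C} (g : Y ⟶ X) (h : X ⟶ one c) (a : P.obj (op c)) :
    ((suspPresheaf C).obj P).map g.op (suspElt h a) = suspElt (g ≫ h) a := by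
  refine hom_ext (fun _ ↦ rfl) fun i j h₁ h₂ h₁' h₂' ↦ ?_
  obtain ⟨k, h₃, h₄, h₅, h₆⟩ := exists_step h.φ _ _ j h₁ h₂
  refine (comp_f ((map yoneda).map g) (show (map yoneda).obj X ⟶ one P from suspElt h a)
    i k j h₁ h₂ h₃ h₄ h₅ h₆).trans ?_
  have e := comp_f g h i k j h₁' h₂' h₃ h₄ h₅ h₆
  exact (yonedaEquiv_symm_map _ _ _).symm.trans
    (congrArg (fun k ↦ yonedaEquiv.symm (P.map (Quiver.Hom.op k) a)) e.symm)

lemma suspEnd_comp {X Y : Theta C} (g : Y ⟶ X) (v : Fin 2) :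
    ((suspPresheaf C).obj P).map g.op (suspEnd P X v) = suspEnd P Y v :=
  hom_ext (fun _ ↦ rfl) fun _ _ h₁ h₂ ↦ absurd (lt_of_lt_of_le h₁ h₂) (lt_irrefl _)

/-- A map of labels can be moved from the morphism to the element, so pairs `(h, a)` are not unique;
`suspMk` selects those where `h` is a step. -/
lemma suspElt_oneFunctor {X : Theta C} {c d : C} (h : X ⟶ one c) (g : c ⟶ d) (a : P.obj (op d)) :
    suspElt (h ≫ (oneFunctor C).map g) a = suspElt h (P.map g.op a) := by
  refine hom_ext (fun _ ↦ rfl) fun i (j : Fin 1) h₁ h₂ h₁' h₂' ↦ ?_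
  have e := comp_f h ((oneFunctor C).map g) i j j h₁ h₂ h₁' h₂' (Fin.castSucc_lt_succ) le_rfl
  refine (congrArg (fun k ↦ yonedaEquiv.symm (P.map (Quiver.Hom.op k) a)) e).trans ?_
  exact congrArg yonedaEquiv.symm (Functor.map_comp_apply P _ _ a)

lemma suspElt_const {X : Theta C} {c : C} (v : Fin 2) (a : P.obj (op c)) :
    suspElt (toZero X ≫ vertex (one c) v) a = suspEnd P X v :=
  hom_ext (fun _ ↦ rfl) fun _ _ _ _ h₁ h₂ ↦ absurd (lt_of_lt_of_le h₁ h₂) (lt_irrefl _)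

lemma map_suspElt (α : P ⟶ Q) {X : Theta C} {c : C} (h : X ⟶ one c) (a : P.obj (op c)) :
    ((suspPresheaf C).map α).app (op X) (suspElt h a) = suspElt h (α.app _ a) := by
  refine hom_ext (fun _ ↦ rfl) fun i (j : Fin 1) h₁ h₂ h₁' h₂' ↦ ?_
  refine (comp_f (show (map yoneda).obj X ⟶ one P from suspElt h a) ((oneFunctor _).map α) i j j
    h₁ h₂ h₁' h₂' (Fin.castSucc_lt_succ) le_rfl).trans ?_
  exact (yonedaEquiv_symm_naturality_right _ _ _).trans
    (congrArg yonedaEquiv.symm (NatTrans.naturality_apply α _ a))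

lemma map_suspEnd (α : P ⟶ Q) (X : Theta C) (v : Fin 2) :
    ((suspPresheaf C).map α).app (op X) (suspEnd P X v) = suspEnd Q X v :=
  hom_ext (fun _ ↦ rfl) fun _ _ h₁ h₂ ↦ absurd (lt_of_lt_of_le h₁ h₂) (lt_irrefl _)

/-- The elements of the suspension on `X`, indexed by the steps and the two ends. -/
def suspMk (P : Cᵒᵖ ⥤ Type u) (X : Theta C)
    (p : (Σ i, P.obj (op (X.label i))) ⊕ Fin 2) : ((suspPresheaf C).obj P).obj (op X) :=
  Sum.elim (fun q ↦ suspElt (stepHom X q.1) q.2) (suspEnd P X) p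

lemma stepHom_f_self (X : Theta C) (i : Fin X.len) (h₁ h₂) :
    (stepHom X i).f i (0 : Fin 1) h₁ h₂ = 𝟙 _ := rfl

lemma suspElt_injective {X : Theta C} {i i' : Fin X.len} {a : P.obj (op (X.label i))}
    {a' : P.obj (op (X.label i'))} (h : suspElt (stepHom X i) a = suspElt (stepHom X i') a') :
    (⟨i, a⟩ : Σ i, P.obj (op (X.label i))) = ⟨i', a'⟩ := by
  have hφ (b) : (stepHom X i).φ b = (stepHom X i').φ b :=
    congrArg (fun k : (map yoneda).obj X ⟶ one P ↦ k.φ b) h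
  obtain rfl : i = i' := by
    by_contra hne
    obtain h' | h' := lt_or_gt_of_ne hne
    · have h₁ := stepHom_φ_lt (X := X) (i := i) (a := i'.castSucc) (Fin.castSucc_lt_castSucc_iff.2 h')
      rw [hφ, stepHom_φ_le le_rfl] at h₁
      exact absurd h₁ (zero_ne_one (α := Fin 2))
    · have h₁ := stepHom_φ_le (X := X) (i := i) (a := i.castSucc) le_rfl
      rw [hφ, stepHom_φ_lt (Fin.castSucc_lt_castSucc_iff.2 h')] at h₁
      exact absurd h₁ (one_ne_zero (α := Fin 2))
  have h₁ : (stepHom X i).φ i.castSucc < Fin.succ (0 : Fin 1) := by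
    rw [stepHom_φ_le le_rfl]; exact Fin.zero_lt_one
  have h₂ : Fin.succ (0 : Fin 1) ≤ (stepHom X i).φ i.succ := by
    rw [stepHom_φ_lt Fin.castSucc_lt_succ]; exact le_rfl
  have := yonedaEquiv.symm.injective (hom_f_congr (Y := (map yoneda).obj X) (X := one P) h i (0 : Fin 1)
    h₁ h₂ h₁ h₂)
  rw [stepHom_f_self] at this
  rw [(Functor.map_id_apply P _ a).symm.trans (this.trans (Functor.map_id_apply P _ a'))]

/-- A morphism to `[1](P)` is constant or jumps at one step; in the latter case its only label
component is, by the Yoneda lemma, an element of `P` at the label of that step. -/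
lemma suspMk_bijective (P : Cᵒᵖ ⥤ Type u) (X : Theta C) : Function.Bijective (suspMk P X) := by
  have aux {i : Fin X.len} {a : P.obj (op (X.label i))} {v : Fin 2}
      (h : suspElt (stepHom X i) a = suspEnd P X v) : False := by
    have hφ (b) : (stepHom X i).φ b = v :=
      congrArg (fun k : (map yoneda).obj X ⟶ one P ↦ k.φ b) h
    have h₁ := stepHom_φ_le (X := X) (i := i) (a := i.castSucc) le_rfl
    rw [hφ, ← hφ i.succ, stepHom_φ_lt Fin.castSucc_lt_succ] at h₁
    exact absurd h₁ (one_ne_zero (α := Fin 2))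
  refine ⟨?_, fun g ↦ ?_⟩
  · rintro (⟨i, a⟩ | v) (⟨i', a'⟩ | v') h
    · exact congrArg Sum.inl (suspElt_injective h)
    · exact (aux h).elim
    · exact (aux (Eq.symm h)).elim
    · have : v = v' :=
        congrArg (fun k : (map yoneda).obj X ⟶ one P ↦ k.φ (0 : Fin (X.len + 1))) h
      rw [this]
  · obtain ⟨g, rfl⟩ : ∃ g' : (map yoneda).obj X ⟶ one P, g' = g := ⟨g, rfl⟩
    obtain ⟨v, h⟩ | ⟨i, h₀, h₁⟩ := exists_step_or_const (m := X.len) g.φ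
    · refine ⟨.inr v, hom_ext (fun a ↦ (h a).symm) fun _ _ h₁ h₂ ↦
        absurd (lt_of_lt_of_le h₁ h₂) (lt_irrefl _)⟩
    · have h₂ : g.φ i.castSucc < Fin.succ (0 : Fin 1) := (h₀ _ le_rfl).trans_lt Fin.zero_lt_one
      have h₃ : Fin.succ (0 : Fin 1) ≤ g.φ i.succ := (h₁ _ Fin.castSucc_lt_succ).ge
      refine ⟨.inl ⟨i, yonedaEquiv (g.f i (0 : Fin 1) h₂ h₃)⟩, hom_ext (fun a ↦ ?_) ?_⟩
      · by_cases ha : a ≤ i.castSucc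
        · exact (stepHom_φ_le (X := X) (i := i) ha).trans (h₀ a ha).symm
        · exact (stepHom_φ_lt (X := X) (i := i) (not_le.1 ha)).trans (h₁ a (not_le.1 ha)).symm
      · intro i' (j : Fin 1) h₄ h₅ h₆ h₇
        obtain rfl := Subsingleton.elim j 0
        obtain rfl : i' = i := step_unique g.φ (0 : Fin 1) h₆ h₇ h₂ h₃
        exact (congrArg yonedaEquiv.symm (Functor.map_id_apply P _ _)).trans
          (Equiv.symm_apply_apply _ _)

lemma suspPresheaf_cases {X : Theta C} (g : ((suspPresheaf C).obj P).obj (op X)) :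
    (∃ v, g = suspEnd P X v) ∨ ∃ i a, g = suspElt (stepHom X i) a := by
  obtain ⟨⟨i, a⟩ | v, rfl⟩ := (suspMk_bijective P X).2 g
  · exact .inr ⟨i, a, rfl⟩
  · exact .inl ⟨v, rfl⟩

/-- A morphism to `[1](c)` is constant, or factors through a step. -/
lemma hom_one_cases {X : Theta C} {c : C} (h : X ⟶ one c) :
    (∃ v : Fin 2, h = toZero X ≫ vertex (one c) v) ∨
      ∃ i g, h = stepHom X i ≫ (oneFunctor C).map g := by
  obtain ⟨v, hv⟩ | ⟨i, h₀, h₁⟩ := exists_step_or_const (m := X.len) h.φ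
  · exact .inl ⟨v, eq_toZero_vertex h _ hv⟩
  · have h₂ : h.φ i.castSucc < Fin.succ (0 : Fin 1) := (h₀ _ le_rfl).trans_lt Fin.zero_lt_one
    have h₃ : Fin.succ (0 : Fin 1) ≤ h.φ i.succ := (h₁ _ Fin.castSucc_lt_succ).ge
    refine .inr ⟨i, h.f i (0 : Fin 1) h₂ h₃, hom_ext (fun a ↦ ?_) ?_⟩
    · by_cases ha : a ≤ i.castSucc
      · exact (h₀ a ha).trans (stepHom_φ_le ha).symm
      · exact (h₁ a (not_le.1 ha)).trans (stepHom_φ_lt (not_le.1 ha)).symm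
    · intro i' (j : Fin 1) h₄ h₅ h₆ h₇
      obtain rfl := Subsingleton.elim j 0
      obtain rfl : i' = i := step_unique h.φ (0 : Fin 1) h₄ h₅ h₂ h₃
      have h₈ : (stepHom X i').φ i'.castSucc < Fin.succ (0 : Fin 1) := by
        rw [stepHom_φ_le le_rfl]; exact Fin.zero_lt_one
      have h₉ : Fin.succ (0 : Fin 1) ≤ (stepHom X i').φ i'.succ := by
        rw [stepHom_φ_lt Fin.castSucc_lt_succ]; exact le_rfl
      refine Eq.trans ?_ (comp_f (stepHom X i') ((oneFunctor C).map (h.f i' (0 : Fin 1) h₂ h₃)) i'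
        (0 : Fin 1) (0 : Fin 1) h₆ h₇ h₈ h₉ (Fin.castSucc_lt_succ) le_rfl).symm
      exact (Category.id_comp _).symm

section
variable {R : (Theta C)ᵒᵖ ⥤ Type u}

/-- The ends on `X` are restricted from `[0]`, and the other elements from `[1](c)` along a step. -/
lemma suspPresheaf_hom_ext {g g' : (suspPresheaf C).obj P ⟶ R}
    (h : ∀ v, g.app _ (suspEnd P zero v) = g'.app _ (suspEnd P zero v))
    (h' : ∀ c (a : P.obj (op c)), g.app _ (suspElt (𝟙 (one c)) a) = g'.app _ (suspElt (𝟙 (one c)) a)) :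
    g = g' := by
  ext ⟨X⟩ z
  obtain ⟨v, rfl⟩ | ⟨i, a, rfl⟩ := suspPresheaf_cases z
  · rw [← suspEnd_comp (toZero X)]
    exact (NatTrans.naturality_apply g (toZero X).op _).trans ((congrArg _ (h v)).trans
      (NatTrans.naturality_apply g' (toZero X).op _).symm)
  · rw [← Category.comp_id (stepHom X i), ← suspElt_comp]
    exact (NatTrans.naturality_apply g (stepHom X i).op _).trans ((congrArg _ (h' _ a)).trans
      (NatTrans.naturality_apply g' (stepHom X i).op _).symm)

/-- A map from the suspension of `P` is given by two elements on `[0]`, and compatible elements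
on `[1](c)` for the elements of `P c`. -/
lemma exists_suspPresheaf_map (x : Fin 2 → R.obj (op zero))
    (k : ∀ c, P.obj (op c) → R.obj (op (one c)))
    (hk : ∀ {c d} (g : c ⟶ d) a, R.map ((oneFunctor C).map g).op (k d a) = k c (P.map g.op a))
    (hx : ∀ c a (v : Fin 2), R.map (vertex (one c) v).op (k c a) = x v) :
    ∃ G : (suspPresheaf C).obj P ⟶ R, (∀ v, G.app _ (suspEnd P zero v) = x v) ∧
      ∀ c a, G.app _ (suspElt (𝟙 (one c)) a) = k c a := by
  let e (X : Theta C) := Equiv.ofBijective _ (suspMk_bijective P X)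
  let val (X : Theta C) : (Σ i, P.obj (op (X.label i))) ⊕ Fin 2 → R.obj (op X) :=
    Sum.elim (fun q ↦ R.map (stepHom X q.1).op (k _ q.2)) fun v ↦ R.map (toZero X).op (x v)
  let G (X : Theta C) (z : ((suspPresheaf C).obj P).obj (op X)) := val X ((e X).symm z)
  have hEnd (X v) : G X (suspEnd P X v) = R.map (toZero X).op (x v) :=
    congrArg (val X) ((e X).symm_apply_apply (.inr v))
  have hStep (X i a) : G X (suspElt (stepHom X i) a) = R.map (stepHom X i).op (k _ a) :=
    congrArg (val X) ((e X).symm_apply_apply (.inl ⟨i, a⟩))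
  -- The formula on steps extends to every `suspElt h a`: for constant `h` by `hx`, otherwise by
  -- `hk`. Naturality then reduces to composing morphisms.
  have hElt {X : Theta C} {c : C} (h : X ⟶ one c) (a) : G X (suspElt h a) = R.map h.op (k c a) := by
    obtain ⟨v, rfl⟩ | ⟨i, g, rfl⟩ := hom_one_cases h
    · rw [suspElt_const, hEnd, op_comp, Functor.map_comp_apply, hx]
    · refine (congrArg (G X) (suspElt_oneFunctor _ g a)).trans ((hStep _ _ _).trans ?_)
      exact (congrArg _ (hk g a).symm).trans
        (Functor.map_comp_apply R ((oneFunctor C).map g).op (stepHom X i).op _).symm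
  refine ⟨{ app X := ↾(G X.unop), naturality X Y g := ?_ }, fun v ↦ ?_, fun c a ↦ ?_⟩
  · ext z
    change G Y.unop (((suspPresheaf C).obj P).map g.unop.op z) = R.map g.unop.op (G X.unop z)
    obtain ⟨v, rfl⟩ | ⟨i, a, rfl⟩ := suspPresheaf_cases z
    · rw [suspEnd_comp, hEnd, hEnd, ← Functor.map_comp_apply, ← op_comp,
        hom_zero_ext (g.unop ≫ toZero _) (toZero _)]
    · rw [suspElt_comp, hElt, hElt, op_comp, Functor.map_comp_apply]
  · refine (hEnd _ _).trans ?_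
    rw [hom_zero_ext (toZero zero) (𝟙 _), op_id, Functor.map_id_apply]
  · refine (hElt _ _).trans ?_
    rw [op_id, Functor.map_id_apply]

end

/-! ### The suspension of a simplicial presheaf -/

variable {A B : Cᵒᵖ ⥤ SSet.{u}}

/-- The components of the suspension on `X`. -/
def suspComponent (A : Cᵒᵖ ⥤ SSet.{u}) (X : Theta C) (j : ULift.{u} (Fin X.len ⊕ Fin 2)) : SSet.{u} :=
  match j with
  | ⟨.inl i⟩ => A.obj (op (X.label i))
  | ⟨.inr _⟩ => (Functor.const _).obj PUnit

/-- The inclusions of the components of the suspension. -/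
def suspIncl (A : Cᵒᵖ ⥤ SSet.{u}) (X : Theta C) (j : ULift.{u} (Fin X.len ⊕ Fin 2)) :
    suspComponent A X j ⟶ ((susp C).obj A).obj (op X) :=
  match j with
  | ⟨.inl i⟩ =>
    { app n := ↾fun (a : (A.obj (op (X.label i))).obj n) ↦
        (suspElt (stepHom X i) a : ((suspPresheaf C).obj (A.flip.obj n)).obj (op X))
      naturality n m θ := by
        ext a
        exact (map_suspElt (A.flip.map θ) (stepHom X i) a).symm }
  | ⟨.inr v⟩ =>
    { app n := ↾fun _ ↦ (suspEnd (A.flip.obj n) X v)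
      naturality n m θ := by
        ext a
        exact (map_suspEnd (A.flip.map θ) X v).symm }

lemma suspIncl_isDisjointUnion (A : Cᵒᵖ ⥤ SSet.{u}) (X : Theta C) :
    IsDisjointUnion (suspIncl A X) := by
  intro n
  obtain ⟨h₁, h₂⟩ := suspMk_bijective (A.flip.obj n) X
  refine ⟨?_, fun z ↦ ?_⟩
  · rintro ⟨⟨i | v⟩, a⟩ ⟨⟨i' | v'⟩, a'⟩ h
    · obtain ⟨rfl, h₄⟩ := Sigma.mk.inj_iff.1
        (Sum.inl_injective (h₁ (a₁ := .inl ⟨i, a⟩) (a₂ := .inl ⟨i', a'⟩) h))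
      obtain rfl := eq_of_heq h₄
      rfl
    · exact absurd (h₁ (a₁ := .inl ⟨i, a⟩) (a₂ := .inr v') h) (by simp)
    · exact absurd (h₁ (a₁ := .inr v) (a₂ := .inl ⟨i', a'⟩) h) (by simp)
    · obtain rfl := Sum.inr_injective (h₁ (a₁ := .inr v) (a₂ := .inr v') h)
      rfl
  · obtain ⟨⟨i, a⟩ | v, rfl⟩ := h₂ z
    · exact ⟨⟨⟨.inl i⟩, a⟩, rfl⟩
    · exact ⟨⟨⟨.inr v⟩, ⟨⟩⟩, rfl⟩

/-- The suspension preserves levelwise weak equivalences. -/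
lemma susp_map_we {i : A ⟶ B} (hi : LevelwiseWeakEquiv i) : LevelwiseWeakEquiv ((susp C).map i) := by
  intro X
  refine (suspIncl_isDisjointUnion A X.unop).we (suspIncl_isDisjointUnion B X.unop)
    (α := fun j ↦ match j with
      | ⟨.inl j⟩ => i.app (op (X.unop.label j))
      | ⟨.inr _⟩ => 𝟙 _) ?_ ?_
  · rintro ⟨j | v⟩
    · exact hi _
    · exact we_iso (𝟙 _)
  · rintro ⟨j | v⟩
    · ext n a
      exact map_suspElt (((flipFunctor _ _ _).map i).app n) (stepHom X.unop j) a
    · ext n a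
      exact map_suspEnd (((flipFunctor _ _ _).map i).app n) X.unop v

instance susp_map_mono (i : A ⟶ B) [Mono i] : Mono ((susp C).map i) := by
  refine mono_presheaf _ fun X n z z' h ↦ ?_
  have hB := (suspMk_bijective (B.flip.obj n) X.unop).1
  have w₁ (j) (a : (A.flip.obj n).obj (op (X.unop.label j))) :=
    map_suspElt (((flipFunctor _ _ _).map i).app n) (stepHom X.unop j) a
  have w₂ (v) := map_suspEnd (((flipFunctor _ _ _).map i).app n) X.unop v
  have H {z z' : ((suspPresheaf C).obj (A.flip.obj n)).obj X} {p p'}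
      (hp : ((suspPresheaf C).map (((flipFunctor _ _ _).map i).app n)).app X z = suspMk _ _ p)
      (hp' : ((suspPresheaf C).map (((flipFunctor _ _ _).map i).app n)).app X z' = suspMk _ _ p')
      (h : ((suspPresheaf C).map (((flipFunctor _ _ _).map i).app n)).app X z =
        ((suspPresheaf C).map (((flipFunctor _ _ _).map i).app n)).app X z') : p = p' :=
    hB (hp.symm.trans (h.trans hp'))
  obtain ⟨⟨j, a⟩ | v, rfl⟩ := (suspMk_bijective (A.flip.obj n) X.unop).2 z <;>
    obtain ⟨⟨j', a'⟩ | v', rfl⟩ := (suspMk_bijective (A.flip.obj n) X.unop).2 z'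
  · obtain ⟨rfl, h'⟩ := Sigma.mk.inj_iff.1 (Sum.inl_injective
      (H (p := .inl ⟨_, _⟩) (p' := .inl ⟨_, _⟩) (w₁ j a) (w₁ j' a') h))
    rw [app_injective i _ n (eq_of_heq h')]
  · exact absurd (H (p := .inl ⟨_, _⟩) (p' := .inr _) (w₁ j a) (w₂ v') h) (by simp)
  · exact absurd (H (p := .inr _) (p' := .inl ⟨_, _⟩) (w₂ v) (w₁ j' a') h) (by simp)
  · rw [Sum.inr_injective (H (p := .inr _) (p' := .inr _) (w₂ v) (w₂ v') h)]

end Theta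

/-! ### Maps from the suspension -/

section
variable {C : Type u} [SmallCategory.{u} C] {W : (Theta C)ᵒᵖ ⥤ SSet.{u}} {A B : Cᵒᵖ ⥤ SSet.{u}}
  {K L : SSet.{u}}

open Theta

/-- The restriction of a map from `susp A × K` to a simplex of `K`. -/
def suspSlice (G : (tensorConst ((susp C).obj A)).obj K ⟶ W) {n} (s : K.obj n) :
    (suspPresheaf C).obj (A.flip.obj n) ⟶ W.flip.obj n where
  app X := ↾fun z ↦ (G.app X).app n ((z, s) : ((susp C).obj A ⋙ tensorRight K).obj X |>.obj n)
  naturality X Y g := by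
    ext z
    exact app_congr (G.naturality g) n
      ((z, s) : ((susp C).obj A ⋙ tensorRight K).obj X |>.obj n)

lemma susp_hom_ext {G G' : (tensorConst ((susp C).obj A)).obj K ⟶ W}
    (h : ∀ n (s : K.obj n) v, (suspSlice G s).app _ (suspEnd _ zero v) =
      (suspSlice G' s).app _ (suspEnd _ zero v))
    (h' : ∀ n (s : K.obj n) c (a : (A.obj (op c)).obj n),
      (suspSlice G s).app _ (suspElt (P := A.flip.obj n) (𝟙 (one c)) a) =
        (suspSlice G' s).app _ (suspElt (P := A.flip.obj n) (𝟙 (one c)) a)) : G = G' := by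
  refine NatTrans.ext (funext fun X ↦ NatTrans.ext (funext fun n ↦ ?_))
  ext ⟨z, s⟩
  have : suspSlice G s = suspSlice G' s := suspPresheaf_hom_ext (h n s) (h' n s)
  exact ConcreteCategory.congr_hom (NatTrans.congr_app this X) z

lemma suspSlice_naturality (G : (tensorConst ((susp C).obj A)).obj K ⟶ W) {n m} (θ : n ⟶ m)
    (s : K.obj n) : (suspPresheaf C).map (A.flip.map θ) ≫ suspSlice G (K.map θ s) =
      suspSlice G s ≫ W.flip.map θ := by
  ext X z
  exact NatTrans.naturality_apply (G.app X) θ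
    ((z, s) : ((susp C).obj A ⋙ tensorRight K).obj X |>.obj n)

variable {x y : ObjOf W}

/-- `G` is the map from the suspension of `A` with ends `x` and `y` given by `k`. -/
structure IsSuspended (x y : ObjOf W) (k : (tensorConst A).obj K ⟶ mapObj x y)
    (G : (tensorConst ((susp C).obj A)).obj K ⟶ W) : Prop where
  ends (n) (s : K.obj n) (v : Fin 2) : (suspSlice G s).app _ (suspEnd _ zero v) =
    degen ((![x, y] : Fin 2 → ObjOf W) v) n
  elt (n) (s : K.obj n) (c) (a : (A.obj (op c)).obj n) :
    (suspSlice G s).app _ (suspElt (P := A.flip.obj n) (𝟙 (one c)) a) =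
      ((k.app (op c)).app n ((a, s) : (A ⋙ tensorRight K).obj (op c) |>.obj n)).1

lemma IsSuspended.unique {k : (tensorConst A).obj K ⟶ mapObj x y}
    {G G' : (tensorConst ((susp C).obj A)).obj K ⟶ W} (h : IsSuspended x y k G)
    (h' : IsSuspended x y k G') : G = G' :=
  susp_hom_ext (fun n s v ↦ (h.ends n s v).trans (h'.ends n s v).symm)
    fun n s c a ↦ (h.elt n s c a).trans (h'.elt n s c a).symm

lemma IsSuspended.injective {k k' : (tensorConst A).obj K ⟶ mapObj x y}
    {G : (tensorConst ((susp C).obj A)).obj K ⟶ W} (h : IsSuspended x y k G)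
    (h' : IsSuspended x y k' G) : k = k' := by
  refine NatTrans.ext (funext fun X ↦ NatTrans.ext (funext fun n ↦ ?_))
  ext ⟨a, s⟩
  exact Subtype.ext ((h.elt n s X.unop a).symm.trans (h'.elt n s X.unop a))

/-- In each simplicial degree this is `exists_suspPresheaf_map`; since maps are determined on
generators, those of different degrees are compatible. -/
lemma exists_isSuspended (k : (tensorConst A).obj K ⟶ mapObj x y) :
    ∃ G : (tensorConst ((susp C).obj A)).obj K ⟶ W, IsSuspended x y k G := by
  have H (n) (s : K.obj n) := exists_suspPresheaf_map (P := A.flip.obj n) (R := W.flip.obj n)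
    (fun v ↦ degen ((![x, y] : Fin 2 → ObjOf W) v) n)
    (fun c a ↦ ((k.app (op c)).app n ((a, s) : (A ⋙ tensorRight K).obj (op c) |>.obj n)).1)
    (fun {c d} g a ↦ (congrArg Subtype.val (app_congr (k.naturality g.op) n
      ((a, s) : (A ⋙ tensorRight K).obj (op d) |>.obj n))).symm)
    (fun c a v ↦ by
      have := ((k.app (op c)).app n ((a, s) : (A ⋙ tensorRight K).obj (op c) |>.obj n)).2
      fin_cases v
      exacts [this.1, this.2])
  choose G hG hG' using H
  have hnat {n m} (θ : n ⟶ m) (s : K.obj n) :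
      (suspPresheaf C).map (A.flip.map θ) ≫ G m (K.map θ s) = G n s ≫ W.flip.map θ := by
    refine suspPresheaf_hom_ext (fun v ↦ ?_) fun c a ↦ ?_
    · exact (congrArg _ (map_suspEnd (A.flip.map θ) _ v)).trans ((hG m _ v).trans
        ((congrArg ((W.obj _).map θ) (hG n s v)).trans (map_degen _ θ)).symm)
    · refine (congrArg _ (map_suspElt (A.flip.map θ) (𝟙 (one c)) a)).trans ((hG' m _ c _).trans
        (Eq.trans ?_ (congrArg ((W.obj _).map θ) (hG' n s c a)).symm))
      exact congrArg Subtype.val (NatTrans.naturality_apply (k.app (op c)) θ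
        ((a, s) : (A ⋙ tensorRight K).obj (op c) |>.obj n))
  refine ⟨{ app X :=
              { app n := ↾fun z ↦ (G n z.2).app X z.1
                naturality n m θ := ?_ }
            naturality X Y g := ?_ }, hG, hG'⟩
  · ext ⟨z, s⟩
    exact ConcreteCategory.congr_hom (NatTrans.congr_app (hnat θ s) X) z
  · refine NatTrans.ext (funext fun n ↦ ?_)
    ext ⟨z, s⟩
    exact NatTrans.naturality_apply (G n s) g z

/-- A map from the suspension with ends `x` and `y` comes from a map to the mapping object. -/
lemma exists_of_ends {G : (tensorConst ((susp C).obj A)).obj K ⟶ W}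
    (h : ∀ n (s : K.obj n) v, (suspSlice G s).app _ (suspEnd _ zero v) =
      degen ((![x, y] : Fin 2 → ObjOf W) v) n) :
    ∃ k : (tensorConst A).obj K ⟶ mapObj x y, IsSuspended x y k G := by
  have hv (c) (v : Fin 2) (n) (s : K.obj n) (a : (A.obj (op c)).obj n) :
      res W (vertex (one c) v) ((suspSlice G s).app _ (suspElt (P := A.flip.obj n) (𝟙 (one c)) a)) =
        degen ((![x, y] : Fin 2 → ObjOf W) v) n := by
    refine (NatTrans.naturality_apply (suspSlice G s) (vertex (one c) v).op _).symm.trans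
      (Eq.trans (congrArg _ ?_) (h n s v))
    refine (suspElt_comp _ _ _).trans ?_
    rw [Category.comp_id]
    refine Eq.trans ?_ (suspElt_const (X := zero) v a)
    rw [hom_zero_ext (toZero zero) (𝟙 _), Category.id_comp]
  refine ⟨{ app c :=
              { app n := ↾fun z ↦ ⟨(suspSlice G z.2).app _
                  (suspElt (P := A.flip.obj n) (𝟙 (one c.unop)) z.1),
                  hv c.unop 0 n z.2 z.1, hv c.unop 1 n z.2 z.1⟩
                naturality n m θ := ?_ }
            naturality c d g := ?_ }, h, fun _ _ _ _ ↦ rfl⟩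
  · ext ⟨a, s⟩
    refine Subtype.ext ?_
    refine (congrArg ((suspSlice G (K.map θ s)).app (op (one c.unop)))
      (map_suspElt (A.flip.map θ) (𝟙 (one c.unop)) a).symm).trans ?_
    exact ConcreteCategory.congr_hom (NatTrans.congr_app (suspSlice_naturality G θ s) _)
      (suspElt (P := A.flip.obj n) (𝟙 (one c.unop)) a)
  · refine NatTrans.ext (funext fun n ↦ ?_)
    ext ⟨a, s⟩
    refine Subtype.ext ?_
    refine Eq.trans (congrArg ((suspSlice G s).app (op (one d.unop))) ?_) (NatTrans.naturality_apply (suspSlice G s)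
      ((oneFunctor C).map g.unop).op (suspElt (P := A.flip.obj n) (𝟙 (one c.unop)) a))
    refine Eq.trans ?_ (suspElt_comp (P := A.flip.obj n) ((oneFunctor C).map g.unop)
      (𝟙 (one c.unop)) a).symm
    refine (suspElt_oneFunctor (P := A.flip.obj n) (𝟙 (one d.unop)) g.unop a).symm.trans ?_
    exact congrArg (fun h ↦ suspElt (P := A.flip.obj n) h a)
      ((Category.id_comp _).trans (Category.comp_id _).symm)

lemma IsSuspended.map_right {k : (tensorConst A).obj L ⟶ mapObj x y}
    {G : (tensorConst ((susp C).obj A)).obj L ⟶ W} (h : IsSuspended x y k G) (j : K ⟶ L) :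
    IsSuspended x y ((tensorConst A).map j ≫ k) ((tensorConst _).map j ≫ G) :=
  ⟨fun n s v ↦ h.ends n (j.app n s) v, fun n s c a ↦ h.elt n (j.app n s) c a⟩

lemma ends_whiskerRight (f : A ⟶ B) (G : (tensorConst ((susp C).obj B)).obj K ⟶ W) {n}
    (s : K.obj n) (v : Fin 2) :
    (suspSlice (Functor.whiskerRight ((susp C).map f) (tensorRight K) ≫ G) s).app _
      (suspEnd _ zero v) = (suspSlice G s).app _ (suspEnd _ zero v) :=
  congrArg ((suspSlice G s).app _) (map_suspEnd (((flipFunctor _ _ _).map f).app n) zero v)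

lemma IsSuspended.whiskerRight {k : (tensorConst B).obj K ⟶ mapObj x y}
    {G : (tensorConst ((susp C).obj B)).obj K ⟶ W} (h : IsSuspended x y k G) (f : A ⟶ B) :
    IsSuspended x y (Functor.whiskerRight f (tensorRight K) ≫ k)
      (Functor.whiskerRight ((susp C).map f) (tensorRight K) ≫ G) :=
  ⟨fun n s v ↦ (ends_whiskerRight f G s v).trans (h.ends n s v), fun n s c a ↦
    (congrArg ((suspSlice G s).app _) (map_suspElt (((flipFunctor _ _ _).map f).app n)
      (𝟙 (one c)) a)).trans (h.elt n s c _)⟩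

variable (A x y) in
/-- The map from `Map(A, map_W(x, y))` to `Map(V[1](A), W)`. -/
def suspMap : mapSpace A (mapObj x y) ⟶ mapSpace ((susp C).obj A) W where
  app n := ↾fun k ↦ (exists_isSuspended (K := Δ[n.unop.len]) k).choose
  naturality n m θ := by
    ext k
    exact (exists_isSuspended _).choose_spec.unique
      ((exists_isSuspended (K := Δ[n.unop.len]) k).choose_spec.map_right (SSet.stdSimplex.map θ.unop))

lemma suspMap_spec {n} (k : (mapSpace A (mapObj x y)).obj n) :
    IsSuspended (K := Δ[n.unop.len]) x y k ((suspMap A x y).app n k) :=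
  (exists_isSuspended (K := Δ[n.unop.len]) k).choose_spec

/-- `Map(A, map_W(x, y))` is the part of `Map(V[1](A), W)` with ends `x` and `y`. -/
lemma suspMap_isPullback (f : A ⟶ B) :
    IsPullback (suspMap B x y) (mapSpacePre f (mapObj x y)) (mapSpacePre ((susp C).map f) W)
      (suspMap A x y) := by
  refine IsPullback.of_forall_isPullback_app fun n ↦ (Limits.Types.isPullback_iff _ _ _ _).2 ⟨?_, ?_, ?_⟩
  · ext k
    exact ((suspMap_spec k).whiskerRight f).unique (suspMap_spec _)
  · intro k k' h
    have := suspMap_spec k'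
    rw [← h.1] at this
    exact (suspMap_spec k).injective this
  · intro G k h
    obtain ⟨k', hk'⟩ := exists_of_ends (x := x) (y := y) (K := Δ[n.unop.len]) (G := G) fun m s v ↦ by
      refine (ends_whiskerRight f _ s v).symm.trans (Eq.trans ?_ ((suspMap_spec k).ends m s v))
      exact congrArg (fun G : (tensorConst ((susp C).obj A)).obj Δ[n.unop.len] ⟶ W ↦
        (suspSlice G s).app _ (suspEnd _ zero v)) h
    refine ⟨k', (suspMap_spec (n := n) k').unique hk', ?_⟩
    have h' := suspMap_spec k
    rw [← h] at h'
    exact (hk'.whiskerRight f).injective h'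

lemma mapVertex_injective {D : Type u} [SmallCategory.{u} D] {X Y : Dᵒᵖ ⥤ SSet.{u}} {f g : X ⟶ Y}
    (h : mapVertex f = mapVertex g) : f = g := by
  refine NatTrans.ext (funext fun d ↦ ?_)
  ext n z
  exact app_congr (NatTrans.congr_app h d) n
    (z, SSet.stdSimplex.objEquiv.symm (SimplexCategory.const _ ⦋0⦌ 0))

/-- The suspension preserves trivial cofibrations, so restriction along `V[1](i)` is a trivial
fibration of mapping spaces into `W`. Restriction along `i` for maps into `mapObj x y` is a base
change of it by `suspMap_isPullback`; so it has a section, which extends `a`. -/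
lemma mapObj_injectiveFibrant (hW : InjectiveFibrant W) (x y : ObjOf W) :
    InjectiveFibrant (mapObj x y) := by
  intro A B i _ hi a
  obtain ⟨v, hv⟩ := ((mapSpacePre_trivFib hW ((susp C).map i) (susp_map_we hi)).of_isPullback
    (suspMap_isPullback (x := x) (y := y) i)).exists_section
  obtain ⟨b, hb⟩ := exists_eq_mapVertex (v.app _ (mapVertex a))
  refine ⟨b, mapVertex_injective ?_⟩
  exact (congrArg ((mapSpacePre i (mapObj x y)).app _) hb.symm).trans (app_congr hv _ (mapVertex a))

/-- Mapping objects of objects that are local for the suspensions of the maps in `S` are local for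
`S`. -/
lemma mapObj_isFibrantFor {S : MorphismProperty (Cᵒᵖ ⥤ SSet.{u})}
    (hW : IsFibrantFor (S.strictMap (susp C)) W) (x y : ObjOf W) :
    IsFibrantFor S (mapObj x y) := by
  have hM := mapObj_injectiveFibrant hW.injectiveFibrant x y
  refine ⟨fun A B f hf ↦ ?_, hM⟩
  -- The suspension of the empty presheaf has only the two ends. Over the space of maps out of it,
  -- locality of `W` for `V[1](f)` is a relative lifting property, which can be base changed to the
  -- fixed ends `x` and `y`.
  let E : Cᵒᵖ ⥤ SSet.{u} := (Functor.const _).obj ((Functor.const _).obj PEmpty)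
  let i : E ⟶ A := { app d := { app n := ↾PEmpty.elim, naturality _ _ _ := by ext x; exact x.elim },
                     naturality _ _ _ := by ext n x; exact PEmpty.elim x }
  have : Mono i := mono_presheaf _ fun _ _ a ↦ PEmpty.elim a
  have : Mono (i ≫ f) := mono_presheaf _ fun _ _ a ↦ PEmpty.elim a
  have := mapSpace_kanComplex hW.injectiveFibrant (B := (susp C).obj A)
  have := mapSpacePre_fibration hW.injectiveFibrant ((susp C).map i)
  have : Fibration (mapSpacePre ((susp C).map f) W ≫ mapSpacePre ((susp C).map i) W) := by
    rw [← mapSpacePre_comp, ← Functor.map_comp]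
    exact mapSpacePre_fibration hW.injectiveFibrant _
  have := mapSpacePre_fibration hM i
  have : Fibration (mapSpacePre f (mapObj x y) ≫ mapSpacePre i (mapObj x y)) := by
    rw [← mapSpacePre_comp]
    exact mapSpacePre_fibration hM _
  exact ((RelLift.of_we (mapSpacePre ((susp C).map i) W)
    (hW.isLocal _ (MorphismProperty.map_mem_strictMap _ _ _ hf))).of_isPullback
    (suspMap_isPullback (x := x) (y := y) i) (suspMap_isPullback f)).we

end

/-! ### Iteration -/

section
variable {C : Type u} [SmallCategory.{u} C] {t : C} (ht : Limits.IsTerminal t)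

open Theta

lemma IsFibrantFor.mono {D : Type u} [SmallCategory.{u} D] {S T : MorphismProperty (Dᵒᵖ ⥤ SSet.{u})}
    (h : S ≤ T) {W : Dᵒᵖ ⥤ SSet.{u}} (hW : IsFibrantFor T W) : IsFibrantFor S W :=
  ⟨fun _ _ f hf ↦ hW.isLocal f (h f hf), hW.injectiveFibrant⟩

lemma se_le_cpt {S T : MorphismProperty (Cᵒᵖ ⥤ SSet.{u})} (h : S ≤ T) : se S ≤ cpt T :=
  sup_le (le_sup_right.trans le_sup_left)
    ((MorphismProperty.monotone_strictMap (susp C) h).trans le_sup_right)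

lemma strictMap_le_cpt (S : MorphismProperty (Cᵒᵖ ⥤ SSet.{u})) : S.strictMap (susp C) ≤ cpt S :=
  le_sup_right

lemma seIter_le_cptIter (S : MorphismProperty (Cᵒᵖ ⥤ SSet.{u})) (n : ℕ) : seIter S n ≤ cptIter S n := by
  induction n with
  | zero => exact le_rfl
  | succ n ih => exact se_le_cpt (C := ThetaIter C n) ih

/-- Between objects that are fibrant for `cpt(T)`, the maps that are DK-equivalences relative to a
class `P` that agrees with the levelwise weak equivalences between `T`-fibrant objects are the
levelwise weak equivalences. -/
lemma isDKWith_iff {S T : MorphismProperty (Cᵒᵖ ⥤ SSet.{u})} (hST : S ≤ T)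
    {P : ∀ {A B : Cᵒᵖ ⥤ SSet.{u}}, (A ⟶ B) → Prop}
    (hP : ∀ {A B : Cᵒᵖ ⥤ SSet.{u}} (f : A ⟶ B), IsFibrantFor T A → IsFibrantFor T B →
      (P f ↔ LevelwiseWeakEquiv f)) {U V : (Theta C)ᵒᵖ ⥤ SSet.{u}} (f : U ⟶ V)
    (hU : IsFibrantFor (cpt T) U) (hV : IsFibrantFor (cpt T) V) :
    IsDKWith ht S P f ↔ LevelwiseWeakEquiv f := by
  -- Mapping objects of `cpt(T)`-fibrant objects are `T`-fibrant, so `hP` applies to the maps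
  -- between them.
  have hP' (x y : ObjOf U) : P (mapObjMap f x y) ↔ LevelwiseWeakEquiv (mapObjMap f x y) :=
    hP _ (mapObj_isFibrantFor (hU.mono (strictMap_le_cpt T)) _ _)
      (mapObj_isFibrantFor (hV.mono (strictMap_le_cpt T)) _ _)
  constructor
  · rintro ⟨hU', hV', h, h'⟩
    exact levelwiseWeakEquiv_of_essSurj ht hU'.segal hV'.segal hU.isComplete hV.isComplete f
      h.essSurj fun x y ↦ (hP' x y).1 (h' x y)
  · intro hf
    exact ⟨hU.mono (se_le_cpt hST), hV.mono (se_le_cpt hST), hoFunctor_isEquivalence ht _ _ f hf,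
      fun x y ↦ (hP' x y).2 (mapObjMap_we f hU.injectiveFibrant hV.injectiveFibrant hf x y)⟩

/-- Induction through `isDKWith_iff`, where `T` is `cptⁿ(S)`, which contains `seⁿ(S)`, and `P` is
the notion of DK-equivalence one level down, identified by the induction hypothesis. -/
lemma isDKIter_iff (S : MorphismProperty (Cᵒᵖ ⥤ SSet.{u})) (n : ℕ) :
    ∀ {U V : (ThetaIter C n)ᵒᵖ ⥤ SSet.{u}} (f : U ⟶ V), IsFibrantFor (cptIter S n) U →
      IsFibrantFor (cptIter S n) V → (IsDKIter ht S n f ↔ LevelwiseWeakEquiv f) := by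
  induction n with
  | zero => exact fun f hU hV ↦ ⟨fun h ↦ h.2.2, fun h ↦ ⟨hU, hV, h⟩⟩
  | succ n ih =>
    exact isDKWith_iff (C := ThetaIter C n) (ThetaIter.isTerminal ht n) (seIter_le_cptIter S n) ih

end

end

end ThetaSpaces

end

theorem proposition4p10 {C : Type u} [SmallCategory.{u} C] {t : C} (ht : Limits.IsTerminal t)
    (S : MorphismProperty (Cᵒᵖ ⥤ SSet.{u})) :
    (∀ {U V : (Theta C)ᵒᵖ ⥤ SSet.{u}} (f : U ⟶ V), IsFibrantFor (cpt S) U →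
      IsFibrantFor (cpt S) V → (LevelwiseWeakEquiv f ↔ IsDK ht S f)) ∧
    (∀ (n : ℕ) {U V : (ThetaIter C n)ᵒᵖ ⥤ SSet.{u}} (f : U ⟶ V), IsFibrantFor (cptIter S n) U →
      IsFibrantFor (cptIter S n) V → (IsDKIter ht S n f ↔ LevelwiseWeakEquiv f)) :=
  ⟨levelwiseWeakEquiv_iff_isDK ht S, isDKIter_iff ht S⟩
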